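/- **Proposition (Stationary solutions).** Consider a Reissner–Nordström exterior with mass $M>0$ and charge $Q$, $|Q|\le M$, $\Omega^2=1-\frac{2M}{r}+\frac{Q^2}{r^2}$, horizon radii $r_\pm=M\pm\sqrt{M^2-Q^2}$, normalised by $r_+=1$, and surface gravity $\kappa_+=\frac{Mr_+-Q^2}{r_+^3}$ (so that $r_-=1-2\kappa_+$), with metric $g=-\Omega^2dv^2+2\,dv\,dr+r^2(d\theta^2+\sin^2\theta\,d\varphi^2)$. Let $\tau=v-\int_{r_+}^r\tilde h\,dr'$, where $\tilde h\ge 0$ is smooth on $[r_+,\infty)$ and $h:=2-\tilde h\,\Omega^2$ satisfies $h\ge 0$ and $h=O(r^{-1-\delta})$ as $r\to\infty$ for some $\delta>0$. Let $\mathfrak q\in\mathbb R$ with $q:=\mathfrak qQ\neq 0$, let $A=-\frac{Q}{r}d\tau$ and $D=\nabla-i\mathfrak qA$, and consider $$r\,g^{\mu\nu}D_\mu D_\nu(r^{-1}\psi)=0.\qquad(*)$$ For $\ell\in\mathbb N_0$ let $\beta_\ell=\sqrt{(2\ell+1)^2-4q^2}\in[0,\infty)\cup i(0,\infty)$. For each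 $\ell\in\mathbb N_0$ and all $m\in\mathbb Z$ with $|m|\le\ell$: (i) There is a unique smooth $\mathfrak w_\ell:[r_+,\infty)\to\mathbb C$ with $\mathfrak w_\ell(r_+)=1$ such that $\mathfrak w_\ell Y_{\ell m}$ solves $(*)$. There is a unique smooth $\mathfrak w_\ell^-:(r_+,\infty)\to\mathbb C$ such that $\mathfrak w_\ell^-Y_{\ell m}$ solves $(*)$ and $\mathfrak w_\ell^-=r^{\frac12+iq-\frac12\beta_\ell}(1+O(r^{-1}))$ for $r>2$. There is a smooth $\mathfrak w_\ell^+:(r_+,\infty)\to\mathbb C$ such that $\mathfrak w_\ell^+Y_{\ell m}$ solves $(*)$ and, for $r>2$, $$\mathfrak w^+_\ell=r^{\frac12+iq+\frac12\beta_\ell}(1+O(r^{-1}))\ (\beta_\ell\ne0,1),\quad \mathfrak w^+_\ell=r^{\frac12+iq}\log r\,(1+O(r^{-1}))\ (\beta_\ell=0),\quad \mathfrak w^+_\ell=r^{1+iq}(1+O(r^{-1}\log r))\ (\beta_\ell=1).$$ It is unique if $\ell(\ell+1)<q^2$, i.e. if $\beta_\ell\in[0,1)\cup i(0,\infty)$,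 and unique up to adding multiples of $\mathfrak w_\ell^-$ otherwise. These functions do not depend on $m$ (for a suitable choice of $\mathfrak w_\ell^+$ if $\ell(\ell+1)\ge q^2$). (ii) There are unique $\alpha_\pm\in\mathbb C$ with $\mathfrak w_\ell=\alpha_+\mathfrak w_\ell^++\alpha_-\mathfrak w_\ell^-$ on $(r_+,\infty)$, and $\alpha_+\neq0$. Put $P=\frac q2\,\frac{r_-+r_+}{r_+^2\kappa_+}$ when $\kappa_+>0$. If $\beta_\ell\in i(0,\infty)$ and $s=\operatorname{Im}\beta_\ell$, then $\alpha_-\ne0$ and, for $\kappa_+>0$, $$\operatorname{sign}(q)\log\left|\frac{\alpha_-}{\alpha_+}\right|=-\frac\pi2\left(s-\frac1\pi\log\frac{\cosh(\pi(|q|-\frac s2))}{\cosh(\pi(|q|+\frac s2))}\right)+\frac\pi2\left(s-\frac1\pi\log\frac{\cosh(\pi(|P|+\frac s2))}{\cosh(\pi(|P|-\frac s2))}\right).$$ As $\kappa_+\downarrow0$ with $q,\ell$ fixed, the right-hand side tends to $-\frac\pi2\Big(s-\frac1\pi\log\frac{\cosh(\pi(|q|-\frac s2))}{\cosh(\pi(|q|+\frac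 s2))}\Big)$, which is the value of $\operatorname{sign}(q)\log|\alpha_- /\alpha_+|$ when $\kappa_+=0$. (iii) With $q$ and the black hole fixed, replace $\ell(\ell+1)$ by $\frac{\beta^2-1}4+q^2$ in the radial equation for $\mathfrak w_\ell$, with $\beta\in\mathbb C$, $|\operatorname{Re}\beta|<1$. The existence and uniqueness statements of (i) (with the logarithmic normalisation at $\beta=0$) and the decomposition of (ii) with $\alpha_+(\beta)\ne 0$ hold for the resulting solutions $\mathfrak w(\cdot;\beta),\mathfrak w^\pm(\cdot;\beta)$ and coefficients $\alpha_\pm(\beta)$; for $\ell(\ell+1)<q^2$ the value $\beta=\beta_\ell$ gives the functions and constants of (i), (ii). For $\beta\ne0$, $\alpha_-(\beta)=\alpha_+(-\beta)$ and $$\frac{\alpha_-(\beta)}{\alpha_+(\beta)}=(2iq)^{\beta}\frac{\Gamma(-\beta)}{\Gamma(\beta)}\frac{\Gamma(\frac12+\frac\beta2+iq)}{\Gamma(\frac12-\frac\beta2+iq)}\quad(\kappa_+=0),$$ $$\frac{\alpha_-(\beta)}{\alpha_+(\beta)}=(r_+-r_-)^{\beta}\frac{\Gamma(-\beta)}{\Gamma(\beta)}\frac{\Gamma(\frac12+\frac\beta2+iq)}{\Gamma(\frac12-\frac\beta2+iq)}\frac{\Gamma(\frac12+\frac\beta2+iP)}{\Gamma(\frac12-\frac\beta2+iP)}\quad(\kappa_+>0),$$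 with principal powers. Extended by the value $-1$ at $\beta=0$, the ratio $\alpha_- /\alpha_+$ is complex differentiable at $0$, and for $r\geq r_+$ we have $\lim_{\beta\to0}\mathfrak w(r;\beta)=\mathfrak w(r;0)$. At $\beta=0$, $$\alpha_+=\lim_{\beta\to0}\alpha_+(\beta)\beta,\qquad \alpha_-=\alpha_+\frac{d}{d\beta}\Big|_{\beta=0}\frac{\alpha_-(\beta)}{\alpha_+(\beta)}=\alpha_+\,\frac1i\frac{d}{ds}\Big|_{s=0}\frac{\alpha_-(is)}{\alpha_+(is)},$$ $$\mathfrak w(r;0)=\Big(\lim_{\beta\to0}\alpha_+(\beta)\beta\Big)r^{\frac12+iq}\Big[\log r+\frac{d}{d\beta}\Big|_{\beta=0}\frac{\alpha_-(\beta)}{\alpha_+(\beta)}\Big]+O(r^{-\frac12}\log r)\qquad(r>2),$$ and, at $\beta=0$, for $\kappa_+>0$, $$\operatorname{sign}(q)\operatorname{Im}\frac{\alpha_-}{\alpha_+}=-\operatorname{sign}(q)\operatorname{Re}\,\frac{d}{ds}\Big|_{s=0}\frac{\alpha_-(is)}{\alpha_+(is)}=-\frac\pi2(1-\tanh(\pi|q|))+\frac\pi2\big(1-\tanh(\pi|P|)-2\tanh(\pi|q|)\big).$$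 As $\kappa_+\downarrow0$ with $q$ fixed, the last expression tends to $-\frac\pi2(1+\tanh(\pi|q|))$, which is the value of $\operatorname{sign}(q)\operatorname{Im}(\alpha_- /\alpha_+)$ when $\kappa_+=0$ (the first equality holds there too). (iv) $\mathfrak w_\ell(r)\neq0$ for all $r\ge r_+$. -/

import Mathlib

open Set Filter Topology
open scoped ContDiff

noncomputable section

/-- The data of a charged scalar field on a Reissner--Nordstrom exterior: mass `M`, black hole
charge `Q`, charge coupling constant `e` of the field, and the function `ht` (`h` with a tilde)
defining the time function `τ = v - ∫ ht dr`. -/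
structure Background where
  M : ℝ
  Q : ℝ
  e : ℝ
  ht : ℝ → ℝ

namespace Background

variable (B : Background)

/-- Event horizon radius. -/
def rPlus : ℝ := B.M + Real.sqrt (B.M ^ 2 - B.Q ^ 2)

/-- Inner horizon radius. -/
def rMinus : ℝ := B.M - Real.sqrt (B.M ^ 2 - B.Q ^ 2)

/-- `Ω² = 1 - 2M/r + Q²/r²`. -/
def OmegaSq (r : ℝ) : ℝ := 1 - 2 * B.M / r + B.Q ^ 2 / r ^ 2

/-- Surface gravity `κ₊`. -/
def kappaPlus : ℝ := (B.M * B.rPlus - B.Q ^ 2) / B.rPlus ^ 3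

/-- The dimensionless charge parameter `q`. -/
def q : ℝ := B.e * B.Q

/-- The function `h = 2 - ht Ω²`. -/
def h (r : ℝ) : ℝ := 2 - B.ht r * B.OmegaSq r

/-- The standing assumptions on the black hole parameters and on the foliation. -/
def Admissible : Prop :=
  0 < B.M ∧ |B.Q| ≤ B.M ∧ ContDiffOn ℝ ∞ B.ht (Ici B.rPlus) ∧
    (∀ r, B.rPlus ≤ r → 0 ≤ B.ht r ∧ 0 ≤ B.h r) ∧
    ∃ δ : ℝ, 0 < δ ∧ B.h =O[atTop] fun r : ℝ => r ^ (-1 - δ)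

/-- The metric `-Ω² dv² + 2 dv dr + r² (dθ² + sin² θ dφ²)` in the coordinates
`(x 0, x 1, x 2, x 3) = (τ, r, θ, φ)`, in which `dv = dτ + ht dr`. -/
def metric (x : Fin 4 → ℝ) : Matrix (Fin 4) (Fin 4) ℝ :=
  !![-B.OmegaSq (x 1), 1 - B.OmegaSq (x 1) * B.ht (x 1), 0, 0;
     1 - B.OmegaSq (x 1) * B.ht (x 1),
       2 * B.ht (x 1) - B.OmegaSq (x 1) * B.ht (x 1) ^ 2, 0, 0;
     0, 0, x 1 ^ 2, 0;
     0, 0, 0, x 1 ^ 2 * Real.sin (x 2) ^ 2]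

/-- The volume density `√|det g|`. -/
def density (x : Fin 4 → ℝ) : ℝ := Real.sqrt |(B.metric x).det|

/-- The electromagnetic gauge `A = -(Q/r) dτ`. -/
def potential (μ : Fin 4) (x : Fin 4 → ℝ) : ℝ := if μ = 0 then -(B.Q / x 1) else 0

/-- Coordinate partial derivative. -/
def _root_.coordDeriv (μ : Fin 4) (Φ : (Fin 4 → ℝ) → ℂ) (x : Fin 4 → ℝ) : ℂ :=
  deriv (fun s : ℝ => Φ (Function.update x μ s)) (x μ)

/-- `∂_μ - i e A_μ`. -/
def gaugeDeriv (μ : Fin 4) (Φ : (Fin 4 → ℝ) → ℂ) (x : Fin 4 → ℝ) : ℂ :=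
  coordDeriv μ Φ x - Complex.I * B.e * B.potential μ x * Φ x

/-- The gauge-covariant wave operator `g^{μν} D_μ D_ν`, `D = ∇ - i e A`, on scalar functions, in
the coordinate form `|g|^{-1/2} (∂_μ - i e A_μ) (|g|^{1/2} g^{μν} (∂_ν - i e A_ν) Φ)`. -/
def chargedBox (Φ : (Fin 4 → ℝ) → ℂ) (x : Fin 4 → ℝ) : ℂ :=
  (B.density x : ℂ)⁻¹ * ∑ μ : Fin 4, B.gaugeDeriv μ
    (fun y => (B.density y : ℂ) *
      ∑ ν : Fin 4, (((B.metric y)⁻¹ μ ν : ℝ) : ℂ) * B.gaugeDeriv ν Φ y) x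

/-- The homogeneous equation `r g^{μν} D_μ D_ν (r⁻¹ ψ) = 0` on the exterior region `r > r₊`
(in spherical coordinates, with `0 < θ < π`). -/
def SolvesCSF (ψ : (Fin 4 → ℝ) → ℂ) : Prop :=
  ∀ x : Fin 4 → ℝ, B.rPlus < x 1 → 0 < x 2 → x 2 < Real.pi →
    ((x 1 : ℝ) : ℂ) * B.chargedBox (fun y => ((y 1 : ℝ) : ℂ)⁻¹ * ψ y) x = 0

/-- The spherical harmonic `Y_{ℓm}(θ, φ)` (for `|m| ≤ ℓ`), normalised in `L²` of the unit sphere,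
up to an irrelevant constant phase. -/
def _root_.sphHarmonic (l : ℕ) (m : ℤ) (θ φ : ℝ) : ℂ :=
  ((Real.sqrt ((2 * l + 1) / (4 * Real.pi) *
        ((l - m.natAbs).factorial / (l + m.natAbs).factorial)) / (2 ^ l * l.factorial) *
      Real.sin θ ^ m.natAbs *
      ((Polynomial.derivative^[l + m.natAbs])
        ((Polynomial.X ^ 2 - 1 : Polynomial ℝ) ^ l)).eval (Real.cos θ) : ℝ) : ℂ) *
    Complex.exp (Complex.I * m * φ)

/-- `f : (r₊, ∞) → ℂ` is smooth and `f Y_{ℓm}` is a (time-independent) solution. -/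
def IsMode (l : ℕ) (m : ℤ) (f : ℝ → ℂ) : Prop :=
  ContDiffOn ℝ ∞ f (Ioi B.rPlus) ∧
    B.SolvesCSF fun x => f (x 1) * sphHarmonic l m (x 2) (x 3)

/-- `f : (r₊, ∞) → ℂ` is smooth and solves the radial equation for time-independent solutions, with
`ℓ(ℓ+1)` replaced by the complex number `lam`. -/
def SolvesRadial (lam : ℂ) (f : ℝ → ℂ) : Prop :=
  ContDiffOn ℝ ∞ f (Ioi B.rPlus) ∧ ∀ r : ℝ, B.rPlus < r →
    deriv (fun s : ℝ => (B.OmegaSq s : ℂ) * deriv f s) r - lam / (r : ℂ) ^ 2 * f r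
      - 2 * (1 - (B.h r : ℂ)) * (Complex.I * B.q / r) * deriv f r
      - (((deriv B.OmegaSq r / r : ℝ) : ℂ) - Complex.I * B.q / r * (deriv B.h r : ℝ)
          - ((B.q ^ 2 * B.h r * B.ht r / r ^ 2 : ℝ) : ℂ)
          - Complex.I * B.q / (r : ℂ) ^ 2 * (1 - (B.h r : ℂ))) * f r = 0

/-- Smooth up to and including the event horizon, where the value is `1`. -/
def HorizonNormalised (f : ℝ → ℂ) : Prop :=
  ContDiffOn ℝ ∞ f (Ici B.rPlus) ∧ f B.rPlus = 1

/-- `f(r) = r^{1/2 + iq - β/2} (1 + O(r⁻¹))` for `r > 2`. -/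
def MinusAsymptotics (β : ℂ) (f : ℝ → ℂ) : Prop :=
  ∃ C : ℝ, ∀ r : ℝ, 2 < r →
    ‖f r / (r : ℂ) ^ (1 / 2 + Complex.I * B.q - β / 2) - 1‖ ≤ C * r⁻¹

/-- `f(r) = r^{1/2 + iq + β/2} (1 + O(r⁻¹))` for `r > 2`, with an extra factor `log r` in front if
`β = 0`, and with remainder `O(r⁻¹ log r)` in the resonant case `β = 1`. -/
def PlusAsymptotics (β : ℂ) (f : ℝ → ℂ) : Prop :=
  ∃ C : ℝ, ∀ r : ℝ, 2 < r →
    ‖f r / ((r : ℂ) ^ (1 / 2 + Complex.I * B.q + β / 2) *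
        (if β = 0 then (Real.log r : ℂ) else 1)) - 1‖
      ≤ C * r⁻¹ * (if β = 1 then Real.log r else 1)

end Background

/-- `β_ℓ = √((2ℓ+1)² - 4q²)`, in `[0, ∞) ∪ i(0, ∞)`; at most one of the two summands is nonzero. -/
def betaL (l : ℕ) (q : ℝ) : ℂ :=
  (Real.sqrt ((2 * l + 1) ^ 2 - 4 * q ^ 2) : ℂ)
    + (Real.sqrt (4 * q ^ 2 - (2 * l + 1) ^ 2) : ℂ) * Complex.I

/-- The separation constant corresponding to `β`: `lam = ℓ(ℓ+1)` when `β = β_ℓ`. -/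
def sepConst (q : ℝ) (β : ℂ) : ℂ := (β ^ 2 - 1) / 4 + (q : ℂ) ^ 2

/-- The quantity `(q/2) (r₋ + r₊) / (r₊² κ₊)`. -/
def horizonCharge (q rm rp kap : ℝ) : ℝ := q / 2 * ((rm + rp) / (rp ^ 2 * kap))

/-- Connection formula for `α₋/α₊`, extremal case (`r₊ = 1`). -/
def ratioExtremal (q : ℝ) (β : ℂ) : ℂ :=
  (2 * Complex.I * q) ^ β * (Complex.Gamma (-β) / Complex.Gamma β) *
    (Complex.Gamma (1 / 2 + β / 2 + Complex.I * q) /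
      Complex.Gamma (1 / 2 - β / 2 + Complex.I * q))

/-- Connection formula for `α₋/α₊`, sub-extremal case (`r₊ = 1`). -/
def ratioSubextremal (q rm rp kap : ℝ) (β : ℂ) : ℂ :=
  ((rp - rm : ℝ) : ℂ) ^ β * (Complex.Gamma (-β) / Complex.Gamma β) *
    (Complex.Gamma (1 / 2 + β / 2 + Complex.I * q) /
      Complex.Gamma (1 / 2 - β / 2 + Complex.I * q)) *
    (Complex.Gamma (1 / 2 + β / 2 + Complex.I * horizonCharge q rm rp kap) /
      Complex.Gamma (1 / 2 - β / 2 + Complex.I * horizonCharge q rm rp kap))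

/-- `sign(q) log |α₋/α₊|` in the extremal case, `s = Im β_ℓ`. -/
def logRatioExtremal (q s : ℝ) : ℝ :=
  -(Real.pi / 2) * (s - 1 / Real.pi *
    Real.log (Real.cosh (Real.pi * (|q| - s / 2)) / Real.cosh (Real.pi * (|q| + s / 2))))

/-- `sign(q) log |α₋/α₊|` in the sub-extremal case, `s = Im β_ℓ`. -/
def logRatioSubextremal (q s rm rp kap : ℝ) : ℝ :=
  -(Real.pi / 2) * (s - 1 / Real.pi *
    Real.log (Real.cosh (Real.pi * (|q| - s / 2)) / Real.cosh (Real.pi * (|q| + s / 2))))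
  + Real.pi / 2 * (s - 1 / Real.pi *
    Real.log (Real.cosh (Real.pi * (horizonCharge |q| rm rp kap + s / 2)) /
      Real.cosh (Real.pi * (horizonCharge |q| rm rp kap - s / 2))))

/-- `sign(q) Im (α₋/α₊)` for `β = 0` in the extremal case. -/
def imRatioExtremal (q : ℝ) : ℝ := -(Real.pi / 2) * (1 + Real.tanh (Real.pi * |q|))

/-- `sign(q) Im (α₋/α₊)` for `β = 0` in the sub-extremal case. -/
def imRatioSubextremal (q rm rp kap : ℝ) : ℝ :=
  -(Real.pi / 2) * (1 - Real.tanh (Real.pi * |q|))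
  + Real.pi / 2 * (1 - Real.tanh (Real.pi * horizonCharge |q| rm rp kap)
      - 2 * Real.tanh (Real.pi * |q|))

/-- The quotient `α₋(β)/α₊(β)`, given the value `-1` at `β = 0`. -/
def extendedRatio (ap am : ℂ → ℂ) : ℂ → ℂ :=
  Function.update (fun β => am β / ap β) 0 (-1)

end

/-! With r₊ = 1 and y = r − 1, division by r and by the gauge factor exp(iq∫h̃/r) turns the radial
equation into `IsRed`, from which h̃ has disappeared (`radialExpr_lift`). It is a hypergeometric
equation with a, b = 1/2 + iq ± β/2 and c = 1 + iq/κ, confluent when κ = 0. The wave equation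
separates by `box_separated`. Asymptotics are carried over by `exists_phase_limit`: h̃ = 2 + O(1/r)
makes the gauge factor a constant N times r^(2iq)(1 + O(1/r)).

In the strip |Re β| < 1 both distinguished solutions are explicit integrals: `hor`, regular at y = 0
(Euler's integral or its confluent version), and `infSol`, which behaves like y^(−a) at infinity.
They and their weighted Wronskian `conn` are holomorphic in β. The Wronskian of `infSol` at β and −β
is β, and `hor` is even in β, so for β ≠ 0 the coefficients of `hor` are conn(β)/β and
conn(−β)/(−β); this explains α₋(β) = α₊(−β). For 0 < Re β < 1 dominated convergence in the integral
yields the dominant coefficient in terms of Gamma functions (`tendsto_hor`), and the identity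
theorem extends the formula to the strip (`conn_eq`). Gamma has no zeros, hence α₊ ≠ 0. On the
imaginary axis |Γ(1/2 + ix)|² = π/cosh(πx) gives the modulus of the ratio.

At β = 0 the solutions at ±β coalesce. The quotient hor/infSol minus conn(β)(y^β − 1)/β converges as
y → ∞, at a rate uniform for β near 0, so its limit is continuous there. For β ≠ 0 the limit is α₊ +
α₋ = conn(β)(R(β) − R(0))/β, where R = `connRatio` and R(0) = −1; hence its value at 0 is
conn(0)R′(0) (`remLimit_zero`), which is the recessive coefficient next to the logarithmic solution.
The imaginary part of R′(0) is the derivative of log|R(is)| at s = 0.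

For real β ≥ 1, that is ℓ(ℓ+1) ≥ q², Euler's integral need not converge. A contiguity relation still
provides a regular solution, and a conserved charge current replaces the connection formula: it
equals 2iq at the horizon, but would tend to 0 at infinity for a multiple of the recessive solution
(`wr_infSol_ne_zero_of_regular`). A multiple of the regular solution can therefore serve as dominant
solution. The same current shows that the regular solution has no zeros, since each of its terms
contains the solution or its conjugate as a factor (`ne_zero_of_regular`).

Uniqueness at infinity rests on `coeff_eq_zero`, which compares a solution at y and at a dilated
point xy; this also works for imaginary β, where both solutions have the same size. -/

namespace RNStat
open MeasureTheory

/-! ### Calculus lemmas -/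

/-- A sequence of functions, each the derivative of the previous one, consists of smooth functions. -/
theorem contDiffOn_of_hasDerivAt_succ {U : Set ℝ} (hU : IsOpen U) {F : ℕ → ℝ → ℂ}
    (h : ∀ n, ∀ y ∈ U, HasDerivAt (F n) (F (n + 1) y) y) (n : ℕ) : ContDiffOn ℝ ∞ (F n) U := by
  have key : ∀ m : ℕ, ∀ n, ContDiffOn ℝ (m : ℕ∞) (F n) U := by
    intro m
    induction m with
    | zero =>
      intro n
      have : ContinuousOn (F n) U := fun y hy => (h n y hy).continuousAt.continuousWithinAt
      simpa using this
    | succ m ih =>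
      intro n
      have h1 : ((m + 1 : ℕ) : ℕ∞) = ((m : ℕ∞) + 1) := by push_cast; rfl
      rw [h1]
      push_cast
      rw [contDiffOn_succ_iff_deriv_of_isOpen hU]
      refine ⟨fun y hy => (h n y hy).differentiableAt.differentiableWithinAt, by simp, ?_⟩
      exact (ih (n + 1)).congr fun y hy => (h n y hy).deriv
  exact contDiffOn_infty.2 fun m => key m n

/-- Applied below with constant, linear, logarithmic and power majorants, to turn bounds on
derivatives into rates at infinity. -/
theorem norm_sub_le_of_norm_deriv_le {D D' : ℝ → ℂ} {b b' : ℝ → ℝ} {y z : ℝ} (hyz : y ≤ z)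
    (hD : ∀ t ∈ Icc y z, HasDerivAt D (D' t) t) (hb : ∀ t ∈ Icc y z, HasDerivAt b (b' t) t)
    (hbd : ∀ t ∈ Icc y z, ‖D' t‖ ≤ b' t) : ‖D z - D y‖ ≤ b z - b y := by
  have := image_norm_le_of_norm_deriv_right_le_deriv_boundary' (f := fun t => D t - D y)
    (f' := D') (a := y) (b := z) (B := fun t => b t - b y) (B' := b')
    (fun t ht => ((hD t ht).continuousAt.sub continuousAt_const).continuousWithinAt)
    (fun t ht => ((hD t ⟨ht.1, ht.2.le⟩).sub_const _).hasDerivWithinAt) (by simp)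
    (fun t ht => ((hb t ht).continuousAt.sub continuousAt_const).continuousWithinAt)
    (fun t ht => ((hb t ⟨ht.1, ht.2.le⟩).sub_const _).hasDerivWithinAt)
    (fun t ht => hbd t ⟨ht.1, ht.2.le⟩)
  exact this ⟨hyz, le_rfl⟩

/-- A function with derivative `O(t^{-1-σ})` converges at rate `t^{-σ}`. -/
theorem exists_limit_of_norm_deriv_le {D D' : ℝ → ℂ} {Y M σ : ℝ} (hY : 0 < Y) (hσ : 0 < σ)
    (hD : ∀ t, Y ≤ t → HasDerivAt D (D' t) t) (hb : ∀ t, Y ≤ t → ‖D' t‖ ≤ M * t ^ (-σ - 1)) :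
    ∃ C : ℂ, ∀ y, Y ≤ y → ‖D y - C‖ ≤ M / σ * y ^ (-σ) := by
  have hM : 0 ≤ M := by
    have := (norm_nonneg _).trans (hb Y le_rfl)
    exact nonneg_of_mul_nonneg_left this (Real.rpow_pos_of_pos hY _)
  have key : ∀ y z, Y ≤ y → y ≤ z → ‖D z - D y‖ ≤ M / σ * y ^ (-σ) := by
    intro y z hy hyz
    have h1 := norm_sub_le_of_norm_deriv_le (D := D) (D' := D')
      (b := fun t => -(M / σ) * t ^ (-σ)) (b' := fun t => M * t ^ (-σ - 1)) hyz
      (fun t ht => hD t (hy.trans ht.1))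
      (fun t ht => by
        have ht0 : 0 < t := hY.trans_le (hy.trans ht.1)
        have := (Real.hasDerivAt_rpow_const (p := -σ) (Or.inl ht0.ne')).const_mul (-(M / σ))
        refine this.congr_deriv ?_
        field_simp) (fun t ht => hb t (hy.trans ht.1))
    refine h1.trans ?_
    have : 0 ≤ M / σ * z ^ (-σ) :=
      mul_nonneg (div_nonneg hM hσ.le) (Real.rpow_nonneg (hY.le.trans (hy.trans hyz)) _)
    linarith
  -- `D` is controlled only on [Y, ∞); clamping the argument makes the Cauchy estimate valid for
  -- every real y.
  have ht : Tendsto (fun y : ℝ => M / σ * (max y Y) ^ (-σ)) atTop (𝓝 0) := by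
    have h1 : Tendsto (fun y : ℝ => max y Y) atTop atTop :=
      tendsto_atTop_mono (fun y => le_max_left _ _) tendsto_id
    simpa using ((tendsto_rpow_neg_atTop hσ).comp h1).const_mul (M / σ)
  have hc : CauchySeq fun y : ℝ => D (max y Y) := by
    refine cauchySeq_of_le_tendsto_0' (fun y : ℝ => M / σ * (max y Y) ^ (-σ)) ?_ ht
    intro y z hyz
    rw [dist_comm, dist_eq_norm]
    exact key _ _ (le_max_right _ _) (max_le_max hyz le_rfl)
  obtain ⟨C, hC⟩ := cauchySeq_tendsto_of_complete hc
  refine ⟨C, fun y hy => ?_⟩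
  have h2 : Tendsto (fun z : ℝ => ‖D y - D (max z Y)‖) atTop (𝓝 ‖D y - C‖) :=
    (tendsto_const_nhds.sub hC).norm
  refine le_of_tendsto h2 ?_
  filter_upwards [eventually_ge_atTop y] with z hz
  rw [norm_sub_rev]
  exact key _ _ hy (hz.trans (le_max_left _ _))

/-! ### Integrals depending on a parameter -/

/-- Provides the majorants for differentiation under the integral: finite moments absorb kernels of
polynomial growth. -/
theorem integrable_pow_mul_norm {μ : Measure ℝ} {g : ℝ → ℂ}
    (hg : ∀ n : ℕ, Integrable (fun t : ℝ => (t : ℂ) ^ n * g t) μ) (R : ℝ) (N n : ℕ) :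
    Integrable (fun t : ℝ => ‖(t : ℂ) ^ n * g t‖ * (1 + R * |t|) ^ N) μ := by
  induction N generalizing n with
  | zero => simpa using (hg n).norm
  | succ N ih =>
    refine ((ih n).add ((ih (n + 1)).const_mul R)).congr (Eventually.of_forall fun t => ?_)
    simp only [Pi.add_apply, norm_mul, norm_pow, Complex.norm_real, Real.norm_eq_abs]
    ring

theorem hasDerivAt_kernelIntegral {T U V : Set ℝ} (hT : MeasurableSet T) (hU : IsOpen U)
    (hUV : ∀ y ∈ U, ∀ t ∈ T, y * t ∈ V) {g : ℝ → ℂ}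
    (hg : ∀ n : ℕ, IntegrableOn (fun t : ℝ => (t : ℂ) ^ n * g t) T) {k : ℕ → ℝ → ℂ}
    (hk : ∀ n, ∀ z ∈ V, HasDerivAt (k n) (k (n + 1) z) z)
    (hb : ∀ n, ∃ C : ℝ, ∃ N : ℕ, ∀ z ∈ V, ‖k n z‖ ≤ C * (1 + |z|) ^ N) (n : ℕ) {y : ℝ}
    (hy : y ∈ U) :
    HasDerivAt (fun y : ℝ => ∫ t in T, (t : ℂ) ^ n * g t * k n (y * t))
      (∫ t in T, (t : ℂ) ^ (n + 1) * g t * k (n + 1) (y * t)) y ∧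
    IntegrableOn (fun t : ℝ => (t : ℂ) ^ n * g t * k n (y * t)) T := by
  have hmeas : ∀ n, ∀ y ∈ U,
      AEStronglyMeasurable (fun t : ℝ => (t : ℂ) ^ n * g t * k n (y * t)) (volume.restrict T) := by
    intro n y hy
    refine (hg n).aestronglyMeasurable.mul ?_
    refine ContinuousOn.aestronglyMeasurable (fun t ht => ?_) hT
    have h1 : ContinuousAt (k n) (y * t) := (hk n _ (hUV y hy t ht)).continuousAt
    exact (ContinuousAt.comp (f := fun t => y * t) h1 (by fun_prop)).continuousWithinAt
  obtain ⟨ε, hε, hball⟩ := Metric.isOpen_iff.1 hU y hy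
  -- On the unit ball about y one has |xt| ≤ (|y| + 1)|t|, so the polynomial bound on the kernel
  -- gives a majorant independent of x.
  have hbound : ∀ n, ∃ b : ℝ → ℝ, IntegrableOn b T ∧ ∀ t ∈ T, ∀ x ∈ Metric.ball y (min ε 1),
      ‖(t : ℂ) ^ n * g t * k n (x * t)‖ ≤ b t := by
    intro n
    obtain ⟨C, N, hC⟩ := hb n
    refine ⟨fun t => |C| * (‖(t : ℂ) ^ n * g t‖ * (1 + (|y| + 1) * |t|) ^ N),
      (integrable_pow_mul_norm hg _ _ _).const_mul _, fun t ht x hx => ?_⟩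
    have hx' : x ∈ U := hball (Metric.ball_subset_ball (min_le_left _ _) hx)
    have hx1 : |x| ≤ |y| + 1 := by
      have h1 : |x - y| < 1 := by
        have := Metric.mem_ball.1 hx
        rw [Real.dist_eq] at this
        exact this.trans_le (min_le_right _ _)
      have := abs_add_le (x - y) y
      rw [sub_add_cancel] at this
      linarith
    rw [norm_mul]
    have h2 : ‖k n (x * t)‖ ≤ |C| * (1 + (|y| + 1) * |t|) ^ N := by
      refine (hC _ (hUV x hx' t ht)).trans ?_
      rw [abs_mul]
      have h3 : (0 : ℝ) ≤ 1 + |x| * |t| := by positivity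
      gcongr
      exact le_abs_self C
    calc _ ≤ ‖(t : ℂ) ^ n * g t‖ * (|C| * (1 + (|y| + 1) * |t|) ^ N) := by gcongr
      _ = _ := by ring
  have hball_mem : Metric.ball y (min ε 1) ∈ 𝓝 y := Metric.ball_mem_nhds _ (by positivity)
  have hint : ∀ n, IntegrableOn (fun t : ℝ => (t : ℂ) ^ n * g t * k n (y * t)) T := by
    intro n
    obtain ⟨b, hb1, hb2⟩ := hbound n
    exact Integrable.mono' hb1 (hmeas n y hy) ((ae_restrict_iff' hT).2
      (Eventually.of_forall fun t ht => hb2 t ht y (mem_of_mem_nhds hball_mem)))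
  refine ⟨?_, hint n⟩
  obtain ⟨b, hb1, hb2⟩ := hbound (n + 1)
  refine (hasDerivAt_integral_of_dominated_loc_of_deriv_le (bound := b) (μ := volume.restrict T)
    (F := fun y t => (t : ℂ) ^ n * g t * k n (y * t))
    (F' := fun y t => (t : ℂ) ^ (n + 1) * g t * k (n + 1) (y * t)) hball_mem
    ?_ (hint n) (hmeas (n + 1) y hy) ?_ hb1 ?_).2
  · filter_upwards [hU.mem_nhds hy] with x hx using hmeas n x hx
  · exact (ae_restrict_iff' hT).2 (Eventually.of_forall hb2)
  · refine (ae_restrict_iff' hT).2 (Eventually.of_forall fun t ht x hx => ?_)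
    have hx' : x ∈ U := hball (Metric.ball_subset_ball (min_le_left _ _) hx)
    have h1 := (hk n _ (hUV x hx' t ht)).scomp x ((hasDerivAt_id x).mul_const t)
    refine (h1.const_mul ((t : ℂ) ^ n * g t)).congr_deriv ?_
    rw [one_mul, Complex.real_smul]
    ring

/-- A bound on the integrand alone suffices, because Cauchy's estimate on slightly larger discs
bounds its β-derivative. -/
theorem differentiableAt_integral_param {μ : Measure ℝ} {f : ℂ → ℝ → ℂ} {β₀ : ℂ} {ε : ℝ}
    (hε : 0 < ε) {bound : ℝ → ℝ}
    (hm : ∀ β ∈ Metric.ball β₀ ε, AEStronglyMeasurable (f β) μ) (hbi : Integrable bound μ)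
    (hb : ∀ᵐ t ∂μ, ∀ β ∈ Metric.ball β₀ ε, ‖f β t‖ ≤ bound t)
    (hd : ∀ᵐ t ∂μ, DifferentiableOn ℂ (fun β => f β t) (Metric.ball β₀ ε)) :
    DifferentiableAt ℂ (fun β => ∫ t, f β t ∂μ) β₀ := by
  have h0 : β₀ ∈ Metric.ball β₀ ε := Metric.mem_ball_self hε
  -- Measurability of the derivative in t: it is a limit of difference quotients along ε/(n+2), a
  -- null sequence that stays inside the ball.
  have hmeas' : AEStronglyMeasurable (fun t => deriv (fun β => f β t) β₀) μ := by
    let u : ℕ → ℂ := fun n => ((ε / (n + 2) : ℝ) : ℂ)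
    have hu_pos : ∀ n : ℕ, 0 < ε / (n + 2) := fun n => by positivity
    have hu_lt : ∀ n : ℕ, ε / ((n : ℝ) + 2) < ε := fun n => by
      rw [div_lt_iff₀ (by positivity)]
      nlinarith [(Nat.cast_nonneg n : (0 : ℝ) ≤ n)]
    have hu0 : Tendsto u atTop (𝓝[≠] 0) := by
      refine tendsto_nhdsWithin_iff.2 ⟨?_, Eventually.of_forall fun n => ?_⟩
      · have h1 : Tendsto (fun n : ℕ => ε / ((n : ℝ) + 2)) atTop (𝓝 0) :=
          tendsto_const_nhds.div_atTop
            (tendsto_atTop_add_const_right _ _ tendsto_natCast_atTop_atTop)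
        have h2 := (Complex.continuous_ofReal.tendsto 0).comp h1
        simpa [u, Function.comp_def] using h2
      · simp only [mem_compl_iff, mem_singleton_iff, u, Complex.ofReal_eq_zero]
        exact (hu_pos n).ne'
    have hmem : ∀ n, β₀ + u n ∈ Metric.ball β₀ ε := fun n => by
      rw [Metric.mem_ball, dist_eq_norm, add_sub_cancel_left, Complex.norm_real, Real.norm_eq_abs,
        abs_of_pos (hu_pos n)]
      exact hu_lt n
    refine aestronglyMeasurable_of_tendsto_ae atTop
      (f := fun n t => (u n)⁻¹ • (f (β₀ + u n) t - f β₀ t)) (fun n => ?_) ?_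
    · exact AEStronglyMeasurable.const_smul ((hm _ (hmem n)).sub (hm _ h0)) ((u n)⁻¹)
    · filter_upwards [hd] with t ht
      have h1 : HasDerivAt (fun β => f β t) (deriv (fun β => f β t) β₀) β₀ :=
        (ht.differentiableAt (Metric.isOpen_ball.mem_nhds h0)).hasDerivAt
      exact (hasDerivAt_iff_tendsto_slope_zero.1 h1).comp hu0
  refine (hasDerivAt_integral_of_dominated_loc_of_deriv_le (s := Metric.ball β₀ (ε / 2))
    (F' := fun β t => deriv (fun β => f β t) β) (bound := fun t => bound t / (ε / 4))
    (Metric.ball_mem_nhds _ (by positivity)) ?_ ?_ hmeas' ?_ (hbi.div_const _)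
    ?_).2.differentiableAt
  · filter_upwards [Metric.ball_mem_nhds β₀ hε] with β hβ using hm β hβ
  · exact Integrable.mono' hbi (hm _ h0) (hb.mono fun t ht => ht _ h0)
  · filter_upwards [hb, hd] with t ht hdt β hβ
    -- A disc of radius ε/4 about a point of the half-size ball stays in the full ball, whence the
    -- loss of a factor ε/4.
    have hsub : Metric.closedBall β (ε / 4) ⊆ Metric.ball β₀ ε := by
      intro z hz
      rw [Metric.mem_closedBall] at hz
      rw [Metric.mem_ball] at hβ ⊢
      have := dist_triangle z β β₀
      linarith
    refine Complex.norm_deriv_le_of_forall_mem_sphere_norm_le (by positivity) ?_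
      fun z hz => ht z (hsub (Metric.sphere_subset_closedBall hz))
    refine DifferentiableOn.diffContOnCl ?_
    rw [closure_ball _ (by positivity)]
    exact hdt.mono hsub
  · filter_upwards [hd] with t ht β hβ
    exact (ht.differentiableAt (Metric.isOpen_ball.mem_nhds
      (Metric.ball_subset_ball (by linarith) hβ))).hasDerivAt

end RNStat

namespace RNStat
open MeasureTheory

/-! ### The reduced radial equation -/

/-- The radial equation in the ingoing gauge for `φ = ψ / r`, as a function of `y = r - 1`. -/
def IsRed (κ q : ℝ) (lam : ℂ) (φ : ℝ → ℂ) : Prop :=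
  ContDiffOn ℝ ∞ φ (Ioi 0) ∧ ∀ y : ℝ, 0 < y →
    (y : ℂ) * (y + 2 * κ) * deriv (deriv φ) y
      + (2 * κ + 2 * Complex.I * q + (2 + 2 * Complex.I * q) * y) * deriv φ y
      + (Complex.I * q - lam) * φ y = 0

theorem hasDerivAt_of_smooth {φ : ℝ → ℂ} {s : Set ℝ} (hs : IsOpen s) (h : ContDiffOn ℝ ∞ φ s)
    {y : ℝ} (hy : y ∈ s) : HasDerivAt φ (deriv φ y) y :=
  ((h.differentiableOn (by simp)).differentiableAt (hs.mem_nhds hy)).hasDerivAt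

theorem contDiffOn_deriv_of_smooth {φ : ℝ → ℂ} {s : Set ℝ} (hs : IsOpen s)
    (h : ContDiffOn ℝ ∞ φ s) : ContDiffOn ℝ ∞ (deriv φ) s :=
  ((contDiffOn_infty_iff_deriv_of_isOpen hs).1 h).2

variable {κ q : ℝ} {lam : ℂ} {f g φ ψ : ℝ → ℂ}

theorem IsRed.hasDerivAt (h : IsRed κ q lam f) {y : ℝ} (hy : 0 < y) :
    HasDerivAt f (deriv f y) y :=
  hasDerivAt_of_smooth isOpen_Ioi h.1 hy

theorem IsRed.hasDerivAt_deriv (h : IsRed κ q lam f) {y : ℝ} (hy : 0 < y) :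
    HasDerivAt (deriv f) (deriv (deriv f) y) y :=
  hasDerivAt_of_smooth isOpen_Ioi (contDiffOn_deriv_of_smooth isOpen_Ioi h.1) hy

theorem deriv_eq_of_eqOn_Ioi {x : ℝ} (h : EqOn f g (Ioi x)) {y : ℝ} (hy : x < y) :
    deriv f y = deriv g y :=
  (h.eventuallyEq_of_mem (Ioi_mem_nhds hy)).deriv_eq

theorem eqOn_deriv_Ioi {x : ℝ} (h : EqOn f g (Ioi x)) : EqOn (deriv f) (deriv g) (Ioi x) :=
  fun _ hy => deriv_eq_of_eqOn_Ioi h hy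

theorem IsRed.of_hasDerivAt {f1 f2 : ℝ → ℂ} (hs : ContDiffOn ℝ ∞ f (Ioi 0))
    (h1 : ∀ y, 0 < y → HasDerivAt f (f1 y) y) (h2 : ∀ y, 0 < y → HasDerivAt f1 (f2 y) y)
    (he : ∀ y : ℝ, 0 < y → (y : ℂ) * (y + 2 * κ) * f2 y
      + (2 * κ + 2 * Complex.I * q + (2 + 2 * Complex.I * q) * y) * f1 y
      + (Complex.I * q - lam) * f y = 0) : IsRed κ q lam f := by
  refine ⟨hs, fun y hy => ?_⟩
  have e1 : EqOn (deriv f) f1 (Ioi 0) := fun z hz => (h1 z hz).deriv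
  rw [eqOn_deriv_Ioi e1 hy, e1 hy, (h2 y hy).deriv]
  exact he y hy

theorem IsRed.linComb (hf : IsRed κ q lam f) (hg : IsRed κ q lam g) (A B : ℂ) :
    IsRed κ q lam fun y => A * f y + B * g y := by
  refine IsRed.of_hasDerivAt (f1 := fun y => A * deriv f y + B * deriv g y)
    (f2 := fun y => A * deriv (deriv f) y + B * deriv (deriv g) y)
    ((contDiffOn_const.mul hf.1).add (contDiffOn_const.mul hg.1))
    (fun y hy => ((hf.hasDerivAt hy).const_mul A).add ((hg.hasDerivAt hy).const_mul B))
    (fun y hy => ((hf.hasDerivAt_deriv hy).const_mul A).add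
      ((hg.hasDerivAt_deriv hy).const_mul B)) fun y hy => ?_
  linear_combination A * hf.2 y hy + B * hg.2 y hy

/-! ### The integrating factor and Wronskians -/

/-- A primitive of `(1 + y) / (y (y + 2κ))`. -/
noncomputable def theta (κ y : ℝ) : ℝ :=
  if κ = 0 then Real.log y - y⁻¹
  else 1 / (2 * κ) * Real.log y + (1 - 1 / (2 * κ)) * Real.log (y + 2 * κ)

/-- The integrating factor of the reduced equation. -/
noncomputable def weight (κ q y : ℝ) : ℂ :=
  (y : ℂ) * (y + 2 * κ) * Complex.exp (2 * Complex.I * q * theta κ y)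

theorem hasDerivAt_theta (hκ : 0 ≤ κ) {y : ℝ} (hy : 0 < y) :
    HasDerivAt (theta κ) ((1 + y) / (y * (y + 2 * κ))) y := by
  unfold theta
  rcases eq_or_ne κ 0 with h0 | h0
  · subst h0
    simp only [if_true]
    refine ((Real.hasDerivAt_log hy.ne').sub (hasDerivAt_inv hy.ne')).congr_deriv ?_
    field_simp
    ring
  · simp only [h0, if_false]
    have hk : 0 < κ := lt_of_le_of_ne hκ h0.symm
    have hy2 : y + 2 * κ ≠ 0 := by positivity
    have h1 := (Real.hasDerivAt_log hy.ne').const_mul (1 / (2 * κ))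
    have h2 := (((hasDerivAt_id y).add_const (2 * κ)).log hy2).const_mul (1 - 1 / (2 * κ))
    refine (h1.add h2).congr_deriv ?_
    simp only [id]
    field_simp
    ring

theorem ofReal_add_two_mul_ne_zero (hκ : 0 ≤ κ) {y : ℝ} (hy : 0 < y) : (y : ℂ) + 2 * κ ≠ 0 := by
  have : (0 : ℝ) < y + 2 * κ := by positivity
  exact_mod_cast this.ne'

theorem hasDerivAt_weight (hκ : 0 ≤ κ) {y : ℝ} (hy : 0 < y) :
    HasDerivAt (weight κ q) ((2 * κ + 2 * Complex.I * q + (2 + 2 * Complex.I * q) * y)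
      * Complex.exp (2 * Complex.I * q * theta κ y)) y := by
  have h1 : HasDerivAt (fun y : ℝ => (y : ℂ) * (y + 2 * κ)) (2 * y + 2 * κ) y := by
    have h := (hasDerivAt_id (y : ℂ)).mul ((hasDerivAt_id (y : ℂ)).add_const (2 * (κ : ℂ)))
    refine h.comp_ofReal.congr_deriv ?_
    simp only [id]
    ring
  have h2 : HasDerivAt (fun y : ℝ => Complex.exp (2 * Complex.I * q * theta κ y))
      (Complex.exp (2 * Complex.I * q * theta κ y) *
        (2 * Complex.I * q * (((1 + y) / (y * (y + 2 * κ)) : ℝ) : ℂ))) y :=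
    ((hasDerivAt_theta hκ hy).ofReal_comp.const_mul (2 * Complex.I * (q : ℂ))).cexp
  refine (h1.mul h2).congr_deriv ?_
  have hy' : (y : ℂ) ≠ 0 := by exact_mod_cast hy.ne'
  have hy2 := ofReal_add_two_mul_ne_zero hκ hy
  push_cast
  field_simp
  ring

theorem norm_weight (hκ : 0 ≤ κ) {y : ℝ} (hy : 0 ≤ y) : ‖weight κ q y‖ = y * (y + 2 * κ) := by
  have h1 : (2 * Complex.I * q * theta κ y : ℂ) = ((2 * q * theta κ y : ℝ) : ℂ) * Complex.I := by
    push_cast; ring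
  have h2 : ((y : ℂ) * (y + 2 * κ)) = ((y * (y + 2 * κ) : ℝ) : ℂ) := by push_cast; ring
  rw [weight, norm_mul, h1, Complex.norm_exp_ofReal_mul_I, mul_one, h2, Complex.norm_real,
    Real.norm_eq_abs, abs_of_nonneg (by positivity)]

theorem weight_ne_zero (hκ : 0 ≤ κ) {y : ℝ} (hy : 0 < y) : weight κ q y ≠ 0 := by
  rw [← norm_pos_iff, norm_weight hκ hy.le]
  positivity

/-- The two logarithms in `theta` have coefficients with sum 1, so after subtracting log y only a
multiple of log(1 + 2κ/y) remains. -/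
theorem theta_sub_log (hκ : 0 ≤ κ) {y : ℝ} (hy : 1 ≤ y) :
    |theta κ y - Real.log y| ≤ (1 + 2 * κ) / y := by
  have hy0 : 0 < y := by linarith
  unfold theta
  rcases eq_or_ne κ 0 with h0 | h0
  · subst h0
    simp [abs_of_pos hy0]
  · simp only [h0, if_false]
    have hk : 0 < κ := lt_of_le_of_ne hκ h0.symm
    have e1 : Real.log (y + 2 * κ) = Real.log y + Real.log (1 + 2 * κ / y) := by
      rw [← Real.log_mul hy0.ne' (by positivity)]
      congr 1
      field_simp
    have e2 : 1 / (2 * κ) * Real.log y + (1 - 1 / (2 * κ)) * Real.log (y + 2 * κ) - Real.log y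
        = (1 - 1 / (2 * κ)) * Real.log (1 + 2 * κ / y) := by
      rw [e1]; ring
    have hx : 0 ≤ 2 * κ / y := by positivity
    have e3 : Real.log (1 + 2 * κ / y) ≤ 2 * κ / y := by
      have := Real.log_le_sub_one_of_pos (show 0 < 1 + 2 * κ / y by positivity)
      linarith
    have e4 : 0 ≤ Real.log (1 + 2 * κ / y) := Real.log_nonneg (by linarith)
    rw [e2, abs_mul, abs_of_nonneg e4]
    have e5 : |1 - 1 / (2 * κ)| ≤ 1 + 1 / (2 * κ) := by
      have h := abs_sub (1 : ℝ) (1 / (2 * κ))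
      rwa [abs_one, abs_of_pos (by positivity : 0 < 1 / (2 * κ))] at h
    calc _ ≤ (1 + 1 / (2 * κ)) * (2 * κ / y) := by gcongr
      _ = _ := by field_simp; ring

/-- The integrating factor is `y ^ (2 + 2iq)` up to a factor `1 + O(1/y)`. -/
theorem exists_weight_eq (hκ : 0 ≤ κ) : ∃ C : ℝ, 0 ≤ C ∧ ∀ y : ℝ, 1 ≤ y →
    ‖weight κ q y / (y : ℂ) ^ (2 + 2 * Complex.I * q) - 1‖ ≤ C / y := by
  refine ⟨2 * κ + (1 + 2 * κ) * (2 * |q| * (1 + 2 * κ)), by positivity, fun y hy => ?_⟩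
  have hy0 : 0 < y := by linarith
  have hyc : (y : ℂ) ≠ 0 := by exact_mod_cast hy0.ne'
  have e1 : weight κ q y / (y : ℂ) ^ (2 + 2 * Complex.I * q)
      = (1 + 2 * κ / y) * Complex.exp (((2 * q * (theta κ y - Real.log y) : ℝ) : ℂ) * Complex.I) := by
    rw [Complex.cpow_add _ _ hyc, Complex.cpow_def_of_ne_zero hyc (2 * Complex.I * q), weight,
      ← Complex.ofReal_log hy0.le]
    have : Complex.exp (((2 * q * (theta κ y - Real.log y) : ℝ) : ℂ) * Complex.I)
        = Complex.exp (2 * Complex.I * q * theta κ y) /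
          Complex.exp (Real.log y * (2 * Complex.I * q)) := by
      rw [← Complex.exp_sub]; congr 1; push_cast; ring
    rw [this]
    have h2 : (y : ℂ) ^ (2 : ℂ) = y ^ 2 := by norm_cast
    rw [h2]
    have := Complex.exp_ne_zero (Real.log y * (2 * Complex.I * q))
    field_simp
  set x : ℝ := 2 * q * (theta κ y - Real.log y) with hx
  have e2 : ‖Complex.exp ((x : ℂ) * Complex.I) - 1‖ ≤ |x| := by
    have h := Real.norm_exp_I_mul_ofReal_sub_one_le (x := x)
    rwa [mul_comm, Real.norm_eq_abs] at h
  have e3 : |x| ≤ 2 * |q| * ((1 + 2 * κ) / y) := by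
    rw [hx, abs_mul, abs_mul, abs_two]
    exact mul_le_mul_of_nonneg_left (theta_sub_log hκ hy) (by positivity)
  have e4 : ‖((2 * κ / y : ℝ) : ℂ)‖ = 2 * κ / y := by
    rw [Complex.norm_real, Real.norm_eq_abs, abs_of_nonneg (by positivity)]
  have e5 : (1 + 2 * κ / y : ℂ) * Complex.exp ((x : ℂ) * Complex.I) - 1
      = ((2 * κ / y : ℝ) : ℂ) + (1 + ((2 * κ / y : ℝ) : ℂ)) *
        (Complex.exp ((x : ℂ) * Complex.I) - 1) := by push_cast; ring
  rw [e1, e5]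
  refine (norm_add_le _ _).trans ?_
  rw [norm_mul, e4]
  have e6 : ‖1 + ((2 * κ / y : ℝ) : ℂ)‖ ≤ 1 + 2 * κ := by
    refine (norm_add_le _ _).trans ?_
    rw [e4, norm_one]
    have : 2 * κ / y ≤ 2 * κ := div_le_self (by positivity) hy
    linarith
  calc _ ≤ 2 * κ / y + (1 + 2 * κ) * (2 * |q| * ((1 + 2 * κ) / y)) := by
        gcongr
        exact e2.trans e3
    _ = _ := by ring

/-- The weighted Wronskian. -/
noncomputable def wr (κ q : ℝ) (f g : ℝ → ℂ) (y : ℝ) : ℂ :=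
  weight κ q y * (f y * deriv g y - deriv f y * g y)

theorem eq_of_hasDerivAt_zero {D : ℝ → ℂ} (h : ∀ y : ℝ, 0 < y → HasDerivAt D 0 y) {y z : ℝ}
    (hy : 0 < y) (hz : 0 < z) : D y = D z := by
  have key : ∀ y z : ℝ, 0 < y → y ≤ z → D z = D y := by
    intro y z hy hyz
    have := norm_sub_le_of_norm_deriv_le (D := D) (D' := fun _ => 0) (b := fun _ => 0)
      (b' := fun _ => 0) hyz (fun t ht => h t (hy.trans_le ht.1))
      (fun t _ => hasDerivAt_const t 0) (fun t _ => by simp)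
    simpa [sub_eq_zero] using this
  rcases le_total y z with h1 | h1
  · exact (key y z hy h1).symm
  · exact key z y hz h1

/-- Abel's identity: the derivative of `weight` cancels the first-order term of the equation. -/
theorem wr_const (hκ : 0 ≤ κ) (hf : IsRed κ q lam f) (hg : IsRed κ q lam g) {y z : ℝ}
    (hy : 0 < y) (hz : 0 < z) : wr κ q f g y = wr κ q f g z := by
  refine eq_of_hasDerivAt_zero (fun y hy => ?_) hy hz
  have h1 := (hasDerivAt_weight (q := q) hκ hy).mul
    (((hf.hasDerivAt hy).mul (hg.hasDerivAt_deriv hy)).sub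
      ((hf.hasDerivAt_deriv hy).mul (hg.hasDerivAt hy)))
  refine h1.congr_deriv ?_
  have ef := hf.2 y hy
  have eg := hg.2 y hy
  simp only [weight, Pi.sub_apply, Pi.mul_apply]
  linear_combination Complex.exp (2 * Complex.I * q * theta κ y) * (f y * eg - g y * ef)

/-- Expansion of a vanishing 3×3 determinant with rows (f, g, h), (f, g, h), (f′, g′, h′). With
constant Wronskians it becomes a linear relation between three solutions. -/
theorem wr_three_term (f g h : ℝ → ℂ) (y : ℝ) :
    wr κ q g h y * f y = wr κ q f h y * g y - wr κ q f g y * h y := by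
  simp only [wr]
  ring

/-- Two solutions with nonvanishing Wronskian span the solution space. -/
theorem IsRed.exists_eq_linComb (hκ : 0 ≤ κ) (hf : IsRed κ q lam f) (hg : IsRed κ q lam g)
    (hφ : IsRed κ q lam φ) (hw : wr κ q g φ 1 ≠ 0) :
    ∀ y : ℝ, 0 < y → f y = wr κ q f φ 1 / wr κ q g φ 1 * g y
      + -(wr κ q f g 1 / wr κ q g φ 1) * φ y := by
  intro y hy
  have h := wr_three_term (κ := κ) (q := q) f g φ y
  rw [wr_const hκ hg hφ hy one_pos, wr_const hκ hf hφ hy one_pos,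
    wr_const hκ hf hg hy one_pos] at h
  field_simp
  linear_combination h

theorem wr_swap (f g : ℝ → ℂ) (y : ℝ) : wr κ q g f y = -wr κ q f g y := by
  simp only [wr]
  ring

theorem wr_congr {f' g' : ℝ → ℂ} (hf : EqOn f f' (Ioi 0)) (hg : EqOn g g' (Ioi 0)) {y : ℝ}
    (hy : 0 < y) : wr κ q f g y = wr κ q f' g' y := by
  simp only [wr, hf hy, hg hy, eqOn_deriv_Ioi hf hy, eqOn_deriv_Ioi hg hy]

theorem wr_linComb_left (hf : IsRed κ q lam f) (hg : IsRed κ q lam g) (A B : ℂ) (h : ℝ → ℂ)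
    {y : ℝ} (hy : 0 < y) :
    wr κ q (fun y => A * f y + B * g y) h y = A * wr κ q f h y + B * wr κ q g h y := by
  have := (((hf.hasDerivAt hy).const_mul A).add ((hg.hasDerivAt hy).const_mul B)).deriv
  simp only [Pi.add_def] at this
  simp only [wr, this]
  ring

theorem wr_self (f : ℝ → ℂ) (y : ℝ) : wr κ q f f y = 0 := by
  simp only [wr]
  ring

/-! ### Solutions which are regular at the horizon -/

theorem tendsto_deriv_of_contDiffOn_Ici {x : ℝ} (h : ContDiffOn ℝ ∞ f (Ici x)) :
    Tendsto f (𝓝[>] x) (𝓝 (f x)) ∧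
      Tendsto (deriv f) (𝓝[>] x) (𝓝 (derivWithin f (Ici x) x)) := by
  have hx : x ∈ Ici x := self_mem_Ici
  refine ⟨((h.continuousOn x hx).mono Ioi_subset_Ici_self), ?_⟩
  have h1 : ContinuousOn (derivWithin f (Ici x)) (Ici x) :=
    h.continuousOn_derivWithin (uniqueDiffOn_Ici x) (by simp)
  have h2 : Tendsto (derivWithin f (Ici x)) (𝓝[>] x) (𝓝 (derivWithin f (Ici x) x)) :=
    (h1 x hx).mono Ioi_subset_Ici_self
  refine h2.congr' ?_
  filter_upwards [self_mem_nhdsWithin] with y hy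
  exact derivWithin_of_mem_nhds (Ici_mem_nhds hy)

theorem tendsto_weight_zero (hκ : 0 ≤ κ) : Tendsto (weight κ q) (𝓝[>] 0) (𝓝 0) := by
  rw [tendsto_zero_iff_norm_tendsto_zero]
  have h1 : Tendsto (fun y : ℝ => y * (y + 2 * κ)) (𝓝[>] 0) (𝓝 0) := by
    have : Continuous fun y : ℝ => y * (y + 2 * κ) := by fun_prop
    simpa using (this.tendsto 0).mono_left nhdsWithin_le_nhds
  refine h1.congr' ?_
  filter_upwards [self_mem_nhdsWithin] with y hy
  exact (norm_weight hκ (le_of_lt hy)).symm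

/-- The weight vanishes at the horizon while smooth solutions and their derivatives stay bounded, so
the constant Wronskian is 0. -/
theorem wr_eq_zero_of_regular (hκ : 0 ≤ κ) (hf : IsRed κ q lam f) (hg : IsRed κ q lam g)
    (hf' : ContDiffOn ℝ ∞ f (Ici 0)) (hg' : ContDiffOn ℝ ∞ g (Ici 0)) : wr κ q f g 1 = 0 := by
  obtain ⟨f0, f1⟩ := tendsto_deriv_of_contDiffOn_Ici hf'
  obtain ⟨g0, g1⟩ := tendsto_deriv_of_contDiffOn_Ici hg'
  have h1 : Tendsto (wr κ q f g) (𝓝[>] 0) (𝓝 0) := by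
    have := (tendsto_weight_zero (q := q) hκ).mul ((f0.mul g1).sub (f1.mul g0))
    unfold wr
    simpa using this
  have h2 : Tendsto (wr κ q f g) (𝓝[>] 0) (𝓝 (wr κ q f g 1)) := by
    refine tendsto_const_nhds.congr' ?_
    filter_upwards [self_mem_nhdsWithin] with y hy
    exact wr_const hκ hf hg one_pos hy
  exact tendsto_nhds_unique h2 h1

/-- The solution which is regular at the horizon is determined by its value there. -/
theorem IsRed.eqOn_of_regular (hκ : 0 ≤ κ) (hf : IsRed κ q lam f) (hg : IsRed κ q lam g)
    (hφ : IsRed κ q lam φ) (hf' : ContDiffOn ℝ ∞ f (Ici 0)) (hg' : ContDiffOn ℝ ∞ g (Ici 0))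
    (hw : wr κ q g φ 1 ≠ 0) (hfg : f 0 = g 0) (hg0 : g 0 ≠ 0) : EqOn f g (Ici 0) := by
  have h1 := hf.exists_eq_linComb hκ hg hφ hw
  rw [wr_eq_zero_of_regular hκ hf hg hf' hg'] at h1
  obtain ⟨A, hA⟩ : ∃ A : ℂ, ∀ y : ℝ, 0 < y → f y = A * g y :=
    ⟨wr κ q f φ 1 / wr κ q g φ 1, fun y hy => by rw [h1 y hy, zero_div]; ring⟩
  have h2 : f 0 = A * g 0 := by
    have t1 := (tendsto_deriv_of_contDiffOn_Ici hf').1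
    have t2 := ((tendsto_deriv_of_contDiffOn_Ici hg').1.const_mul A)
    refine tendsto_nhds_unique (t1.congr' ?_) t2
    filter_upwards [self_mem_nhdsWithin] with y hy using hA y hy
  have h3 : A = 1 := by
    have : A * g 0 = 1 * g 0 := by rw [← h2, hfg, one_mul]
    exact mul_right_cancel₀ hg0 this
  intro y hy
  rcases eq_or_lt_of_le (show (0 : ℝ) ≤ y from hy) with h | h
  · rw [← h, hfg]
  · rw [hA y h, h3, one_mul]

/-! ### The conserved current -/

/-- The radial charge current of a solution. -/
noncomputable def current (κ q : ℝ) (f : ℝ → ℂ) (y : ℝ) : ℂ :=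
  (y : ℂ) * (y + 2 * κ) * (star (f y) * deriv f y - f y * star (deriv f y))
    + 2 * Complex.I * q * (1 + y) * (f y * star (f y))

/-- Multiplying the equation by the conjugate of f and subtracting the conjugate expression gives a
total derivative. The zeroth-order terms combine to 2iq|f|² precisely because λ is real. -/
theorem current_const {lam : ℝ} (hf : IsRed κ q lam f) {y z : ℝ} (hy : 0 < y) (hz : 0 < z) :
    current κ q f y = current κ q f z := by
  refine eq_of_hasDerivAt_zero (fun y hy => ?_) hy hz
  have h1 : HasDerivAt (fun y : ℝ => (y : ℂ) * (y + 2 * κ)) (2 * y + 2 * κ) y := by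
    have h := (hasDerivAt_id (y : ℂ)).mul ((hasDerivAt_id (y : ℂ)).add_const (2 * (κ : ℂ)))
    refine h.comp_ofReal.congr_deriv ?_
    simp only [id]
    ring
  have h2 : HasDerivAt (fun y : ℝ => 2 * Complex.I * q * (1 + (y : ℂ))) (2 * Complex.I * q) y := by
    have h := ((hasDerivAt_id (y : ℂ)).const_add 1).const_mul (2 * Complex.I * (q : ℂ))
    refine h.comp_ofReal.congr_deriv ?_
    ring
  have d0 := hf.hasDerivAt hy
  have d1 := hf.hasDerivAt_deriv hy
  refine ((h1.mul ((d0.star.mul d1).sub (d0.mul d1.star))).add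
    (h2.mul (d0.mul d0.star))).congr_deriv ?_
  have e := hf.2 y hy
  have e' := congrArg star e
  simp only [star_add, star_mul', star_sub, star_zero, RCLike.star_def, Complex.conj_ofReal,
    Complex.conj_I, map_ofNat] at e'
  simp only [Pi.sub_apply, Pi.mul_apply, RCLike.star_def] at *
  linear_combination (starRingEnd ℂ) (f y) * e - f y * e'

/-- At y = 0 the factor y(y + 2κ) removes the derivative terms and only the charge term survives. -/
theorem current_eq_of_regular {lam : ℝ} (hf : IsRed κ q lam f) (hf' : ContDiffOn ℝ ∞ f (Ici 0))
    {y : ℝ} (hy : 0 < y) : current κ q f y = 2 * Complex.I * q * (f 0 * star (f 0)) := by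
  obtain ⟨f0, f1⟩ := tendsto_deriv_of_contDiffOn_Ici hf'
  have c1 : Tendsto (fun y : ℝ => (y : ℂ) * (y + 2 * κ)) (𝓝[>] 0) (𝓝 0) := by
    have : Continuous fun y : ℝ => (y : ℂ) * (y + 2 * κ) := by fun_prop
    simpa using (this.tendsto 0).mono_left nhdsWithin_le_nhds
  have c2 : Tendsto (fun y : ℝ => 2 * Complex.I * q * (1 + (y : ℂ))) (𝓝[>] 0)
      (𝓝 (2 * Complex.I * q)) := by
    have : Continuous fun y : ℝ => 2 * Complex.I * q * (1 + (y : ℂ)) := by fun_prop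
    simpa using (this.tendsto 0).mono_left nhdsWithin_le_nhds
  have h1 : Tendsto (current κ q f) (𝓝[>] 0) (𝓝 (2 * Complex.I * q * (f 0 * star (f 0)))) := by
    have := (c1.mul ((f0.star.mul f1).sub (f0.mul f1.star))).add (c2.mul (f0.mul f0.star))
    unfold current
    simpa using this
  have h2 : Tendsto (current κ q f) (𝓝[>] 0) (𝓝 (current κ q f y)) := by
    refine tendsto_const_nhds.congr' ?_
    filter_upwards [self_mem_nhdsWithin] with z hz
    exact current_const hf hy hz
  exact tendsto_nhds_unique h2 h1

theorem ne_zero_of_regular {lam : ℝ} (hq : q ≠ 0) (hf : IsRed κ q lam f)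
    (hf' : ContDiffOn ℝ ∞ f (Ici 0)) (hf0 : f 0 = 1) {y : ℝ} (hy : 0 ≤ y) : f y ≠ 0 := by
  rcases eq_or_lt_of_le hy with h | h
  · rw [← h, hf0]; exact one_ne_zero
  -- Every term of the current contains f or its conjugate, so a zero of f would force 2iq = 0.
  · intro h0
    have := current_eq_of_regular hf hf' h
    simp [current, h0, hf0, hq] at this

end RNStat

namespace RNStat
open MeasureTheory

/-! ### Kernels of hypergeometric integrals -/

theorem hasDerivAt_cpow_real (s : ℂ) {y : ℝ} (hy : 0 < y) :
    HasDerivAt (fun y : ℝ => (y : ℂ) ^ s) (s * (y : ℂ) ^ (s - 1)) y := by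
  have h := (hasDerivAt_id (y : ℂ)).cpow_const (c := s) (Or.inl (by simpa using hy))
  refine h.comp_ofReal.congr_deriv ?_
  simp

theorem hasDerivAt_one_sub_cpow_real (s : ℂ) {y : ℝ} (hy : y < 1) :
    HasDerivAt (fun y : ℝ => (1 - y : ℂ) ^ s) (-(s * (1 - y : ℂ) ^ (s - 1))) y := by
  have h := ((hasDerivAt_id (y : ℂ)).const_sub 1).cpow_const (c := s)
    (Or.inl (by simpa using hy))
  refine h.comp_ofReal.congr_deriv ?_
  simp

/-- The `n`-th derivative of `(1 + ζ z) ^ (-s)`. -/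
noncomputable def powK (ζ s : ℂ) (n : ℕ) (z : ℝ) : ℂ :=
  (∏ i ∈ Finset.range n, (-(s + i) * ζ)) * (1 + ζ * z) ^ (-s - n)

theorem hasDerivAt_powK {ζ s : ℂ} (n : ℕ) {z : ℝ} (hz : 0 < (1 + ζ * z).re) :
    HasDerivAt (powK ζ s n) (powK ζ s (n + 1) z) z := by
  have h1 : HasDerivAt (fun z : ℝ => 1 + ζ * (z : ℂ)) ζ z := by
    have h := ((hasDerivAt_id (z : ℂ)).const_mul ζ).const_add 1
    refine h.comp_ofReal.congr_deriv (by ring)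
  have h2 : HasDerivAt (fun x : ℂ => x ^ (-s - n)) ((-s - n) * (1 + ζ * z) ^ (-s - n - 1))
      (1 + ζ * (z : ℂ)) := by
    refine ((hasDerivAt_id _).cpow_const (c := -s - n) (Or.inl hz)).congr_deriv ?_
    simp
  refine ((h2.comp z h1).const_mul (∏ i ∈ Finset.range n, (-(s + i) * ζ))).congr_deriv ?_
  rw [powK, Finset.prod_range_succ]
  have : -s - ((n + 1 : ℕ) : ℂ) = -s - n - 1 := by push_cast; ring
  rw [this]
  ring

theorem powK_succ_mul {ζ s : ℂ} (n : ℕ) {z : ℝ} (hz : 0 < (1 + ζ * z).re) :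
    (1 + ζ * z) * powK ζ s (n + 1) z = -(s + n) * ζ * powK ζ s n z := by
  have h0 : (1 + ζ * z) ≠ 0 := fun h => by rw [h] at hz; simp at hz
  have : -s - ((n + 1 : ℕ) : ℂ) = -s - n - 1 := by push_cast; ring
  rw [powK, powK, Finset.prod_range_succ, this, Complex.cpow_sub _ _ h0, Complex.cpow_one]
  field_simp

theorem norm_cpow_le_exp (w s : ℂ) : ‖w ^ s‖ ≤ ‖w‖ ^ s.re * Real.exp (Real.pi * |s.im|) := by
  refine (Complex.norm_cpow_le w s).trans ?_
  rw [div_eq_mul_inv, ← Real.exp_neg]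
  gcongr
  have h1 : |Complex.arg w * s.im| ≤ Real.pi * |s.im| := by
    rw [abs_mul]
    gcongr
    exact Complex.abs_arg_le_pi w
  have := neg_abs_le (Complex.arg w * s.im)
  linarith

/-- With the base at distance at least 1/2 from 0, a negative power is bounded by a power of 2 and a
positive one by a polynomial; the base to the exponent |Re| rounded up covers both. -/
theorem exists_norm_powK_le {V : Set ℝ} {ζ : ℂ} (hV : ∀ z ∈ V, 1 / 2 ≤ (1 + ζ * (z : ℂ)).re)
    (s : ℂ) (n : ℕ) : ∃ C : ℝ, ∃ N : ℕ, ∀ z ∈ V, ‖powK ζ s n z‖ ≤ C * (1 + |z|) ^ N := by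
  set ρ : ℝ := (-s - n).re with hρ
  set N : ℕ := ⌈|ρ|⌉₊ with hN
  refine ⟨‖∏ i ∈ Finset.range n, (-(s + i) * ζ)‖ * ((2 * (1 + ‖ζ‖)) ^ N *
    Real.exp (Real.pi * |(-s - n : ℂ).im|)), N, fun z hz => ?_⟩
  have hw := hV z hz
  set w : ℂ := 1 + ζ * z with hwdef
  have hw1 : 1 / 2 ≤ ‖w‖ := hw.trans (Complex.re_le_norm w)
  have hw0 : 0 < ‖w‖ := by linarith
  have hw2 : ‖w‖ ≤ (1 + ‖ζ‖) * (1 + |z|) := by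
    have h := norm_add_le (1 : ℂ) (ζ * z)
    rw [norm_one, norm_mul, Complex.norm_real, Real.norm_eq_abs] at h
    nlinarith [norm_nonneg ζ, abs_nonneg z]
  have hm : ‖w‖ ^ ρ ≤ (2 * (1 + ‖ζ‖) * (1 + |z|)) ^ N := by
    have hb : 1 ≤ 2 * (1 + ‖ζ‖) * (1 + |z|) := by
      nlinarith [norm_nonneg ζ, abs_nonneg z, mul_nonneg (norm_nonneg ζ) (abs_nonneg z)]
    have hρN : |ρ| ≤ N := Nat.le_ceil _
    rw [← Real.rpow_natCast]
    rcases le_total 1 ‖w‖ with h1 | h1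
    · calc ‖w‖ ^ ρ ≤ ‖w‖ ^ (N : ℝ) :=
            Real.rpow_le_rpow_of_exponent_le h1 ((le_abs_self ρ).trans hρN)
        _ ≤ _ := by
          refine Real.rpow_le_rpow hw0.le ?_ (by positivity)
          nlinarith [norm_nonneg ζ, abs_nonneg z, mul_nonneg (norm_nonneg ζ) (abs_nonneg z)]
    · have h2 : ‖w‖⁻¹ ≤ 2 := by
        rw [inv_le_comm₀ hw0 two_pos]; linarith
      have h3 : 1 ≤ ‖w‖⁻¹ := (one_le_inv₀ hw0).2 h1
      calc ‖w‖ ^ ρ = ‖w‖⁻¹ ^ (-ρ) := by rw [Real.inv_rpow hw0.le, Real.rpow_neg hw0.le, inv_inv]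
        _ ≤ ‖w‖⁻¹ ^ (N : ℝ) :=
            Real.rpow_le_rpow_of_exponent_le h3 ((neg_le_abs ρ).trans hρN)
        _ ≤ _ := by
          refine Real.rpow_le_rpow (by positivity) ?_ (by positivity)
          nlinarith [norm_nonneg ζ, abs_nonneg z, mul_nonneg (norm_nonneg ζ) (abs_nonneg z)]
  rw [powK, norm_mul, mul_assoc]
  gcongr
  calc ‖w ^ (-s - (n : ℂ))‖ ≤ ‖w‖ ^ ρ * Real.exp (Real.pi * |(-s - n : ℂ).im|) :=
        norm_cpow_le_exp _ _
    _ ≤ (2 * (1 + ‖ζ‖) * (1 + |z|)) ^ N * Real.exp (Real.pi * |(-s - n : ℂ).im|) := by gcongr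
    _ = _ := by rw [mul_pow]; ring

theorem integral_Ioo_eq_zero {P P' : ℝ → ℂ} (hd : ∀ t ∈ Ioo (0 : ℝ) 1, HasDerivAt P (P' t) t)
    (hi : IntegrableOn P' (Ioo 0 1)) (h0 : Tendsto P (𝓝[>] 0) (𝓝 0))
    (h1 : Tendsto P (𝓝[<] 1) (𝓝 0)) : ∫ t in Ioo (0 : ℝ) 1, P' t = 0 := by
  rw [← integral_Ioc_eq_integral_Ioo, ← intervalIntegral.integral_of_le zero_le_one,
    intervalIntegral.integral_eq_sub_of_hasDerivAt_of_tendsto zero_lt_one hd ?_ h0 h1, sub_zero]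
  rwa [intervalIntegrable_iff_integrableOn_Ioo_of_le zero_le_one]

theorem integral_Ioi_eq_zero {P P' : ℝ → ℂ} (hd : ∀ t ∈ Ioi (0 : ℝ), HasDerivAt P (P' t) t)
    (hi : IntegrableOn P' (Ioi 0)) (hP : IntegrableOn P (Ioi 0)) (h0 : Tendsto P (𝓝[>] 0) (𝓝 0)) :
    ∫ t in Ioi (0 : ℝ), P' t = 0 := by
  have h1 := tendsto_zero_of_hasDerivAt_of_integrableOn_Ioi hd hi hP
  -- The boundary value at 0 exists only as a one-sided limit, so the primitive is redefined there
  -- to be 0.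
  have hne : ∀ t ∈ Ioi (0 : ℝ), Function.update P 0 0 =ᶠ[𝓝 t] P := fun t ht => by
    filter_upwards [isOpen_Ioi.mem_nhds ht] with x hx
    exact Function.update_of_ne (ne_of_gt hx) _ _
  have h2 := integral_Ioi_of_hasDerivAt_of_tendsto (f := Function.update P 0 0) (f' := P')
    (a := 0) (m := 0) ?_ (fun t ht => (hd t ht).congr_of_eventuallyEq (hne t ht)) hi ?_
  · simpa using h2
  · rw [continuousWithinAt_update_same, Ici_sdiff_left]
    exact h0
  · refine h1.congr' ?_
    filter_upwards [eventually_gt_atTop 0] with t ht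
    exact (Function.update_of_ne ht.ne' _ _).symm

theorem mul_cpow_self {x : ℂ} (hx : x ≠ 0) (s : ℂ) : x * x ^ s = x ^ (1 + s) := by
  rw [Complex.cpow_add _ _ hx, Complex.cpow_one]

theorem tendsto_cpow_real_zero {a : ℂ} (ha : 0 < a.re) :
    Tendsto (fun t : ℝ => (t : ℂ) ^ a) (𝓝[>] 0) (𝓝 0) := by
  have h := (Complex.continuousAt_ofReal_cpow_const 0 a (Or.inl ha)).tendsto
  have ha0 : a ≠ 0 := fun h => by simp [h] at ha
  simp only [Complex.ofReal_zero, Complex.zero_cpow ha0] at h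
  exact h.mono_left nhdsWithin_le_nhds

theorem tendsto_one_sub_cpow_real_zero {a : ℂ} (ha : 0 < a.re) :
    Tendsto (fun t : ℝ => (1 - t : ℂ) ^ a) (𝓝[<] 1) (𝓝 0) := by
  have h1 : Tendsto (fun t : ℝ => 1 - t) (𝓝[<] 1) (𝓝[>] 0) := by
    refine tendsto_nhdsWithin_iff.2 ⟨?_, ?_⟩
    · have : Continuous fun t : ℝ => 1 - t := by fun_prop
      simpa using (this.tendsto 1).mono_left nhdsWithin_le_nhds
    · filter_upwards [self_mem_nhdsWithin] with t ht
      simpa using ht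
  refine ((tendsto_cpow_real_zero ha).comp h1).congr fun t => ?_
  simp

theorem integrableOn_beta {u v : ℂ} (hu : 0 < u.re) (hv : 0 < v.re) (n : ℕ) :
    IntegrableOn (fun t : ℝ => (t : ℂ) ^ n * ((t : ℂ) ^ (u - 1) * (1 - t : ℂ) ^ (v - 1)))
      (Ioo 0 1) := by
  have h := Complex.betaIntegral_convergent (u := u + n) (v := v)
    (by simp only [Complex.add_re, Complex.natCast_re]; positivity) hv
  rw [intervalIntegrable_iff_integrableOn_Ioo_of_le zero_le_one] at h
  refine h.congr_fun (fun t ht => ?_) measurableSet_Ioo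
  have ht0 : (t : ℂ) ≠ 0 := by exact_mod_cast ht.1.ne'
  have e : u + n - 1 = u - 1 + n := by ring
  simp only [e]
  rw [Complex.cpow_add _ _ ht0, Complex.cpow_natCast]
  ring

theorem integrableOn_gamma {u : ℂ} (hu : 0 < u.re) (n : ℕ) :
    IntegrableOn (fun t : ℝ => (t : ℂ) ^ n * ((t : ℂ) ^ (u - 1) * Complex.exp (-t))) (Ioi 0) := by
  have h := Complex.GammaIntegral_convergent (s := u + n)
    (by simp only [Complex.add_re, Complex.natCast_re]; positivity)
  refine h.congr_fun (fun t ht => ?_) measurableSet_Ioi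
  have ht0 : (t : ℂ) ≠ 0 := by exact_mod_cast (show (0 : ℝ) < t from ht).ne'
  have e : u + n - 1 = u - 1 + n := by ring
  simp only [e]
  rw [Complex.cpow_add _ _ ht0, Complex.cpow_natCast]
  push_cast
  ring

theorem integral_Ioo_beta (u v : ℂ) :
    ∫ t in Ioo (0 : ℝ) 1, (t : ℂ) ^ (u - 1) * (1 - t : ℂ) ^ (v - 1) = Complex.betaIntegral u v := by
  rw [Complex.betaIntegral, intervalIntegral.integral_of_le zero_le_one,
    integral_Ioc_eq_integral_Ioo]

/-! ### Solutions regular at the horizon, as integrals -/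

/-- Up to normalisation, the solution regular at `y = 0`, together with its derivatives. -/
noncomputable def horInt (T : Set ℝ) (om : ℝ → ℂ) (ζ a b : ℂ) (n : ℕ) (y : ℝ) : ℂ :=
  ∫ t in T, (t : ℂ) ^ n * ((t : ℂ) ^ (a - 1) * om t) * powK ζ b n (y * t)

/-- The equation applied to the integrand is an exact t-derivative. The parameter ε treats both
cases at once: ε = 1 with S = (1 − t)^ν for Euler's integral, ε = 0 with ν = 1 and S = e^(−t) for
the confluent one. -/
theorem hasDerivAt_horInt_primitive {om S : ℝ → ℂ} {κ ν ε ζ a b m : ℂ} {y t : ℝ} (ht : 0 < t)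
    (hw : 0 < (1 + ζ * ((y * t : ℝ) : ℂ)).re) (hS : HasDerivAt S (-ν * om t) t)
    (hS' : S t = (1 - ε * t) * om t) (hε : ε = 2 * κ * ζ) (hν : ν + ε * a = m * ζ) :
    HasDerivAt (fun t : ℝ => b * ((t : ℂ) ^ a * S t * powK ζ (b + 1) 0 (y * t)))
      ((y : ℂ) * (y + 2 * κ) * ((t : ℂ) ^ 2 * ((t : ℂ) ^ (a - 1) * om t) * powK ζ b 2 (y * t))
        + (m + (a + b + 1) * y) * ((t : ℂ) ^ 1 * ((t : ℂ) ^ (a - 1) * om t) * powK ζ b 1 (y * t))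
        + a * b * ((t : ℂ) ^ 0 * ((t : ℂ) ^ (a - 1) * om t) * powK ζ b 0 (y * t))) t := by
  have h1 : HasDerivAt (fun t : ℝ => powK ζ (b + 1) 0 (y * t))
      (y * powK ζ (b + 1) 1 (y * t)) t := by
    have := (hasDerivAt_powK (s := b + 1) 0 hw).scomp t ((hasDerivAt_id t).const_mul y)
    refine this.congr_deriv ?_
    simp
  have h2 := (((hasDerivAt_cpow_real a ht).mul hS).mul h1).const_mul b
  refine h2.congr_deriv ?_
  have ht0 : (t : ℂ) ≠ 0 := by exact_mod_cast ht.ne'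
  have hw0 : (1 + ζ * ((y * t : ℝ) : ℂ)) ≠ 0 := fun h => by rw [h] at hw; simp at hw
  -- All kernels are reduced to the common power (1 + ζyt)^(−b−2), after which the claim is
  -- polynomial.
  have e2 : powK ζ (b + 1) 1 (y * t) = -(b + 1) * ζ * (1 + ζ * ((y * t : ℝ) : ℂ)) ^ (-b - 2) := by
    simp only [powK, Finset.prod_range_one, Nat.cast_zero, Nat.cast_one, add_zero]
    congr 2
    ring
  have e3 : powK ζ (b + 1) 0 (y * t)
      = (1 + ζ * ((y * t : ℝ) : ℂ)) * (1 + ζ * ((y * t : ℝ) : ℂ)) ^ (-b - 2) := by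
    rw [mul_cpow_self hw0]
    simp only [powK, Finset.prod_range_zero, Nat.cast_zero, one_mul]
    congr 1
    ring
  have e4 : powK ζ b 2 (y * t) = b * (b + 1) * ζ ^ 2 * (1 + ζ * ((y * t : ℝ) : ℂ)) ^ (-b - 2) := by
    simp only [powK, Finset.prod_range_succ, Finset.prod_range_zero, Nat.cast_zero, Nat.cast_one,
      Nat.cast_ofNat]
    ring
  have e5 : powK ζ b 1 (y * t)
      = -b * ζ * ((1 + ζ * ((y * t : ℝ) : ℂ)) * (1 + ζ * ((y * t : ℝ) : ℂ)) ^ (-b - 2)) := by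
    rw [mul_cpow_self hw0]
    simp only [powK, Finset.prod_range_one, Nat.cast_zero, Nat.cast_one, add_zero]
    congr 2
    ring
  have e6 : powK ζ b 0 (y * t) = (1 + ζ * ((y * t : ℝ) : ℂ)) * ((1 + ζ * ((y * t : ℝ) : ℂ)) *
      (1 + ζ * ((y * t : ℝ) : ℂ)) ^ (-b - 2)) := by
    rw [mul_cpow_self hw0, mul_cpow_self hw0]
    simp only [powK, Finset.prod_range_zero, Nat.cast_zero, one_mul]
    congr 1
    ring
  have e7 : (t : ℂ) ^ a = t * (t : ℂ) ^ (a - 1) := by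
    rw [mul_cpow_self ht0]
    congr 1
    ring
  simp only [Pi.mul_apply]
  rw [e2, e3, e4, e5, e6, hS', e7]
  push_cast
  set W := (1 + ζ * (y * t : ℂ)) ^ (-b - 2)
  set A := (t : ℂ) ^ (a - 1)
  subst hε
  linear_combination (-(b * A * om t * W * (1 + ζ * (y * t)) * t)) * hν

theorem horInt_ode {T : Set ℝ} {om P : ℝ → ℂ} {κ ζ a b m : ℂ} {y : ℝ}
    (hi : ∀ n, IntegrableOn
      (fun t : ℝ => (t : ℂ) ^ n * ((t : ℂ) ^ (a - 1) * om t) * powK ζ b n (y * t)) T)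
    (h0 : ∀ P' : ℝ → ℂ, IntegrableOn P' T → (∀ t ∈ T, HasDerivAt P (P' t) t) → ∫ t in T, P' t = 0)
    (hP : ∀ t ∈ T, HasDerivAt P
      ((y : ℂ) * (y + 2 * κ) * ((t : ℂ) ^ 2 * ((t : ℂ) ^ (a - 1) * om t) * powK ζ b 2 (y * t))
        + (m + (a + b + 1) * y) * ((t : ℂ) ^ 1 * ((t : ℂ) ^ (a - 1) * om t) * powK ζ b 1 (y * t))
        + a * b * ((t : ℂ) ^ 0 * ((t : ℂ) ^ (a - 1) * om t) * powK ζ b 0 (y * t))) t) :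
    (y : ℂ) * (y + 2 * κ) * horInt T om ζ a b 2 y + (m + (a + b + 1) * y) * horInt T om ζ a b 1 y
      + a * b * horInt T om ζ a b 0 y = 0 := by
  have i2 := (hi 2).const_mul ((y : ℂ) * (y + 2 * κ))
  have i1 := (hi 1).const_mul (m + (a + b + 1) * y)
  have i0 := (hi 0).const_mul (a * b)
  have h := h0 _ ((i2.add i1).add i0) hP
  simp only [horInt]
  rw [← integral_const_mul, ← integral_const_mul, ← integral_const_mul]
  exact (congrArg₂ (· + ·) (integral_add i2 i1).symm rfl).trans
    ((integral_add (i2.add i1) i0).symm.trans h)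

/-- This is why Euler's integral is smooth across y = 0, on the whole half-line y > −κ. -/
theorem euler_re {κ : ℝ} (hκ : 0 < κ) {z : ℝ} (hz : -κ < z) :
    1 / 2 ≤ (1 + (2 * (κ : ℂ))⁻¹ * (z : ℂ)).re := by
  have : (1 + (2 * (κ : ℂ))⁻¹ * (z : ℂ)) = ((1 + (2 * κ)⁻¹ * z : ℝ) : ℂ) := by push_cast; ring
  rw [this, Complex.ofReal_re]
  have h2 : -(1 / 2) ≤ (2 * κ)⁻¹ * z := by
    have : (2 * κ)⁻¹ * (-κ) ≤ (2 * κ)⁻¹ * z := by gcongr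
    rwa [show (2 * κ)⁻¹ * (-κ) = -(1 / 2) by field_simp] at this
  linarith

/-- Here ζ is purely imaginary, so in the extremal case the kernel is regular for every real y. -/
theorem confluent_re {q : ℝ} {z : ℝ} : (1 + (2 * Complex.I * q)⁻¹ * (z : ℂ)).re = 1 := by
  have : ((2 * Complex.I * q)⁻¹ * (z : ℂ)) = ((-(z * (2 * q)⁻¹) : ℝ) : ℂ) * Complex.I := by
    push_cast
    rw [mul_inv, mul_inv, Complex.inv_I, mul_inv]
    ring
  rw [this]
  simp

theorem euler_mem {κ : ℝ} (hκ : 0 < κ) : ∀ y ∈ Ioi (-κ), ∀ t ∈ Ioo (0 : ℝ) 1, y * t ∈ Ioi (-κ) := by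
  intro y hy t ht
  simp only [mem_Ioi, mem_Ioo] at *
  rcases le_total 0 y with h | h
  · have := mul_nonneg h ht.1.le
    linarith
  · nlinarith [ht.1, ht.2]

theorem hasDerivAt_horInt_euler {κ : ℝ} (hκ : 0 < κ) {a ν : ℂ} (ha : 0 < a.re) (hν : 0 < ν.re)
    (b : ℂ) (n : ℕ) {y : ℝ} (hy : -κ < y) :
    HasDerivAt (horInt (Ioo 0 1) (fun t => (1 - t : ℂ) ^ (ν - 1)) (2 * (κ : ℂ))⁻¹ a b n)
      (horInt (Ioo 0 1) (fun t => (1 - t : ℂ) ^ (ν - 1)) (2 * (κ : ℂ))⁻¹ a b (n + 1) y) y ∧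
    IntegrableOn (fun t : ℝ => (t : ℂ) ^ n * ((t : ℂ) ^ (a - 1) * (1 - t : ℂ) ^ (ν - 1)) *
      powK (2 * (κ : ℂ))⁻¹ b n (y * t)) (Ioo 0 1) :=
  hasDerivAt_kernelIntegral measurableSet_Ioo isOpen_Ioi (euler_mem hκ)
    (integrableOn_beta ha hν)
    (fun n z hz => hasDerivAt_powK n (by linarith [euler_re hκ hz]))
    (fun n => exists_norm_powK_le (fun z hz => euler_re hκ hz) b n) n hy

theorem hasDerivAt_horInt_confluent (q : ℝ) {a : ℂ} (ha : 0 < a.re) (b : ℂ) (n : ℕ) (y : ℝ) :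
    HasDerivAt (horInt (Ioi 0) (fun t => Complex.exp (-t)) (2 * Complex.I * q)⁻¹ a b n)
      (horInt (Ioi 0) (fun t => Complex.exp (-t)) (2 * Complex.I * q)⁻¹ a b (n + 1) y) y ∧
    IntegrableOn (fun t : ℝ => (t : ℂ) ^ n * ((t : ℂ) ^ (a - 1) * Complex.exp (-t)) *
      powK (2 * Complex.I * q)⁻¹ b n (y * t)) (Ioi 0) :=
  hasDerivAt_kernelIntegral (V := univ) measurableSet_Ioi isOpen_univ (fun _ _ _ _ => mem_univ _)
    (integrableOn_gamma ha)
    (fun n z _ => hasDerivAt_powK n (by rw [confluent_re]; exact one_pos))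
    (fun n => exists_norm_powK_le (fun z _ => by rw [confluent_re]; norm_num) b n) n (mem_univ y)

/-- Boundary terms vanish at t = 0 by Re a > 0 and at t = 1 by Re ν > 0. -/
theorem horInt_ode_euler {κ : ℝ} (hκ : 0 < κ) {a ν : ℂ} (ha : 0 < a.re) (hν : 0 < ν.re)
    (b : ℂ) {y : ℝ} (hy : -κ < y) :
    letI F := horInt (Ioo 0 1) (fun t => (1 - t : ℂ) ^ (ν - 1)) (2 * (κ : ℂ))⁻¹ a b
    (y : ℂ) * (y + 2 * κ) * F 2 y + (2 * κ * (a + ν) + (a + b + 1) * y) * F 1 y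
      + a * b * F 0 y = 0 := by
  have hκ2 : 2 * (κ : ℂ) ≠ 0 := mul_ne_zero two_ne_zero (by exact_mod_cast hκ.ne')
  have hc : ∀ t ∈ Icc (0 : ℝ) 1, ContinuousAt (fun t : ℝ => powK (2 * (κ : ℂ))⁻¹ (b + 1) 0 (y * t)) t := by
    intro t ht
    have h : -κ < y * t := by
      rcases le_total 0 y with h | h
      · have := mul_nonneg h ht.1
        linarith
      · nlinarith [ht.1, ht.2]
    have h1 := (hasDerivAt_powK (s := b + 1) 0
      (lt_of_lt_of_le (by norm_num) (euler_re hκ h))).continuousAt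
    exact ContinuousAt.comp (f := fun t : ℝ => y * t) h1 (by fun_prop)
  have hc' : ∀ (s : ℂ) {t : ℝ}, t < 1 → ContinuousAt (fun t : ℝ => (1 - t : ℂ) ^ s) t :=
    fun s t ht => (hasDerivAt_one_sub_cpow_real s ht).continuousAt
  refine horInt_ode
    (P := fun t : ℝ => b * ((t : ℂ) ^ a * (1 - t : ℂ) ^ ν * powK (2 * (κ : ℂ))⁻¹ (b + 1) 0 (y * t)))
    (fun n => (hasDerivAt_horInt_euler hκ ha hν b n hy).2) ?_ ?_
  · intro P' hi hd
    refine integral_Ioo_eq_zero hd hi ?_ ?_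
    · have h1 := (((tendsto_cpow_real_zero ha).mul
        ((hc' ν zero_lt_one).tendsto.mono_left nhdsWithin_le_nhds)).mul
        ((hc 0 (by simp)).tendsto.mono_left nhdsWithin_le_nhds)).const_mul b
      simpa using h1
    · have h0 : ContinuousAt (fun t : ℝ => (t : ℂ) ^ a) 1 :=
        (hasDerivAt_cpow_real a zero_lt_one).continuousAt
      have h1 := (((h0.tendsto.mono_left nhdsWithin_le_nhds).mul
        (tendsto_one_sub_cpow_real_zero hν)).mul
        ((hc 1 (by simp)).tendsto.mono_left nhdsWithin_le_nhds)).const_mul b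
      simpa using h1
  · intro t ht
    have h1 : (1 - t : ℂ) ≠ 0 := by
      have : (1 - t : ℝ) ≠ 0 := by linarith [ht.2]
      exact_mod_cast this
    refine hasDerivAt_horInt_primitive (om := fun t : ℝ => (1 - t : ℂ) ^ (ν - 1))
      (S := fun t : ℝ => (1 - t : ℂ) ^ ν) (κ := (κ : ℂ)) (ζ := (2 * (κ : ℂ))⁻¹) (a := a) (b := b)
      (m := 2 * κ * (a + ν)) (y := y) (ν := ν) (ε := 1) ht.1
      (lt_of_lt_of_le (by norm_num) (euler_re hκ (euler_mem hκ y hy t ht))) ?_ ?_ ?_ ?_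
    · refine (hasDerivAt_one_sub_cpow_real ν ht.2).congr_deriv (by ring)
    · simp only [one_mul]
      rw [mul_cpow_self h1]
      congr 1
      ring
    · rw [mul_inv_cancel₀ hκ2]
    · linear_combination (-(a + ν)) * mul_inv_cancel₀ hκ2

theorem horInt_ode_confluent {q : ℝ} (hq : q ≠ 0) {a : ℂ} (ha : 0 < a.re) (b : ℂ) (y : ℝ) :
    letI F := horInt (Ioi 0) (fun t => Complex.exp (-t)) (2 * Complex.I * q)⁻¹ a b
    (y : ℂ) * (y + 2 * (0 : ℂ)) * F 2 y + (2 * Complex.I * q + (a + b + 1) * y) * F 1 y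
      + a * b * F 0 y = 0 := by
  have hq' : (q : ℂ) ≠ 0 := by exact_mod_cast hq
  have hw : ∀ z : ℝ, 0 < (1 + (2 * Complex.I * q)⁻¹ * (z : ℂ)).re := fun z => by
    rw [confluent_re]; exact one_pos
  refine horInt_ode
    (P := fun t : ℝ => b * ((t : ℂ) ^ a * Complex.exp (-t) *
      powK (2 * Complex.I * q)⁻¹ (b + 1) 0 (y * t)))
    (fun n => (hasDerivAt_horInt_confluent q ha b n y).2) ?_ ?_
  · intro P' hi hd
    refine integral_Ioi_eq_zero hd hi ?_ ?_
    · have h1 := ((hasDerivAt_horInt_confluent q (a := a + 1)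
        (by simp only [Complex.add_re, Complex.one_re]; linarith) (b + 1) 0 y).2).const_mul b
      refine IntegrableOn.congr_fun h1 (fun t _ => ?_) measurableSet_Ioi
      simp
    · have h1 : ContinuousAt (fun t : ℝ => Complex.exp (-(t : ℂ)) *
          powK (2 * Complex.I * q)⁻¹ (b + 1) 0 (y * t)) 0 := by
        refine ContinuousAt.mul (by fun_prop) ?_
        have h1 := (hasDerivAt_powK (s := b + 1) 0 (hw (y * 0))).continuousAt
        exact ContinuousAt.comp (f := fun t : ℝ => y * t) h1 (by fun_prop)
      have h2 := ((tendsto_cpow_real_zero ha).mul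
        (h1.tendsto.mono_left nhdsWithin_le_nhds)).const_mul b
      simpa [mul_assoc] using h2
  · intro t ht
    refine hasDerivAt_horInt_primitive (om := fun t : ℝ => Complex.exp (-t))
      (S := fun t : ℝ => Complex.exp (-t)) (κ := 0) (ζ := (2 * Complex.I * q)⁻¹) (a := a) (b := b)
      (m := 2 * Complex.I * q) (y := y) (ν := 1) (ε := 0) ht (hw _) ?_ ?_ ?_ ?_
    · have h := ((hasDerivAt_id (t : ℂ)).neg.cexp).comp_ofReal
      refine h.congr_deriv ?_
      simp
    · simp
    · simp
    · rw [mul_inv_cancel₀ (mul_ne_zero (mul_ne_zero two_ne_zero Complex.I_ne_zero) hq')]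
      ring

end RNStat

/-! ### Exponents at infinity and their relation to the separation constant -/

namespace RNStat
open MeasureTheory

/-- The exponent `1/2 + iq + β/2`. -/
noncomputable def pa (q : ℝ) (β : ℂ) : ℂ := 1 / 2 + Complex.I * q + β / 2

theorem pa_re (q : ℝ) (β : ℂ) : (pa q β).re = 1 / 2 + β.re / 2 := by
  simp [pa]

theorem pa_re_pos (q : ℝ) {β : ℂ} (hβ : -1 < β.re) : 0 < (pa q β).re := by
  rw [pa_re]; linarith

theorem one_sub_pa_re_pos (q : ℝ) {β : ℂ} (hβ : -1 < β.re) : 0 < (1 - pa q (-β)).re := by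
  rw [Complex.sub_re, pa_re, Complex.neg_re, Complex.one_re]; linarith

/-- Together with `pa_add_pa` this identifies `IsRed` as the hypergeometric equation with parameters
a = `pa q β`, b = `pa q (-β)`. -/
theorem pa_mul_pa (q : ℝ) (β : ℂ) : pa q β * pa q (-β) = Complex.I * q - sepConst q β := by
  simp only [pa, sepConst]
  linear_combination (q : ℂ) ^ 2 * Complex.I_sq

theorem pa_add_pa (q : ℝ) (β : ℂ) : pa q β + pa q (-β) + 1 = 2 + 2 * Complex.I * q := by
  simp only [pa]
  ring

theorem sepConst_neg (q : ℝ) (β : ℂ) : sepConst q (-β) = sepConst q β := by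
  simp [sepConst]

/-! ### Solutions regular at the horizon -/

/-- The parameter `c - a` of the hypergeometric equation in the sub-extremal case. -/
noncomputable def nuPar (κ q : ℝ) (β : ℂ) : ℂ := 1 + Complex.I * q / κ - pa q β

theorem nuPar_re (κ q : ℝ) (β : ℂ) : (nuPar κ q β).re = 1 / 2 - β.re / 2 := by
  have : (Complex.I * q / κ) = ((q / κ : ℝ) : ℂ) * Complex.I := by push_cast; ring
  simp only [nuPar, this, Complex.sub_re, Complex.add_re, pa_re, Complex.re_ofReal_mul,
    Complex.I_re, Complex.one_re]
  ring

/-- The unnormalised regular solution and its derivatives. -/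
noncomputable def horRaw (κ q : ℝ) (β : ℂ) (n : ℕ) (y : ℝ) : ℂ :=
  if κ = 0 then horInt (Ioi 0) (fun t => Complex.exp (-t)) (2 * Complex.I * q)⁻¹
    (pa q β) (pa q (-β)) n y
  else horInt (Ioo 0 1) (fun t => (1 - t : ℂ) ^ (nuPar κ q β - 1)) (2 * (κ : ℂ))⁻¹
    (pa q β) (pa q (-β)) n y

/-- The range of `β` for which the integral representation converges. -/
def HorRange (κ : ℝ) (β : ℂ) : Prop := -1 < β.re ∧ (κ = 0 ∨ β.re < 1)

variable {κ q : ℝ} {β : ℂ}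

theorem horRaw_zero (hκ : κ = 0) (β : ℂ) (n : ℕ) : horRaw κ q β n
    = horInt (Ioi 0) (fun t => Complex.exp (-t)) (2 * Complex.I * q)⁻¹ (pa q β) (pa q (-β)) n := by
  ext y; simp only [horRaw, if_pos hκ]

theorem horRaw_pos (hκ : κ ≠ 0) (β : ℂ) (n : ℕ) : horRaw κ q β n
    = horInt (Ioo 0 1) (fun t => (1 - t : ℂ) ^ (nuPar κ q β - 1)) (2 * (κ : ℂ))⁻¹
    (pa q β) (pa q (-β)) n := by
  ext y; simp only [horRaw, if_neg hκ]

theorem nuPar_re_pos (q : ℝ) (hβ : β.re < 1) : 0 < (nuPar κ q β).re := by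
  rw [nuPar_re]; linarith

/-- A neighbourhood of `[0, ∞)` on which the regular solution is defined. -/
noncomputable def horDom (κ : ℝ) : Set ℝ := if κ = 0 then univ else Ioi (-κ)

theorem isOpen_horDom (κ : ℝ) : IsOpen (horDom κ) := by
  unfold horDom; split_ifs
  · exact isOpen_univ
  · exact isOpen_Ioi

theorem Ici_subset_horDom (hκ : 0 ≤ κ) : Ici 0 ⊆ horDom κ := by
  unfold horDom; split_ifs with h
  · exact subset_univ _
  · intro y hy
    have : 0 < κ := lt_of_le_of_ne hκ (Ne.symm h)
    have hy' : (0 : ℝ) ≤ y := hy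
    simp only [mem_Ioi]
    linarith

theorem hasDerivAt_horRaw (hκ : 0 ≤ κ) (hβ : HorRange κ β) (n : ℕ) {y : ℝ} (hy : y ∈ horDom κ) :
    HasDerivAt (horRaw κ q β n) (horRaw κ q β (n + 1) y) y := by
  rcases eq_or_ne κ 0 with h | h
  · rw [horRaw_zero h, horRaw_zero h]
    exact (hasDerivAt_horInt_confluent q (pa_re_pos q hβ.1) _ n y).1
  · rw [horRaw_pos h, horRaw_pos h]
    have hk : 0 < κ := lt_of_le_of_ne hκ h.symm
    rw [horDom, if_neg h] at hy
    exact (hasDerivAt_horInt_euler hk (pa_re_pos q hβ.1)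
      (nuPar_re_pos q (hβ.2.resolve_left h)) _ n hy).1

theorem horRaw_ode (hκ : 0 ≤ κ) (hq : q ≠ 0) (hβ : HorRange κ β) {y : ℝ} (hy : y ∈ horDom κ) :
    (y : ℂ) * (y + 2 * κ) * horRaw κ q β 2 y
      + (2 * κ + 2 * Complex.I * q + (2 + 2 * Complex.I * q) * y) * horRaw κ q β 1 y
      + (Complex.I * q - sepConst q β) * horRaw κ q β 0 y = 0 := by
  rw [← pa_mul_pa, ← pa_add_pa q β]
  rcases eq_or_ne κ 0 with h | h
  · rw [horRaw_zero h, horRaw_zero h, horRaw_zero h]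
    have := horInt_ode_confluent hq (pa_re_pos q hβ.1) (pa q (-β)) y
    rw [h]
    simpa using this
  · rw [horRaw_pos h, horRaw_pos h, horRaw_pos h]
    have hk : 0 < κ := lt_of_le_of_ne hκ h.symm
    rw [horDom, if_neg h] at hy
    have := horInt_ode_euler hk (pa_re_pos q hβ.1)
      (nuPar_re_pos (κ := κ) q (hβ.2.resolve_left h)) (pa q (-β)) hy
    have e : 2 * (κ : ℂ) * (pa q β + nuPar κ q β) = 2 * κ + 2 * Complex.I * q := by
      have hk' : (κ : ℂ) ≠ 0 := by exact_mod_cast h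
      simp only [nuPar]
      field_simp
      ring
    rw [e] at this
    exact this

/-- The normalisation constant of `horRaw`. -/
noncomputable def horNorm (κ q : ℝ) (β : ℂ) : ℂ :=
  if κ = 0 then Complex.Gamma (pa q β)
  else Complex.Gamma (pa q β) * Complex.Gamma (nuPar κ q β) /
    Complex.Gamma (1 + Complex.I * q / κ)

theorem powK_zero (ζ s : ℂ) : powK ζ s 0 0 = 1 := by
  simp [powK]

theorem c_re_pos (κ q : ℝ) : 0 < (1 + Complex.I * q / κ).re := by
  have : (Complex.I * q / κ) = ((q / κ : ℝ) : ℂ) * Complex.I := by push_cast; ring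
  rw [this]; simp

theorem betaIntegral_eq {u v : ℂ} (hu : 0 < u.re) (hv : 0 < v.re) :
    Complex.betaIntegral u v = Complex.Gamma u * Complex.Gamma v / Complex.Gamma (u + v) := by
  rw [Complex.Gamma_mul_Gamma_eq_betaIntegral hu hv, mul_div_cancel_left₀]
  exact Complex.Gamma_ne_zero_of_re_pos (by rw [Complex.add_re]; linarith)

/-- At y = 0 the kernel equals 1 and a Gamma or Beta integral is left. -/
theorem horRaw_at_zero (hβ : HorRange κ β) : horRaw κ q β 0 0 = horNorm κ q β := by
  have ha := pa_re_pos q hβ.1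
  rcases eq_or_ne κ 0 with h | h
  · rw [horRaw_zero h, horNorm, if_pos h, Complex.Gamma_eq_integral ha, Complex.GammaIntegral]
    simp only [horInt, zero_mul, powK_zero, mul_one, pow_zero, one_mul]
    congr 1
    ext t
    push_cast
    ring
  · have hν := nuPar_re_pos (κ := κ) q (hβ.2.resolve_left h)
    rw [horRaw_pos h, horNorm, if_neg h]
    simp only [horInt, zero_mul, powK_zero, mul_one, pow_zero, one_mul]
    rw [integral_Ioo_beta, betaIntegral_eq ha hν]
    congr 2
    simp only [nuPar]
    ring

theorem horNorm_ne_zero (hβ : HorRange κ β) : horNorm κ q β ≠ 0 := by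
  have ha := Complex.Gamma_ne_zero_of_re_pos (pa_re_pos q hβ.1)
  rcases eq_or_ne κ 0 with h | h
  · rwa [horNorm, if_pos h]
  · have hν := Complex.Gamma_ne_zero_of_re_pos (nuPar_re_pos (κ := κ) q (hβ.2.resolve_left h))
    rw [horNorm, if_neg h]
    exact div_ne_zero (mul_ne_zero ha hν) (Complex.Gamma_ne_zero_of_re_pos (c_re_pos κ q))

/-- The solution of the reduced equation with value `1` at the horizon. -/
noncomputable def hor (κ q : ℝ) (β : ℂ) (y : ℝ) : ℂ := horRaw κ q β 0 y / horNorm κ q β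

theorem hor_zero (hβ : HorRange κ β) : hor κ q β 0 = 1 := by
  rw [hor, horRaw_at_zero hβ, div_self (horNorm_ne_zero hβ)]

theorem hor_smooth (hκ : 0 ≤ κ) (hβ : HorRange κ β) : ContDiffOn ℝ ∞ (hor κ q β) (Ici 0) := by
  have := contDiffOn_of_hasDerivAt_succ (isOpen_horDom κ)
    (fun n y hy => hasDerivAt_horRaw (q := q) hκ hβ n hy) 0
  exact (this.mono (Ici_subset_horDom hκ)).div_const _

theorem hasDerivAt_hor (hκ : 0 ≤ κ) (hβ : HorRange κ β) {y : ℝ} (hy : 0 ≤ y) :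
    HasDerivAt (hor κ q β) (horRaw κ q β 1 y / horNorm κ q β) y :=
  (hasDerivAt_horRaw hκ hβ 0 (Ici_subset_horDom hκ hy)).div_const _

theorem hor_isRed (hκ : 0 ≤ κ) (hq : q ≠ 0) (hβ : HorRange κ β) :
    IsRed κ q (sepConst q β) (hor κ q β) := by
  refine IsRed.of_hasDerivAt (f1 := fun y => horRaw κ q β 1 y / horNorm κ q β)
    (f2 := fun y => horRaw κ q β 2 y / horNorm κ q β)
    ((hor_smooth hκ hβ).mono Ioi_subset_Ici_self)
    (fun y hy => hasDerivAt_hor hκ hβ hy.le)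
    (fun y hy => (hasDerivAt_horRaw hκ hβ 1 (Ici_subset_horDom hκ hy.le)).div_const _)
    fun y hy => ?_
  have := horRaw_ode hκ hq hβ (Ici_subset_horDom hκ hy.le)
  simp only [hor]
  linear_combination this / horNorm κ q β

/-- Regular solutions of the hypergeometric equation with lower parameter `c`, obtained from
Euler's integral by lowering the parameter. -/
theorem exists_regular_hypergeometric (hκ : 0 < κ) {a b : ℂ} (ha : 0 < a.re) (n : ℕ) :
    ∀ c : ℂ, 0 < c.re → 0 < (c + n - a).re → ∃ u : ℝ → ℂ, ContDiffOn ℝ ∞ u (Ioi (-κ)) ∧ u 0 = 1 ∧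
      ∀ y : ℝ, -κ < y → (y : ℂ) * (y + 2 * κ) * deriv (deriv u) y
        + (2 * κ * c + (a + b + 1) * y) * deriv u y + a * b * u y = 0 := by
  induction n with
  | zero =>
    intro c hc hca
    simp only [Nat.cast_zero, add_zero] at hca
    set F := horInt (Ioo 0 1) (fun t => (1 - t : ℂ) ^ (c - a - 1)) (2 * (κ : ℂ))⁻¹ a b with hF
    have hd : ∀ n, ∀ y ∈ Ioi (-κ), HasDerivAt (F n) (F (n + 1) y) y := fun n y hy =>
      (hasDerivAt_horInt_euler hκ ha hca b n hy).1
    have hN : F 0 0 ≠ 0 := by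
      simp only [hF, horInt, zero_mul, powK_zero, mul_one, pow_zero, one_mul]
      rw [integral_Ioo_beta, betaIntegral_eq ha hca]
      exact div_ne_zero (mul_ne_zero (Complex.Gamma_ne_zero_of_re_pos ha)
        (Complex.Gamma_ne_zero_of_re_pos hca))
        (Complex.Gamma_ne_zero_of_re_pos (by rw [add_sub_cancel]; exact hc))
    refine ⟨fun y => F 0 y / F 0 0, (contDiffOn_of_hasDerivAt_succ isOpen_Ioi hd 0).div_const _,
      div_self hN, fun y hy => ?_⟩
    have e1 : EqOn (deriv fun y => F 0 y / F 0 0) (fun y => F 1 y / F 0 0) (Ioi (-κ)) :=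
      fun z hz => ((hd 0 z hz).div_const _).deriv
    rw [eqOn_deriv_Ioi e1 hy, e1 hy, ((hd 1 y hy).div_const _).deriv]
    have := horInt_ode_euler hκ ha hca b hy
    rw [add_sub_cancel] at this
    linear_combination this / F 0 0
  | succ n ih =>
    intro c hc hca
    have hc0 : c ≠ 0 := fun h => by simp [h] at hc
    obtain ⟨u, hu, hu0, hode⟩ := ih (c + 1) (by rw [Complex.add_re, Complex.one_re]; linarith)
      (by convert hca using 2; push_cast; ring)
    have s1 := contDiffOn_deriv_of_smooth isOpen_Ioi hu
    have s2 := contDiffOn_deriv_of_smooth isOpen_Ioi s1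
    have d0 : ∀ y ∈ Ioi (-κ), HasDerivAt u (deriv u y) y := fun y hy =>
      hasDerivAt_of_smooth isOpen_Ioi hu hy
    have d1 : ∀ y ∈ Ioi (-κ), HasDerivAt (deriv u) (deriv (deriv u) y) y := fun y hy =>
      hasDerivAt_of_smooth isOpen_Ioi s1 hy
    have d2 : ∀ y ∈ Ioi (-κ), HasDerivAt (deriv (deriv u)) (deriv (deriv (deriv u)) y) y :=
      fun y hy => hasDerivAt_of_smooth isOpen_Ioi s2 hy
    have hid : ∀ y : ℝ, HasDerivAt (fun y : ℝ => (y : ℂ)) 1 y := fun y =>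
      (hasDerivAt_id (y : ℂ)).comp_ofReal
    -- The differentiated equation: u + (y/c)u′ solves the equation with parameter c when u solves
    -- it with c + 1, by combining c times the equation with y times its derivative.
    have hode' : ∀ y : ℝ, -κ < y → (2 * (y : ℂ) + 2 * κ) * deriv (deriv u) y
        + (y : ℂ) * (y + 2 * κ) * deriv (deriv (deriv u)) y + (a + b + 1) * deriv u y
        + (2 * κ * (c + 1) + (a + b + 1) * y) * deriv (deriv u) y + a * b * deriv u y = 0 := by
      intro y hy
      have h1 := ((((hid y).mul ((hid y).add_const (2 * (κ : ℂ)))).mul (d2 y hy)).add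
        ((((hid y).const_mul (a + b + 1)).const_add (2 * κ * (c + 1))).mul (d1 y hy))).add
        ((d0 y hy).const_mul (a * b))
      have h2 := h1.congr_of_eventuallyEq (f₁ := fun _ => (0 : ℂ)) (by
        filter_upwards [Ioi_mem_nhds hy] with z hz
        exact (hode z hz).symm)
      have h3 := h2.unique (hasDerivAt_const y 0)
      simp only [Pi.mul_apply] at h3
      linear_combination h3
    have v1 : ∀ y ∈ Ioi (-κ), HasDerivAt (fun y : ℝ => u y + y / c * deriv u y)
        (deriv u y + (1 / c * deriv u y + y / c * deriv (deriv u) y)) y := fun y hy =>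
      (d0 y hy).add (((hid y).div_const c).mul (d1 y hy))
    have v2 : ∀ y ∈ Ioi (-κ), HasDerivAt
        (fun y : ℝ => deriv u y + (1 / c * deriv u y + y / c * deriv (deriv u) y))
        (deriv (deriv u) y + (1 / c * deriv (deriv u) y + (1 / c * deriv (deriv u) y
          + y / c * deriv (deriv (deriv u)) y))) y := fun y hy =>
      (d1 y hy).add (((d1 y hy).const_mul (1 / c)).add (((hid y).div_const c).mul (d2 y hy)))
    refine ⟨fun y => u y + y / c * deriv u y, ?_, by simp [hu0], fun y hy => ?_⟩
    · refine hu.add (ContDiffOn.mul ?_ s1)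
      exact (Complex.ofRealCLM.contDiff.contDiffOn).div_const c
    · have e1 : EqOn (deriv fun y : ℝ => u y + y / c * deriv u y) _ (Ioi (-κ)) :=
        fun z hz => (v1 z hz).deriv
      rw [eqOn_deriv_Ioi e1 hy, e1 hy, (v2 y hy).deriv]
      have E0 := hode y hy
      have E1 := hode' y hy
      field_simp
      linear_combination c * E0 + y * E1

theorem exists_regular (hκ : 0 ≤ κ) (hq : q ≠ 0) (hβ : -1 < β.re) :
    ∃ φ : ℝ → ℂ, IsRed κ q (sepConst q β) φ ∧ ContDiffOn ℝ ∞ φ (Ici 0) ∧ φ 0 = 1 := by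
  rcases eq_or_ne κ 0 with h | h
  · have hr : HorRange κ β := ⟨hβ, Or.inl h⟩
    exact ⟨hor κ q β, hor_isRed hκ hq hr, hor_smooth hκ hr, hor_zero hr⟩
  · have hk : 0 < κ := lt_of_le_of_ne hκ h.symm
    have hk' : (κ : ℂ) ≠ 0 := by exact_mod_cast h
    -- Raising c by n > Re a makes Re(c + n − a) positive, so Euler's integral converges after n
    -- steps.
    obtain ⟨n, hn⟩ := exists_nat_gt (pa q β).re
    have hc := c_re_pos κ q
    obtain ⟨u, hu, hu0, hode⟩ := exists_regular_hypergeometric (b := pa q (-β)) hk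
      (pa_re_pos q hβ) n (1 + Complex.I * q / κ) hc (by
        rw [Complex.sub_re, Complex.add_re, Complex.natCast_re]; linarith)
    refine ⟨u, ⟨hu.mono fun y hy => ?_, fun y hy => ?_⟩, hu.mono fun y hy => ?_, hu0⟩
    · exact lt_trans (by linarith) (show (0 : ℝ) < y from hy)
    · have := hode y (by linarith)
      rw [pa_mul_pa, pa_add_pa] at this
      have e : 2 * (κ : ℂ) * (1 + Complex.I * q / κ) = 2 * κ + 2 * Complex.I * q := by
        field_simp
      rwa [e] at this
    · exact lt_of_lt_of_le (by linarith) (show (0 : ℝ) ≤ y from hy)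

end RNStat

namespace RNStat
open MeasureTheory

variable {κ q : ℝ} {β : ℂ}

/-! ### Solutions with prescribed behaviour at infinity -/

/-- The derivatives of `(1 + 2κz)^{c-a-1}`, or of `exp (2iqz)` in the extremal case. -/
noncomputable def infK (κ q : ℝ) (β : ℂ) (n : ℕ) (z : ℝ) : ℂ :=
  if κ = 0 then (2 * Complex.I * q) ^ n * Complex.exp (2 * Complex.I * q * z)
  else powK (2 * κ) (pa q β - Complex.I * q / κ) n z

/-- The domain of the kernel `infK`. -/
noncomputable def infDom (κ : ℝ) : Set ℝ := if κ = 0 then univ else Ioi (-(1 / (4 * κ)))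

theorem isOpen_infDom (κ : ℝ) : IsOpen (infDom κ) := by
  unfold infDom; split_ifs
  · exact isOpen_univ
  · exact isOpen_Ioi

theorem Ici_subset_infDom (hκ : 0 ≤ κ) : Ici 0 ⊆ infDom κ := by
  unfold infDom; split_ifs with h
  · exact subset_univ _
  · intro y hy
    have : 0 < κ := lt_of_le_of_ne hκ (Ne.symm h)
    have hy' : (0 : ℝ) ≤ y := hy
    simp only [mem_Ioi]
    have : 0 < 1 / (4 * κ) := by positivity
    linarith

theorem infDom_mul_mem (hκ : 0 ≤ κ) : ∀ w ∈ infDom κ, ∀ s ∈ Ioo (0 : ℝ) 1, w * s ∈ infDom κ := by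
  intro w hw s hs
  unfold infDom at *
  split_ifs at * with h
  · exact mem_univ _
  · have hk : 0 < κ := lt_of_le_of_ne hκ (Ne.symm h)
    have : 0 < 1 / (4 * κ) := by positivity
    simp only [mem_Ioi] at *
    rcases le_total 0 w with h | h
    · have := mul_nonneg h hs.1.le
      linarith
    · nlinarith [hs.1, hs.2]

theorem infDom_re (hκ : 0 < κ) {z : ℝ} (hz : z ∈ infDom κ) :
    1 / 2 ≤ (1 + (2 * (κ : ℂ)) * (z : ℂ)).re := by
  rw [infDom, if_neg hκ.ne', mem_Ioi] at hz
  have : (1 + (2 * (κ : ℂ)) * (z : ℂ)) = ((1 + 2 * κ * z : ℝ) : ℂ) := by push_cast; ring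
  rw [this, Complex.ofReal_re]
  have h2 : 2 * κ * (-(1 / (4 * κ))) ≤ 2 * κ * z := by gcongr
  rw [show 2 * κ * (-(1 / (4 * κ))) = -(1 / 2) by field_simp; norm_num] at h2
  linarith

theorem hasDerivAt_infK (hκ : 0 ≤ κ) (n : ℕ) {z : ℝ} (hz : z ∈ infDom κ) :
    HasDerivAt (infK κ q β n) (infK κ q β (n + 1) z) z := by
  rcases eq_or_ne κ 0 with h | h
  · have e : ∀ n, infK κ q β n
        = fun z : ℝ => (2 * Complex.I * q) ^ n * Complex.exp (2 * Complex.I * q * z) := fun n => by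
      ext z; simp only [infK, if_pos h]
    rw [e, e]
    have h1 := ((((hasDerivAt_id (z : ℂ)).const_mul (2 * Complex.I * (q : ℂ))).cexp).const_mul
      ((2 * Complex.I * (q : ℂ)) ^ n)).comp_ofReal
    refine h1.congr_deriv ?_
    simp only [id]
    ring
  · have e : ∀ n, infK κ q β n = powK (2 * κ) (pa q β - Complex.I * q / κ) n := fun n => by
      ext z; simp only [infK, if_neg h]
    rw [e, e]
    exact hasDerivAt_powK n (lt_of_lt_of_le (by norm_num)
      (infDom_re (lt_of_le_of_ne hκ (Ne.symm h)) hz))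

theorem exists_norm_infK_le (hκ : 0 ≤ κ) (n : ℕ) : ∃ C : ℝ, ∃ N : ℕ, ∀ z ∈ infDom κ,
    ‖infK κ q β n z‖ ≤ C * (1 + |z|) ^ N := by
  rcases eq_or_ne κ 0 with h | h
  · refine ⟨‖(2 * Complex.I * (q : ℂ)) ^ n‖, 0, fun z _ => ?_⟩
    have e : 2 * Complex.I * q * z = ((2 * q * z : ℝ) : ℂ) * Complex.I := by push_cast; ring
    rw [infK, if_pos h, norm_mul, e, Complex.norm_exp_ofReal_mul_I, pow_zero]
  · have e : ∀ n, infK κ q β n = powK (2 * κ) (pa q β - Complex.I * q / κ) n := fun n => by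
      ext z; simp only [infK, if_neg h]
    rw [e]
    exact exists_norm_powK_le (fun z hz => infDom_re (lt_of_le_of_ne hκ (Ne.symm h)) hz) _ n

/-- These first-order relations are all that the equation for `infJ` needs from the kernel; they
cover the power and the exponential simultaneously. -/
theorem infK_rel (hκ : 0 ≤ κ) {z : ℝ} (hz : z ∈ infDom κ) :
    (1 + 2 * κ * z) * infK κ q β 1 z = (2 * Complex.I * q - 2 * κ * pa q β) * infK κ q β 0 z ∧
    (1 + 2 * κ * z) * infK κ q β 2 z
      = (2 * Complex.I * q - 2 * κ * pa q β - 2 * κ) * infK κ q β 1 z := by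
  rcases eq_or_ne κ 0 with h | h
  · subst h
    simp only [infK, if_true, Complex.ofReal_zero]
    constructor <;> ring
  · have hk' : (κ : ℂ) ≠ 0 := by exact_mod_cast h
    have hz' := lt_of_lt_of_le one_half_pos (infDom_re (lt_of_le_of_ne hκ (Ne.symm h)) hz)
    have e : ∀ n, infK κ q β n = powK (2 * κ) (pa q β - Complex.I * q / κ) n := fun n => by
      ext z; simp only [infK, if_neg h]
    rw [e, e, e]
    have h1 := powK_succ_mul (s := pa q β - Complex.I * q / κ) 0 hz'
    have h2 := powK_succ_mul (s := pa q β - Complex.I * q / κ) 1 hz'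
    constructor
    · rw [h1]; push_cast; field_simp; ring
    · rw [h2]; push_cast; field_simp; ring

/-- Up to a power and a constant, the solution at infinity as a function of `w = 1/y`, together
with its derivatives. -/
noncomputable def infJ (κ q : ℝ) (β : ℂ) (n : ℕ) (w : ℝ) : ℂ :=
  ∫ s in Ioo (0 : ℝ) 1, (s : ℂ) ^ n *
    ((s : ℂ) ^ (pa q β - 1) * (1 - s : ℂ) ^ ((1 - pa q (-β)) - 1)) * infK κ q β n (w * s)

theorem hasDerivAt_infJ (hκ : 0 ≤ κ) (hβ : -1 < β.re) (n : ℕ) {w : ℝ} (hw : w ∈ infDom κ) :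
    HasDerivAt (infJ κ q β n) (infJ κ q β (n + 1) w) w ∧
    IntegrableOn (fun s : ℝ => (s : ℂ) ^ n *
    ((s : ℂ) ^ (pa q β - 1) * (1 - s : ℂ) ^ ((1 - pa q (-β)) - 1)) * infK κ q β n (w * s))
      (Ioo 0 1) :=
  hasDerivAt_kernelIntegral measurableSet_Ioo (isOpen_infDom κ) (infDom_mul_mem hκ)
    (integrableOn_beta (pa_re_pos q hβ) (one_sub_pa_re_pos q hβ))
    (fun n _ hz => hasDerivAt_infK hκ n hz) (exists_norm_infK_le hκ) n hw

/-- The integrand is the derivative of −s^a (1 − s)^(1−b) K′(ws), which vanishes at both endpoints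
since Re a and Re(1 − b) are positive for Re β > −1. No upper bound on Re β enters. -/
theorem infJ_ode (hκ : 0 ≤ κ) (hβ : -1 < β.re) {w : ℝ} (hw : 0 ≤ w) :
    w * (1 + 2 * κ * w) * infJ κ q β 2 w
      + (pa q β + (1 - pa q (-β)) + (2 * κ * (pa q β + 1) - (2 * Complex.I * q - 2 * κ * pa q β)) * w)
        * infJ κ q β 1 w
      + (-(pa q β * (2 * Complex.I * q - 2 * κ * pa q β))) * infJ κ q β 0 w = 0 := by
  have ha := pa_re_pos q hβ
  have hv := one_sub_pa_re_pos q hβ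
  have hmem : ∀ s : ℝ, 0 ≤ s → w * s ∈ infDom κ := fun s hs =>
    Ici_subset_infDom hκ (mul_nonneg hw hs)
  have hwd : w ∈ infDom κ := Ici_subset_infDom hκ hw
  have hrel1 : ∀ s : ℝ, 0 ≤ s → _ := fun s hs => (infK_rel (q := q) (β := β) hκ (hmem s hs)).1
  have hrel2 : ∀ s : ℝ, 0 ≤ s → _ := fun s hs => (infK_rel (q := q) (β := β) hκ (hmem s hs)).2
  set a := pa q β
  set v := 1 - pa q (-β)
  set p := 2 * Complex.I * q - 2 * κ * a with hp
  have hdK : ∀ s : ℝ, 0 ≤ s → HasDerivAt (fun s : ℝ => infK κ q β 1 (w * s))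
      (w * infK κ q β 2 (w * s)) s := fun s hs => by
    have := (hasDerivAt_infK (q := q) (β := β) hκ 1 (hmem s hs)).scomp s
      ((hasDerivAt_id s).const_mul w)
    refine this.congr_deriv ?_
    simp
  have hder : ∀ s ∈ Ioo (0 : ℝ) 1, HasDerivAt
      (fun s : ℝ => -((s : ℂ) ^ a * (1 - s : ℂ) ^ v * infK κ q β 1 (w * s)))
      (w * (1 + 2 * κ * w) * ((s : ℂ) ^ 2 * ((s : ℂ) ^ (a - 1) * (1 - s : ℂ) ^ (v - 1)) *
          infK κ q β 2 (w * s))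
        + (a + v + (2 * κ * (a + 1) - p) * w) * ((s : ℂ) ^ 1 *
          ((s : ℂ) ^ (a - 1) * (1 - s : ℂ) ^ (v - 1)) * infK κ q β 1 (w * s))
        + (-(a * p)) * ((s : ℂ) ^ 0 * ((s : ℂ) ^ (a - 1) * (1 - s : ℂ) ^ (v - 1)) *
          infK κ q β 0 (w * s))) s := by
    intro s hs
    have h0 := (((hasDerivAt_cpow_real a hs.1).mul (hasDerivAt_one_sub_cpow_real v hs.2)).mul
      (hdK s hs.1.le)).neg
    refine h0.congr_deriv ?_
    have hs0 : (s : ℂ) ≠ 0 := by exact_mod_cast hs.1.ne'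
    have hs1 : (1 - s : ℂ) ≠ 0 := by
      have : (1 - s : ℝ) ≠ 0 := by linarith [hs.2]
      exact_mod_cast this
    have e1 : (s : ℂ) ^ a = s * (s : ℂ) ^ (a - 1) := by
      rw [mul_cpow_self hs0]; congr 1; ring
    have e2 : (1 - s : ℂ) ^ v = (1 - s) * (1 - s : ℂ) ^ (v - 1) := by
      rw [mul_cpow_self hs1]; congr 1; ring
    have r1 := hrel1 s hs.1.le
    have r2 := hrel2 s hs.1.le
    push_cast at r1 r2
    simp only [Pi.mul_apply]
    rw [e1, e2]
    linear_combination (-(s : ℂ) ^ (a - 1) * (1 - s : ℂ) ^ (v - 1)) * (a * r1 + w * s * r2)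
  have i2 := ((hasDerivAt_infJ (q := q) hκ hβ 2 hwd).2).const_mul (w * (1 + 2 * κ * w) : ℂ)
  have i1 := ((hasDerivAt_infJ (q := q) hκ hβ 1 hwd).2).const_mul
    (a + v + (2 * κ * (a + 1) - p) * w)
  have i0 := ((hasDerivAt_infJ (q := q) hκ hβ 0 hwd).2).const_mul (-(a * p))
  have hc : ∀ s : ℝ, 0 ≤ s → ContinuousAt (fun s : ℝ => infK κ q β 1 (w * s)) s :=
    fun s hs => (hdK s hs).continuousAt
  have hz := integral_Ioo_eq_zero hder ((i2.add i1).add i0) ?_ ?_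
  · simp only [infJ]
    rw [← integral_const_mul, ← integral_const_mul, ← integral_const_mul]
    exact (congrArg₂ (· + ·) (integral_add i2 i1).symm rfl).trans
      ((integral_add (i2.add i1) i0).symm.trans hz)
  · have h1 : ContinuousAt (fun s : ℝ => (1 - s : ℂ) ^ v) 0 :=
      (hasDerivAt_one_sub_cpow_real v zero_lt_one).continuousAt
    have := (((tendsto_cpow_real_zero ha).mul (h1.tendsto.mono_left nhdsWithin_le_nhds)).mul
      ((hc 0 le_rfl).tendsto.mono_left nhdsWithin_le_nhds)).neg
    simpa using this
  · have h1 : ContinuousAt (fun s : ℝ => (s : ℂ) ^ a) 1 :=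
      (hasDerivAt_cpow_real a zero_lt_one).continuousAt
    have := (((h1.tendsto.mono_left nhdsWithin_le_nhds).mul
      (tendsto_one_sub_cpow_real_zero hv)).mul
      ((hc 1 zero_le_one).tendsto.mono_left nhdsWithin_le_nhds)).neg
    simpa using this

/-- The normalisation constant of `infJ`. -/
noncomputable def infNorm (q : ℝ) (β : ℂ) : ℂ :=
  Complex.Gamma (pa q β) * Complex.Gamma (1 - pa q (-β)) / Complex.Gamma (1 + β)

theorem infNorm_ne_zero (q : ℝ) (hβ : -1 < β.re) : infNorm q β ≠ 0 :=
  div_ne_zero (mul_ne_zero (Complex.Gamma_ne_zero_of_re_pos (pa_re_pos q hβ))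
    (Complex.Gamma_ne_zero_of_re_pos (one_sub_pa_re_pos q hβ)))
    (Complex.Gamma_ne_zero_of_re_pos (by rw [Complex.add_re, Complex.one_re]; linarith))

theorem infJ_zero (κ q : ℝ) (hβ : -1 < β.re) : infJ κ q β 0 0 = infNorm q β := by
  have e : infK κ q β 0 0 = 1 := by simp [infK, powK]
  simp only [infJ, zero_mul, e, mul_one, pow_zero, one_mul]
  rw [integral_Ioo_beta, betaIntegral_eq (pa_re_pos q hβ) (one_sub_pa_re_pos q hβ), infNorm]
  congr 2
  simp only [pa]
  ring

/-- `y ^ a` times the normalised solution at infinity, as a function of `w = 1/y`, and its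
derivatives. -/
noncomputable def infF (κ q : ℝ) (β : ℂ) (n : ℕ) (w : ℝ) : ℂ := infJ κ q β n w / infNorm q β

theorem infF_zero (κ q : ℝ) (hβ : -1 < β.re) : infF κ q β 0 0 = 1 := by
  rw [infF, infJ_zero κ q hβ, div_self (infNorm_ne_zero q hβ)]

theorem hasDerivAt_infF (hκ : 0 ≤ κ) (hβ : -1 < β.re) (n : ℕ) {w : ℝ} (hw : 0 ≤ w) :
    HasDerivAt (infF κ q β n) (infF κ q β (n + 1) w) w :=
  (hasDerivAt_infJ hκ hβ n (Ici_subset_infDom hκ hw)).1.div_const _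

/-- The solution of the reduced equation which behaves like `y ^ (-a)` at infinity. -/
noncomputable def infSol (κ q : ℝ) (β : ℂ) (y : ℝ) : ℂ :=
  (y : ℂ) ^ (-pa q β) * infF κ q β 0 y⁻¹

/-- The derivative of `infSol`. -/
noncomputable def infSol' (κ q : ℝ) (β : ℂ) (y : ℝ) : ℂ :=
  -((y : ℂ) ^ (-pa q β - 1) * (pa q β * infF κ q β 0 y⁻¹ + (y : ℂ)⁻¹ * infF κ q β 1 y⁻¹))

theorem hasDerivAt_infF_inv (hκ : 0 ≤ κ) (hβ : -1 < β.re) (n : ℕ) {y : ℝ} (hy : 0 < y) :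
    HasDerivAt (fun y : ℝ => infF κ q β n y⁻¹) (-((y : ℂ)⁻¹ ^ 2 * infF κ q β (n + 1) y⁻¹)) y := by
  have := (hasDerivAt_infF (q := q) hκ hβ n (inv_nonneg.2 hy.le)).scomp y (hasDerivAt_inv hy.ne')
  refine this.congr_deriv ?_
  rw [Complex.real_smul]
  push_cast
  ring

theorem hasDerivAt_infSol (hκ : 0 ≤ κ) (hβ : -1 < β.re) {y : ℝ} (hy : 0 < y) :
    HasDerivAt (infSol κ q β) (infSol' κ q β y) y := by
  have hy0 : (y : ℂ) ≠ 0 := by exact_mod_cast hy.ne'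
  refine ((hasDerivAt_cpow_real (-pa q β) hy).mul (hasDerivAt_infF_inv hκ hβ 0 hy)).congr_deriv ?_
  have e : (y : ℂ) ^ (-pa q β) = y * (y : ℂ) ^ (-pa q β - 1) := by
    rw [mul_cpow_self hy0]; congr 1; ring
  rw [e, infSol']
  field_simp
  ring

theorem hasDerivAt_infSol' (hκ : 0 ≤ κ) (hβ : -1 < β.re) {y : ℝ} (hy : 0 < y) :
    HasDerivAt (infSol' κ q β) ((y : ℂ) ^ (-pa q β - 2) *
      (pa q β * (pa q β + 1) * infF κ q β 0 y⁻¹ + (2 * pa q β + 2) * (y : ℂ)⁻¹ * infF κ q β 1 y⁻¹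
        + (y : ℂ)⁻¹ ^ 2 * infF κ q β 2 y⁻¹)) y := by
  have hy0 : (y : ℂ) ≠ 0 := by exact_mod_cast hy.ne'
  have hinv : HasDerivAt (fun y : ℝ => (y : ℂ)⁻¹) (-((y : ℂ) ^ 2)⁻¹) y :=
    (hasDerivAt_inv hy0).comp_ofReal
  refine ((hasDerivAt_cpow_real (-pa q β - 1) hy).mul
    (((hasDerivAt_infF_inv hκ hβ 0 hy).const_mul (pa q β)).add
      (hinv.mul (hasDerivAt_infF_inv hκ hβ 1 hy)))).neg.congr_deriv ?_
  have e : (y : ℂ) ^ (-pa q β - 1) = y * (y : ℂ) ^ (-pa q β - 2) := by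
    rw [mul_cpow_self hy0]; congr 1; ring
  have e2 : (y : ℂ) ^ (-pa q β - 1 - 1) = (y : ℂ) ^ (-pa q β - 2) := by congr 1; ring
  simp only [Pi.mul_apply, Pi.add_apply]
  rw [e2, e]
  field_simp
  ring

theorem infSol_smooth (hκ : 0 ≤ κ) (hβ : -1 < β.re) : ContDiffOn ℝ ∞ (infSol κ q β) (Ioi 0) := by
  have h1 : ContDiffOn ℝ ∞ (infF κ q β 0) (infDom κ) :=
    (contDiffOn_of_hasDerivAt_succ (isOpen_infDom κ)
      (fun n w hw => (hasDerivAt_infJ (q := q) hκ hβ n hw).1) 0).div_const _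
  have h2 : ContDiffOn ℝ ∞ (fun y : ℝ => y⁻¹) (Ioi 0) := fun y hy =>
    (contDiffAt_inv ℝ (ne_of_gt hy)).contDiffWithinAt
  have h3 : ContDiffOn ℝ ∞ (fun y : ℝ => (y : ℂ) ^ (-pa q β)) (Ioi 0) := by
    have hd : ∀ n : ℕ, ∀ y ∈ Ioi (0 : ℝ), HasDerivAt
        (fun y : ℝ => (∏ i ∈ Finset.range n, (-pa q β - i)) * (y : ℂ) ^ (-pa q β - n))
        ((∏ i ∈ Finset.range (n + 1), (-pa q β - i)) * (y : ℂ) ^ (-pa q β - (n + 1 : ℕ))) y := by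
      intro n y hy
      refine ((hasDerivAt_cpow_real (-pa q β - n) hy).const_mul _).congr_deriv ?_
      rw [Finset.prod_range_succ, mul_assoc]
      congr 3
      push_cast
      ring
    have := contDiffOn_of_hasDerivAt_succ isOpen_Ioi
      (F := fun (n : ℕ) (y : ℝ) => (∏ i ∈ Finset.range n, (-pa q β - i)) *
        (y : ℂ) ^ (-pa q β - n)) hd 0
    simpa using this
  refine h3.mul (h1.comp h2 fun y hy => Ici_subset_infDom hκ ?_)
  have : (0 : ℝ) < y := hy
  simp only [mem_Ici]
  positivity

theorem infSol_isRed (hκ : 0 ≤ κ) (hβ : -1 < β.re) :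
    IsRed κ q (sepConst q β) (infSol κ q β) := by
  refine IsRed.of_hasDerivAt (infSol_smooth hκ hβ) (fun y hy => hasDerivAt_infSol hκ hβ hy)
    (fun y hy => hasDerivAt_infSol' hκ hβ hy) fun y hy => ?_
  have hy0 : (y : ℂ) ≠ 0 := by exact_mod_cast hy.ne'
  have h := infJ_ode (q := q) hκ hβ (inv_nonneg.2 hy.le)
  have e : (y : ℂ) ^ (-pa q β - 1) = y * (y : ℂ) ^ (-pa q β - 2) := by
    rw [mul_cpow_self hy0]; congr 1; ring
  have e2 : (y : ℂ) ^ (-pa q β) = y * (y * (y : ℂ) ^ (-pa q β - 2)) := by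
    rw [mul_cpow_self hy0, mul_cpow_self hy0]; congr 1; ring
  rw [← pa_mul_pa]
  simp only [infSol', infSol]
  rw [e, e2]
  set X := (y : ℂ) ^ (-pa q β - 2)
  -- Eliminating b makes the equation in w = 1/y and the reduced equation comparable.
  have hab : pa q (-β) = 1 + 2 * Complex.I * q - pa q β := by
    linear_combination pa_add_pa q β
  push_cast at h
  simp only [infF]
  set N := infNorm q β
  have hN : N ≠ 0 := infNorm_ne_zero q hβ
  rw [hab] at h ⊢
  field_simp at h ⊢
  linear_combination X * h

end RNStat

namespace RNStat
open MeasureTheory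

variable {κ q : ℝ} {β : ℂ}

/-! ### Holomorphic dependence on `β` -/

/-- The strip `|Re β| < 1`. -/
def strip : Set ℂ := {β | |β.re| < 1}

theorem strip_bounds (h : β ∈ strip) : -1 < β.re ∧ β.re < 1 := abs_lt.1 h

theorem neg_mem_strip (h : β ∈ strip) : -β ∈ strip := by
  simpa [strip] using h

theorem horRange_of_strip (h : β ∈ strip) : HorRange κ β :=
  ⟨(strip_bounds h).1, Or.inr (strip_bounds h).2⟩

theorem isOpen_strip : IsOpen strip :=
  isOpen_lt (Complex.continuous_re.abs) continuous_const

theorem zero_mem_strip : (0 : ℂ) ∈ strip := by simp [strip]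

theorem convex_strip : Convex ℝ strip := by
  have : strip = Complex.reCLM ⁻¹' (Ioo (-1) 1) := by
    ext β; simp [strip, abs_lt]
  rw [this]
  exact (convex_Ioo (-1 : ℝ) 1).is_linear_preimage Complex.reCLM.isLinear

theorem differentiable_pa (q : ℝ) : Differentiable ℂ (pa q) := by
  unfold pa; fun_prop

theorem differentiable_pa_neg (q : ℝ) : Differentiable ℂ fun β => pa q (-β) := by
  unfold pa; fun_prop

theorem differentiable_nuPar (κ q : ℝ) : Differentiable ℂ (nuPar κ q) := by
  unfold nuPar pa; fun_prop

theorem differentiable_powK {ζ : ℂ} {s : ℂ → ℂ} (hs : Differentiable ℂ s) (n : ℕ) {z : ℝ}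
    (hz : (1 + ζ * z) ≠ 0) : Differentiable ℂ fun β => powK ζ (s β) n z := by
  unfold powK
  refine Differentiable.mul ?_ ?_
  · fun_prop
  · intro β
    exact ((hs.neg.sub_const _) β).const_cpow (Or.inl hz)

theorem norm_powK_le {ζ s : ℂ} {n : ℕ} {z : ℝ} (hz : 1 ≤ ‖1 + ζ * z‖) (hs : 0 ≤ s.re) :
    ‖powK ζ s n z‖
      ≤ ‖∏ i ∈ Finset.range n, (-(s + i) * ζ)‖ * Real.exp (Real.pi * |s.im|) := by
  rw [powK, norm_mul]
  gcongr
  refine (norm_cpow_le_exp _ _).trans ?_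
  have h1 : ‖1 + ζ * (z : ℂ)‖ ^ (-s - (n : ℂ)).re ≤ 1 := by
    refine Real.rpow_le_one_of_one_le_of_nonpos hz ?_
    simp only [Complex.sub_re, Complex.neg_re, Complex.natCast_re]
    have := Nat.cast_nonneg (α := ℝ) n
    linarith
  have h2 : |(-s - (n : ℂ)).im| = |s.im| := by simp
  rw [h2]
  exact mul_le_of_le_one_left (Real.exp_pos _).le h1

/-- A bound uniform in β on a ball and in z, by compactness of the closed ball. -/
theorem exists_powK_bound {ζ : ℂ} {s : ℂ → ℂ} (hs : Differentiable ℂ s) (n : ℕ) (β₀ : ℂ) (ε : ℝ) :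
    ∃ C : ℝ, ∀ β ∈ Metric.ball β₀ ε, 0 ≤ (s β).re → ∀ z : ℝ, 1 ≤ ‖1 + ζ * z‖ →
      ‖powK ζ (s β) n z‖ ≤ C := by
  have hc : Continuous fun β => ‖∏ i ∈ Finset.range n, (-(s β + i) * ζ)‖ *
      Real.exp (Real.pi * |(s β).im|) := by
    have := hs.continuous
    fun_prop
  obtain ⟨C, hC⟩ := (isCompact_closedBall β₀ ε).exists_bound_of_continuousOn hc.continuousOn
  refine ⟨C, fun β hβ hre z hz => (norm_powK_le hz hre).trans ?_⟩
  exact (le_abs_self _).trans (hC β (Metric.ball_subset_closedBall hβ))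

theorem re_close {β β₀ : ℂ} {ε : ℝ} (h : β ∈ Metric.ball β₀ ε) : |β.re - β₀.re| < ε := by
  rw [Metric.mem_ball, dist_eq_norm] at h
  exact lt_of_le_of_lt (by simpa using Complex.abs_re_le_norm (β - β₀)) h

/-- On (0, 1) lowering an exponent enlarges the power, so a common lower bound δ for the real parts
gives a majorant independent of β. -/
theorem norm_beta_weight_le {t δ : ℝ} {u v : ℂ} (ht : t ∈ Ioo (0 : ℝ) 1) (hu : δ ≤ u.re)
    (hv : δ ≤ v.re) (n : ℕ) : ‖(t : ℂ) ^ n * ((t : ℂ) ^ (u - 1) * (1 - t : ℂ) ^ (v - 1))‖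
      ≤ t ^ (δ - 1) * (1 - t) ^ (δ - 1) := by
  have h1 : 0 < 1 - t := by linarith [ht.2]
  have e : (1 - t : ℂ) = ((1 - t : ℝ) : ℂ) := by push_cast; ring
  rw [norm_mul, norm_mul, norm_pow, e, Complex.norm_cpow_eq_rpow_re_of_pos ht.1,
    Complex.norm_cpow_eq_rpow_re_of_pos h1, Complex.norm_real, Real.norm_eq_abs,
    abs_of_pos ht.1]
  have h2 : t ^ n ≤ 1 := pow_le_one₀ ht.1.le ht.2.le
  have h3 : t ^ (u - 1).re ≤ t ^ (δ - 1) := by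
    refine Real.rpow_le_rpow_of_exponent_ge ht.1 ht.2.le ?_
    simp only [Complex.sub_re, Complex.one_re]; linarith
  have h4 : (1 - t) ^ (v - 1).re ≤ (1 - t) ^ (δ - 1) := by
    refine Real.rpow_le_rpow_of_exponent_ge h1 (by linarith [ht.1]) ?_
    simp only [Complex.sub_re, Complex.one_re]; linarith
  have p1 := Real.rpow_nonneg ht.1.le (u - 1).re
  have p2 := Real.rpow_nonneg h1.le (v - 1).re
  have p3 := Real.rpow_nonneg ht.1.le (δ - 1)
  have h5 := mul_le_mul h3 h4 p2 p3
  calc _ ≤ 1 * (t ^ (δ - 1) * (1 - t) ^ (δ - 1)) :=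
        mul_le_mul h2 h5 (mul_nonneg p1 p2) zero_le_one
    _ = _ := one_mul _

theorem integrableOn_beta_weight {δ : ℝ} (hδ : 0 < δ) :
    IntegrableOn (fun t : ℝ => t ^ (δ - 1) * (1 - t) ^ (δ - 1)) (Ioo 0 1) := by
  have h := (integrableOn_beta (u := δ) (v := δ) (by simpa using hδ) (by simpa using hδ) 0).norm
  refine IntegrableOn.congr_fun h (fun t ht => ?_) measurableSet_Ioo
  have h1 : 0 < 1 - t := by linarith [ht.2]
  have e : (1 - t : ℂ) = ((1 - t : ℝ) : ℂ) := by push_cast; ring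
  simp only [pow_zero, one_mul, norm_mul, e]
  rw [Complex.norm_cpow_eq_rpow_re_of_pos ht.1, Complex.norm_cpow_eq_rpow_re_of_pos h1]
  simp

theorem one_le_norm_one_add {r : ℝ} (hr : 0 ≤ r) : 1 ≤ ‖(1 + (r : ℂ))‖ := by
  have : (1 + (r : ℂ)) = ((1 + r : ℝ) : ℂ) := by push_cast; ring
  rw [this, Complex.norm_real, Real.norm_eq_abs]
  exact le_trans (by linarith) (le_abs_self _)

theorem exists_infK_bound (hκ : 0 ≤ κ) (n : ℕ) {ε : ℝ}
    (hball : ∀ β' ∈ Metric.ball β ε, -1 < β'.re) :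
    ∃ C : ℝ, ∀ β' ∈ Metric.ball β ε, ∀ z : ℝ, 0 ≤ z → ‖infK κ q β' n z‖ ≤ C := by
  rcases eq_or_ne κ 0 with h | h
  · refine ⟨‖(2 * Complex.I * (q : ℂ)) ^ n‖, fun β' _ z _ => ?_⟩
    have e : 2 * Complex.I * q * z = ((2 * q * z : ℝ) : ℂ) * Complex.I := by push_cast; ring
    rw [infK, if_pos h, norm_mul, e, Complex.norm_exp_ofReal_mul_I, mul_one]
  · obtain ⟨C, hC⟩ := exists_powK_bound (ζ := 2 * κ) (s := fun β => pa q β - Complex.I * q / κ)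
      ((differentiable_pa q).sub_const _) n β ε
    refine ⟨C, fun β' hβ' z hz => ?_⟩
    rw [infK, if_neg h]
    have e : (2 * (κ : ℂ)) * z = ((2 * κ * z : ℝ) : ℂ) := by push_cast; ring
    refine hC β' hβ' ?_ z (by rw [e]; exact one_le_norm_one_add (by positivity))
    have e2 : (Complex.I * q / κ) = ((q / κ : ℝ) : ℂ) * Complex.I := by push_cast; ring
    rw [e2, Complex.sub_re, pa_re, Complex.re_ofReal_mul, Complex.I_re]
    have := hball β' hβ'
    linarith

theorem differentiableAt_infJ (hκ : 0 ≤ κ) (n : ℕ) {w : ℝ} (hw : 0 ≤ w) (hβ : β ∈ strip) :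
    DifferentiableAt ℂ (fun β => infJ κ q β n w) β := by
  obtain ⟨hβ1, hβ2⟩ := strip_bounds hβ
  -- Half the distance to Re β = −1: on the ball of this radius both exponents keep real part at
  -- least ε/2.
  set ε : ℝ := (1 + β.re) / 2 with hε
  have hε0 : 0 < ε := by rw [hε]; linarith
  have hball : ∀ β' ∈ Metric.ball β ε, -1 + ε < β'.re := fun β' h => by
    have := abs_lt.1 (re_close h)
    rw [hε] at *; linarith
  obtain ⟨C, hC⟩ := exists_infK_bound (q := q) hκ n (β := β) (ε := ε)
    fun β' h => by linarith [hball β' h]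
  refine differentiableAt_integral_param hε0
    (bound := fun t => (t ^ (ε / 2 - 1) * (1 - t) ^ (ε / 2 - 1)) * C)
    (fun β' hβ' => ?_) ((integrableOn_beta_weight (by positivity)).mul_const C) ?_ ?_
  · exact (hasDerivAt_infJ (q := q) (β := β') hκ (by linarith [hball β' hβ']) n
      (Ici_subset_infDom hκ hw)).2.aestronglyMeasurable
  · refine (ae_restrict_iff' measurableSet_Ioo).2 (Eventually.of_forall fun t ht β' hβ' => ?_)
    rw [norm_mul]
    have hb := hball β' hβ'
    have h1 := norm_beta_weight_le (δ := ε / 2) (u := pa q β') (v := 1 - pa q (-β')) ht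
      (by rw [pa_re]; linarith)
      (by rw [Complex.sub_re, pa_re, Complex.neg_re, Complex.one_re]; linarith) n
    exact mul_le_mul h1 (hC β' hβ' _ (mul_nonneg hw ht.1.le)) (norm_nonneg _)
      (mul_nonneg (Real.rpow_nonneg ht.1.le _) (Real.rpow_nonneg (by linarith [ht.2]) _))
  · refine (ae_restrict_iff' measurableSet_Ioo).2 (Eventually.of_forall fun t ht => ?_)
    have ht0 : (t : ℂ) ≠ 0 := by exact_mod_cast ht.1.ne'
    have ht1 : (1 - t : ℂ) ≠ 0 := by
      have : (1 - t : ℝ) ≠ 0 := by linarith [ht.2]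
      exact_mod_cast this
    refine Differentiable.differentiableOn (Differentiable.mul (Differentiable.mul
      (differentiable_const _) (Differentiable.mul (fun β => ?_) (fun β => ?_))) ?_)
    · exact (((differentiable_pa q).sub_const 1) β).const_cpow (Or.inl ht0)
    · exact ((((differentiable_pa_neg q).const_sub 1).sub_const 1) β).const_cpow (Or.inl ht1)
    · rcases eq_or_ne κ 0 with h | h
      · simp only [infK, if_pos h]
        exact differentiable_const _
      · simp only [infK, if_neg h]
        refine differentiable_powK ((differentiable_pa q).sub_const _) n ?_
        have e : (2 * (κ : ℂ)) * ((w * t : ℝ) : ℂ) = ((2 * κ * (w * t) : ℝ) : ℂ) := by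
          push_cast; ring
        rw [e]
        intro h0
        have := one_le_norm_one_add (r := 2 * κ * (w * t)) (by
          have := ht.1; positivity)
        rw [h0, norm_zero] at this
        linarith

theorem differentiableAt_horRaw (hκ : 0 ≤ κ) (n : ℕ) {y : ℝ} (hy : 0 ≤ y) (hβ : β ∈ strip) :
    DifferentiableAt ℂ (fun β => horRaw κ q β n y) β := by
  have habs : |β.re| < 1 := hβ
  -- Half the distance to the boundary of the strip; the upper bound on Re β is needed for Re ν and
  -- for Re b ≥ 0.
  set ε : ℝ := (1 - |β.re|) / 2 with hε
  have hε0 : 0 < ε := by rw [hε]; linarith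
  have hball : ∀ β' ∈ Metric.ball β ε, -1 + ε < β'.re ∧ β'.re < 1 - ε := fun β' h => by
    have h1 := abs_lt.1 (re_close h)
    have h2 := le_abs_self β.re
    have h3 := neg_abs_le β.re
    rw [hε] at *
    constructor <;> linarith
  have hbre : ∀ β' ∈ Metric.ball β ε, 0 ≤ (pa q (-β')).re := fun β' h => by
    rw [pa_re, Complex.neg_re]; linarith [(hball β' h).2]
  rcases eq_or_ne κ 0 with h | h
  · obtain ⟨C, hC⟩ := exists_powK_bound (ζ := (2 * Complex.I * (q : ℂ))⁻¹)
      (differentiable_pa_neg q) n β ε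
    have hw1 : ∀ z : ℝ, 1 ≤ ‖1 + (2 * Complex.I * (q : ℂ))⁻¹ * z‖ := fun z => by
      have := Complex.re_le_norm (1 + (2 * Complex.I * (q : ℂ))⁻¹ * z)
      rwa [confluent_re] at this
    simp only [horRaw_zero h]
    -- Two powers are added in the majorant: one dominates for t ≤ 1, the other for t ≥ 1.
    refine differentiableAt_integral_param hε0
      (bound := fun t => (Real.exp (-t) * t ^ ((ε / 2 + n) - 1) +
        Real.exp (-t) * t ^ ((1 + n : ℝ) - 1)) * C)
      (fun β' hβ' => ?_) (((Real.GammaIntegral_convergent (by positivity)).add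
        (Real.GammaIntegral_convergent (by positivity))).mul_const C) ?_ ?_
    · exact (hasDerivAt_horInt_confluent q (pa_re_pos q (by linarith [(hball β' hβ').1]))
        (pa q (-β')) n y).2.aestronglyMeasurable
    · refine (ae_restrict_iff' measurableSet_Ioi).2 (Eventually.of_forall fun t ht β' hβ' => ?_)
      have ht0 : (0 : ℝ) < t := ht
      obtain ⟨b1, b2⟩ := hball β' hβ'
      rw [norm_mul]
      have e1 : ‖Complex.exp (-(t : ℂ))‖ = Real.exp (-t) := by
        rw [Complex.norm_exp]; simp
      have e2 : t ^ (pa q β' - 1).re ≤ t ^ (ε / 2 - 1) + t ^ (1 - 1 : ℝ) := by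
        simp only [Complex.sub_re, pa_re, Complex.one_re]
        rcases le_total t 1 with h1 | h1
        · exact (Real.rpow_le_rpow_of_exponent_ge ht0 h1
            (show ε / 2 - 1 ≤ 1 / 2 + β'.re / 2 - 1 by linarith)).trans
            (le_add_of_nonneg_right (Real.rpow_nonneg ht0.le _))
        · exact (Real.rpow_le_rpow_of_exponent_le h1
            (show 1 / 2 + β'.re / 2 - 1 ≤ (1 - 1 : ℝ) by linarith)).trans
            (le_add_of_nonneg_left (Real.rpow_nonneg ht0.le _))
      have h1 : ‖(t : ℂ) ^ n * ((t : ℂ) ^ (pa q β' - 1) * Complex.exp (-t))‖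
          ≤ Real.exp (-t) * t ^ ((ε / 2 + n) - 1) + Real.exp (-t) * t ^ ((1 + n : ℝ) - 1) := by
        rw [norm_mul, norm_mul, norm_pow, Complex.norm_cpow_eq_rpow_re_of_pos ht0, e1,
          Complex.norm_real, Real.norm_eq_abs, abs_of_pos ht0]
        have f1 : t ^ ((ε / 2 + n) - 1) = t ^ n * t ^ (ε / 2 - 1) := by
          rw [← Real.rpow_natCast, ← Real.rpow_add ht0]; congr 1; ring
        have f2 : t ^ ((1 + n : ℝ) - 1) = t ^ n * t ^ (1 - 1 : ℝ) := by
          rw [← Real.rpow_natCast, ← Real.rpow_add ht0]; congr 1; ring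
        rw [f1, f2]
        calc _ ≤ t ^ n * ((t ^ (ε / 2 - 1) + t ^ (1 - 1 : ℝ)) * Real.exp (-t)) := by gcongr
          _ = _ := by ring
      refine mul_le_mul h1 (hC β' hβ' (hbre β' hβ') _ (hw1 _)) (norm_nonneg _) ?_
      exact add_nonneg (mul_nonneg (Real.exp_pos _).le (Real.rpow_nonneg ht0.le _))
        (mul_nonneg (Real.exp_pos _).le (Real.rpow_nonneg ht0.le _))
    · refine (ae_restrict_iff' measurableSet_Ioi).2 (Eventually.of_forall fun t ht => ?_)
      have ht0 : (t : ℂ) ≠ 0 := by exact_mod_cast (show (0 : ℝ) < t from ht).ne'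
      refine Differentiable.differentiableOn (Differentiable.mul (Differentiable.mul
        (differentiable_const _) (Differentiable.mul (fun β => ?_) (differentiable_const _))) ?_)
      · exact (((differentiable_pa q).sub_const 1) β).const_cpow (Or.inl ht0)
      · refine differentiable_powK (differentiable_pa_neg q) n fun h0 => ?_
        have := hw1 (y * t)
        rw [h0, norm_zero] at this
        linarith
  · have hk : 0 < κ := lt_of_le_of_ne hκ (Ne.symm h)
    obtain ⟨C, hC⟩ := exists_powK_bound (ζ := (2 * (κ : ℂ))⁻¹)
      (differentiable_pa_neg q) n β ε
    have hw1 : ∀ z : ℝ, 0 ≤ z → 1 ≤ ‖1 + (2 * (κ : ℂ))⁻¹ * z‖ := fun z hz => by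
      have e : (2 * (κ : ℂ))⁻¹ * z = (((2 * κ)⁻¹ * z : ℝ) : ℂ) := by push_cast; ring
      rw [e]
      exact one_le_norm_one_add (by positivity)
    simp only [horRaw_pos h]
    refine differentiableAt_integral_param hε0
      (bound := fun t => (t ^ (ε / 2 - 1) * (1 - t) ^ (ε / 2 - 1)) * C)
      (fun β' hβ' => ?_) ((integrableOn_beta_weight (by positivity)).mul_const C) ?_ ?_
    · exact (hasDerivAt_horInt_euler hk (pa_re_pos q (by linarith [(hball β' hβ').1]))
        (nuPar_re_pos q (by linarith [(hball β' hβ').2]))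
        (pa q (-β')) n (lt_of_lt_of_le (by linarith) hy)).2.aestronglyMeasurable
    · refine (ae_restrict_iff' measurableSet_Ioo).2 (Eventually.of_forall fun t ht β' hβ' => ?_)
      rw [norm_mul]
      obtain ⟨b1, b2⟩ := hball β' hβ'
      have h1 := norm_beta_weight_le (δ := ε / 2) (u := pa q β') (v := nuPar κ q β') ht
        (by rw [pa_re]; linarith) (by rw [nuPar_re]; linarith) n
      exact mul_le_mul h1 (hC β' hβ' (hbre β' hβ') _ (hw1 _ (mul_nonneg hy ht.1.le)))
        (norm_nonneg _)
        (mul_nonneg (Real.rpow_nonneg ht.1.le _) (Real.rpow_nonneg (by linarith [ht.2]) _))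
    · refine (ae_restrict_iff' measurableSet_Ioo).2 (Eventually.of_forall fun t ht => ?_)
      have ht0 : (t : ℂ) ≠ 0 := by exact_mod_cast ht.1.ne'
      have ht1 : (1 - t : ℂ) ≠ 0 := by
        have : (1 - t : ℝ) ≠ 0 := by linarith [ht.2]
        exact_mod_cast this
      refine Differentiable.differentiableOn (Differentiable.mul (Differentiable.mul
        (differentiable_const _) (Differentiable.mul (fun β => ?_) (fun β => ?_))) ?_)
      · exact (((differentiable_pa q).sub_const 1) β).const_cpow (Or.inl ht0)
      · exact (((differentiable_nuPar κ q).sub_const 1) β).const_cpow (Or.inl ht1)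
      · refine differentiable_powK (differentiable_pa_neg q) n fun h0 => ?_
        have := hw1 (y * t) (mul_nonneg hy ht.1.le)
        rw [h0, norm_zero] at this
        linarith

theorem differentiableAt_Gamma_of_re_pos {s : ℂ} (hs : 0 < s.re) :
    DifferentiableAt ℂ Complex.Gamma s := by
  refine Complex.differentiableAt_Gamma s fun m h => ?_
  rw [h] at hs
  simp only [Complex.neg_re, Complex.natCast_re] at hs
  have := Nat.cast_nonneg (α := ℝ) m
  linarith

theorem differentiableAt_Gamma_comp {s : ℂ → ℂ} (hd : DifferentiableAt ℂ s β)
    (hs : 0 < (s β).re) : DifferentiableAt ℂ (fun β => Complex.Gamma (s β)) β :=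
  (differentiableAt_Gamma_of_re_pos hs).comp β hd

theorem one_add_re_pos (hβ : -1 < β.re) : 0 < (1 + β).re := by
  rw [Complex.add_re, Complex.one_re]; linarith

theorem differentiableAt_infNorm (h1 : -1 < β.re) : DifferentiableAt ℂ (infNorm q) β := by
  unfold infNorm
  refine DifferentiableAt.div (DifferentiableAt.mul
    (differentiableAt_Gamma_comp (differentiable_pa q β) (pa_re_pos q h1))
    (differentiableAt_Gamma_comp (((differentiable_pa_neg q).const_sub 1) β)
      (one_sub_pa_re_pos q h1)))
    (differentiableAt_Gamma_comp (by fun_prop) (one_add_re_pos h1))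
    (Complex.Gamma_ne_zero_of_re_pos (one_add_re_pos h1))

theorem differentiableAt_horNorm (hβ : β ∈ strip) : DifferentiableAt ℂ (horNorm κ q) β := by
  obtain ⟨h1, h2⟩ := strip_bounds hβ
  have e1 := differentiableAt_Gamma_comp (differentiable_pa q β) (pa_re_pos q h1)
  have e2 := differentiableAt_Gamma_comp (differentiable_nuPar κ q β) (nuPar_re_pos q h2)
  unfold horNorm
  split_ifs
  · exact e1
  · exact (e1.mul e2).div_const _

theorem differentiableAt_infF (hκ : 0 ≤ κ) (n : ℕ) {w : ℝ} (hw : 0 ≤ w) (hβ : β ∈ strip) :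
    DifferentiableAt ℂ (fun β => infF κ q β n w) β :=
  (differentiableAt_infJ hκ n hw hβ).div (differentiableAt_infNorm (strip_bounds hβ).1)
    (infNorm_ne_zero q (strip_bounds hβ).1)

theorem differentiableAt_hor (hκ : 0 ≤ κ) {y : ℝ} (hy : 0 ≤ y) (hβ : β ∈ strip) :
    DifferentiableAt ℂ (fun β => hor κ q β y) β :=
  (differentiableAt_horRaw hκ 0 hy hβ).div (differentiableAt_horNorm hβ)
    (horNorm_ne_zero (horRange_of_strip hβ))

theorem differentiableAt_infSol (hκ : 0 ≤ κ) {y : ℝ} (hy : 0 < y) (hβ : β ∈ strip) :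
    DifferentiableAt ℂ (fun β => infSol κ q β y) β := by
  have hy0 : (y : ℂ) ≠ 0 := by exact_mod_cast hy.ne'
  exact (((differentiable_pa q).neg β).const_cpow (Or.inl hy0)).mul
    (differentiableAt_infF hκ 0 (inv_nonneg.2 hy.le) hβ)

theorem differentiableAt_infSol' (hκ : 0 ≤ κ) {y : ℝ} (hy : 0 < y) (hβ : β ∈ strip) :
    DifferentiableAt ℂ (fun β => infSol' κ q β y) β := by
  have hy0 : (y : ℂ) ≠ 0 := by exact_mod_cast hy.ne'
  have hF := fun n => differentiableAt_infF (q := q) hκ n (inv_nonneg.2 hy.le) hβ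
  exact ((((((differentiable_pa q).neg.sub_const 1) β).const_cpow (Or.inl hy0))).mul
    (((differentiable_pa q β).mul (hF 0)).add ((hF 1).const_mul _))).neg

/-- The Wronskian of the solution at infinity and the regular solution. -/
noncomputable def conn (κ q : ℝ) (β : ℂ) : ℂ := wr κ q (infSol κ q β) (hor κ q β) 1

/-- A Wronskian evaluated at y = 1 is an algebraic expression in functions already known to be
holomorphic. -/
theorem differentiableAt_conn (hκ : 0 ≤ κ) (hβ : β ∈ strip) :
    DifferentiableAt ℂ (conn κ q) β := by
  have e : conn κ q =ᶠ[𝓝 β] fun β => weight κ q 1 *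
      (infSol κ q β 1 * (horRaw κ q β 1 1 / horNorm κ q β) - infSol' κ q β 1 * hor κ q β 1) := by
    filter_upwards [isOpen_strip.mem_nhds hβ] with β' hβ'
    rw [conn, wr, (hasDerivAt_infSol hκ (strip_bounds hβ').1 one_pos).deriv,
      (hasDerivAt_hor hκ (horRange_of_strip hβ') zero_le_one).deriv]
  refine DifferentiableAt.congr_of_eventuallyEq ?_ e
  refine DifferentiableAt.const_mul (DifferentiableAt.sub (DifferentiableAt.mul
    (differentiableAt_infSol hκ one_pos hβ) ?_) (DifferentiableAt.mul
    (differentiableAt_infSol' hκ one_pos hβ) (differentiableAt_hor hκ zero_le_one hβ))) _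
  exact (differentiableAt_horRaw hκ 1 zero_le_one hβ).div (differentiableAt_horNorm hβ)
    (horNorm_ne_zero (horRange_of_strip hβ))

end RNStat

namespace RNStat
open MeasureTheory

variable {κ q : ℝ} {β : ℂ}

/-! ### The connection formula -/

theorem ofReal_mul_cpow {x : ℝ} (hx : 0 < x) {w : ℂ} (hw : w ≠ 0) (s : ℂ) :
    ((x : ℂ) * w) ^ s = (x : ℂ) ^ s * w ^ s := by
  have hx0 : (x : ℂ) ≠ 0 := by exact_mod_cast hx.ne'
  rw [Complex.cpow_def_of_ne_zero (mul_ne_zero hx0 hw), Complex.cpow_def_of_ne_zero hx0,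
    Complex.cpow_def_of_ne_zero hw, Complex.log_ofReal_mul hx hw, ← Complex.ofReal_log hx.le,
    ← Complex.exp_add]
  ring_nf

/-- Since y^b (1 + ζyt)^(−b) = (1/y + ζt)^(−b), dominated convergence extracts the leading
coefficient at infinity. The slit-plane condition provides continuity of the power in the limit. -/
theorem tendsto_horInt {T : Set ℝ} (hT : MeasurableSet T) (hTpos : T ⊆ Ioi 0) {om : ℝ → ℂ}
    {ζ a b : ℂ} (hζ : ζ ∈ Complex.slitPlane) (hζre : 0 ≤ ζ.re) (hb : 0 < b.re)
    (hint : IntegrableOn (fun t : ℝ => (t : ℂ) ^ (a - b - 1) * om t) T)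
    (hmeas : ∀ y : ℝ, 0 < y → AEStronglyMeasurable
      (fun t : ℝ => (t : ℂ) ^ 0 * ((t : ℂ) ^ (a - 1) * om t) * powK ζ b 0 (y * t))
      (volume.restrict T)) :
    Tendsto (fun y : ℝ => (y : ℂ) ^ b * horInt T om ζ a b 0 y) atTop
      (𝓝 (ζ ^ (-b) * ∫ t in T, (t : ℂ) ^ (a - b - 1) * om t)) := by
  have hζ0 : ζ ≠ 0 := Complex.slitPlane_ne_zero hζ
  have hζn : 0 < ‖ζ‖ := norm_pos_iff.2 hζ0
  have key : ∀ y : ℝ, 0 < y → ∀ t ∈ T, (y : ℂ) ^ b *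
      ((t : ℂ) ^ 0 * ((t : ℂ) ^ (a - 1) * om t) * powK ζ b 0 (y * t))
      = (t : ℂ) ^ (a - 1) * om t * ((y⁻¹ : ℝ) + ζ * t) ^ (-b) := by
    intro y hy t ht
    have ht0 : (0 : ℝ) < t := hTpos ht
    have hy0 : (y : ℂ) ≠ 0 := by exact_mod_cast hy.ne'
    have hne : ((y⁻¹ : ℝ) + ζ * t : ℂ) ≠ 0 := by
      intro h
      have h1 := congrArg Complex.re h
      simp only [Complex.add_re, Complex.ofReal_re, Complex.re_mul_ofReal, Complex.zero_re] at h1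
      have : 0 < y⁻¹ := inv_pos.2 hy
      have := mul_nonneg hζre ht0.le
      linarith
    have e1 : (1 + ζ * ((y * t : ℝ) : ℂ)) = (y : ℂ) * ((y⁻¹ : ℝ) + ζ * t) := by
      push_cast; field_simp
    simp only [powK, Finset.range_zero, Finset.prod_empty, one_mul, pow_zero, Nat.cast_zero,
      sub_zero]
    rw [e1, ofReal_mul_cpow hy hne, Complex.cpow_neg (y : ℂ) b]
    have : (y : ℂ) ^ b ≠ 0 := by simp [Complex.cpow_eq_zero_iff, hy0]
    field_simp
  have e0 : ζ ^ (-b) * ∫ t in T, (t : ℂ) ^ (a - b - 1) * om t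
      = ∫ t in T, (t : ℂ) ^ (a - 1) * om t * (ζ * t) ^ (-b) := by
    rw [← integral_const_mul]
    refine setIntegral_congr_fun hT fun t ht => ?_
    have ht0 : (0 : ℝ) < t := hTpos ht
    have ht1 : (t : ℂ) ≠ 0 := by exact_mod_cast ht0.ne'
    have e : (t : ℂ) ^ (a - b - 1) = (t : ℂ) ^ (a - 1) * (t : ℂ) ^ (-b) := by
      rw [← Complex.cpow_add _ _ ht1]; congr 1; ring
    rw [e, mul_comm ζ, ofReal_mul_cpow ht0 hζ0]
    ring
  rw [e0]
  have hcongr : (fun y : ℝ => (y : ℂ) ^ b * horInt T om ζ a b 0 y) =ᶠ[atTop]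
      fun y : ℝ => ∫ t in T, (y : ℂ) ^ b *
        ((t : ℂ) ^ 0 * ((t : ℂ) ^ (a - 1) * om t) * powK ζ b 0 (y * t)) :=
    Eventually.of_forall fun y => (integral_const_mul _ _).symm
  refine Tendsto.congr' hcongr.symm ?_
  refine tendsto_integral_filter_of_dominated_convergence
    (fun t => ‖(t : ℂ) ^ (a - b - 1) * om t‖ * (‖ζ‖ ^ (-b.re) * Real.exp (Real.pi * |b.im|)))
    ?_ ?_ (hint.norm.mul_const _) ?_
  · filter_upwards [eventually_gt_atTop 0] with y hy
    exact (hmeas y hy).const_mul _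
  · filter_upwards [eventually_gt_atTop 0] with y hy
    refine (ae_restrict_iff' hT).2 (Eventually.of_forall fun t ht => ?_)
    rw [key y hy t ht]
    have ht0 : (0 : ℝ) < t := hTpos ht
    have ht1 : (t : ℂ) ≠ 0 := by exact_mod_cast ht0.ne'
    have e : (t : ℂ) ^ (a - 1) = (t : ℂ) ^ (a - b - 1) * (t : ℂ) ^ b := by
      rw [← Complex.cpow_add _ _ ht1]; congr 1; ring
    have h1 := norm_cpow_le_exp ((y⁻¹ : ℝ) + ζ * t) (-b)
    -- As Re ζ ≥ 0, adding the positive number 1/y can only increase the modulus; with Re b > 0 this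
    -- bounds the negative power uniformly in y.
    have h2 : ‖ζ‖ * t ≤ ‖((y⁻¹ : ℝ) + ζ * t : ℂ)‖ := by
      have e3 : ‖ζ‖ * t = ‖ζ * (t : ℂ)‖ := by
        rw [norm_mul, Complex.norm_real, Real.norm_eq_abs, abs_of_pos ht0]
      rw [e3, Complex.norm_eq_sqrt_sq_add_sq, Complex.norm_eq_sqrt_sq_add_sq]
      apply Real.sqrt_le_sqrt
      simp only [Complex.add_re, Complex.ofReal_re, Complex.re_mul_ofReal, Complex.add_im,
        Complex.ofReal_im, Complex.im_mul_ofReal, zero_add]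
      have h3 : 0 < y⁻¹ := inv_pos.2 hy
      have h4 := mul_nonneg hζre ht0.le
      nlinarith
    have h3 : ‖((y⁻¹ : ℝ) + ζ * t : ℂ)‖ ^ (-b).re ≤ (‖ζ‖ * t) ^ (-b.re) := by
      rw [Complex.neg_re]
      exact Real.rpow_le_rpow_of_nonpos (by positivity) h2 (by linarith)
    rw [norm_mul, e, mul_right_comm, norm_mul, Complex.norm_cpow_eq_rpow_re_of_pos ht0]
    rw [Real.mul_rpow hζn.le ht0.le] at h3
    have h4 : t ^ b.re * t ^ (-b.re) = 1 := by
      rw [← Real.rpow_add ht0]; simp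
    have h5 : |(-b).im| = |b.im| := by simp
    rw [h5] at h1
    calc _ ≤ ‖(t : ℂ) ^ (a - b - 1) * om t‖ * t ^ b.re *
          (‖ζ‖ ^ (-b.re) * t ^ (-b.re) * Real.exp (Real.pi * |b.im|)) := by
          gcongr
          exact h1.trans (by gcongr)
      _ = ‖(t : ℂ) ^ (a - b - 1) * om t‖ * (‖ζ‖ ^ (-b.re) * Real.exp (Real.pi * |b.im|)) *
          (t ^ b.re * t ^ (-b.re)) := by ring
      _ = _ := by rw [h4, mul_one]
  · refine (ae_restrict_iff' hT).2 (Eventually.of_forall fun t ht => ?_)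
    have ht0 : (0 : ℝ) < t := hTpos ht
    have hs : ζ * t ∈ Complex.slitPlane := by
      rcases Complex.mem_slitPlane_iff.1 hζ with h | h
      · exact Complex.mem_slitPlane_iff.2 (Or.inl (by
          rw [Complex.re_mul_ofReal]; positivity))
      · exact Complex.mem_slitPlane_iff.2 (Or.inr (by
          rw [Complex.im_mul_ofReal]; exact mul_ne_zero h ht0.ne'))
    have h1 : Tendsto (fun y : ℝ => ((y⁻¹ : ℝ) : ℂ) + ζ * t) atTop (𝓝 (ζ * t)) := by
      have := (Complex.continuous_ofReal.tendsto 0).comp tendsto_inv_atTop_zero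
      simpa [Function.comp_def] using this.add_const (ζ * (t : ℂ))
    have h2 : Tendsto (fun y : ℝ => (((y⁻¹ : ℝ) : ℂ) + ζ * t) ^ (-b)) atTop
        (𝓝 ((ζ * t) ^ (-b))) :=
      ((continuousAt_cpow_const hs).tendsto).comp h1
    refine (h2.const_mul ((t : ℂ) ^ (a - 1) * om t)).congr' ?_
    filter_upwards [eventually_gt_atTop 0] with y hy
    exact (key y hy t ht).symm

/-- The closed form of the connection coefficient `conn`. -/
noncomputable def connVal (κ q : ℝ) (β : ℂ) : ℂ :=
  if κ = 0 then (2 * Complex.I * q) ^ pa q (-β) * (Complex.Gamma (1 + β) / Complex.Gamma (pa q β))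
  else ((2 * κ : ℝ) : ℂ) ^ pa q (-β) *
    (Complex.Gamma (1 + β) * Complex.Gamma (1 + Complex.I * q / κ) /
      (Complex.Gamma (pa q β) * Complex.Gamma (nuPar κ q (-β))))

theorem two_I_mul_mem_slitPlane (hq : q ≠ 0) : 2 * Complex.I * (q : ℂ) ∈ Complex.slitPlane := by
  refine Complex.mem_slitPlane_iff.2 (Or.inr ?_)
  simpa using hq

/-- The limiting integral has a − b = β as its exponent parameter, so it converges for Re β > 0 and
equals Γ(β), respectively the Beta value B(β, ν). -/
theorem tendsto_hor (hκ : 0 ≤ κ) (hq : q ≠ 0) (h0 : 0 < β.re) (h1 : β.re < 1) :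
    Tendsto (fun y : ℝ => (y : ℂ) ^ pa q (-β) * hor κ q β y) atTop
      (𝓝 (connVal κ q β / β)) := by
  have hβ0 : β ≠ 0 := fun h => by simp [h] at h0
  have ha : 0 < (pa q β).re := pa_re_pos q (by linarith)
  have hb : 0 < (pa q (-β)).re := pa_re_pos q (by rw [Complex.neg_re]; linarith)
  have e1 : pa q β - pa q (-β) - 1 = β - 1 := by simp only [pa]; ring
  have hG : Complex.Gamma (1 + β) = β * Complex.Gamma β := by
    rw [add_comm, Complex.Gamma_add_one _ hβ0]
  have hGa := Complex.Gamma_ne_zero_of_re_pos ha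
  have hGb := Complex.Gamma_ne_zero_of_re_pos h0
  rcases eq_or_ne κ 0 with h | h
  · have hm := two_I_mul_mem_slitPlane hq
    have hz : (2 * Complex.I * (q : ℂ))⁻¹ ∈ Complex.slitPlane := by
      refine Complex.mem_slitPlane_iff.2 (Or.inr ?_)
      rw [Complex.inv_im]
      refine div_ne_zero ?_ ?_
      · simpa using hq
      · rw [Ne, Complex.normSq_eq_zero]; exact Complex.slitPlane_ne_zero hm
    have hint := integrableOn_gamma h0 0
    have hlim := tendsto_horInt (om := fun t => Complex.exp (-t)) (a := pa q β)
      (b := pa q (-β)) measurableSet_Ioi subset_rfl hz (by simp [Complex.inv_re]) hb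
      (by rw [e1]; simpa using hint)
      (fun y _ => (hasDerivAt_horInt_confluent q ha (pa q (-β)) 0 y).2.aestronglyMeasurable)
    have e2 : ∫ t in Ioi (0 : ℝ), (t : ℂ) ^ (pa q β - pa q (-β) - 1) * Complex.exp (-t)
        = Complex.Gamma β := by
      rw [Complex.Gamma_eq_integral h0, Complex.GammaIntegral, e1]
      congr 1
      ext t
      push_cast
      ring
    rw [e2] at hlim
    have e3 : (2 * Complex.I * (q : ℂ))⁻¹ ^ (-pa q (-β)) = (2 * Complex.I * (q : ℂ)) ^ pa q (-β) := by
      rw [Complex.inv_cpow _ _ (Complex.slitPlane_arg_ne_pi hm), Complex.cpow_neg, inv_inv]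
    rw [e3] at hlim
    have := hlim.div_const (horNorm κ q β)
    rw [connVal, if_pos h, hG]
    rw [horNorm, if_pos h] at this
    simp only [hor, horRaw_zero h, horNorm, if_pos h]
    convert this using 1
    · ext y; ring
    · congr 1; field_simp
  · have hk : 0 < κ := lt_of_le_of_ne hκ (Ne.symm h)
    have hν := nuPar_re_pos (κ := κ) q h1
    have hz : (2 * (κ : ℂ))⁻¹ = (((2 * κ)⁻¹ : ℝ) : ℂ) := by push_cast; ring
    have hint := integrableOn_beta h0 hν 0
    have hlim := tendsto_horInt (om := fun t => (1 - t : ℂ) ^ (nuPar κ q β - 1)) (a := pa q β)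
      (b := pa q (-β)) (ζ := (2 * (κ : ℂ))⁻¹) measurableSet_Ioo (fun t ht => ht.1)
      (by rw [hz]; exact Complex.ofReal_mem_slitPlane.2 (by positivity))
      (by rw [hz, Complex.ofReal_re]; positivity) hb
      (by rw [e1]; simpa using hint)
      (fun y hy => (hasDerivAt_horInt_euler hk ha hν (pa q (-β)) 0
        (lt_trans (by linarith) hy)).2.aestronglyMeasurable)
    have e4 : β + nuPar κ q β = nuPar κ q (-β) := by simp only [nuPar, pa]; ring
    have e2 : ∫ t in Ioo (0 : ℝ) 1, (t : ℂ) ^ (pa q β - pa q (-β) - 1) *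
        (1 - t : ℂ) ^ (nuPar κ q β - 1)
        = Complex.Gamma β * Complex.Gamma (nuPar κ q β) / Complex.Gamma (nuPar κ q (-β)) := by
      rw [e1, integral_Ioo_beta, betaIntegral_eq h0 hν, e4]
    rw [e2] at hlim
    have e3 : (2 * (κ : ℂ))⁻¹ ^ (-pa q (-β)) = ((2 * κ : ℝ) : ℂ) ^ pa q (-β) := by
      have : (2 * (κ : ℂ)) = ((2 * κ : ℝ) : ℂ) := by push_cast; ring
      rw [this, Complex.inv_cpow _ _ ?_, Complex.cpow_neg, inv_inv]
      rw [Complex.arg_ofReal_of_nonneg (by positivity)]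
      exact Real.pi_ne_zero.symm
    rw [e3] at hlim
    have hGν := Complex.Gamma_ne_zero_of_re_pos hν
    have hGν' : Complex.Gamma (nuPar κ q (-β)) ≠ 0 := Complex.Gamma_ne_zero_of_re_pos
      (nuPar_re_pos q (by rw [Complex.neg_re]; linarith))
    have hGc := Complex.Gamma_ne_zero_of_re_pos (c_re_pos κ q)
    have := hlim.div_const (horNorm κ q β)
    rw [connVal, if_neg h, hG]
    rw [horNorm, if_neg h] at this
    simp only [hor, horRaw_pos h, horNorm, if_neg h]
    convert this using 1
    · ext y; ring
    · congr 1; field_simp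

theorem infSol_isRed_neg (hκ : 0 ≤ κ) (hβ : β ∈ strip) :
    IsRed κ q (sepConst q β) (infSol κ q (-β)) := by
  rw [← sepConst_neg]
  exact infSol_isRed hκ (strip_bounds (neg_mem_strip hβ)).1

theorem tendsto_infF_inv (hκ : 0 ≤ κ) (hβ : -1 < β.re) (n : ℕ) :
    Tendsto (fun y : ℝ => infF κ q β n y⁻¹) atTop (𝓝 (infF κ q β n 0)) :=
  ((hasDerivAt_infF hκ hβ n le_rfl).continuousAt.tendsto).comp tendsto_inv_atTop_zero

theorem cpow_ne_zero_of_pos {y : ℝ} (hy : 0 < y) (s : ℂ) : (y : ℂ) ^ s ≠ 0 := by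
  have : (y : ℂ) ≠ 0 := by exact_mod_cast hy.ne'
  simp [Complex.cpow_eq_zero_iff, this]

theorem cpow_mul_infSol {y : ℝ} (hy : 0 < y) :
    (y : ℂ) ^ pa q β * infSol κ q β y = infF κ q β 0 y⁻¹ := by
  have := cpow_ne_zero_of_pos hy (pa q β)
  rw [infSol, Complex.cpow_neg]
  field_simp

theorem tendsto_weight_div (hκ : 0 ≤ κ) :
    Tendsto (fun y : ℝ => weight κ q y / (y : ℂ) ^ (2 + 2 * Complex.I * q)) atTop (𝓝 1) := by
  obtain ⟨C, _, hC⟩ := exists_weight_eq (q := q) hκ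
  rw [tendsto_iff_norm_sub_tendsto_zero]
  have h1 : Tendsto (fun y : ℝ => C / y) atTop (𝓝 0) := tendsto_const_nhds.div_atTop tendsto_id
  refine tendsto_of_tendsto_of_tendsto_of_le_of_le' tendsto_const_nhds h1
    (Eventually.of_forall fun _ => norm_nonneg _) ?_
  filter_upwards [eventually_ge_atTop 1] with y hy using hC y hy

theorem tendsto_ofReal_inv_atTop : Tendsto (fun y : ℝ => (y : ℂ)⁻¹) atTop (𝓝 0) := by
  have := (Complex.continuous_ofReal.tendsto 0).comp tendsto_inv_atTop_zero
  simpa [Function.comp_def] using this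

/-- The constant is read off at infinity: the powers of y cancel against the weight y^(2+2iq),
leaving a − b = β. -/
theorem wr_infSol_neg (hκ : 0 ≤ κ) (hβ : β ∈ strip) {y : ℝ} (hy : 0 < y) :
    wr κ q (infSol κ q β) (infSol κ q (-β)) y = β := by
  have h1 := (strip_bounds hβ).1
  have h2 := (strip_bounds (neg_mem_strip hβ)).1
  have hlim : Tendsto (fun z : ℝ => wr κ q (infSol κ q β) (infSol κ q (-β)) z) atTop
      (𝓝 (1 * (-(1 * (pa q (-β) * 1 + 0 * infF κ q (-β) 1 0))
        + (pa q β * 1 + 0 * infF κ q β 1 0) * 1))) := by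
    have t1 := fun n => tendsto_infF_inv (q := q) hκ h1 n
    have t2 := fun n => tendsto_infF_inv (q := q) hκ h2 n
    have t10 := t1 0
    have t20 := t2 0
    rw [infF_zero κ q h1] at t10
    rw [infF_zero κ q h2] at t20
    refine ((tendsto_weight_div (q := q) hκ).mul ((t10.mul ((t20.const_mul (pa q (-β))).add
      (tendsto_ofReal_inv_atTop.mul (t2 1)))).neg.add (((t10.const_mul (pa q β)).add
      (tendsto_ofReal_inv_atTop.mul (t1 1))).mul t20))).congr' ?_
    filter_upwards [eventually_gt_atTop 0] with z hz
    have hz0 : (z : ℂ) ≠ 0 := by exact_mod_cast hz.ne'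
    rw [wr, (hasDerivAt_infSol hκ h1 hz).deriv, (hasDerivAt_infSol hκ h2 hz).deriv]
    simp only [infSol, infSol']
    have e1 : (z : ℂ) ^ (2 + 2 * Complex.I * q) = ((z : ℂ) ^ (-pa q β))⁻¹ *
        ((z : ℂ) ^ (-pa q (-β) - 1))⁻¹ := by
      rw [← Complex.cpow_neg, ← Complex.cpow_neg, ← Complex.cpow_add _ _ hz0]
      congr 1
      linear_combination -pa_add_pa q β
    have e2 : (z : ℂ) ^ (-pa q β - 1) * (z : ℂ) ^ (-pa q (-β))
        = (z : ℂ) ^ (-pa q β) * (z : ℂ) ^ (-pa q (-β) - 1) := by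
      rw [← Complex.cpow_add _ _ hz0, ← Complex.cpow_add _ _ hz0]
      congr 1
      ring
    rw [e1, div_eq_mul_inv, mul_inv, inv_inv, inv_inv]
    linear_combination (-weight κ q z * (pa q β * infF κ q β 0 z⁻¹ +
      (z : ℂ)⁻¹ * infF κ q β 1 z⁻¹) * infF κ q (-β) 0 z⁻¹) * e2
  have hconst : Tendsto (fun z : ℝ => wr κ q (infSol κ q β) (infSol κ q (-β)) z) atTop
      (𝓝 (wr κ q (infSol κ q β) (infSol κ q (-β)) y)) := by
    refine tendsto_const_nhds.congr' ?_
    filter_upwards [eventually_gt_atTop 0] with z hz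
    exact wr_const hκ (infSol_isRed hκ h1) (infSol_isRed_neg hκ hβ) hy hz
  rw [tendsto_nhds_unique hconst hlim]
  simp only [pa]
  ring

theorem hor_eq_linComb (hκ : 0 ≤ κ) (hq : q ≠ 0) (hβ : β ∈ strip) (h0 : β ≠ 0) :
    ∀ y : ℝ, 0 < y → hor κ q β y
      = wr κ q (hor κ q β) (infSol κ q (-β)) 1 / β * infSol κ q β y
        + conn κ q β / β * infSol κ q (-β) y := by
  intro y hy
  have := (hor_isRed hκ hq (horRange_of_strip hβ)).exists_eq_linComb hκ
    (infSol_isRed hκ (strip_bounds hβ).1) (infSol_isRed_neg hκ hβ)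
    (by rw [wr_infSol_neg hκ hβ one_pos]; exact h0) y hy
  rw [wr_infSol_neg hκ hβ one_pos, wr_swap (infSol κ q β)] at this
  rw [this, conn]
  ring

theorem tendsto_cpow_neg_atTop {s : ℂ} (hs : s.re < 0) :
    Tendsto (fun y : ℝ => (y : ℂ) ^ s) atTop (𝓝 0) := by
  rw [tendsto_zero_iff_norm_tendsto_zero]
  have h := tendsto_rpow_neg_atTop (y := -s.re) (by linarith)
  rw [neg_neg] at h
  refine h.congr' ?_
  filter_upwards [eventually_gt_atTop 0] with y hy
  rw [Complex.norm_cpow_eq_rpow_re_of_pos hy]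

/-- For Re β > 0 the component along `infSol κ q β` is suppressed by y^(−β), so the limit of y^b
times the regular solution isolates conn(β)/β. -/
theorem conn_eq_of_re_pos (hκ : 0 ≤ κ) (hq : q ≠ 0) (h0 : 0 < β.re) (h1 : β.re < 1) :
    conn κ q β = connVal κ q β := by
  have hβ : β ∈ strip := by
    rw [strip, mem_ofPred_eq, abs_lt]; constructor <;> linarith
  have hβ0 : β ≠ 0 := fun h => by simp [h] at h0
  have hn := neg_mem_strip hβ
  have t1 : Tendsto (fun y : ℝ => (y : ℂ) ^ pa q (-β) * hor κ q β y) atTop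
      (𝓝 (wr κ q (hor κ q β) (infSol κ q (-β)) 1 / β * (0 * 1) + conn κ q β / β * 1)) := by
    have f1 := tendsto_infF_inv (q := q) hκ (strip_bounds hβ).1 0
    have f2 := tendsto_infF_inv (q := q) hκ (strip_bounds hn).1 0
    rw [infF_zero κ q (strip_bounds hβ).1] at f1
    rw [infF_zero κ q (strip_bounds hn).1] at f2
    have f3 := tendsto_cpow_neg_atTop (s := -β) (by rw [Complex.neg_re]; linarith)
    refine (((f3.mul f1).const_mul _).add (f2.const_mul _)).congr' ?_
    filter_upwards [eventually_gt_atTop 0] with y hy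
    have hy0 : (y : ℂ) ≠ 0 := by exact_mod_cast hy.ne'
    rw [hor_eq_linComb hκ hq hβ hβ0 y hy, ← cpow_mul_infSol hy, ← cpow_mul_infSol hy]
    have e : (y : ℂ) ^ pa q (-β) = (y : ℂ) ^ (-β) * (y : ℂ) ^ pa q β := by
      rw [← Complex.cpow_add _ _ hy0]
      congr 1
      simp only [pa]
      ring
    rw [e]
    ring
  have := tendsto_nhds_unique t1 (tendsto_hor hκ hq h0 h1)
  field_simp at this
  linear_combination this

theorem differentiableAt_connVal (hκ : 0 ≤ κ) (hq : q ≠ 0) (hβ : β ∈ strip) :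
    DifferentiableAt ℂ (connVal κ q) β := by
  have hn := neg_mem_strip hβ
  have g1 : DifferentiableAt ℂ (fun β => Complex.Gamma (1 + β)) β :=
    differentiableAt_Gamma_comp (by fun_prop) (one_add_re_pos (strip_bounds hβ).1)
  have g2 := differentiableAt_Gamma_comp (differentiable_pa q β) (pa_re_pos q (strip_bounds hβ).1)
  have g2' := Complex.Gamma_ne_zero_of_re_pos (pa_re_pos q (strip_bounds hβ).1)
  have hν : 0 < (nuPar κ q (-β)).re := nuPar_re_pos q (strip_bounds hn).2
  have g3 : DifferentiableAt ℂ (fun β => Complex.Gamma (nuPar κ q (-β))) β :=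
    differentiableAt_Gamma_comp
      (((differentiable_nuPar κ q).comp differentiable_neg) β) hν
  have g3' := Complex.Gamma_ne_zero_of_re_pos hν
  unfold connVal
  split_ifs with h
  · exact ((differentiable_pa_neg q β).const_cpow
      (Or.inl (Complex.slitPlane_ne_zero (two_I_mul_mem_slitPlane hq)))).mul (g1.div g2 g2')
  · have hk : (0 : ℝ) < 2 * κ := by have := lt_of_le_of_ne hκ (Ne.symm h); positivity
    exact ((differentiable_pa_neg q β).const_cpow (Or.inl (by exact_mod_cast hk.ne'))).mul
      ((g1.mul_const _).div (g2.mul g3) (mul_ne_zero g2' g3'))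

/-- The connection formula. -/
theorem conn_eq (hκ : 0 ≤ κ) (hq : q ≠ 0) (hβ : β ∈ strip) : conn κ q β = connVal κ q β := by
  have h1 : AnalyticOnNhd ℂ (conn κ q) strip := fun z hz =>
    DifferentiableOn.analyticAt (s := strip)
      (fun w hw => (differentiableAt_conn hκ hw).differentiableWithinAt) (isOpen_strip.mem_nhds hz)
  have h2 : AnalyticOnNhd ℂ (connVal κ q) strip := fun z hz =>
    DifferentiableOn.analyticAt (s := strip)
      (fun w hw => (differentiableAt_connVal hκ hq hw).differentiableWithinAt)
      (isOpen_strip.mem_nhds hz)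
  have h3 : ((1 / 2 : ℝ) : ℂ) ∈ strip := by
    simp only [strip, mem_ofPred_eq, Complex.ofReal_re]
    rw [abs_of_pos] <;> norm_num
  -- Identity theorem on the convex strip: near β = 1/2 the two sides agree by the limit computation
  -- for 0 < Re β < 1.
  refine h1.eqOn_of_preconnected_of_eventuallyEq h2 convex_strip.isPreconnected h3 ?_ hβ
  have ho : IsOpen {z : ℂ | 0 < z.re ∧ z.re < 1} :=
    (isOpen_lt continuous_const Complex.continuous_re).inter
      (isOpen_lt Complex.continuous_re continuous_const)
  filter_upwards [ho.mem_nhds (show ((1 / 2 : ℝ) : ℂ) ∈ {z : ℂ | 0 < z.re ∧ z.re < 1} by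
    simp only [mem_ofPred_eq, Complex.ofReal_re]; norm_num)] with z hz
  exact conn_eq_of_re_pos hκ hq hz.1 hz.2

/-- All Gamma arguments have positive real part, and Gamma has no zeros there. This is the source of
α₊ ≠ 0 in the strip. -/
theorem connVal_ne_zero (hκ : 0 ≤ κ) (hq : q ≠ 0) (hβ : β ∈ strip) : connVal κ q β ≠ 0 := by
  have hn := neg_mem_strip hβ
  have g1 := Complex.Gamma_ne_zero_of_re_pos (one_add_re_pos (strip_bounds hβ).1)
  have g2 := Complex.Gamma_ne_zero_of_re_pos (pa_re_pos q (strip_bounds hβ).1)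
  have g3 := Complex.Gamma_ne_zero_of_re_pos (nuPar_re_pos (κ := κ) q (strip_bounds hn).2)
  have g4 := Complex.Gamma_ne_zero_of_re_pos (c_re_pos κ q)
  unfold connVal
  split_ifs with h
  · refine mul_ne_zero ?_ (div_ne_zero g1 g2)
    simp [Complex.cpow_eq_zero_iff, hq]
  · have hk : (0 : ℝ) < 2 * κ := by have := lt_of_le_of_ne hκ (Ne.symm h); positivity
    exact mul_ne_zero (cpow_ne_zero_of_pos hk _) (div_ne_zero (mul_ne_zero g1 g4)
      (mul_ne_zero g2 g3))

theorem conn_ne_zero (hκ : 0 ≤ κ) (hq : q ≠ 0) (hβ : β ∈ strip) : conn κ q β ≠ 0 := by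
  rw [conn_eq hκ hq hβ]
  exact connVal_ne_zero hκ hq hβ

end RNStat

namespace RNStat
open MeasureTheory

variable {κ q : ℝ} {β : ℂ} {lam : ℂ} {φ : ℝ → ℂ}

/-! ### Asymptotics at infinity -/

/-- Locally uniform expansion of the solution at infinity. -/
theorem exists_infF_bound (hκ : 0 ≤ κ) (q : ℝ) {β₀ : ℂ} (hβ₀ : -1 < β₀.re) :
    ∃ C : ℝ, 0 ≤ C ∧ ∀ᶠ β in 𝓝 β₀, -1 < β.re ∧ ∀ w : ℝ, 0 ≤ w → w ≤ 1 →
      ‖infF κ q β 0 w - 1‖ ≤ C * w := by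
  set ε : ℝ := (1 + β₀.re) / 2 with hε
  have hε0 : 0 < ε := by rw [hε]; linarith
  have hball : ∀ β' ∈ Metric.ball β₀ ε, -1 + ε < β'.re := fun β' h => by
    have := abs_lt.1 (re_close h)
    rw [hε] at *; linarith
  obtain ⟨C, hC⟩ := exists_infK_bound (q := q) hκ 1 (β := β₀) (ε := ε)
    fun β' h => by linarith [hball β' h]
  -- Bounds the first derivative of `infJ` uniformly in w ≥ 0 and in β on the ball; the expansion
  -- then follows from the mean value inequality.
  set I : ℝ := ∫ t in Ioo (0 : ℝ) 1, (t ^ (ε / 2 - 1) * (1 - t) ^ (ε / 2 - 1)) * C with hI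
  have hN0 : 0 < ‖infNorm q β₀‖ := norm_pos_iff.2 (infNorm_ne_zero q hβ₀)
  have hN : ∀ᶠ β in 𝓝 β₀, ‖infNorm q β₀‖ / 2 < ‖infNorm q β‖ :=
    ((differentiableAt_infNorm hβ₀).continuousAt.norm).eventually (lt_mem_nhds (by linarith))
  have hI1 : ∀ β ∈ Metric.ball β₀ ε, ∀ w : ℝ, 0 ≤ w → ‖infJ κ q β 1 w‖ ≤ I := by
    intro β hβ w hw
    refine norm_integral_le_of_norm_le ((integrableOn_beta_weight (by positivity)).mul_const C) ?_
    refine (ae_restrict_iff' measurableSet_Ioo).2 (Eventually.of_forall fun t ht => ?_)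
    rw [norm_mul]
    have hb := hball β hβ
    have h1 := norm_beta_weight_le (δ := ε / 2) (u := pa q β) (v := 1 - pa q (-β)) ht
      (by rw [pa_re]; linarith)
      (by rw [Complex.sub_re, pa_re, Complex.neg_re, Complex.one_re]; linarith) 1
    exact mul_le_mul h1 (hC β hβ _ (mul_nonneg hw ht.1.le)) (norm_nonneg _)
      (mul_nonneg (Real.rpow_nonneg ht.1.le _) (Real.rpow_nonneg (by linarith [ht.2]) _))
  have hInn : 0 ≤ I := (norm_nonneg _).trans (hI1 β₀ (Metric.mem_ball_self hε0) 0 le_rfl)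
  refine ⟨I / (‖infNorm q β₀‖ / 2), by positivity, ?_⟩
  filter_upwards [hN, Metric.ball_mem_nhds β₀ hε0] with β hβN hβ
  have hre : -1 < β.re := by linarith [hball β hβ]
  refine ⟨hre, fun w hw _ => ?_⟩
  have := norm_sub_le_of_norm_deriv_le (D := infF κ q β 0) (D' := infF κ q β 1)
    (b := fun t => I / (‖infNorm q β₀‖ / 2) * t) (b' := fun _ => I / (‖infNorm q β₀‖ / 2)) hw
    (fun t ht => hasDerivAt_infF hκ hre 0 ht.1)
    (fun t _ => by simpa using (hasDerivAt_id t).const_mul (I / (‖infNorm q β₀‖ / 2)))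
    (fun t ht => by
      rw [infF, norm_div]
      exact div_le_div₀ hInn (hI1 β hβ t ht.1) (by positivity) hβN.le)
  rw [infF_zero κ q hre] at this
  simpa using this

theorem norm_inv_sub_one_le {u : ℂ} {ε : ℝ} (h : ‖u - 1‖ ≤ ε) (hε : ε ≤ 1 / 2) :
    ‖u⁻¹ - 1‖ ≤ 2 * ε ∧ 1 / 2 ≤ ‖u‖ := by
  have h1 : 1 / 2 ≤ ‖u‖ := by
    have := norm_sub_norm_le (1 : ℂ) (1 - u)
    rw [sub_sub_cancel, norm_one, norm_sub_rev] at this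
    linarith
  have hu : u ≠ 0 := fun h0 => by rw [h0, norm_zero] at h1; linarith
  refine ⟨?_, h1⟩
  have e : u⁻¹ - 1 = -(u - 1) * u⁻¹ := by field_simp; ring
  rw [e, norm_mul, norm_neg, norm_inv]
  have h2 : ‖u‖⁻¹ ≤ 2 := by
    rw [inv_le_comm₀ (by linarith) two_pos]; linarith
  calc ‖u - 1‖ * ‖u‖⁻¹ ≤ ε * 2 := by
        have : 0 ≤ ε := (norm_nonneg _).trans h
        gcongr
    _ = _ := mul_comm _ _

/-- Locally uniform asymptotics of the derivative of a quotient of solutions. -/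
theorem exists_inv_weight_bound (hκ : 0 ≤ κ) (q : ℝ) {β₀ : ℂ} (hβ₀ : -1 < β₀.re) :
    ∃ Y C : ℝ, 1 ≤ Y ∧ 0 ≤ C ∧ ∀ᶠ β in 𝓝 β₀, -1 < β.re ∧ ∀ y : ℝ, Y ≤ y →
      1 / 2 ≤ ‖infF κ q β 0 y⁻¹‖ ∧
      ‖(weight κ q y * infSol κ q β y ^ 2)⁻¹ - (y : ℂ) ^ (β - 1)‖ ≤ C * y ^ (β.re - 2) := by
  obtain ⟨C₁, hC₁, h₁⟩ := exists_infF_bound hκ q hβ₀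
  obtain ⟨C₂, hC₂, h₂⟩ := exists_weight_eq (q := q) hκ
  set K : ℝ := C₂ * (1 + C₁) ^ 2 + C₁ * (2 + C₁) with hK
  have hK0 : 0 ≤ K := by positivity
  refine ⟨1 + 2 * (K + C₁), 2 * K, by linarith, by positivity, ?_⟩
  filter_upwards [h₁] with β hβ
  refine ⟨hβ.1, fun y hy => ?_⟩
  have hy1 : 1 ≤ y := by linarith
  have hy0 : 0 < y := by linarith
  have hyc : (y : ℂ) ≠ 0 := by exact_mod_cast hy0.ne'
  have hF := hβ.2 y⁻¹ (by positivity) (inv_le_one_of_one_le₀ hy1)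
  have hW := h₂ y hy1
  set F := infF κ q β 0 y⁻¹ with hFdef
  set W := weight κ q y / (y : ℂ) ^ (2 + 2 * Complex.I * q) with hWdef
  rw [← div_eq_mul_inv] at hF
  have hFC : C₁ / y ≤ C₁ := div_le_self hC₁ hy1
  have hF1 : ‖F‖ ≤ 1 + C₁ := by
    have := norm_add_le (1 : ℂ) (F - 1)
    rw [add_sub_cancel, norm_one] at this
    linarith
  have hu : ‖W * F ^ 2 - 1‖ ≤ K / y := by
    have e : W * F ^ 2 - 1 = (W - 1) * F ^ 2 + (F - 1) * (2 + (F - 1)) := by ring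
    rw [e]
    refine (norm_add_le _ _).trans ?_
    rw [norm_mul, norm_mul, norm_pow]
    have h3 : ‖2 + (F - 1)‖ ≤ 2 + C₁ := by
      refine (norm_add_le _ _).trans ?_
      rw [Complex.norm_ofNat]
      linarith
    calc _ ≤ C₂ / y * (1 + C₁) ^ 2 + C₁ / y * (2 + C₁) := by gcongr
      _ = _ := by rw [hK]; ring
  have hKy : K / y ≤ 1 / 2 := by
    rw [div_le_iff₀ hy0]; linarith
  have hCy : C₁ / y ≤ 1 / 2 := by
    rw [div_le_iff₀ hy0]; linarith
  refine ⟨(norm_inv_sub_one_le hF hCy).2, ?_⟩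
  have h4 := (norm_inv_sub_one_le hu hKy).1
  have e : (weight κ q y * infSol κ q β y ^ 2)⁻¹ = (y : ℂ) ^ (β - 1) * (W * F ^ 2)⁻¹ := by
    -- The exponents satisfy 2a − (2 + 2iq) = β − 1.
    have e1 : (y : ℂ) ^ (β - 1) = (y : ℂ) ^ pa q β * (y : ℂ) ^ pa q β /
        (y : ℂ) ^ (2 + 2 * Complex.I * q) := by
      rw [← Complex.cpow_add _ _ hyc, ← Complex.cpow_sub _ _ hyc]
      congr 1
      simp only [pa]
      ring
    have n1 := cpow_ne_zero_of_pos hy0 (2 + 2 * Complex.I * q)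
    have n2 := cpow_ne_zero_of_pos hy0 (pa q β)
    rw [e1, infSol, Complex.cpow_neg, hWdef, ← hFdef]
    generalize (y : ℂ) ^ (2 + 2 * Complex.I * q) = P at n1 ⊢
    field_simp
  rw [e]
  have e2 : (y : ℂ) ^ (β - 1) * (W * F ^ 2)⁻¹ - (y : ℂ) ^ (β - 1)
      = (y : ℂ) ^ (β - 1) * ((W * F ^ 2)⁻¹ - 1) := by ring
  rw [e2, norm_mul, Complex.norm_cpow_eq_rpow_re_of_pos hy0]
  have e3 : y ^ (β.re - 2) = y ^ (β - 1).re * y⁻¹ := by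
    rw [← Real.rpow_neg_one, ← Real.rpow_add hy0]
    congr 1
    simp only [Complex.sub_re, Complex.one_re]
    ring
  rw [e3]
  calc _ ≤ y ^ (β - 1).re * (2 * (K / y)) := by gcongr
    _ = _ := by ring

/-- The quotient rule produces the Wronskian, which is constant after weighting: reduction of order.
-/
theorem hasDerivAt_quotient (hκ : 0 ≤ κ) (hβ : -1 < β.re) (hφ : IsRed κ q (sepConst q β) φ)
    {y : ℝ} (hy : 0 < y) (h0 : infSol κ q β y ≠ 0) :
    HasDerivAt (fun y => φ y / infSol κ q β y)
      (wr κ q (infSol κ q β) φ 1 * (weight κ q y * infSol κ q β y ^ 2)⁻¹) y := by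
  have h1 := infSol_isRed (q := q) hκ hβ
  refine ((hφ.hasDerivAt hy).div (h1.hasDerivAt hy) h0).congr_deriv ?_
  rw [wr_const hκ h1 hφ one_pos hy, wr]
  have := weight_ne_zero (q := q) hκ hy
  field_simp

/-- The primitive of `y ^ (β - 1)` vanishing at `y = 1`. -/
noncomputable def powPrim (β : ℂ) (y : ℝ) : ℂ := if β = 0 then (Real.log y : ℂ) else ((y : ℂ) ^ β - 1) / β

theorem hasDerivAt_powPrim (β : ℂ) {y : ℝ} (hy : 0 < y) :
    HasDerivAt (powPrim β) ((y : ℂ) ^ (β - 1)) y := by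
  unfold powPrim
  split_ifs with h
  · refine (Real.hasDerivAt_log hy.ne').ofReal_comp.congr_deriv ?_
    rw [h, zero_sub, Complex.cpow_neg_one]
    push_cast
    rfl
  · refine (((hasDerivAt_cpow_real β hy).sub_const 1).div_const β).congr_deriv ?_
    field_simp

/-- The behaviour under dilations, uniform in β including 0; it drives the comparison of y with xy
in `coeff_eq_zero`. -/
theorem powPrim_mul (β : ℂ) {x y : ℝ} (hx : 0 < x) (hy : 0 < y) :
    powPrim β (x * y) = powPrim β y + (y : ℂ) ^ β * powPrim β x := by
  unfold powPrim
  split_ifs with h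
  · rw [Real.log_mul hx.ne' hy.ne', h, Complex.cpow_zero]
    push_cast
    ring
  · have : (((x * y : ℝ) : ℂ)) ^ β = (x : ℂ) ^ β * (y : ℂ) ^ β := by
      rw [Complex.ofReal_mul, Complex.mul_cpow_ofReal_nonneg hx.le hy.le]
    rw [this]
    field_simp
    ring

/-- The remainder of a quotient of solutions after subtracting its leading part. -/
noncomputable def remainder (κ q : ℝ) (β : ℂ) (φ : ℝ → ℂ) (y : ℝ) : ℂ :=
  φ y / infSol κ q β y - wr κ q (infSol κ q β) φ 1 * powPrim β y

theorem infSol_ne_zero_of {y : ℝ} (hy : 0 < y) (h : 1 / 2 ≤ ‖infF κ q β 0 y⁻¹‖) :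
    infSol κ q β y ≠ 0 := by
  refine mul_ne_zero (cpow_ne_zero_of_pos hy _) fun h0 => ?_
  rw [h0, norm_zero] at h
  linarith

theorem hasDerivAt_remainder (hκ : 0 ≤ κ) (hβ : -1 < β.re) (hφ : IsRed κ q (sepConst q β) φ)
    {y : ℝ} (hy : 0 < y) (h0 : infSol κ q β y ≠ 0) :
    HasDerivAt (remainder κ q β φ) (wr κ q (infSol κ q β) φ 1 *
      ((weight κ q y * infSol κ q β y ^ 2)⁻¹ - (y : ℂ) ^ (β - 1))) y := by
  refine ((hasDerivAt_quotient hκ hβ hφ hy h0).sub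
    ((hasDerivAt_powPrim β hy).const_mul _)).congr_deriv ?_
  ring

/-- The dilation factor must be chosen: for imaginary β one may have x^β = 1 with x > 1. Since the
derivative never vanishes, `powPrim` cannot vanish identically. -/
theorem exists_powPrim_ne_zero (β : ℂ) : ∃ x : ℝ, 1 < x ∧ powPrim β x ≠ 0 := by
  by_contra! h
  have h2 : HasDerivAt (powPrim β) 0 2 :=
    (hasDerivAt_const (2 : ℝ) (0 : ℂ)).congr_of_eventuallyEq (by
      filter_upwards [Ioi_mem_nhds (show (1 : ℝ) < 2 by norm_num)] with z hz using h z hz)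
  exact cpow_ne_zero_of_pos two_pos _ ((hasDerivAt_powPrim β two_pos).unique h2)

theorem tendsto_rpow_of_neg {s : ℝ} (hs : s < 0) : Tendsto (fun y : ℝ => y ^ s) atTop (𝓝 0) := by
  have := tendsto_rpow_neg_atTop (y := -s) (by linarith)
  rwa [neg_neg] at this

/-- A combination of the recessive solution and a second solution which is small compared to the
dominant behaviour does not contain the second solution. -/
theorem coeff_eq_zero (hκ : 0 ≤ κ) (hβ : -1 < β.re) (hφ : IsRed κ q (sepConst q β) φ)
    (hw : wr κ q (infSol κ q β) φ 1 ≠ 0) {u v : ℂ} {Z K θ : ℝ} (hθ : θ < β.re)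
    (h : ∀ y : ℝ, Z ≤ y → ‖u + v * (φ y / infSol κ q β y)‖ ≤ K * y ^ θ) : v = 0 := by
  obtain ⟨Y, C, hY, hC, hev⟩ := exists_inv_weight_bound hκ q hβ
  obtain ⟨-, hb⟩ := hev.self_of_nhds
  obtain ⟨x, hx, hpx⟩ := exists_powPrim_ne_zero β
  have hx0 : 0 < x := by linarith
  set L := wr κ q (infSol κ q β) φ 1 with hL
  set E := remainder κ q β φ with hE
  -- Bounds (t/y)^(Re β − 2) for 1 ≤ t/y ≤ x, whichever sign the exponent has.
  set X : ℝ := max 1 (x ^ (β.re - 2)) with hX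
  have hrem : ∀ y, Y ≤ y → ‖E (x * y) - E y‖ ≤ ‖L‖ * C * X * (x - 1) * y ^ (β.re - 1) := by
    intro y hy
    have hy0 : 0 < y := by linarith
    have hyx : y ≤ x * y := by nlinarith
    have := norm_sub_le_of_norm_deriv_le (D := E) (D' := fun t => L *
        ((weight κ q t * infSol κ q β t ^ 2)⁻¹ - (t : ℂ) ^ (β - 1)))
      (b := fun t => ‖L‖ * (C * (X * y ^ (β.re - 2))) * t)
      (b' := fun _ => ‖L‖ * (C * (X * y ^ (β.re - 2)))) hyx
      (fun t ht => hasDerivAt_remainder hκ hβ hφ (by linarith [ht.1])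
        (infSol_ne_zero_of (by linarith [ht.1]) (hb t (hy.trans ht.1)).1))
      (fun t _ => by simpa using (hasDerivAt_id t).const_mul _)
      (fun t ht => by
        rw [norm_mul]
        refine mul_le_mul_of_nonneg_left (((hb t (hy.trans ht.1)).2).trans ?_) (norm_nonneg _)
        refine mul_le_mul_of_nonneg_left ?_ hC
        have ht0 : 0 < t := by linarith [ht.1]
        have hs : t = (t / y) * y := by field_simp
        have h1 : 1 ≤ t / y := by rw [le_div_iff₀ hy0]; linarith [ht.1]
        have h2 : t / y ≤ x := by rw [div_le_iff₀ hy0]; exact ht.2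
        rw [hs, Real.mul_rpow (by positivity) hy0.le]
        refine mul_le_mul_of_nonneg_right ?_ (Real.rpow_nonneg hy0.le _)
        rcases le_total 0 (β.re - 2) with h3 | h3
        · exact le_max_of_le_right (Real.rpow_le_rpow (by positivity) h2 h3)
        · exact le_max_of_le_left (Real.rpow_le_one_of_one_le_of_nonpos h1 h3))
    refine this.trans (le_of_eq ?_)
    have e : y ^ (β.re - 1) = y ^ (β.re - 2) * y := by
      rw [← Real.rpow_add_one hy0.ne']; congr 1; ring
    rw [e]
    ring
  by_contra hv
  have hpos : 0 < ‖v‖ * (‖L‖ * ‖powPrim β x‖) := by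
    have := norm_pos_iff.2 hv
    have := norm_pos_iff.2 hw
    have := norm_pos_iff.2 hpx
    positivity
  have hmain : ∀ᶠ y : ℝ in atTop, ‖v‖ * (‖L‖ * ‖powPrim β x‖) ≤
      K * (x ^ θ + 1) * y ^ (θ - β.re) + ‖v‖ * (‖L‖ * C * X * (x - 1)) * y ^ (-1 : ℝ) := by
    filter_upwards [eventually_ge_atTop Y, eventually_ge_atTop Z] with y hyY hyZ
    have hy0 : 0 < y := by linarith
    have hyx : y ≤ x * y := by nlinarith
    have h1 := h y hyZ
    have h2 := h (x * y) (hyZ.trans hyx)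
    have h3 := hrem y hyY
    -- Subtracting the values at xy and at y removes the unknown constant u and leaves a term of
    -- exact size y^(Re β), to be compared with y^θ and y^(Re β − 1).
    have hid : v * (L * ((y : ℂ) ^ β * powPrim β x))
        = (u + v * (φ (x * y) / infSol κ q β (x * y))) - (u + v * (φ y / infSol κ q β y))
          - v * (E (x * y) - E y) := by
      simp only [hE, remainder, ← hL]
      rw [powPrim_mul β hx0 hy0]
      ring
    have h4 : ‖v * (L * ((y : ℂ) ^ β * powPrim β x))‖ ≤ K * (x * y) ^ θ + K * y ^ θ +
        ‖v‖ * (‖L‖ * C * X * (x - 1) * y ^ (β.re - 1)) := by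
      rw [hid]
      refine (norm_sub_le _ _).trans (add_le_add ((norm_sub_le _ _).trans (add_le_add h2 h1)) ?_)
      rw [norm_mul]
      gcongr
    rw [norm_mul, norm_mul, norm_mul, Complex.norm_cpow_eq_rpow_re_of_pos hy0,
      Real.mul_rpow hx0.le hy0.le] at h4
    have e1 : y ^ θ = y ^ (θ - β.re) * y ^ β.re := by
      rw [← Real.rpow_add hy0]; congr 1; ring
    have e2 : y ^ (β.re - 1) = y ^ (-1 : ℝ) * y ^ β.re := by
      rw [← Real.rpow_add hy0]; congr 1; ring
    rw [e1, e2] at h4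
    refine le_of_mul_le_mul_right ?_ (Real.rpow_pos_of_pos hy0 β.re)
    linarith
  have hlim : Tendsto (fun y : ℝ => K * (x ^ θ + 1) * y ^ (θ - β.re) +
      ‖v‖ * (‖L‖ * C * X * (x - 1)) * y ^ (-1 : ℝ)) atTop (𝓝 (K * (x ^ θ + 1) * 0 +
        ‖v‖ * (‖L‖ * C * X * (x - 1)) * 0)) :=
    ((tendsto_rpow_of_neg (by linarith)).const_mul _).add
      ((tendsto_rpow_of_neg (by norm_num)).const_mul _)
  have := ge_of_tendsto hlim hmain
  simp only [mul_zero, add_zero] at this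
  linarith

end RNStat

namespace RNStat
open MeasureTheory

variable {κ q : ℝ} {β : ℂ} {lam : ℂ} {φ g p : ℝ → ℂ}

/-! ### Normalisations at infinity and uniqueness -/

/-- `g = 1 + O(e)` on `(1, ∞)`. -/
def NearOne (e : ℝ → ℝ) (g : ℝ → ℂ) : Prop := ∃ C : ℝ, ∀ y : ℝ, 1 < y → ‖g y - 1‖ ≤ C * e y

/-- Continuity on the compact interval [1, Y] and positivity of e extend the bound from large y to
all y > 1. -/
theorem nearOne_of_eventually {e : ℝ → ℝ} {g : ℝ → ℂ} (he : ContinuousOn e (Ici 1))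
    (hpos : ∀ y, 1 ≤ y → 0 < e y) (hg : ContinuousOn g (Ici 1)) {Y K : ℝ}
    (h : ∀ y, Y ≤ y → ‖g y - 1‖ ≤ K * e y) : NearOne e g := by
  have hc : ContinuousOn (fun y => ‖g y - 1‖ / e y) (Icc 1 Y) :=
    (((hg.sub continuousOn_const).norm).div he fun y hy => (hpos y hy).ne').mono
      Icc_subset_Ici_self
  obtain ⟨C, hC⟩ := isCompact_Icc.exists_bound_of_continuousOn hc
  refine ⟨max C K, fun y hy => ?_⟩
  have hey := hpos y hy.le
  rcases le_total Y y with h1 | h1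
  · exact (h y h1).trans (mul_le_mul_of_nonneg_right (le_max_right _ _) hey.le)
  · have := (le_abs_self _).trans (hC y ⟨hy.le, h1⟩)
    rw [div_le_iff₀ hey] at this
    exact this.trans (mul_le_mul_of_nonneg_right (le_max_left _ _) hey.le)

theorem NearOne.mono {e e' : ℝ → ℝ} {g : ℝ → ℂ} (h : NearOne e g)
    (he : ∀ y, 1 < y → 0 ≤ e y) {K : ℝ} (hee : ∀ y, 1 < y → e y ≤ K * e' y) : NearOne e' g := by
  obtain ⟨C, hC⟩ := h
  refine ⟨|C| * K, fun y hy => (hC y hy).trans ?_⟩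
  calc C * e y ≤ |C| * e y := mul_le_mul_of_nonneg_right (le_abs_self _) (he y hy)
    _ ≤ |C| * (K * e' y) := mul_le_mul_of_nonneg_left (hee y hy) (abs_nonneg _)
    _ = _ := by ring

theorem NearOne.mul {e : ℝ → ℝ} {f g : ℝ → ℂ} (hf : NearOne e f) (hg : NearOne e g)
    {K : ℝ} (he : ∀ y, 1 < y → 0 ≤ e y ∧ e y ≤ K) : NearOne e fun y => f y * g y := by
  obtain ⟨C, hC⟩ := hf
  obtain ⟨D, hD⟩ := hg
  refine ⟨|C| * (1 + |D| * K) + |D|, fun y hy => ?_⟩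
  obtain ⟨h0, h1⟩ := he y hy
  have e1 : f y * g y - 1 = (f y - 1) * (1 + (g y - 1)) + (g y - 1) := by ring
  have a1 : ‖f y - 1‖ ≤ |C| * e y :=
    (hC y hy).trans (mul_le_mul_of_nonneg_right (le_abs_self _) h0)
  have a2 : ‖g y - 1‖ ≤ |D| * e y :=
    (hD y hy).trans (mul_le_mul_of_nonneg_right (le_abs_self _) h0)
  have a3 : ‖1 + (g y - 1)‖ ≤ 1 + |D| * K := by
    refine (norm_add_le _ _).trans ?_
    rw [norm_one]
    have := mul_le_mul_of_nonneg_left h1 (abs_nonneg D)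
    linarith
  rw [e1]
  refine (norm_add_le _ _).trans ?_
  rw [norm_mul]
  calc _ ≤ (|C| * e y) * (1 + |D| * K) + |D| * e y := by gcongr
    _ = _ := by ring

theorem NearOne.congr {e : ℝ → ℝ} {f g : ℝ → ℂ} (hf : NearOne e f)
    (h : ∀ y, 1 < y → g y = f y) : NearOne e g := by
  obtain ⟨C, hC⟩ := hf
  exact ⟨C, fun y hy => by rw [h y hy]; exact hC y hy⟩

/-- The relative error in the normalisation of the dominant solution. -/
noncomputable def errPlus (β : ℂ) (y : ℝ) : ℝ := y⁻¹ * if β = 1 then Real.log (1 + y) else 1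

/-- The logarithmic factor in the normalisation of the dominant solution. -/
noncomputable def leadPlus (β : ℂ) (y : ℝ) : ℂ := if β = 0 then (Real.log (1 + y) : ℂ) else 1

/-- Normalisation of the recessive solution. -/
def AsyMinus (q : ℝ) (β : ℂ) (φ : ℝ → ℂ) : Prop :=
  NearOne (fun y => y⁻¹) fun y => (y : ℂ) ^ pa q β * φ y

/-- Normalisation of the dominant solution. -/
def AsyPlus (q : ℝ) (β : ℂ) (φ : ℝ → ℂ) : Prop :=
  NearOne (errPlus β) fun y => (y : ℂ) ^ pa q (-β) * φ y / leadPlus β y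

theorem log_one_add_pos {y : ℝ} (hy : 0 < y) : 0 < Real.log (1 + y) := Real.log_pos (by linarith)

theorem leadPlus_ne_zero (β : ℂ) {y : ℝ} (hy : 0 < y) : leadPlus β y ≠ 0 := by
  unfold leadPlus
  split_ifs
  · exact_mod_cast (log_one_add_pos hy).ne'
  · exact one_ne_zero

theorem errPlus_pos (β : ℂ) {y : ℝ} (hy : 0 < y) : 0 < errPlus β y := by
  unfold errPlus
  have := log_one_add_pos hy
  split_ifs <;> positivity

theorem continuousOn_log_one_add : ContinuousOn (fun y : ℝ => Real.log (1 + y)) (Ici 1) :=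
  ContinuousOn.log (by fun_prop) fun y hy => by
    have : (1 : ℝ) ≤ y := hy
    linarith

theorem continuousOn_inv_Ici : ContinuousOn (fun y : ℝ => y⁻¹) (Ici 1) :=
  continuousOn_id.inv₀ fun y hy => by
    have : (1 : ℝ) ≤ y := hy
    simp only [id]
    linarith

theorem continuousOn_errPlus (β : ℂ) : ContinuousOn (errPlus β) (Ici 1) := by
  unfold errPlus
  split_ifs
  · exact continuousOn_inv_Ici.mul continuousOn_log_one_add
  · simpa using continuousOn_inv_Ici

theorem continuousOn_leadPlus (β : ℂ) : ContinuousOn (leadPlus β) (Ici 1) := by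
  unfold leadPlus
  split_ifs
  · exact Complex.continuous_ofReal.comp_continuousOn continuousOn_log_one_add
  · exact continuousOn_const

theorem continuousOn_cpow_Ici (s : ℂ) : ContinuousOn (fun y : ℝ => (y : ℂ) ^ s) (Ici 1) :=
  fun _ hy => (hasDerivAt_cpow_real s (lt_of_lt_of_le one_pos hy)).continuousAt.continuousWithinAt

theorem IsRed.continuousOn_Ici_one (h : IsRed κ q lam φ) : ContinuousOn φ (Ici 1) :=
  h.1.continuousOn.mono fun y hy => show (0 : ℝ) < y from lt_of_lt_of_le one_pos hy

theorem asyMinus_of_eventually (h : IsRed κ q lam φ) {Y K : ℝ}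
    (hb : ∀ y : ℝ, Y ≤ y → ‖(y : ℂ) ^ pa q β * φ y - 1‖ ≤ K * y⁻¹) : AsyMinus q β φ :=
  nearOne_of_eventually continuousOn_inv_Ici (fun _ hy => inv_pos.2 (lt_of_lt_of_le one_pos hy))
    ((continuousOn_cpow_Ici _).mul h.continuousOn_Ici_one) hb

theorem asyPlus_of_eventually (h : IsRed κ q lam φ) {Y K : ℝ}
    (hb : ∀ y, Y ≤ y → ‖(y : ℂ) ^ pa q (-β) * φ y / leadPlus β y - 1‖ ≤ K * errPlus β y) :
    AsyPlus q β φ :=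
  nearOne_of_eventually (continuousOn_errPlus β) (fun y hy => errPlus_pos β (by linarith))
    (((continuousOn_cpow_Ici _).mul h.continuousOn_Ici_one).div (continuousOn_leadPlus β)
      fun y hy => leadPlus_ne_zero β (lt_of_lt_of_le one_pos hy)) hb

theorem exists_infSol_bounds (hκ : 0 ≤ κ) (q : ℝ) (hβ : -1 < β.re) :
    ∃ Y C : ℝ, 2 ≤ Y ∧ 0 ≤ C ∧ ∀ y : ℝ, Y ≤ y →
      1 / 2 ≤ ‖infF κ q β 0 y⁻¹‖ ∧ ‖infF κ q β 0 y⁻¹ - 1‖ ≤ C * y⁻¹ ∧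
      ‖(weight κ q y * infSol κ q β y ^ 2)⁻¹ - (y : ℂ) ^ (β - 1)‖ ≤ C * y ^ (β.re - 2) := by
  obtain ⟨C₁, hC₁, h₁⟩ := exists_infF_bound hκ q hβ
  obtain ⟨Y, C₂, hY, hC₂, h₂⟩ := exists_inv_weight_bound hκ q hβ
  obtain ⟨-, h₁⟩ := h₁.self_of_nhds
  obtain ⟨-, h₂⟩ := h₂.self_of_nhds
  refine ⟨max Y 2, max C₁ C₂, le_max_right _ _, le_max_of_le_left hC₁, fun y hy => ?_⟩
  have hyY : Y ≤ y := (le_max_left _ _).trans hy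
  have hy2 : 2 ≤ y := (le_max_right _ _).trans hy
  refine ⟨(h₂ y hyY).1, ?_, ?_⟩
  · refine (h₁ y⁻¹ (by positivity) (inv_le_one_of_one_le₀ (by linarith))).trans ?_
    gcongr
    exact le_max_left _ _
  · refine ((h₂ y hyY).2).trans ?_
    gcongr
    exact le_max_right _ _

theorem asyMinus_infSol (hκ : 0 ≤ κ) (hβ : -1 < β.re) : AsyMinus q β (infSol κ q β) := by
  obtain ⟨Y, C, hY, -, h⟩ := exists_infSol_bounds hκ q hβ
  refine asyMinus_of_eventually (infSol_isRed hκ hβ) (Y := Y) (K := C) fun y hy => ?_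
  rw [cpow_mul_infSol (by linarith)]
  exact (h y hy).2.1

/-- Relative to `infSol` a competitor differs by O(1/y), and −1 < Re β, so `coeff_eq_zero` excludes
any admixture of the second solution p; the limit at infinity fixes the factor. This holds although
p may be no larger than `infSol`. -/
theorem eqOn_infSol_of_asyMinus (hκ : 0 ≤ κ) (hβ : -1 < β.re) (hp : IsRed κ q (sepConst q β) p)
    (hw : wr κ q (infSol κ q β) p 1 ≠ 0) (hg : IsRed κ q (sepConst q β) g)
    (h : AsyMinus q β g) : EqOn g (infSol κ q β) (Ioi 0) := by
  have h1 := hg.exists_eq_linComb hκ (infSol_isRed hκ hβ) hp hw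
  set u := wr κ q g p 1 / wr κ q (infSol κ q β) p 1
  set v := -(wr κ q g (infSol κ q β) 1 / wr κ q (infSol κ q β) p 1)
  obtain ⟨Y, C, hY, hC, hb⟩ := exists_infSol_bounds hκ q hβ
  obtain ⟨D, hD⟩ := h
  have key : ∀ y, Y ≤ y → ‖(u - 1) + v * (p y / infSol κ q β y)‖ ≤ (D + C) * 2 * y ^ (-1 : ℝ) := by
    intro y hy
    have hy0 : 0 < y := by linarith
    have hF := hb y hy
    have hF0 : infF κ q β 0 y⁻¹ ≠ 0 := norm_pos_iff.1 (by linarith [hF.1])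
    have hs := infSol_ne_zero_of hy0 hF.1
    have hn := cpow_ne_zero_of_pos hy0 (pa q β)
    have e : (u - 1) + v * (p y / infSol κ q β y)
        = (((y : ℂ) ^ pa q β * g y - 1) - (infF κ q β 0 y⁻¹ - 1)) * (infF κ q β 0 y⁻¹)⁻¹ := by
      rw [← cpow_mul_infSol hy0, h1 y hy0]
      field_simp
      ring
    rw [e, norm_mul, norm_inv, Real.rpow_neg_one]
    have h2 : ‖infF κ q β 0 y⁻¹‖⁻¹ ≤ 2 := by
      rw [inv_le_comm₀ (by linarith [hF.1]) two_pos]; linarith [hF.1]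
    have h3 := (norm_sub_le ((y : ℂ) ^ pa q β * g y - 1) (infF κ q β 0 y⁻¹ - 1)).trans
      (add_le_add (hD y (by linarith)) hF.2.1)
    calc _ ≤ (D * y⁻¹ + C * y⁻¹) * 2 :=
          mul_le_mul h3 h2 (by positivity) ((norm_nonneg _).trans h3)
      _ = _ := by ring
  have hv : v = 0 := coeff_eq_zero hκ hβ hp hw hβ key
  have hu : u - 1 = 0 := by
    have h2 : Tendsto (fun y : ℝ => (D + C) * 2 * y ^ (-1 : ℝ)) atTop (𝓝 ((D + C) * 2 * 0)) :=
      (tendsto_rpow_of_neg (by norm_num)).const_mul _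
    rw [mul_zero] at h2
    rw [← norm_le_zero_iff]
    refine ge_of_tendsto h2 ?_
    filter_upwards [eventually_ge_atTop Y] with y hy
    simpa [hv] using key y hy
  intro y hy
  rw [h1 y hy, hv, sub_eq_zero.1 hu]
  ring

/-- The order of decay of the error of the dominant solution. -/
noncomputable def decayPlus (β : ℂ) : ℝ := if β = 0 ∨ β = 1 then 1 / 2 else 1

theorem decayPlus_pos (β : ℂ) : 0 < decayPlus β := by
  unfold decayPlus
  split_ifs <;> norm_num

theorem re_lt_decayPlus (hβ : β ∈ strip) : β.re < decayPlus β := by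
  unfold decayPlus
  have := (strip_bounds hβ).2
  split_ifs with h
  · rcases h with h | h
    · rw [h]; norm_num
    · rw [h] at this; norm_num at this
  · exact this

theorem log_one_add_le {y : ℝ} (hy : 1 ≤ y) : Real.log (1 + y) ≤ 4 * y ^ (1 / 2 : ℝ) := by
  have h1 := Real.log_le_rpow_div (x := 1 + y) (ε := 1 / 2) (by linarith) (by norm_num)
  have h2 : (1 + y) ^ (1 / 2 : ℝ) ≤ (4 * y) ^ (1 / 2 : ℝ) :=
    Real.rpow_le_rpow (by linarith) (by linarith) (by norm_num)
  have h3 : (4 : ℝ) ^ (1 / 2 : ℝ) = 2 := by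
    rw [← Real.sqrt_eq_rpow, show (4 : ℝ) = 2 ^ 2 by norm_num]
    exact Real.sqrt_sq (by norm_num)
  rw [Real.mul_rpow (by norm_num) (by linarith), h3] at h2
  linarith

theorem lead_mul_err_le (β : ℂ) {y : ℝ} (hy : 1 ≤ y) :
    ‖leadPlus β y‖ * errPlus β y ≤ 4 * y ^ (-decayPlus β) := by
  have hy0 : 0 < y := by linarith
  have h1 := log_one_add_le hy
  have h2 : y⁻¹ * (4 * y ^ (1 / 2 : ℝ)) = 4 * y ^ (-(1 / 2) : ℝ) := by
    rw [← Real.rpow_neg_one, mul_left_comm, ← Real.rpow_add hy0]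
    norm_num
  have hl := log_one_add_pos hy0
  have h3 : y⁻¹ * Real.log (1 + y) ≤ 4 * y ^ (-(1 / 2) : ℝ) := by
    rw [← h2]; gcongr
  unfold leadPlus errPlus decayPlus
  by_cases h0 : β = 0
  · rw [if_pos h0, if_neg (by rw [h0]; norm_num), if_pos (Or.inl h0), Complex.norm_real,
      Real.norm_of_nonneg hl.le]
    linarith
  · rw [if_neg h0, norm_one, one_mul]
    by_cases h1 : β = 1
    · rw [if_pos h1, if_pos (Or.inr h1)]; exact h3
    · rw [if_neg h1, if_neg (by tauto), Real.rpow_neg_one, mul_one]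
      have := inv_pos.2 hy0
      linarith

theorem cpow_pa_eq {y : ℝ} (hy : 0 < y) :
    (y : ℂ) ^ pa q β = (y : ℂ) ^ pa q (-β) * (y : ℂ) ^ β := by
  rw [← Complex.cpow_add _ _ (by exact_mod_cast hy.ne')]
  congr 1
  simp only [pa]
  ring

/-- Two dominant normalisations differ, relative to `infSol`, by O(y^(Re β − `decayPlus β`)). This
is below y^(Re β), which fixes the dominant coefficient; it tends to 0 when β lies in the strip,
which then also removes the recessive part. -/
theorem eq_add_infSol_of_asyPlus (hκ : 0 ≤ κ) (hβ : -1 < β.re) (hp : IsRed κ q (sepConst q β) p)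
    (hw : wr κ q (infSol κ q β) p 1 ≠ 0) (hpa : AsyPlus q β p) (hg : IsRed κ q (sepConst q β) g)
    (hga : AsyPlus q β g) :
    ∃ c : ℂ, (∀ y, 0 < y → g y = p y + c * infSol κ q β y) ∧ (β ∈ strip → c = 0) := by
  have h1 := hg.exists_eq_linComb hκ (infSol_isRed hκ hβ) hp hw
  set u := wr κ q g p 1 / wr κ q (infSol κ q β) p 1
  set v := -(wr κ q g (infSol κ q β) 1 / wr κ q (infSol κ q β) p 1)
  obtain ⟨Y, C, hY, hC, hb⟩ := exists_infSol_bounds hκ q hβ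
  obtain ⟨D, hD⟩ := hga
  obtain ⟨D', hD'⟩ := hpa
  have key : ∀ y, Y ≤ y → ‖u + (v - 1) * (p y / infSol κ q β y)‖
      ≤ 2 * (|D| + |D'|) * 4 * y ^ (β.re - decayPlus β) := by
    intro y hy
    have hy0 : 0 < y := by linarith
    have hF := hb y hy
    have hs := infSol_ne_zero_of hy0 hF.1
    have hl := leadPlus_ne_zero β hy0
    have hn := cpow_ne_zero_of_pos hy0 (pa q β)
    have hn' := cpow_ne_zero_of_pos hy0 (pa q (-β))
    have e : u + (v - 1) * (p y / infSol κ q β y)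
        = (((y : ℂ) ^ pa q (-β) * g y / leadPlus β y - 1) -
            ((y : ℂ) ^ pa q (-β) * p y / leadPlus β y - 1)) * leadPlus β y * (y : ℂ) ^ β
          * (infF κ q β 0 y⁻¹)⁻¹ := by
      rw [← cpow_mul_infSol hy0, h1 y hy0, cpow_pa_eq (β := β) hy0]
      have := cpow_ne_zero_of_pos hy0 β
      generalize (y : ℂ) ^ pa q (-β) = P at hn' ⊢
      generalize (y : ℂ) ^ β = R at this ⊢
      field_simp
      ring
    rw [e, norm_mul, norm_inv, norm_mul, norm_mul, Complex.norm_cpow_eq_rpow_re_of_pos hy0]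
    have h2 : ‖infF κ q β 0 y⁻¹‖⁻¹ ≤ 2 := by
      rw [inv_le_comm₀ (by linarith [hF.1]) two_pos]; linarith [hF.1]
    have herr := (errPlus_pos β hy0).le
    have h3 := (norm_sub_le ((y : ℂ) ^ pa q (-β) * g y / leadPlus β y - 1)
        ((y : ℂ) ^ pa q (-β) * p y / leadPlus β y - 1)).trans
      (add_le_add ((hD y (by linarith)).trans (mul_le_mul_of_nonneg_right (le_abs_self D) herr))
        ((hD' y (by linarith)).trans (mul_le_mul_of_nonneg_right (le_abs_self D') herr)))
    have h4 := lead_mul_err_le β (show 1 ≤ y by linarith)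
    have e3 : y ^ (β.re - decayPlus β) = y ^ (-decayPlus β) * y ^ β.re := by
      rw [← Real.rpow_add hy0]; congr 1; ring
    rw [e3]
    calc _ ≤ (|D| * errPlus β y + |D'| * errPlus β y) * ‖leadPlus β y‖ * y ^ β.re * 2 := by
          gcongr
      _ = 2 * (|D| + |D'|) * (‖leadPlus β y‖ * errPlus β y) * y ^ β.re := by ring
      _ ≤ 2 * (|D| + |D'|) * (4 * y ^ (-decayPlus β)) * y ^ β.re := by gcongr
      _ = _ := by ring
  have hv : v - 1 = 0 := coeff_eq_zero hκ hβ hp hw (by linarith [decayPlus_pos β]) key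
  refine ⟨u, fun y hy => ?_, fun hs => ?_⟩
  · rw [h1 y hy, sub_eq_zero.1 hv]
    ring
  · have h2 : Tendsto (fun y : ℝ => 2 * (|D| + |D'|) * 4 * y ^ (β.re - decayPlus β)) atTop
        (𝓝 (2 * (|D| + |D'|) * 4 * 0)) :=
      (tendsto_rpow_of_neg (by linarith [re_lt_decayPlus hs])).const_mul _
    rw [mul_zero] at h2
    rw [← norm_le_zero_iff]
    refine ge_of_tendsto h2 ?_
    filter_upwards [eventually_ge_atTop Y] with y hy
    simpa [hv] using key y hy

/-- The coefficients with respect to a basis of solutions are unique. -/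
theorem coeff_unique (hf : IsRed κ q lam φ) (hp : IsRed κ q lam p)
    (hw : wr κ q φ p 1 ≠ 0) {a b a' b' : ℂ}
    (h : ∀ y : ℝ, 0 < y → a * p y + b * φ y = a' * p y + b' * φ y) : a = a' ∧ b = b' := by
  have hw' : wr κ q p φ 1 ≠ 0 := by rw [wr_swap]; exact neg_ne_zero.2 hw
  have e := fun h' : ℝ → ℂ => wr_linComb_left (κ := κ) (q := q) hp hf (a - a') (b - b') h' one_pos
  have z : ∀ h' : ℝ → ℂ, wr κ q (fun y => (a - a') * p y + (b - b') * φ y) h' 1 = 0 := by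
    intro h'
    have : EqOn (fun y => (a - a') * p y + (b - b') * φ y) (fun _ => 0) (Ioi 0) := fun y hy => by
      have := h y hy
      simp only
      linear_combination this
    rw [wr_congr this (fun _ _ => rfl) one_pos]
    simp [wr]
  have e1 := e φ
  have e2 := e p
  rw [z, wr_self, mul_zero, add_zero, eq_comm, mul_eq_zero] at e1
  rw [z, wr_self, mul_zero, zero_add, eq_comm, mul_eq_zero] at e2
  exact ⟨sub_eq_zero.1 (e1.resolve_right hw'), sub_eq_zero.1 (e2.resolve_right hw)⟩

end RNStat

namespace RNStat
open MeasureTheory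

variable {κ q : ℝ} {β : ℂ} {lam : ℂ} {φ g p : ℝ → ℂ}

/-! ### The dominant solution and the connection coefficients -/

/-- The remainder has derivative O(y^(Re β − 2)), integrable at infinity as Re β < 1. Constants
independent of β are needed for the passage to β = 0. -/
theorem exists_remainder_limit (hκ : 0 ≤ κ) (q : ℝ) {β₀ : ℂ} (hβ₀ : β₀ ∈ strip) :
    ∃ Y C : ℝ, 1 ≤ Y ∧ 0 ≤ C ∧ ∀ᶠ β in 𝓝 β₀, ∀ φ, IsRed κ q (sepConst q β) φ →
      ∃ c : ℂ, ∀ y, Y ≤ y → ‖remainder κ q β φ y - c‖ ≤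
        ‖wr κ q (infSol κ q β) φ 1‖ * C / (1 - β.re) * y ^ (-(1 - β.re)) := by
  obtain ⟨Y, C, hY, hC, h⟩ := exists_inv_weight_bound hκ q (strip_bounds hβ₀).1
  refine ⟨Y, C, hY, hC, ?_⟩
  filter_upwards [h, isOpen_strip.mem_nhds hβ₀] with β hβ hs φ hφ
  refine exists_limit_of_norm_deriv_le (by linarith) (by linarith [(strip_bounds hs).2])
    (fun t ht => hasDerivAt_remainder hκ hβ.1 hφ (by linarith)
      (infSol_ne_zero_of (by linarith) (hβ.2 t ht).1)) fun t ht => ?_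
  rw [norm_mul, mul_assoc]
  refine mul_le_mul_of_nonneg_left ((hβ.2 t ht).2.trans (le_of_eq ?_)) (norm_nonneg _)
  congr 2
  ring

/-- The limit of the remainder of the solution regular at the horizon. -/
noncomputable def remLimit (κ q : ℝ) (β : ℂ) : ℂ :=
  limUnder atTop (remainder κ q β (hor κ q β))

theorem exists_remLimit_rate (hκ : 0 ≤ κ) (hq : q ≠ 0) {β₀ : ℂ} (hβ₀ : β₀ ∈ strip) :
    ∃ Y C : ℝ, 1 ≤ Y ∧ 0 ≤ C ∧ ∀ᶠ β in 𝓝 β₀, β ∈ strip ∧ ∀ y, Y ≤ y →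
      ‖remainder κ q β (hor κ q β) y - remLimit κ q β‖ ≤
        ‖conn κ q β‖ * C / (1 - β.re) * y ^ (-(1 - β.re)) := by
  obtain ⟨Y, C, hY, hC, h⟩ := exists_remainder_limit hκ q hβ₀
  refine ⟨Y, C, hY, hC, ?_⟩
  filter_upwards [h, isOpen_strip.mem_nhds hβ₀] with β hβ hs
  refine ⟨hs, ?_⟩
  obtain ⟨c, hc⟩ := hβ _ (hor_isRed hκ hq (horRange_of_strip hs))
  have h1 : Tendsto (remainder κ q β (hor κ q β)) atTop (𝓝 c) := by
    rw [tendsto_iff_norm_sub_tendsto_zero]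
    have h2 : Tendsto (fun y : ℝ => ‖wr κ q (infSol κ q β) (hor κ q β) 1‖ * C / (1 - β.re) *
        y ^ (-(1 - β.re))) atTop (𝓝 (‖wr κ q (infSol κ q β) (hor κ q β) 1‖ * C / (1 - β.re) * 0)) :=
      (tendsto_rpow_of_neg (by linarith [(strip_bounds hs).2])).const_mul _
    rw [mul_zero] at h2
    refine tendsto_of_tendsto_of_tendsto_of_le_of_le' tendsto_const_nhds h2
      (Eventually.of_forall fun _ => norm_nonneg _) ?_
    filter_upwards [eventually_ge_atTop Y] with y hy using hc y hy
  rw [remLimit, h1.limUnder_eq]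
  exact hc

theorem tendsto_remainder (hκ : 0 ≤ κ) (hq : q ≠ 0) (hβ : β ∈ strip) :
    Tendsto (remainder κ q β (hor κ q β)) atTop (𝓝 (remLimit κ q β)) := by
  obtain ⟨Y, C, -, -, h⟩ := exists_remLimit_rate hκ hq hβ
  obtain ⟨-, h⟩ := h.self_of_nhds
  rw [tendsto_iff_norm_sub_tendsto_zero]
  have h2 : Tendsto (fun y : ℝ => ‖conn κ q β‖ * C / (1 - β.re) *
      y ^ (-(1 - β.re))) atTop (𝓝 (‖conn κ q β‖ * C / (1 - β.re) * 0)) :=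
    (tendsto_rpow_of_neg (by linarith [(strip_bounds hβ).2])).const_mul _
  rw [mul_zero] at h2
  refine tendsto_of_tendsto_of_tendsto_of_le_of_le' tendsto_const_nhds h2
    (Eventually.of_forall fun _ => norm_nonneg _) ?_
  filter_upwards [eventually_ge_atTop Y] with y hy using h y hy

/-- The coefficient of the dominant solution. -/
noncomputable def coefPlus (κ q : ℝ) (β : ℂ) : ℂ :=
  if β = 0 then conn κ q 0 else conn κ q β / β

/-- The coefficient of the recessive solution. -/
noncomputable def coefMinus (κ q : ℝ) (β : ℂ) : ℂ :=
  if β = 0 then remLimit κ q 0 else conn κ q (-β) / -β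

/-- The dominant solution. -/
noncomputable def plusSol (κ q : ℝ) (β : ℂ) : ℝ → ℂ :=
  if β = 0 then fun y => (conn κ q 0)⁻¹ * hor κ q 0 y
    + -((conn κ q 0)⁻¹ * remLimit κ q 0) * infSol κ q 0 y
  else infSol κ q (-β)

theorem coefPlus_ne_zero (hκ : 0 ≤ κ) (hq : q ≠ 0) (hβ : β ∈ strip) : coefPlus κ q β ≠ 0 := by
  unfold coefPlus
  split_ifs with h
  · exact conn_ne_zero hκ hq zero_mem_strip
  · exact div_ne_zero (conn_ne_zero hκ hq hβ) h

theorem coefMinus_eq (h : β ≠ 0) : coefMinus κ q β = coefPlus κ q (-β) := by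
  rw [coefMinus, coefPlus, if_neg h, if_neg (neg_ne_zero.2 h)]

theorem hor_zero_isRed (hκ : 0 ≤ κ) (hq : q ≠ 0) : IsRed κ q (sepConst q 0) (hor κ q 0) :=
  hor_isRed hκ hq (horRange_of_strip zero_mem_strip)

theorem infSol_zero_isRed (hκ : 0 ≤ κ) : IsRed κ q (sepConst q 0) (infSol κ q 0) :=
  infSol_isRed hκ (strip_bounds zero_mem_strip).1

theorem plusSol_isRed (hκ : 0 ≤ κ) (hq : q ≠ 0) (hβ : β ∈ strip) :
    IsRed κ q (sepConst q β) (plusSol κ q β) := by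
  unfold plusSol
  split_ifs with h
  · rw [h]
    exact (hor_zero_isRed hκ hq).linComb (infSol_zero_isRed hκ) _ _
  · exact infSol_isRed_neg hκ hβ

theorem wr_plusSol_ne_zero (hκ : 0 ≤ κ) (hq : q ≠ 0) (hβ : β ∈ strip) :
    wr κ q (infSol κ q β) (plusSol κ q β) 1 ≠ 0 := by
  unfold plusSol
  split_ifs with h
  · rw [wr_swap, h, wr_linComb_left (hor_zero_isRed hκ hq) (infSol_zero_isRed hκ) _ _ _ one_pos,
      wr_self, wr_swap (infSol κ q 0), ← conn]
    have := conn_ne_zero hκ hq zero_mem_strip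
    simpa using this
  · rw [wr_infSol_neg hκ hβ one_pos]
    exact h

/-- The equation depends on β only through β², and the regular solution is determined by its value
at the horizon. -/
theorem hor_neg (hκ : 0 ≤ κ) (hq : q ≠ 0) (hβ : β ∈ strip) :
    EqOn (hor κ q (-β)) (hor κ q β) (Ici 0) := by
  have hn := neg_mem_strip hβ
  have h1 := hor_isRed hκ hq (horRange_of_strip hn)
  rw [sepConst_neg] at h1
  have hw : wr κ q (hor κ q β) (infSol κ q β) 1 ≠ 0 := by
    rw [wr_swap]
    exact neg_ne_zero.2 (conn_ne_zero hκ hq hβ)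
  have hr := hor_zero (κ := κ) (q := q) (horRange_of_strip hβ)
  exact h1.eqOn_of_regular hκ (hor_isRed hκ hq (horRange_of_strip hβ))
    (infSol_isRed hκ (strip_bounds hβ).1) (hor_smooth hκ (horRange_of_strip hn))
    (hor_smooth hκ (horRange_of_strip hβ)) hw (by rw [hr, hor_zero (horRange_of_strip hn)])
    (by rw [hr]; exact one_ne_zero)

theorem hor_eq (hκ : 0 ≤ κ) (hq : q ≠ 0) (hβ : β ∈ strip) {y : ℝ} (hy : 0 < y) :
    hor κ q β y = coefPlus κ q β * plusSol κ q β y + coefMinus κ q β * infSol κ q β y := by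
  unfold coefPlus coefMinus plusSol
  split_ifs with h
  · have := conn_ne_zero hκ hq zero_mem_strip
    rw [h]
    field_simp
    ring
  · rw [hor_eq_linComb hκ hq hβ h y hy]
    -- Evenness of `hor` turns the coefficient of `infSol κ q β` into the connection coefficient at
    -- −β.
    have e : wr κ q (hor κ q β) (infSol κ q (-β)) 1 = -conn κ q (-β) := by
      rw [wr_swap, conn, wr_congr (f := infSol κ q (-β)) (fun _ _ => rfl)
        ((hor_neg hκ hq hβ).mono Ioi_subset_Ici_self) one_pos]
    rw [e]
    field_simp
    ring

theorem one_le_log_one_add {y : ℝ} (hy : 2 ≤ y) : 1 ≤ Real.log (1 + y) := by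
  rw [Real.le_log_iff_exp_le (by linarith)]
  linarith [Real.exp_one_lt_d9]

theorem asyPlus_plusSol (hκ : 0 ≤ κ) (hq : q ≠ 0) (hβ : β ∈ strip) :
    AsyPlus q β (plusSol κ q β) := by
  by_cases h : β = 0
  · subst h
    obtain ⟨Y₁, C₁, hY₁, hC₁, h₁⟩ := exists_infSol_bounds hκ q (strip_bounds hβ).1
    obtain ⟨Y₂, C₂, -, hC₂, h₂⟩ := exists_remLimit_rate hκ hq hβ
    obtain ⟨-, h₂⟩ := h₂.self_of_nhds
    have hL := conn_ne_zero hκ hq hβ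
    refine asyPlus_of_eventually (plusSol_isRed hκ hq hβ) (Y := max Y₁ Y₂)
      (K := C₁ + (1 + C₁) * C₂ + 1) fun y hy => ?_
    have hy1 : Y₁ ≤ y := (le_max_left _ _).trans hy
    have hy2 : Y₂ ≤ y := (le_max_right _ _).trans hy
    have hy0 : 0 < y := by linarith
    obtain ⟨hF0, hF, -⟩ := h₁ y hy1
    have hR := h₂ y hy2
    have hl1 := one_le_log_one_add (show 2 ≤ y by linarith)
    have hs := infSol_ne_zero_of hy0 hF0
    set F := infF κ q 0 0 y⁻¹ with hFd
    set ρ := (conn κ q 0)⁻¹ * (remainder κ q 0 (hor κ q 0) y - remLimit κ q 0) with hρ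
    have hρb : ‖ρ‖ ≤ C₂ * y⁻¹ := by
      have hL' := norm_pos_iff.2 hL
      rw [hρ, norm_mul, norm_inv, inv_mul_le_iff₀ hL']
      refine hR.trans (le_of_eq ?_)
      simp only [Complex.zero_re, sub_zero, Real.rpow_neg_one]
      ring
    -- Subtracting the limit of the remainder leaves log y plus a decaying error; a leftover
    -- constant would spoil the relative error O(1/y).
    have e : (y : ℂ) ^ pa q (-0) * plusSol κ q 0 y = F * (Real.log y + ρ) := by
      rw [hFd, ← cpow_mul_infSol hy0, neg_zero, plusSol, if_pos rfl, hρ, remainder, powPrim,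
        if_pos rfl, ← conn]
      field_simp
      ring
    have hlc : ((Real.log (1 + y) : ℝ) : ℂ) ≠ 0 := by
      exact_mod_cast (by linarith : Real.log (1 + y) ≠ 0)
    rw [e, leadPlus, if_pos rfl, errPlus, if_neg (by norm_num), mul_one]
    have e2 : F * (Real.log y + ρ) / (Real.log (1 + y) : ℝ) - 1
        = ((F - 1) * (Real.log y : ℝ) + F * ρ - ((Real.log (1 + y) - Real.log y : ℝ) : ℂ)) /
          (Real.log (1 + y) : ℝ) := by
      push_cast
      field_simp
      ring
    have hly : 0 ≤ Real.log y := Real.log_nonneg (by linarith)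
    have hlm : Real.log y ≤ Real.log (1 + y) := Real.log_le_log hy0 (by linarith)
    have hld : Real.log (1 + y) - Real.log y ≤ y⁻¹ := by
      rw [← Real.log_div (by linarith) hy0.ne']
      have := Real.log_le_sub_one_of_pos (show 0 < (1 + y) / y by positivity)
      have e3 : (1 + y) / y - 1 = y⁻¹ := by field_simp; ring
      linarith
    have hF1 : ‖F‖ ≤ 1 + C₁ := by
      have := norm_add_le (1 : ℂ) (F - 1)
      rw [add_sub_cancel, norm_one] at this
      have : C₁ * y⁻¹ ≤ C₁ * 1 :=
        mul_le_mul_of_nonneg_left (inv_le_one_of_one_le₀ (by linarith)) hC₁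
      linarith
    rw [e2, norm_div, Complex.norm_real, Real.norm_of_nonneg (by linarith : 0 ≤ Real.log (1 + y)),
      div_le_iff₀ (by linarith)]
    refine (norm_sub_le _ _).trans ((add_le_add_left (norm_add_le _ _) _).trans ?_)
    rw [norm_mul, norm_mul, Complex.norm_real, Complex.norm_real, Real.norm_of_nonneg hly,
      Real.norm_of_nonneg (by linarith : 0 ≤ Real.log (1 + y) - Real.log y)]
    have hyi := inv_pos.2 hy0
    calc _ ≤ C₁ * y⁻¹ * Real.log (1 + y) + (1 + C₁) * (C₂ * y⁻¹) * 1 + y⁻¹ * 1 := by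
          rw [mul_one, mul_one]
          gcongr
      _ ≤ C₁ * y⁻¹ * Real.log (1 + y) + (1 + C₁) * (C₂ * y⁻¹) * Real.log (1 + y)
          + y⁻¹ * Real.log (1 + y) := by gcongr
      _ = _ := by ring
  · have h1 : β ≠ 1 := by
      rintro rfl
      have := (strip_bounds hβ).2
      norm_num at this
    have := asyMinus_infSol (q := q) hκ (strip_bounds (neg_mem_strip hβ)).1
    rw [plusSol, if_neg h]
    unfold AsyPlus
    unfold AsyMinus at this
    convert this using 2 with y y
    · rw [errPlus, if_neg h1, mul_one]
    · rw [leadPlus, if_neg h, div_one]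

/-! ### The limit `β → 0` -/

/-- The quotient of the connection coefficients. -/
noncomputable def connRatio (κ q : ℝ) (β : ℂ) : ℂ := -conn κ q (-β) / conn κ q β

theorem connRatio_zero (hκ : 0 ≤ κ) (hq : q ≠ 0) : connRatio κ q 0 = -1 := by
  rw [connRatio, neg_zero, neg_div, div_self (conn_ne_zero hκ hq zero_mem_strip)]

theorem coefMinus_div_coefPlus (h : β ≠ 0) :
    coefMinus κ q β / coefPlus κ q β = connRatio κ q β := by
  rw [coefMinus, coefPlus, if_neg h, if_neg h, connRatio]
  field_simp

theorem differentiableAt_connRatio (hκ : 0 ≤ κ) (hq : q ≠ 0) (hβ : β ∈ strip) :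
    DifferentiableAt ℂ (connRatio κ q) β := by
  have h1 : DifferentiableAt ℂ (fun b => conn κ q (-b)) β :=
    DifferentiableAt.comp (f := fun b : ℂ => -b) (g := conn κ q) β
      (differentiableAt_conn hκ (neg_mem_strip hβ)) differentiableAt_id.neg
  exact h1.neg.div (differentiableAt_conn hκ hβ) (conn_ne_zero hκ hq hβ)

/-- (y^β − 1)/β is the difference quotient of β ↦ y^β at 0, whose derivative is log y. -/
theorem continuousAt_powPrim {y : ℝ} (hy : 0 < y) : ContinuousAt (fun β => powPrim β y) 0 := by
  have hyc : (y : ℂ) ≠ 0 := by exact_mod_cast hy.ne'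
  have h : HasDerivAt (fun β : ℂ => (y : ℂ) ^ β) (Real.log y) 0 := by
    have := (hasDerivAt_id (0 : ℂ)).const_cpow (c := (y : ℂ)) (Or.inl hyc)
    simpa [Complex.ofReal_log hy.le] using this
  rw [hasDerivAt_iff_tendsto_slope] at h
  rw [continuousAt_iff_punctured_nhds]
  have e : powPrim 0 y = Real.log y := by rw [powPrim, if_pos rfl]
  rw [e]
  refine h.congr' ?_
  filter_upwards [self_mem_nhdsWithin] with b hb
  rw [powPrim, if_neg (show b ≠ 0 from hb), slope_def_field, Complex.cpow_zero, sub_zero]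

/-- Near β = 0 the limit is uniformly approximated by the remainder at a fixed large y, which is
continuous in β. -/
theorem tendsto_remLimit (hκ : 0 ≤ κ) (hq : q ≠ 0) : ContinuousAt (remLimit κ q) 0 := by
  obtain ⟨Y₁, C₁, hY₁, hC₁, h₁⟩ := exists_infSol_bounds hκ q (strip_bounds zero_mem_strip).1
  obtain ⟨Y₂, C₂, -, hC₂, h₂⟩ := exists_remLimit_rate hκ hq zero_mem_strip
  set M : ℝ := (‖conn κ q 0‖ + 1) * C₂ * 2 with hM
  have hM0 : 0 ≤ M := by positivity
  -- Keeping Re β < 1/2 bounds 1/(1 − Re β) by 2 and the decay by y^(−1/2).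
  have hre : ∀ᶠ β : ℂ in 𝓝 0, β.re < 1 / 2 :=
    (Complex.continuous_re.tendsto 0).eventually (gt_mem_nhds (by simp))
  have hcn : ∀ᶠ β : ℂ in 𝓝 0, ‖conn κ q β‖ < ‖conn κ q 0‖ + 1 :=
    ((differentiableAt_conn hκ zero_mem_strip).continuousAt.norm).eventually
      (gt_mem_nhds (by linarith))
  refine continuousAt_of_locally_uniform_approx_of_continuousAt fun u hu => ?_
  obtain ⟨ε, hε, hεu⟩ := Metric.mem_uniformity_dist.1 hu
  have hlim : Tendsto (fun y : ℝ => M * y ^ (-(1 / 2) : ℝ)) atTop (𝓝 (M * 0)) :=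
    (tendsto_rpow_of_neg (by norm_num)).const_mul _
  rw [mul_zero] at hlim
  obtain ⟨y, hyε, hyY₁, hyY₂, hy1⟩ := ((hlim.eventually (gt_mem_nhds hε)).and
    ((eventually_ge_atTop Y₁).and ((eventually_ge_atTop Y₂).and (eventually_ge_atTop 1)))).exists
  have hy0 : 0 < y := by linarith
  refine ⟨_, h₂.and (hre.and hcn), fun β => remainder κ q β (hor κ q β) y, ?_, ?_⟩
  · have hs := infSol_ne_zero_of hy0 (h₁ y hyY₁).1
    exact (((differentiableAt_hor hκ hy0.le zero_mem_strip).continuousAt).div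
      (differentiableAt_infSol hκ hy0 zero_mem_strip).continuousAt hs).sub
      ((differentiableAt_conn hκ zero_mem_strip).continuousAt.mul (continuousAt_powPrim hy0))
  · rintro β ⟨⟨hs, hβ⟩, hb, hc⟩
    refine hεu ?_
    rw [dist_comm, dist_eq_norm]
    refine ((hβ y hyY₂).trans ?_).trans_lt hyε
    have hp : 0 < 1 - β.re := by linarith
    have h3 : ‖conn κ q β‖ * C₂ / (1 - β.re) ≤ M := by
      rw [div_le_iff₀ hp]
      have : ‖conn κ q β‖ * C₂ ≤ (‖conn κ q 0‖ + 1) * C₂ := by gcongr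
      have h4 : 0 ≤ (‖conn κ q 0‖ + 1) * C₂ := by positivity
      rw [hM]
      nlinarith
    have h5 : y ^ (-(1 - β.re)) ≤ y ^ (-(1 / 2) : ℝ) :=
      Real.rpow_le_rpow_of_exponent_le hy1 (by linarith)
    exact mul_le_mul h3 h5 (Real.rpow_nonneg hy0.le _) hM0

/-- Since conn(β) = α₊β, subtracting conn(β)(y^β − 1)/β from α₊y^β + α₋ leaves α₊ + α₋. The relative
O(1/y) corrections, multiplied by y^β, still decay because Re β < 1. -/
theorem remLimit_eq_of_ne_zero (hκ : 0 ≤ κ) (hq : q ≠ 0) (hβ : β ∈ strip) (h : β ≠ 0) :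
    remLimit κ q β = coefMinus κ q β + coefPlus κ q β := by
  obtain ⟨Y₁, C₁, hY₁, hC₁, h₁⟩ := exists_infSol_bounds hκ q (strip_bounds hβ).1
  obtain ⟨Y₂, C₂, hY₂, hC₂, h₂⟩ := exists_infSol_bounds hκ q (strip_bounds (neg_mem_strip hβ)).1
  refine tendsto_nhds_unique (tendsto_remainder hκ hq hβ) ?_
  rw [tendsto_iff_norm_sub_tendsto_zero]
  have hlim : Tendsto (fun y : ℝ => ‖coefPlus κ q β‖ * ((C₂ + C₁) * 2) * y ^ (β.re - 1)) atTop
      (𝓝 (‖coefPlus κ q β‖ * ((C₂ + C₁) * 2) * 0)) :=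
    (tendsto_rpow_of_neg (by linarith [(strip_bounds hβ).2])).const_mul _
  rw [mul_zero] at hlim
  refine tendsto_of_tendsto_of_tendsto_of_le_of_le' tendsto_const_nhds hlim
    (Eventually.of_forall fun _ => norm_nonneg _) ?_
  filter_upwards [eventually_ge_atTop Y₁, eventually_ge_atTop Y₂] with y hy1 hy2
  have hy0 : 0 < y := by linarith
  obtain ⟨hF0, hF, -⟩ := h₁ y hy1
  obtain ⟨-, hG, -⟩ := h₂ y hy2
  have hs := infSol_ne_zero_of hy0 hF0
  have hFn : infF κ q β 0 y⁻¹ ≠ 0 := norm_pos_iff.1 (by linarith)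
  have n1 := cpow_ne_zero_of_pos hy0 (pa q (-β))
  have n2 := cpow_ne_zero_of_pos hy0 β
  have e : remainder κ q β (hor κ q β) y - (coefMinus κ q β + coefPlus κ q β)
      = coefPlus κ q β * (((infF κ q (-β) 0 y⁻¹ - 1) - (infF κ q β 0 y⁻¹ - 1)) *
        (infF κ q β 0 y⁻¹)⁻¹) * (y : ℂ) ^ β := by
    have e1 : conn κ q β = coefPlus κ q β * β := by
      rw [coefPlus, if_neg h]; field_simp
    have e2 : plusSol κ q β y = (y : ℂ) ^ β * infF κ q (-β) 0 y⁻¹ / infF κ q β 0 y⁻¹ *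
        infSol κ q β y := by
      rw [plusSol, if_neg h, ← cpow_mul_infSol (β := -β) hy0, ← cpow_mul_infSol (β := β) hy0,
        cpow_pa_eq (β := β) hy0]
      field_simp
    rw [remainder, ← conn, hor_eq hκ hq hβ hy0, powPrim, if_neg h, e1, e2]
    generalize infF κ q β 0 y⁻¹ = F at hFn ⊢
    generalize infSol κ q β y = S at hs ⊢
    field_simp
    ring
  rw [e, norm_mul, norm_mul, norm_mul, Complex.norm_cpow_eq_rpow_re_of_pos hy0, norm_inv]
  have h2 : ‖infF κ q β 0 y⁻¹‖⁻¹ ≤ 2 := by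
    rw [inv_le_comm₀ (by linarith) two_pos]; linarith
  have h3 := (norm_sub_le (infF κ q (-β) 0 y⁻¹ - 1) (infF κ q β 0 y⁻¹ - 1)).trans
    (add_le_add hG hF)
  calc _ ≤ ‖coefPlus κ q β‖ * ((C₂ * y⁻¹ + C₁ * y⁻¹) * 2) * y ^ β.re := by gcongr
    _ = ‖coefPlus κ q β‖ * ((C₂ + C₁) * 2) * (y ^ β.re / y) := by ring
    _ = _ := by rw [Real.rpow_sub_one hy0.ne']

/-- For β ≠ 0 one has α₊ + α₋ = conn(β)(R(β) + 1)/β, a difference quotient of R = `connRatio` at 0,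
where R(0) = −1. -/
theorem remLimit_zero (hκ : 0 ≤ κ) (hq : q ≠ 0) :
    remLimit κ q 0 = conn κ q 0 * deriv (connRatio κ q) 0 := by
  have h1 : Tendsto (remLimit κ q) (𝓝[≠] 0) (𝓝 (remLimit κ q 0)) :=
    (tendsto_remLimit hκ hq).mono_left nhdsWithin_le_nhds
  have h2 := hasDerivAt_iff_tendsto_slope.1
    (differentiableAt_connRatio hκ hq zero_mem_strip).hasDerivAt
  have h3 : Tendsto (conn κ q) (𝓝[≠] 0) (𝓝 (conn κ q 0)) :=
    ((differentiableAt_conn hκ zero_mem_strip).continuousAt).mono_left nhdsWithin_le_nhds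
  refine tendsto_nhds_unique h1 ((h3.mul h2).congr' ?_)
  filter_upwards [self_mem_nhdsWithin, mem_nhdsWithin_of_mem_nhds
    (isOpen_strip.mem_nhds zero_mem_strip)] with β hβ hs
  have hβ0 : β ≠ 0 := hβ
  rw [remLimit_eq_of_ne_zero hκ hq hs hβ0, slope_def_field, connRatio_zero hκ hq, connRatio,
    coefMinus, coefPlus, if_neg hβ0, if_neg hβ0]
  have := conn_ne_zero hκ hq hs
  field_simp
  ring

end RNStat

namespace RNStat
open MeasureTheory

variable {κ q : ℝ} {β : ℂ} {lam : ℂ} {φ g p : ℝ → ℂ}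

/-! ### Real parameters `β ≥ 1` -/

theorem sepConst_ofReal (q b : ℝ) : sepConst q (b : ℂ) = (((b ^ 2 - 1) / 4 + q ^ 2 : ℝ) : ℂ) := by
  simp [sepConst]

theorem pa_re_ofReal (q b : ℝ) : (pa q (b : ℂ)).re = (1 + b) / 2 := by
  rw [pa_re, Complex.ofReal_re]
  ring

/-- The current of the recessive solution vanishes at infinity. -/
theorem tendsto_infSol_current_bound (hκ : 0 ≤ κ) (q : ℝ) {b : ℝ} (hb : 0 < b) :
    Tendsto (fun y : ℝ => 2 * (y * (y + 2 * κ)) * (‖infSol κ q b y‖ * ‖infSol' κ q b y‖)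
      + 2 * |q| * (1 + y) * ‖infSol κ q b y‖ ^ 2) atTop (𝓝 0) := by
  have hβ : -1 < ((b : ℝ) : ℂ).re := by rw [Complex.ofReal_re]; linarith
  have t0 := (tendsto_infF_inv (q := q) hκ hβ 0)
  have t1 := (tendsto_infF_inv (q := q) hκ hβ 1)
  have ti := tendsto_ofReal_inv_atTop
  have ti' : Tendsto (fun y : ℝ => y⁻¹) atTop (𝓝 0) := tendsto_inv_atTop_zero
  have A := (((ti'.const_mul (2 * κ)).const_add 1).const_mul 2).mul
    (t0.norm.mul ((t0.const_mul (pa q b)).add (ti.mul t1)).norm)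
  have B := ((ti'.add_const 1).const_mul (2 * |q|)).mul (t0.norm.pow 2)
  have D := (tendsto_rpow_of_neg (neg_lt_zero.2 hb)).mul (A.add B)
  rw [zero_mul] at D
  refine D.congr' ?_
  filter_upwards [eventually_gt_atTop 0] with y hy
  have e1 : ‖infSol κ q b y‖ = y ^ (-((1 + b) / 2)) * ‖infF κ q b 0 y⁻¹‖ := by
    rw [infSol, norm_mul, Complex.norm_cpow_eq_rpow_re_of_pos hy, Complex.neg_re, pa_re_ofReal]
  have e2 : ‖infSol' κ q b y‖ = y ^ (-((1 + b) / 2)) * y⁻¹ *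
      ‖pa q b * infF κ q b 0 y⁻¹ + (y : ℂ)⁻¹ * infF κ q b 1 y⁻¹‖ := by
    rw [infSol', norm_neg, norm_mul, Complex.norm_cpow_eq_rpow_re_of_pos hy, Complex.sub_re,
      Complex.neg_re, pa_re_ofReal, Complex.one_re, Real.rpow_sub_one hy.ne', div_eq_mul_inv]
  -- Each term of the current has size y^(−1−b) times y, hence y^(−b), which decays for b > 0.
  have e3 : y ^ (-b) = y ^ (-((1 + b) / 2)) * y ^ (-((1 + b) / 2)) * y := by
    rw [← Real.rpow_add hy, ← Real.rpow_add_one hy.ne']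
    congr 1
    ring
  rw [e1, e2, e3]
  generalize y ^ (-((1 + b) / 2)) = P
  field_simp

/-- The solution which is regular at the horizon is not recessive at infinity. -/
theorem wr_infSol_ne_zero_of_regular (hκ : 0 ≤ κ) (hq : q ≠ 0) {b : ℝ} (hb : 0 < b)
    (hφ : IsRed κ q (sepConst q b) φ) (hφ' : ContDiffOn ℝ ∞ φ (Ici 0)) (hφ0 : φ 0 = 1) :
    wr κ q (infSol κ q b) φ 1 ≠ 0 := by
  intro hw
  have hβ : -1 < ((b : ℝ) : ℂ).re := by rw [Complex.ofReal_re]; linarith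
  obtain ⟨Y, C, hY, hC, h⟩ := exists_infSol_bounds hκ q hβ
  have hs : ∀ y, Y ≤ y → infSol κ q b y ≠ 0 := fun y hy =>
    infSol_ne_zero_of (by linarith) (h y hy).1
  -- With vanishing Wronskian the quotient by the recessive solution has derivative 0.
  obtain ⟨c, hc⟩ : ∃ c : ℂ, ∀ y, Y ≤ y → φ y = c * infSol κ q b y := by
    refine ⟨φ Y / infSol κ q b Y, fun y hy => ?_⟩
    have := norm_sub_le_of_norm_deriv_le (D := fun y => φ y / infSol κ q b y) (D' := fun _ => 0)
      (b := fun _ => 0) (b' := fun _ => 0) hy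
      (fun t ht => (hasDerivAt_quotient hκ hβ hφ (by linarith [ht.1]) (hs t ht.1)).congr_deriv
        (by rw [hw, zero_mul]))
      (fun t _ => hasDerivAt_const t 0) (fun t _ => by simp)
    rw [sub_self, norm_le_zero_iff, sub_eq_zero] at this
    rw [← this, div_mul_cancel₀ _ (hs y hy)]
  have hd : ∀ y, Y ≤ y → deriv φ y = c * infSol' κ q b y := by
    intro y hy
    have hy0 : 0 < y := by linarith
    have h1 : wr κ q (infSol κ q b) φ y = 0 := by
      rw [wr_const hκ (infSol_isRed hκ hβ) hφ hy0 one_pos, hw]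
    rw [wr, (hasDerivAt_infSol hκ hβ hy0).deriv, hc y hy, mul_eq_zero] at h1
    have h2 := h1.resolve_left (weight_ne_zero hκ hy0)
    refine mul_left_cancel₀ (hs y hy) ?_
    linear_combination h2
  -- The left side is the modulus of the current at the horizon, independent of y; the right side
  -- tends to 0.
  have hcur : ∀ y, Y ≤ y → ‖2 * Complex.I * (q : ℂ)‖ ≤ ‖c‖ ^ 2 *
      (2 * (y * (y + 2 * κ)) * (‖infSol κ q b y‖ * ‖infSol' κ q b y‖)
      + 2 * |q| * (1 + y) * ‖infSol κ q b y‖ ^ 2) := by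
    intro y hy
    have hy0 : 0 < y := by linarith
    have h1 := current_eq_of_regular (by rwa [sepConst_ofReal] at hφ) hφ' hy0
    rw [hφ0, star_one, mul_one, mul_one, current, hc y hy, hd y hy] at h1
    rw [← h1]
    refine (norm_add_le _ _).trans ?_
    have n1 : ‖(y : ℂ) * (y + 2 * κ)‖ = y * (y + 2 * κ) := by
      have : (y : ℂ) * (y + 2 * κ) = ((y * (y + 2 * κ) : ℝ) : ℂ) := by push_cast; ring
      rw [this, Complex.norm_real, Real.norm_of_nonneg (by positivity)]
    have n2 : ‖2 * Complex.I * (q : ℂ) * (1 + y)‖ = 2 * |q| * (1 + y) := by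
      have : (1 + (y : ℂ)) = ((1 + y : ℝ) : ℂ) := by push_cast; ring
      rw [this, norm_mul, norm_mul, norm_mul, Complex.norm_real, Complex.norm_real,
        Real.norm_of_nonneg (by positivity : 0 ≤ 1 + y), Complex.norm_I, Complex.norm_ofNat,
        Real.norm_eq_abs]
      ring
    rw [norm_mul, norm_mul _ (c * infSol κ q b y * _), n1, n2, norm_mul (c * _), norm_star,
      norm_mul c]
    have n3 := norm_sub_le (star (c * infSol κ q b y) * (c * infSol' κ q b y))
      (c * infSol κ q b y * star (c * infSol' κ q b y))
    rw [norm_mul (star _), norm_mul (_ * _) (star _), norm_star, norm_star, norm_mul c,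
      norm_mul c] at n3
    have n4 := mul_le_mul_of_nonneg_left n3 (by positivity : 0 ≤ y * (y + 2 * κ))
    linarith
  have hlim := (tendsto_infSol_current_bound hκ q hb).const_mul (‖c‖ ^ 2)
  rw [mul_zero] at hlim
  have := ge_of_tendsto hlim (by filter_upwards [eventually_ge_atTop Y] with y hy using hcur y hy)
  rw [norm_le_zero_iff] at this
  simp [hq] at this

/-- Growth of the remainder for real `β ≥ 1`. -/
theorem exists_remainder_bound (hκ : 0 ≤ κ) {b : ℝ} (hb : 1 ≤ b)
    (hφ : IsRed κ q (sepConst q b) φ) : ∃ Y K : ℝ, 2 ≤ Y ∧ 0 ≤ K ∧ ∀ y, Y ≤ y →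
      y ^ (-b) * ‖remainder κ q b φ y‖ ≤ K * errPlus b y := by
  have hβ : -1 < ((b : ℝ) : ℂ).re := by rw [Complex.ofReal_re]; linarith
  obtain ⟨Y, C, hY, hC, h⟩ := exists_infSol_bounds hκ q hβ
  set M := ‖wr κ q (infSol κ q b) φ 1‖ * C with hM
  have hM0 : 0 ≤ M := by positivity
  have hd : ∀ t, Y ≤ t → HasDerivAt (remainder κ q b φ) (wr κ q (infSol κ q b) φ 1 *
      ((weight κ q t * infSol κ q b t ^ 2)⁻¹ - (t : ℂ) ^ ((b : ℂ) - 1))) t := fun t ht =>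
    hasDerivAt_remainder hκ hβ hφ (by linarith) (infSol_ne_zero_of (by linarith) (h t ht).1)
  have hn : ∀ t, Y ≤ t → ‖wr κ q (infSol κ q b) φ 1 *
      ((weight κ q t * infSol κ q b t ^ 2)⁻¹ - (t : ℂ) ^ ((b : ℂ) - 1))‖ ≤ M * t ^ (b - 2) := by
    intro t ht
    rw [norm_mul, hM, mul_assoc]
    have := (h t ht).2.2
    rw [Complex.ofReal_re] at this
    gcongr
  have hpow : ∀ y : ℝ, 0 < y → y ^ (-b) * y ^ (b - 1) = y⁻¹ := fun y hy => by
    rw [← Real.rpow_add hy, ← Real.rpow_neg_one]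
    congr 1
    ring
  -- The derivative is O(t^(b−2)): its integral is logarithmic for b = 1, the source of the factor
  -- log r in the resonant normalisation, and a power for b > 1.
  rcases eq_or_lt_of_le hb with hb1 | hb1
  · refine ⟨Y, ‖remainder κ q b φ Y‖ + M, hY, by positivity, fun y hy => ?_⟩
    have hy0 : 0 < y := by linarith
    have := norm_sub_le_of_norm_deriv_le (D := remainder κ q b φ) (b := fun t => M * Real.log t)
      (b' := fun t => M * t⁻¹) hy (fun t ht => hd t ht.1)
      (fun t ht => (Real.hasDerivAt_log (by linarith [ht.1])).const_mul M)
      (fun t ht => (hn t ht.1).trans (le_of_eq (by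
        rw [← Real.rpow_neg_one, ← hb1]; norm_num)))
    have hlm : Real.log y ≤ Real.log (1 + y) := Real.log_le_log hy0 (by linarith)
    have hl1 := one_le_log_one_add (show 2 ≤ y by linarith)
    have hlY : 0 ≤ Real.log Y := Real.log_nonneg (by linarith)
    have h2 : ‖remainder κ q b φ y‖ ≤ (‖remainder κ q b φ Y‖ + M) * Real.log (1 + y) := by
      have h3 := norm_sub_norm_le (remainder κ q b φ y) (remainder κ q b φ Y)
      have h4 : M * Real.log y ≤ M * Real.log (1 + y) := by gcongr
      have h5 : 0 ≤ M * Real.log Y := by positivity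
      have h6 : ‖remainder κ q b φ Y‖ * 1 ≤ ‖remainder κ q b φ Y‖ * Real.log (1 + y) := by gcongr
      linarith
    have hp := hpow y hy0
    rw [← hb1, sub_self, Real.rpow_zero, mul_one, ← hb1] at *
    rw [hp, errPlus, if_pos (by norm_num)]
    calc _ ≤ y⁻¹ * ((‖remainder κ q (1 : ℝ) φ Y‖ + M) * Real.log (1 + y)) := by gcongr
      _ = _ := by ring
  · refine ⟨Y, ‖remainder κ q b φ Y‖ + M / (b - 1), hY,
      add_nonneg (norm_nonneg _) (div_nonneg hM0 (by linarith)), fun y hy => ?_⟩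
    have hy0 : 0 < y := by linarith
    have hb2 : b - 1 ≠ 0 := by linarith
    have := norm_sub_le_of_norm_deriv_le (D := remainder κ q b φ)
      (b := fun t => M / (b - 1) * t ^ (b - 1))
      (b' := fun t => M * t ^ (b - 2)) hy (fun t ht => hd t ht.1)
      (fun t ht => ((Real.hasDerivAt_rpow_const (Or.inl (by linarith [ht.1]))).const_mul
        (M / (b - 1))).congr_deriv (by
          rw [show b - 1 - 1 = b - 2 by ring]; field_simp))
      (fun t ht => hn t ht.1)
    have h2 : ‖remainder κ q b φ y‖ ≤ (‖remainder κ q b φ Y‖ + M / (b - 1)) * y ^ (b - 1) := by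
      have h3 := norm_sub_norm_le (remainder κ q b φ y) (remainder κ q b φ Y)
      have h5 : 0 ≤ M / (b - 1) * Y ^ (b - 1) :=
        mul_nonneg (div_nonneg hM0 (by linarith)) (Real.rpow_nonneg (by linarith) _)
      have h6 : ‖remainder κ q b φ Y‖ * 1 ≤ ‖remainder κ q b φ Y‖ * y ^ (b - 1) :=
        mul_le_mul_of_nonneg_left (Real.one_le_rpow (by linarith) (by linarith)) (norm_nonneg _)
      linarith
    rw [errPlus, if_neg (by exact_mod_cast hb1.ne'), mul_one]
    calc _ ≤ y ^ (-b) * ((‖remainder κ q b φ Y‖ + M / (b - 1)) * y ^ (b - 1)) :=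
          mul_le_mul_of_nonneg_left h2 (Real.rpow_nonneg hy0.le _)
      _ = (‖remainder κ q b φ Y‖ + M / (b - 1)) * (y ^ (-b) * y ^ (b - 1)) := by ring
      _ = _ := by rw [hpow y hy0]

/-- With Wronskian b the quotient by `infSol` equals y^b − 1 plus the remainder, so the leading
coefficient is 1. -/
theorem asyPlus_of_wr (hκ : 0 ≤ κ) {b : ℝ} (hb : 1 ≤ b)
    (hφ : IsRed κ q (sepConst q b) φ) (hw : wr κ q (infSol κ q b) φ 1 = b) :
    AsyPlus q b φ := by
  have hβ : -1 < ((b : ℝ) : ℂ).re := by rw [Complex.ofReal_re]; linarith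
  have hb0 : (b : ℂ) ≠ 0 := by
    have : b ≠ 0 := by linarith
    exact_mod_cast this
  obtain ⟨Y₁, C₁, hY₁, hC₁, h₁⟩ := exists_infSol_bounds hκ q hβ
  obtain ⟨Y₂, K, -, hK, h₂⟩ := exists_remainder_bound hκ hb hφ
  refine asyPlus_of_eventually hφ (Y := max Y₁ Y₂) (K := (1 + C₁) * (1 + K) + C₁)
    fun y hy => ?_
  have hy1 : Y₁ ≤ y := (le_max_left _ _).trans hy
  have hy2 : Y₂ ≤ y := (le_max_right _ _).trans hy
  have hy0 : 0 < y := by linarith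
  obtain ⟨hF0, hF, -⟩ := h₁ y hy1
  have hR := h₂ y hy2
  have hs := infSol_ne_zero_of hy0 hF0
  have hy' : y⁻¹ ≤ errPlus b y := by
    unfold errPlus
    have := one_le_log_one_add (show 2 ≤ y by linarith)
    have hyi := (inv_pos.2 hy0).le
    split_ifs
    · exact le_mul_of_one_le_right hyi this
    · rw [mul_one]
  have hF1 : ‖infF κ q b 0 y⁻¹‖ ≤ 1 + C₁ := by
    have := norm_add_le (1 : ℂ) (infF κ q b 0 y⁻¹ - 1)
    rw [add_sub_cancel, norm_one] at this
    have : C₁ * y⁻¹ ≤ C₁ * 1 :=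
      mul_le_mul_of_nonneg_left (inv_le_one_of_one_le₀ (by linarith)) hC₁
    linarith
  have n1 := cpow_ne_zero_of_pos hy0 (pa q (-b))
  have n2 := cpow_ne_zero_of_pos hy0 b
  have e : (y : ℂ) ^ pa q (-b) * φ y / leadPlus b y - 1
      = infF κ q b 0 y⁻¹ * (-((y : ℂ) ^ (-(b : ℂ))) + (y : ℂ) ^ (-(b : ℂ)) * remainder κ q b φ y)
        + (infF κ q b 0 y⁻¹ - 1) := by
    rw [← cpow_mul_infSol hy0, leadPlus, if_neg hb0, remainder, hw, powPrim, if_neg hb0,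
      cpow_pa_eq (β := (b : ℂ)) hy0, Complex.cpow_neg]
    generalize (y : ℂ) ^ pa q (-b) = P at n1 ⊢
    generalize infSol κ q b y = S at hs ⊢
    generalize (y : ℂ) ^ (b : ℂ) = R at n2 ⊢
    field_simp
    ring
  have hyb : ‖(y : ℂ) ^ (-(b : ℂ))‖ = y ^ (-b) := by
    rw [Complex.norm_cpow_eq_rpow_re_of_pos hy0]
    simp
  have hyb' : y ^ (-b) ≤ y⁻¹ := by
    rw [← Real.rpow_neg_one]
    exact Real.rpow_le_rpow_of_exponent_le (by linarith) (by linarith)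
  rw [e]
  refine (norm_add_le _ _).trans ?_
  rw [norm_mul]
  have h3 : ‖-((y : ℂ) ^ (-(b : ℂ))) + (y : ℂ) ^ (-(b : ℂ)) * remainder κ q b φ y‖
      ≤ (1 + K) * errPlus b y := by
    refine (norm_add_le _ _).trans ?_
    rw [norm_neg, norm_mul, hyb]
    linarith
  calc _ ≤ (1 + C₁) * ((1 + K) * errPlus b y) + C₁ * errPlus b y := by
        have : C₁ * y⁻¹ ≤ C₁ * errPlus b y := by gcongr
        refine add_le_add (mul_le_mul hF1 h3 (norm_nonneg _) (by linarith)) (hF.trans this)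
    _ = _ := by ring

theorem IsRed.const_mul (h : IsRed κ q lam φ) (c : ℂ) : IsRed κ q lam fun y => c * φ y := by
  have := h.linComb h c 0
  simpa using this

theorem wr_const_mul_right (h : IsRed κ q lam φ) (c : ℂ) (f : ℝ → ℂ) {y : ℝ} (hy : 0 < y) :
    wr κ q f (fun y => c * φ y) y = c * wr κ q f φ y := by
  rw [wr_swap, ← neg_neg (wr κ q f φ y), ← wr_swap f φ]
  have := wr_linComb_left (κ := κ) (q := q) h h c 0 f hy
  simp only [zero_mul, add_zero] at this
  rw [this]
  ring

/-- The solution theory for real `β ≥ 1`. -/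
theorem exists_solutions_of_one_le (hκ : 0 ≤ κ) (hq : q ≠ 0) {b : ℝ} (hb : 1 ≤ b) :
    ∃ (φ p : ℝ → ℂ) (a : ℂ), IsRed κ q (sepConst q b) φ ∧ ContDiffOn ℝ ∞ φ (Ici 0) ∧ φ 0 = 1 ∧
      wr κ q φ (infSol κ q b) 1 ≠ 0 ∧
      IsRed κ q (sepConst q b) p ∧ AsyPlus q b p ∧ wr κ q (infSol κ q b) p 1 ≠ 0 ∧ a ≠ 0 ∧
      ∀ y, φ y = a * p y := by
  have hβ : -1 < ((b : ℝ) : ℂ).re := by rw [Complex.ofReal_re]; linarith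
  have hb0 : (b : ℂ) ≠ 0 := by
    have : b ≠ 0 := by linarith
    exact_mod_cast this
  obtain ⟨φ, h1, h2, h3⟩ := exists_regular hκ hq hβ
  have hw := wr_infSol_ne_zero_of_regular hκ hq (by linarith) h1 h2 h3
  set L := wr κ q (infSol κ q b) φ 1 with hL
  -- The dominant solution is chosen proportional to the regular one, so the recessive coefficient
  -- will be 0; the factor makes the Wronskian with `infSol` equal to b.
  have hp := h1.const_mul (b / L)
  have hwp : wr κ q (infSol κ q b) (fun y => b / L * φ y) 1 = b := by
    rw [wr_const_mul_right h1 _ _ one_pos, ← hL]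
    field_simp
  refine ⟨φ, fun y => b / L * φ y, L / b, h1, h2, h3, ?_, hp, asyPlus_of_wr hκ hb hp hwp, ?_,
    div_ne_zero hw hb0, fun y => ?_⟩
  · rw [wr_swap]
    exact neg_ne_zero.2 hw
  · rw [hwp]
    exact hb0
  · field_simp

end RNStat

namespace RNStat
open MeasureTheory

variable {B : Background} {β : ℂ} {lam : ℂ} {φ f : ℝ → ℂ}

/-! ### The black hole parameters -/

/-- The normalisation r₊ = 1 gives √(M² − Q²) = 1 − M = κ₊, so κ₊ is the only remaining parameter of
the geometry. -/
theorem params (hB : B.Admissible) (hr : B.rPlus = 1) :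
    0 ≤ B.kappaPlus ∧ B.M = 1 - B.kappaPlus ∧ B.Q ^ 2 = 1 - 2 * B.kappaPlus ∧
      B.rMinus = 1 - 2 * B.kappaPlus := by
  obtain ⟨hM, hQ, -⟩ := hB
  have h0 : 0 ≤ B.M ^ 2 - B.Q ^ 2 := by
    have := sq_le_sq' (by linarith [(abs_le.1 hQ).1]) (abs_le.1 hQ).2
    linarith
  have hs := Real.sq_sqrt h0
  have hs0 := Real.sqrt_nonneg (B.M ^ 2 - B.Q ^ 2)
  have hr' : B.M + Real.sqrt (B.M ^ 2 - B.Q ^ 2) = 1 := hr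
  have hk : B.kappaPlus = B.M - B.Q ^ 2 := by simp [Background.kappaPlus, hr]
  rw [Background.rMinus, hk]
  set S := Real.sqrt (B.M ^ 2 - B.Q ^ 2)
  have hS : S = 1 - B.M := by linarith
  rw [hS] at hs
  refine ⟨by nlinarith, by nlinarith, by nlinarith, ?_⟩
  rw [hS]
  nlinarith

theorem OmegaSq_eq (hB : B.Admissible) (hr : B.rPlus = 1) {r : ℝ} (h : r ≠ 0) :
    B.OmegaSq r = (r - 1) * (r - 1 + 2 * B.kappaPlus) / r ^ 2 := by
  obtain ⟨-, h1, h2, -⟩ := params hB hr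
  rw [Background.OmegaSq, h1, h2]
  field_simp
  ring

theorem hasDerivAt_OmegaSq (B : Background) {r : ℝ} (h : r ≠ 0) :
    HasDerivAt B.OmegaSq (2 * B.M / r ^ 2 - 2 * B.Q ^ 2 / r ^ 3) r := by
  have h1 := (((hasDerivAt_inv h).const_mul (2 * B.M)).const_sub 1).add
    (((hasDerivAt_pow 2 r).inv (pow_ne_zero 2 h)).const_mul (B.Q ^ 2))
  refine (h1.congr_of_eventuallyEq (Eventually.of_forall fun s => ?_)).congr_deriv ?_
  · simp [Background.OmegaSq, div_eq_mul_inv]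
  · field_simp
    ring

theorem ht_smooth (hB : B.Admissible) (hr : B.rPlus = 1) : ContDiffOn ℝ ∞ B.ht (Ici 1) := by
  have := hB.2.2.1
  rwa [hr] at this

theorem hasDerivAt_ht (hB : B.Admissible) (hr : B.rPlus = 1) {r : ℝ} (h : 1 < r) :
    HasDerivAt B.ht (deriv B.ht r) r :=
  (((ht_smooth hB hr).contDiffAt (Ici_mem_nhds h)).differentiableAt (by simp)).hasDerivAt

/-! ### The change of gauge -/

/-- The gauge transformation from the time function `τ` to ingoing coordinates. -/
noncomputable def gaugePhase (B : Background) (r : ℝ) : ℂ :=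
  Complex.exp (Complex.I * B.q * (∫ t in (1 : ℝ)..r, B.ht (max t 1) / max t 1 : ℝ))

theorem norm_gaugePhase (B : Background) (r : ℝ) : ‖gaugePhase B r‖ = 1 := by
  rw [gaugePhase, Complex.norm_exp]
  simp

theorem gaugePhase_ne_zero (B : Background) (r : ℝ) : gaugePhase B r ≠ 0 := Complex.exp_ne_zero _

theorem gaugePhase_one (B : Background) : gaugePhase B 1 = 1 := by
  simp [gaugePhase]

theorem hasDerivAt_gaugePhase (hB : B.Admissible) (hr : B.rPlus = 1) {r : ℝ} (h : 1 ≤ r) :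
    HasDerivAt (gaugePhase B) (Complex.I * B.q * (B.ht r / r : ℝ) * gaugePhase B r) r := by
  have hm : Continuous fun t : ℝ => max t 1 := continuous_id.max continuous_const
  -- h̃ is regular only on [1, ∞); the clamped integrand is continuous on ℝ, so the derivative at r
  -- = 1 is two-sided.
  have hc : Continuous fun t : ℝ => B.ht (max t 1) / max t 1 :=
    ((ht_smooth hB hr).continuousOn.comp_continuous hm
      fun t => mem_Ici.2 (le_max_right t 1)).div hm fun t =>
        (lt_of_lt_of_le one_pos (le_max_right t 1)).ne'
  have h1 := (hc.integral_hasStrictDerivAt 1 r).hasDerivAt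
  refine ((h1.ofReal_comp.const_mul (Complex.I * B.q)).cexp).congr_deriv ?_
  rw [max_eq_left h, gaugePhase]
  ring

/-- Bootstrapping from the first-order equation: the derivative is a smooth coefficient times the
function itself. -/
theorem gaugePhase_smooth (hB : B.Admissible) (hr : B.rPlus = 1) :
    ContDiffOn ℝ ∞ (gaugePhase B) (Ici 1) := by
  have hd : ∀ r ∈ Ici (1 : ℝ), HasDerivWithinAt (gaugePhase B)
      (Complex.I * B.q * (B.ht r / r : ℝ) * gaugePhase B r) (Ici 1) r := fun r hr' =>
    (hasDerivAt_gaugePhase hB hr hr').hasDerivWithinAt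
  have hdiff : DifferentiableOn ℝ (gaugePhase B) (Ici 1) := fun r h => (hd r h).differentiableWithinAt
  have hcoef : ContDiffOn ℝ ∞ (fun r : ℝ => Complex.I * B.q * ((B.ht r / r : ℝ) : ℂ)) (Ici 1) :=
    contDiffOn_const.mul (Complex.ofRealCLM.contDiff.comp_contDiffOn
      ((ht_smooth hB hr).div contDiffOn_id fun r hr' => (lt_of_lt_of_le one_pos hr').ne'))
  refine contDiffOn_infty.2 fun n => ?_
  induction n with
  | zero => exact contDiffOn_zero.2 hdiff.continuousOn
  | succ n ih =>
    rw [show ((n + 1 : ℕ) : WithTop ℕ∞) = (n : WithTop ℕ∞) + 1 by norm_cast,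
      contDiffOn_succ_iff_derivWithin (uniqueDiffOn_Ici 1)]
    refine ⟨hdiff, by simp, ?_⟩
    refine ((hcoef.of_le (by exact_mod_cast le_top)).mul ih).congr fun r h => ?_
    exact (hd r h).derivWithin (uniqueDiffOn_Ici 1 r h)

/-- The solution of the radial equation belonging to a solution of the reduced equation. -/
noncomputable def lift (B : Background) (φ : ℝ → ℂ) (r : ℝ) : ℂ := gaugePhase B r * r * φ (r - 1)

/-- The solution of the reduced equation belonging to a solution of the radial equation. -/
noncomputable def lower (B : Background) (f : ℝ → ℂ) (y : ℝ) : ℂ :=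
  f (1 + y) / (gaugePhase B (1 + y) * (1 + y))

theorem lift_lower (B : Background) (f : ℝ → ℂ) {r : ℝ} (h : r ≠ 0) :
    lift B (lower B f) r = f r := by
  have h1 := gaugePhase_ne_zero B r
  have h2 : (r : ℂ) ≠ 0 := by exact_mod_cast h
  have h3 : 1 + (r - 1) = r := by ring
  have h4 : (1 : ℂ) + ((r - 1 : ℝ) : ℂ) = r := by push_cast; ring
  rw [lift, lower, h4, h3]
  field_simp

theorem lift_smooth {s : Set ℝ} {t : Set ℝ} (hB : B.Admissible) (hr : B.rPlus = 1)
    (hs : s ⊆ Ici 1) (hst : ∀ r ∈ s, r - 1 ∈ t) (h : ContDiffOn ℝ ∞ φ t) :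
    ContDiffOn ℝ ∞ (lift B φ) s :=
  (((gaugePhase_smooth hB hr).mono hs).mul Complex.ofRealCLM.contDiff.contDiffOn).mul
    (h.comp (contDiff_id.sub contDiff_const).contDiffOn hst)

theorem lower_smooth {s : Set ℝ} {t : Set ℝ} (hB : B.Admissible) (hr : B.rPlus = 1)
    (hs : s ⊆ Ici 1) (hst : ∀ y ∈ t, 1 + y ∈ s) (h : ContDiffOn ℝ ∞ f s) :
    ContDiffOn ℝ ∞ (lower B f) t := by
  have ha : ContDiff ℝ ∞ fun y : ℝ => 1 + y := contDiff_const.add contDiff_id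
  have hb : ContDiff ℝ ∞ fun y : ℝ => 1 + (y : ℂ) :=
    contDiff_const.add Complex.ofRealCLM.contDiff
  have he := (((gaugePhase_smooth hB hr).comp ha.contDiffOn
    fun y hy => hs (hst y hy)).mul hb.contDiffOn).inv (𝕜 := ℝ) fun y hy => ?_
  · exact ((h.comp ha.contDiffOn hst).mul he).congr fun y _ => div_eq_mul_inv _ _
  · refine mul_ne_zero (gaugePhase_ne_zero B _) ?_
    have h1 : (1 : ℝ) ≤ 1 + y := hs (hst y hy)
    have : (1 + y : ℝ) ≠ 0 := by linarith
    exact_mod_cast this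

/-- The left-hand side of the radial equation. -/
noncomputable def radialExpr (B : Background) (lam : ℂ) (f : ℝ → ℂ) (r : ℝ) : ℂ :=
  deriv (fun s : ℝ => (B.OmegaSq s : ℂ) * deriv f s) r - lam / (r : ℂ) ^ 2 * f r
      - 2 * (1 - (B.h r : ℂ)) * (Complex.I * B.q / r) * deriv f r
      - (((deriv B.OmegaSq r / r : ℝ) : ℂ) - Complex.I * B.q / r * (deriv B.h r : ℝ)
          - ((B.q ^ 2 * B.h r * B.ht r / r ^ 2 : ℝ) : ℂ)
          - Complex.I * B.q / (r : ℂ) ^ 2 * (1 - (B.h r : ℂ))) * f r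

theorem radialExpr_congr {g : ℝ → ℂ} (h : EqOn f g (Ioi 1)) {r : ℝ} (hr : 1 < r) :
    radialExpr B lam f r = radialExpr B lam g r := by
  have h1 : EqOn (fun s : ℝ => (B.OmegaSq s : ℂ) * deriv f s)
      (fun s : ℝ => (B.OmegaSq s : ℂ) * deriv g s) (Ioi 1) := fun s hs => by
    simp only [eqOn_deriv_Ioi h hs]
  rw [radialExpr, radialExpr, eqOn_deriv_Ioi h1 hr, eqOn_deriv_Ioi h hr, h hr]

/-- The radial expression in terms of ingoing coordinates. -/
theorem radialExpr_lift (hB : B.Admissible) (hr : B.rPlus = 1) (hφ : ContDiffOn ℝ ∞ φ (Ioi 0))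
    {r : ℝ} (h : 1 < r) : radialExpr B lam (lift B φ) r = gaugePhase B r / r *
      (((r - 1 : ℝ) : ℂ) * ((r - 1 : ℝ) + 2 * B.kappaPlus) * deriv (deriv φ) (r - 1)
      + (2 * B.kappaPlus + 2 * Complex.I * B.q + (2 + 2 * Complex.I * B.q) * (r - 1 : ℝ)) *
          deriv φ (r - 1)
      + (Complex.I * B.q - lam) * φ (r - 1)) := by
  have hφ1 : ∀ s : ℝ, 1 < s → HasDerivAt (fun s => φ (s - 1)) (deriv φ (s - 1)) s := fun s hs => by
    have := (hasDerivAt_of_smooth isOpen_Ioi hφ (show s - 1 ∈ Ioi (0 : ℝ) from sub_pos.2 hs))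
    simpa using this.comp_sub_const s 1
  have hφ2 : ∀ s : ℝ, 1 < s →
      HasDerivAt (fun s => deriv φ (s - 1)) (deriv (deriv φ) (s - 1)) s := fun s hs => by
    have := (hasDerivAt_of_smooth isOpen_Ioi (contDiffOn_deriv_of_smooth isOpen_Ioi hφ)
      (show s - 1 ∈ Ioi (0 : ℝ) from sub_pos.2 hs))
    simpa using this.comp_sub_const s 1
  have hid : ∀ s : ℝ, HasDerivAt (fun s : ℝ => (s : ℂ)) 1 s := fun s => (hasDerivAt_id s).ofReal_comp
  have hF : ∀ s : ℝ, 1 < s → HasDerivAt (lift B φ) (gaugePhase B s *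
      ((Complex.I * B.q * B.ht s + 1) * φ (s - 1) + s * deriv φ (s - 1))) s := fun s hs => by
    refine (((hasDerivAt_gaugePhase hB hr hs.le).mul (hid s)).mul (hφ1 s hs)).congr_deriv ?_
    have : (s : ℂ) ≠ 0 := by exact_mod_cast (by linarith : s ≠ 0)
    simp only [Pi.mul_apply]
    push_cast
    field_simp
  have hr0 : r ≠ 0 := by linarith
  have hrc : (r : ℂ) ≠ 0 := by exact_mod_cast hr0
  have hO := hasDerivAt_OmegaSq B hr0
  have hht := hasDerivAt_ht hB hr h
  have hh : HasDerivAt B.h (-(deriv B.ht r * B.OmegaSq r +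
      B.ht r * (2 * B.M / r ^ 2 - 2 * B.Q ^ 2 / r ^ 3))) r :=
    (hht.mul hO).const_sub 2
  have hE := (((hht.ofReal_comp.const_mul (Complex.I * B.q)).add_const 1).mul (hφ1 r h)).add
    ((hid r).mul (hφ2 r h))
  have hD : HasDerivAt (fun s : ℝ => (B.OmegaSq s : ℂ) * deriv (lift B φ) s)
      _ r := (hO.ofReal_comp.mul ((hasDerivAt_gaugePhase hB hr h.le).mul hE)).congr_of_eventuallyEq
        (by
          filter_upwards [Ioi_mem_nhds h] with s hs
          simp only [(hF s hs).deriv, Pi.mul_apply, Pi.add_apply])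
  -- The identity is now algebraic in r and the derivatives of φ; all terms containing h̃ and h̃′
  -- cancel.
  rw [radialExpr, hD.deriv, (hF r h).deriv, hO.deriv, hh.deriv, lift]
  obtain ⟨-, h1, h2, -⟩ := params hB hr
  simp only [Background.h, OmegaSq_eq hB hr hr0, h1, h2, Pi.mul_apply, Pi.add_apply]
  push_cast
  field_simp
  ring_nf
  simp only [Complex.I_sq]
  ring

theorem lift_solvesRadial (hB : B.Admissible) (hr : B.rPlus = 1)
    (h : IsRed B.kappaPlus B.q lam φ) : B.SolvesRadial lam (lift B φ) := by
  refine ⟨?_, fun r h1 => ?_⟩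
  · rw [hr]
    exact lift_smooth hB hr Ioi_subset_Ici_self (fun r h1 => sub_pos.2 h1) h.1
  · rw [hr] at h1
    have := radialExpr_lift (lam := lam) hB hr h.1 h1
    rw [h.2 _ (sub_pos.2 h1), mul_zero] at this
    exact this

theorem lower_isRed (hB : B.Admissible) (hr : B.rPlus = 1) (h : B.SolvesRadial lam f) :
    IsRed B.kappaPlus B.q lam (lower B f) := by
  have h0 := h.1
  rw [hr] at h0
  have hs : ContDiffOn ℝ ∞ (lower B f) (Ioi 0) := lower_smooth hB hr Ioi_subset_Ici_self
    (fun y hy => by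
      have : (0 : ℝ) < y := hy
      exact lt_add_of_pos_right 1 this) h0
  refine ⟨hs, fun y hy => ?_⟩
  have h1 : (1 : ℝ) < 1 + y := by linarith
  have h2 := radialExpr_lift (lam := lam) hB hr hs h1
  have h3 : radialExpr B lam f (1 + y) = 0 := h.2 _ (by rw [hr]; exact h1)
  have h4 : EqOn (lift B (lower B f)) f (Ioi 1) := fun r h' => lift_lower B f (by
    have : (1 : ℝ) < r := h'
    linarith)
  rw [radialExpr_congr h4 h1, h3, add_sub_cancel_left, eq_comm, mul_eq_zero] at h2
  refine h2.resolve_left (div_ne_zero (gaugePhase_ne_zero B _) ?_)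
  exact_mod_cast (by linarith : 1 + y ≠ 0)

end RNStat

namespace RNStat
open MeasureTheory

variable {B : Background} {β : ℂ} {lam : ℂ} {φ f : ℝ → ℂ}

/-! ### Transfer of the asymptotics -/

/-- From (h̃ − 2)Ω² = 2(1 − Ω²) − h, with 1 − Ω² = O(1/r), h = O(1/r) and Ω² ≥ 1/2 for r ≥ 4. -/
theorem exists_ht_bound (hB : B.Admissible) (hr : B.rPlus = 1) :
    ∃ R K : ℝ, 4 ≤ R ∧ 0 ≤ K ∧ ∀ r, R ≤ r → |B.ht r - 2| ≤ K * r⁻¹ := by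
  obtain ⟨δ, hδ, hO⟩ := hB.2.2.2.2
  obtain ⟨C, hC, hb⟩ := hO.exists_pos
  obtain ⟨R, hR⟩ := eventually_atTop.1 hb.bound
  obtain ⟨hκ, h1, h2, -⟩ := params hB hr
  refine ⟨max R 4, 2 * (C + 2 * (2 * |B.M| + B.Q ^ 2)), le_max_right _ _, by positivity,
    fun r hr' => ?_⟩
  have hrR : R ≤ r := (le_max_left _ _).trans hr'
  have hr4 : 4 ≤ r := (le_max_right _ _).trans hr'
  have hr0 : 0 < r := by linarith
  have hh : |B.h r| ≤ C * r⁻¹ := by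
    have := hR r hrR
    rw [Real.norm_eq_abs, Real.norm_of_nonneg (Real.rpow_nonneg hr0.le _)] at this
    refine this.trans (mul_le_mul_of_nonneg_left ?_ hC.le)
    rw [← Real.rpow_neg_one]
    exact Real.rpow_le_rpow_of_exponent_le (by linarith) (by linarith)
  have hΩ : 1 / 2 ≤ B.OmegaSq r := by
    rw [OmegaSq_eq hB hr hr0.ne', le_div_iff₀ (by positivity)]
    nlinarith [mul_nonneg (by linarith : 0 ≤ r - 1) hκ]
  have hΩ' : |1 - B.OmegaSq r| ≤ (2 * |B.M| + B.Q ^ 2) * r⁻¹ := by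
    have e : 1 - B.OmegaSq r = (2 * B.M - B.Q ^ 2 * r⁻¹) * r⁻¹ := by
      rw [Background.OmegaSq]; field_simp; ring
    rw [e, abs_mul, abs_of_pos (inv_pos.2 hr0)]
    refine mul_le_mul_of_nonneg_right ((abs_sub _ _).trans ?_) (by positivity)
    rw [abs_mul, abs_two, abs_of_nonneg (by positivity : 0 ≤ B.Q ^ 2 * r⁻¹)]
    have : B.Q ^ 2 * r⁻¹ ≤ B.Q ^ 2 * 1 :=
      mul_le_mul_of_nonneg_left (inv_le_one_of_one_le₀ (by linarith)) (sq_nonneg _)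
    linarith
  have e : (B.ht r - 2) * B.OmegaSq r = 2 * (1 - B.OmegaSq r) - B.h r := by
    rw [Background.h]; ring
  have h3 : |B.ht r - 2| * B.OmegaSq r ≤ (C + 2 * (2 * |B.M| + B.Q ^ 2)) * r⁻¹ := by
    have e2 : |B.ht r - 2| * B.OmegaSq r = |(B.ht r - 2) * B.OmegaSq r| := by
      rw [abs_mul, abs_of_nonneg (by linarith : 0 ≤ B.OmegaSq r)]
    rw [e2, e]
    refine (abs_sub _ _).trans ?_
    rw [abs_mul, abs_two]
    linarith
  nlinarith [abs_nonneg (B.ht r - 2)]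

/-- The product of the gauge factor with r^(−2iq) has modulus 1 and logarithmic derivative iq(h̃ −
2)/r = O(r^(−2)), so it converges at rate 1/r to a number N of modulus 1. -/
theorem exists_phase_limit (hB : B.Admissible) (hr : B.rPlus = 1) :
    ∃ N : ℂ, N ≠ 0 ∧ NearOne (fun y => y⁻¹) fun y =>
      N⁻¹ * (gaugePhase B (1 + y) * ((1 + y : ℝ) : ℂ) ^ (-(2 * Complex.I * B.q))) := by
  obtain ⟨R, K, hR, hK, hb⟩ := exists_ht_bound hB hr
  set D : ℝ → ℂ := fun r => gaugePhase B r * (r : ℂ) ^ (-(2 * Complex.I * B.q)) with hD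
  have hd : ∀ r, 1 ≤ r → HasDerivAt D (D r * (Complex.I * B.q * ((B.ht r - 2 : ℝ) / r))) r := by
    intro r h
    have h0 : 0 < r := by linarith
    have hrc : (r : ℂ) ≠ 0 := by exact_mod_cast h0.ne'
    refine ((hasDerivAt_gaugePhase hB hr h).mul (hasDerivAt_cpow_real _ h0)).congr_deriv ?_
    rw [Complex.cpow_sub _ _ hrc, Complex.cpow_one]
    simp only [hD]
    push_cast
    field_simp
    ring
  have hn : ∀ r : ℝ, 0 < r → ‖D r‖ = 1 := fun r h => by
    rw [hD, norm_mul, norm_gaugePhase, Complex.norm_cpow_eq_rpow_re_of_pos h]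
    simp
  obtain ⟨N, hN⟩ := exists_limit_of_norm_deriv_le (D := D) (M := |B.q| * K) (Y := R) (σ := 1)
    (by linarith) one_pos (fun t ht => hd t (by linarith)) fun t ht => by
      have ht0 : 0 < t := by linarith
      rw [norm_mul, hn t ht0, one_mul, norm_mul, norm_mul, norm_div, Complex.norm_I, one_mul,
        Complex.norm_real, Complex.norm_real, Complex.norm_real, Real.norm_eq_abs,
        Real.norm_eq_abs, Real.norm_of_nonneg ht0.le, Real.rpow_sub_one ht0.ne',
        Real.rpow_neg_one, ← mul_div_assoc]
      rw [← mul_div_assoc, mul_assoc]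
      refine div_le_div_of_nonneg_right ?_ ht0.le
      exact mul_le_mul_of_nonneg_left (hb t ht) (abs_nonneg _)
  have hlim : Tendsto D atTop (𝓝 N) := by
    rw [tendsto_iff_norm_sub_tendsto_zero]
    have h2 : Tendsto (fun y : ℝ => |B.q| * K / 1 * y ^ (-1 : ℝ)) atTop
        (𝓝 (|B.q| * K / 1 * 0)) := (tendsto_rpow_of_neg (by norm_num)).const_mul _
    rw [mul_zero] at h2
    refine tendsto_of_tendsto_of_tendsto_of_le_of_le' tendsto_const_nhds h2
      (Eventually.of_forall fun _ => norm_nonneg _) ?_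
    filter_upwards [eventually_ge_atTop R] with y hy using hN y hy
  have hN1 : ‖N‖ = 1 := by
    refine tendsto_nhds_unique hlim.norm (tendsto_const_nhds.congr' ?_)
    filter_upwards [eventually_gt_atTop 0] with r h0
    exact (hn r h0).symm
  have hN0 : N ≠ 0 := norm_ne_zero_iff.1 (by rw [hN1]; exact one_ne_zero)
  refine ⟨N, hN0, nearOne_of_eventually continuousOn_inv_Ici
    (fun y hy => inv_pos.2 (by linarith)) (fun y hy => ?_) (Y := R) (K := |B.q| * K)
    fun y hy => ?_⟩
  · have h1 : (1 : ℝ) ≤ 1 + y := by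
      have : (1 : ℝ) ≤ y := hy
      linarith
    have := ((hd (1 + y) h1).continuousAt.comp (f := fun y : ℝ => 1 + y) (x := y)
      (by fun_prop)).const_mul N⁻¹
    exact this.continuousWithinAt
  · have hy0 : 0 < y := by linarith
    have h1 := hN (1 + y) (by linarith)
    have e : N⁻¹ * (gaugePhase B (1 + y) * ((1 + y : ℝ) : ℂ) ^ (-(2 * Complex.I * B.q))) - 1
        = N⁻¹ * (D (1 + y) - N) := by
      simp only [hD]
      field_simp
    rw [e, norm_mul, norm_inv, hN1, inv_one, one_mul]
    refine h1.trans ?_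
    rw [div_one, Real.rpow_neg_one]
    gcongr
    linarith

theorem nearOne_one_add_inv_cpow (s : ℂ) :
    NearOne (fun y => y⁻¹) fun y : ℝ => ((1 + y⁻¹ : ℝ) : ℂ) ^ s := by
  have h1 : HasDerivAt (fun w : ℝ => ((1 + w : ℝ) : ℂ) ^ s) (s * ((1 : ℝ) : ℂ) ^ (s - 1)) 0 := by
    have := hasDerivAt_cpow_real s (show (0 : ℝ) < 1 + 0 by norm_num)
    have h2 := HasDerivAt.scomp (0 : ℝ) this ((hasDerivAt_id (0 : ℝ)).const_add 1)
    simpa [Function.comp_def] using h2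
  obtain ⟨C, hC⟩ := h1.isBigO_sub.bound
  obtain ⟨Y, hY⟩ := eventually_atTop.1 (tendsto_inv_atTop_zero.eventually hC)
  refine nearOne_of_eventually continuousOn_inv_Ici (fun _ hy => inv_pos.2 (by linarith))
    (fun y hy => ?_) (Y := max Y 1) (K := C) fun y hy => ?_
  · have hy0 : (0 : ℝ) < y := lt_of_lt_of_le one_pos hy
    have h2 : (0 : ℝ) < 1 + y⁻¹ := by positivity
    exact (ContinuousAt.comp (f := fun y : ℝ => 1 + y⁻¹) (hasDerivAt_cpow_real s h2).continuousAt
      (continuousAt_const.add (continuousAt_inv₀ hy0.ne'))).continuousWithinAt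
  · have := hY y ((le_max_left _ _).trans hy)
    have hy0 : (0 : ℝ) < y := lt_of_lt_of_le one_pos ((le_max_right _ _).trans hy)
    simpa [abs_of_pos hy0] using this

theorem NearOne.inv {e : ℝ → ℝ} {g : ℝ → ℂ} (h : NearOne e g) (he : ContinuousOn e (Ici 1))
    (hpos : ∀ y, 1 ≤ y → 0 < e y) (he0 : Tendsto e atTop (𝓝 0)) (hg : ContinuousOn g (Ici 1))
    (hg0 : ∀ y, 1 ≤ y → g y ≠ 0) : NearOne e fun y => (g y)⁻¹ := by
  obtain ⟨C, hC⟩ := h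
  have hs : Tendsto (fun y => |C| * e y) atTop (𝓝 (|C| * 0)) := he0.const_mul _
  rw [mul_zero] at hs
  obtain ⟨Y, hY⟩ := eventually_atTop.1 (hs.eventually (gt_mem_nhds (show (0 : ℝ) < 1 / 2 by norm_num)))
  refine nearOne_of_eventually he hpos (hg.inv₀ fun y hy => hg0 y hy) (Y := max Y 2)
    (K := 2 * |C|) fun y hy => ?_
  have hy2 : 2 ≤ y := (le_max_right _ _).trans hy
  have h1 : ‖g y - 1‖ ≤ |C| * e y := (hC y (by linarith)).trans
    (mul_le_mul_of_nonneg_right (le_abs_self _) (hpos y (by linarith)).le)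
  have := (norm_inv_sub_one_le h1 (hY y ((le_max_left _ _).trans hy)).le).1
  linarith

/-- The factor relating the asymptotics in `r` and in `y = r - 1`. -/
noncomputable def transferFactor (B : Background) (N s : ℂ) (y : ℝ) : ℂ :=
  N⁻¹ * (gaugePhase B (1 + y) * ((1 + y : ℝ) : ℂ) ^ (-(2 * Complex.I * B.q))) *
    ((1 + y⁻¹ : ℝ) : ℂ) ^ s

/-- A nonzero `N` such that `transferFactor` tends to one. -/
def IsPhaseLimit (B : Background) (N : ℂ) : Prop :=
  N ≠ 0 ∧ NearOne (fun y => y⁻¹) fun y =>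
    N⁻¹ * (gaugePhase B (1 + y) * ((1 + y : ℝ) : ℂ) ^ (-(2 * Complex.I * B.q)))

variable {N : ℂ}

theorem transferFactor_ne_zero (hN : IsPhaseLimit B N) (s : ℂ) {y : ℝ} (hy : 0 < y) :
    transferFactor B N s y ≠ 0 :=
  mul_ne_zero (mul_ne_zero (inv_ne_zero hN.1) (mul_ne_zero (gaugePhase_ne_zero B _)
    (cpow_ne_zero_of_pos (by linarith) _))) (cpow_ne_zero_of_pos (by positivity) _)

theorem inv_bounds (y : ℝ) (hy : 1 < y) : 0 ≤ y⁻¹ ∧ y⁻¹ ≤ 1 :=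
  ⟨by positivity, inv_le_one_of_one_le₀ hy.le⟩

theorem nearOne_transferFactor (hN : IsPhaseLimit B N) (s : ℂ) :
    NearOne (fun y => y⁻¹) (transferFactor B N s) :=
  hN.2.mul (nearOne_one_add_inv_cpow s) inv_bounds

theorem continuousOn_transferFactor (hB : B.Admissible) (hr : B.rPlus = 1) (N s : ℂ) :
    ContinuousOn (transferFactor B N s) (Ici 1) := by
  intro y hy
  have hy0 : (0 : ℝ) < y := lt_of_lt_of_le one_pos hy
  have h1 : (0 : ℝ) < 1 + y⁻¹ := by positivity
  have h2 : (0 : ℝ) < 1 + y := by positivity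
  have a1 : ContinuousAt (fun y : ℝ => gaugePhase B (1 + y)) y :=
    ContinuousAt.comp (f := fun y : ℝ => 1 + y)
      (hasDerivAt_gaugePhase hB hr (by linarith)).continuousAt (by fun_prop)
  have a2 : ContinuousAt (fun y : ℝ => ((1 + y : ℝ) : ℂ) ^ (-(2 * Complex.I * B.q))) y :=
    ContinuousAt.comp (f := fun y : ℝ => 1 + y) (hasDerivAt_cpow_real _ h2).continuousAt
      (by fun_prop)
  have a3 : ContinuousAt (fun y : ℝ => ((1 + y⁻¹ : ℝ) : ℂ) ^ s) y :=
    ContinuousAt.comp (f := fun y : ℝ => 1 + y⁻¹) (hasDerivAt_cpow_real s h1).continuousAt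
      (continuousAt_const.add (continuousAt_inv₀ hy0.ne'))
  exact ((continuousAt_const.mul (a1.mul a2)).mul a3).continuousWithinAt

/-- Transfer of a normalisation. -/
theorem nearOne_transfer (hB : B.Admissible) (hr : B.rPlus = 1) (hN : IsPhaseLimit B N) (s : ℂ)
    {e e' : ℝ → ℝ} {g g' : ℝ → ℂ} {K K' K'' : ℝ}
    (he : ∀ y, 1 < y → y⁻¹ ≤ K * e y ∧ e y ≤ K' * e' y ∧ e' y ≤ e y ∧ 0 ≤ e' y ∧ e y ≤ K'')
    (h : ∀ y, 1 < y → g' y = transferFactor B N s y * g y) : NearOne e' g' ↔ NearOne e g := by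
  have hT := nearOne_transferFactor hN s
  have hTi := hT.inv continuousOn_inv_Ici (fun y hy => inv_pos.2 (by linarith))
    tendsto_inv_atTop_zero (continuousOn_transferFactor hB hr N s)
    fun y hy => transferFactor_ne_zero hN s (by linarith)
  have hT' := hT.mono (fun y hy => (inv_bounds y hy).1) fun y hy => (he y hy).1
  have hTi' := hTi.mono (fun y hy => (inv_bounds y hy).1) fun y hy => (he y hy).1
  have hb : ∀ y, 1 < y → 0 ≤ e y ∧ e y ≤ K'' := fun y hy =>
    ⟨(he y hy).2.2.2.1.trans (he y hy).2.2.1, (he y hy).2.2.2.2⟩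
  constructor
  · intro hg
    have h1 := hg.mono (e' := e) (K := 1) (fun y hy => (he y hy).2.2.2.1) fun y hy => by
      rw [one_mul]; exact (he y hy).2.2.1
    refine (hTi'.mul h1 hb).congr fun y hy => ?_
    rw [h y hy, inv_mul_cancel_left₀ (transferFactor_ne_zero hN s (by linarith))]
  · intro hg
    refine ((hT'.mul hg hb).congr h).mono (fun y hy => (hb y hy).1) fun y hy => (he y hy).2.1

theorem nearOne_shift {e : ℝ → ℝ} {g : ℝ → ℂ} :
    (∃ C : ℝ, ∀ r : ℝ, 2 < r → ‖g r - 1‖ ≤ C * e r) ↔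
      NearOne (fun y => e (1 + y)) fun y => g (1 + y) := by
  constructor
  · rintro ⟨C, hC⟩
    exact ⟨C, fun y hy => hC _ (by linarith)⟩
  · rintro ⟨C, hC⟩
    refine ⟨C, fun r hr => ?_⟩
    have := hC (r - 1) (by linarith)
    simpa using this

/-- The exponents match because 1 + 2iq − a = 1/2 + iq − β/2; the change from y to 1 + y costs only
(1 + 1/y)^a. -/
theorem lift_asymptotics {y : ℝ} (hN : IsPhaseLimit B N) (hy : 0 < y) (φ : ℝ → ℂ) (β : ℂ) :
    lift B φ (1 + y) / ((1 + y : ℝ) : ℂ) ^ (1 / 2 + Complex.I * B.q - β / 2) =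
      transferFactor B N (pa B.q β) y * ((y : ℂ) ^ pa B.q β * (N * φ y)) := by
  have h1 : 0 < 1 + y := by linarith
  have hc : ((1 + y : ℝ) : ℂ) ≠ 0 := by exact_mod_cast h1.ne'
  have e1 : ((1 + y⁻¹ : ℝ) : ℂ) ^ pa B.q β * (y : ℂ) ^ pa B.q β = ((1 + y : ℝ) : ℂ) ^ pa B.q β := by
    rw [← Complex.mul_cpow_ofReal_nonneg (by positivity) hy.le, ← Complex.ofReal_mul]
    congr 2
    field_simp
    ring
  have e2 : ((1 + y : ℝ) : ℂ) ^ (-(2 * Complex.I * B.q)) * ((1 + y : ℝ) : ℂ) ^ pa B.q β *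
      ((1 + y : ℝ) : ℂ) ^ (1 / 2 + Complex.I * B.q - β / 2) = ((1 + y : ℝ) : ℂ) := by
    rw [← Complex.cpow_add _ _ hc, ← Complex.cpow_add _ _ hc]
    conv_rhs => rw [← Complex.cpow_one ((1 + y : ℝ) : ℂ)]
    congr 1
    simp only [pa]
    ring
  have hn := cpow_ne_zero_of_pos h1 (1 / 2 + Complex.I * B.q - β / 2)
  have hN0 := hN.1
  rw [div_eq_iff hn, lift, add_sub_cancel_left, transferFactor]
  calc gaugePhase B (1 + y) * ((1 + y : ℝ) : ℂ) * φ y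
      = gaugePhase B (1 + y) * (((1 + y : ℝ) : ℂ) ^ (-(2 * Complex.I * B.q)) *
        (((1 + y⁻¹ : ℝ) : ℂ) ^ pa B.q β * (y : ℂ) ^ pa B.q β) *
        ((1 + y : ℝ) : ℂ) ^ (1 / 2 + Complex.I * B.q - β / 2)) * φ y * (N⁻¹ * N) := by
          rw [e1, e2, inv_mul_cancel₀ hN0, mul_one]
    _ = _ := by ring

theorem inv_shift_bounds {y : ℝ} (hy : 1 < y) : y⁻¹ ≤ 2 * (1 + y)⁻¹ ∧ (1 + y)⁻¹ ≤ y⁻¹ := by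
  have hy0 : 0 < y := by linarith
  constructor
  · rw [← div_eq_mul_inv, inv_le_comm₀ hy0 (by positivity), inv_div]
    linarith
  · gcongr
    linarith

theorem minusAsymptotics_lift (hB : B.Admissible) (hr : B.rPlus = 1) (hN : IsPhaseLimit B N)
    (hf : EqOn f (lift B φ) (Ioi 1)) :
    B.MinusAsymptotics β f ↔ AsyMinus B.q β fun y => N * φ y := by
  rw [Background.MinusAsymptotics, nearOne_shift (e := fun r => r⁻¹)
    (g := fun r : ℝ => f r / (r : ℂ) ^ (1 / 2 + Complex.I * B.q - β / 2)), AsyMinus]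
  refine nearOne_transfer hB hr hN (pa B.q β) (K := 1) (K' := 2) (K'' := 1) (fun y hy => ?_)
    fun y hy => ?_
  · obtain ⟨h1, h2⟩ := inv_shift_bounds hy
    exact ⟨by linarith, h1, h2, by positivity, (inv_bounds y hy).2⟩
  · rw [hf (show (1 : ℝ) < 1 + y by linarith), lift_asymptotics hN (by linarith)]

theorem plusAsymptotics_lift (hB : B.Admissible) (hr : B.rPlus = 1) (hN : IsPhaseLimit B N)
    (hf : EqOn f (lift B φ) (Ioi 1)) :
    B.PlusAsymptotics β f ↔ AsyPlus B.q β fun y => N * φ y := by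
  have e1 : B.PlusAsymptotics β f ↔ ∃ C : ℝ, ∀ r : ℝ, 2 < r →
    ‖f r / ((r : ℂ) ^ (1 / 2 + Complex.I * B.q + β / 2) *
        (if β = 0 then (Real.log r : ℂ) else 1)) - 1‖
      ≤ C * (r⁻¹ * (if β = 1 then Real.log r else 1)) := by
    simp only [Background.PlusAsymptotics, mul_assoc]
  rw [e1, nearOne_shift (e := fun r => r⁻¹ * (if β = 1 then Real.log r else 1))
    (g := fun r : ℝ => f r / ((r : ℂ) ^ (1 / 2 + Complex.I * B.q + β / 2) *
        (if β = 0 then (Real.log r : ℂ) else 1))), AsyPlus]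
  -- For y > 1 one has log(1 + y) ≥ log 2, whence 1/log 2, and 1/y ≤ 2/(1 + y), whence 2; the 4 is a
  -- crude bound for `errPlus`.
  refine nearOne_transfer hB hr hN (pa B.q (-β)) (K := 1 / Real.log 2) (K' := 2) (K'' := 4)
    (fun y hy => ?_) fun y hy => ?_
  · obtain ⟨h1, h2⟩ := inv_shift_bounds hy
    have hy0 : 0 < y := by linarith
    have hl2 : 0 < Real.log 2 := Real.log_pos (by norm_num)
    have hl2' : Real.log 2 ≤ 1 := by linarith [Real.log_two_lt_d9]
    have hyi := inv_pos.2 hy0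
    have hl : Real.log 2 ≤ if β = 1 then Real.log (1 + y) else 1 := by
      split_ifs
      · exact Real.log_le_log two_pos (by linarith)
      · exact hl2'
    have h4 := lead_mul_err_le β hy.le
    have h5 : errPlus β y ≤ 4 := by
      unfold errPlus
      split_ifs
      · rw [inv_mul_le_iff₀ hy0]
        linarith [Real.log_le_sub_one_of_pos (show 0 < 1 + y by linarith)]
      · linarith [(inv_bounds y hy).2]
    have hl0 := hl2.le.trans hl
    unfold errPlus at h5 ⊢
    refine ⟨?_, ?_, ?_, by positivity, h5⟩
    · rw [one_div, inv_mul_eq_div, le_div_iff₀ hl2]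
      gcongr
    · rw [← mul_assoc]
      gcongr
    · gcongr
  · have := lift_asymptotics (B := B) hN (show 0 < y by linarith) φ (-β)
    rw [sub_eq_add_neg, neg_div, neg_neg] at this
    rw [hf (show (1 : ℝ) < 1 + y by linarith), ← div_div, this, leadPlus, mul_div_assoc]

end RNStat

namespace RNStat
open MeasureTheory

/-! ### Spherical harmonics -/

section Legendre
open Polynomial

theorem derivative_sq_sub_one_pow (l : ℕ) :
    (X ^ 2 - 1 : ℝ[X]) * derivative ((X ^ 2 - 1) ^ l) = 2 * (l : ℝ[X]) * X * (X ^ 2 - 1) ^ l := by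
  rcases l with _ | l
  · simp
  · rw [derivative_pow]
    simp only [derivative_sub, derivative_X_pow, derivative_one, Nat.add_sub_cancel]
    simp only [map_natCast, Nat.cast_ofNat, map_ofNat]
    push_cast
    ring

/-- The differential equation of the iterated derivatives in Rodrigues' formula. -/
theorem rodrigues_ode (l n : ℕ) :
    (X ^ 2 - 1 : ℝ[X]) * derivative^[n + 2] ((X ^ 2 - 1) ^ l)
      + 2 * ((n : ℝ[X]) + 1 - (l : ℝ[X])) * X * derivative^[n + 1] ((X ^ 2 - 1) ^ l)
      + ((n : ℝ[X]) + 1) * ((n : ℝ[X]) - 2 * (l : ℝ[X])) * derivative^[n] ((X ^ 2 - 1) ^ l) = 0 := by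
  induction n with
  | zero =>
    have h := congrArg derivative (derivative_sq_sub_one_pow l)
    simp only [derivative_mul, derivative_sub, derivative_X_pow, derivative_one, derivative_X,
      derivative_natCast, derivative_ofNat] at h
    simp only [Nat.cast_ofNat, map_ofNat] at h
    simp only [Function.iterate_succ, Function.iterate_zero, Function.comp, id]
    push_cast at h ⊢
    linear_combination h
  | succ n ih =>
    have h := congrArg derivative ih
    simp only [derivative_add, derivative_mul, derivative_sub, derivative_X_pow, derivative_one,
      derivative_X, derivative_natCast, derivative_ofNat, derivative_zero] at h
    simp only [Nat.cast_ofNat, map_ofNat] at h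
    simp only [← Function.iterate_succ_apply' derivative] at h
    push_cast at h ⊢
    linear_combination h

/-- The polynomial (X² − 1)^l is monic of degree 2l, so at most 2l differentiations do not
annihilate its leading term. -/
theorem rodrigues_ne_zero {l k : ℕ} (hk : k ≤ l) :
    derivative^[l + k] ((X ^ 2 - 1 : ℝ[X]) ^ l) ≠ 0 := by
  intro h
  have h1 := congrArg (fun p => coeff p (l - k)) h
  simp only [coeff_iterate_derivative, coeff_zero] at h1
  have h2 : l - k + (l + k) = 2 * l := by omega
  have hm : ((X ^ 2 - 1 : ℝ[X]) ^ l).coeff (2 * l) = 1 := by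
    have hmon : (X ^ 2 - 1 : ℝ[X]).Monic := by
      have := monic_X_pow_sub_C (1 : ℝ) two_ne_zero
      rwa [C_1] at this
    have hd : (X ^ 2 - 1 : ℝ[X]).natDegree = 2 := by
      have := natDegree_X_pow_sub_C (n := 2) (r := (1 : ℝ))
      rwa [C_1] at this
    have := (hmon.pow l).coeff_natDegree
    rwa [hmon.natDegree_pow, hd, mul_comm] at this
  rw [h2, hm, nsmul_eq_mul, mul_one, Nat.cast_eq_zero, Nat.descFactorial_eq_zero_iff_lt] at h1
  omega

/-- The dependence of the spherical harmonic on the polar angle. -/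
noncomputable def polar (l k : ℕ) (θ : ℝ) : ℝ :=
  Real.sqrt ((2 * l + 1) / (4 * Real.pi) *
        ((l - k).factorial / (l + k).factorial)) / (2 ^ l * l.factorial) *
      Real.sin θ ^ k *
      ((derivative^[l + k]) ((X ^ 2 - 1 : ℝ[X]) ^ l)).eval (Real.cos θ)

theorem sphHarmonic_eq (l : ℕ) (m : ℤ) (θ φ : ℝ) :
    sphHarmonic l m θ φ = (polar l m.natAbs θ : ℂ) * Complex.exp (Complex.I * m * φ) := rfl

/-- Needed to divide by the spherical harmonic when recovering the radial equation from the wave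
equation; a nonzero polynomial cannot vanish throughout (−1, 1). -/
theorem exists_polar_ne_zero {l k : ℕ} (hk : k ≤ l) :
    ∃ θ : ℝ, 0 < θ ∧ θ < Real.pi ∧ polar l k θ ≠ 0 := by
  have hinf : (Ioo (-1 : ℝ) 1).Infinite := Ioo_infinite (by norm_num)
  obtain ⟨x, hx, hx0⟩ := hinf.exists_notMem_finset
    ((derivative^[l + k]) ((X ^ 2 - 1 : ℝ[X]) ^ l)).roots.toFinset
  rw [Multiset.mem_toFinset, mem_roots (rodrigues_ne_zero hk)] at hx0
  have h0 : 0 < Real.arccos x := Real.arccos_pos.2 hx.2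
  have h1 : Real.arccos x < Real.pi := Real.arccos_lt_pi.2 hx.1
  refine ⟨Real.arccos x, h0, h1, ?_⟩
  unfold polar
  rw [Real.cos_arccos hx.1.le hx.2.le]
  refine mul_ne_zero (mul_ne_zero ?_ (pow_ne_zero _ (Real.sin_pos_of_pos_of_lt_pi h0 h1).ne')) hx0
  have := Real.pi_pos
  have a1 : (0 : ℝ) < (l - k).factorial := by exact_mod_cast Nat.factorial_pos _
  have a2 : (0 : ℝ) < (l + k).factorial := by exact_mod_cast Nat.factorial_pos _
  have a3 : (0 : ℝ) < l.factorial := by exact_mod_cast Nat.factorial_pos _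
  positivity

theorem hasDerivAt_polar (l k : ℕ) (θ : ℝ) : HasDerivAt (polar l k) (deriv (polar l k) θ) θ := by
  have : Differentiable ℝ (polar l k) := by
    unfold polar
    exact ((Real.differentiable_sin.pow k).const_mul _).mul
      (Differentiable.fun_comp (Polynomial.differentiable _) Real.differentiable_cos)
  exact (this θ).hasDerivAt

/-- The Legendre equation. -/
theorem hasDerivAt_sin_mul_deriv_polar (l k : ℕ) {θ : ℝ} (hθ : Real.sin θ ≠ 0) :
    HasDerivAt (fun θ => Real.sin θ * deriv (polar l k) θ)
      (((k : ℝ) ^ 2 / Real.sin θ - l * (l + 1) * Real.sin θ) * polar l k θ) θ := by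
  set G := (derivative^[l + k]) ((X ^ 2 - 1 : ℝ[X]) ^ l) with hG
  set c := Real.sqrt ((2 * l + 1) / (4 * Real.pi) *
        ((l - k).factorial / (l + k).factorial)) / (2 ^ l * l.factorial) with hc
  have hode := congrArg (eval (Real.cos θ)) (rodrigues_ode l (l + k))
  simp only [Function.iterate_succ_apply', ← hG, eval_add, eval_mul, eval_sub, eval_pow, eval_X,
    eval_one, eval_natCast, eval_ofNat, eval_zero] at hode
  have hGd : ∀ (p : ℝ[X]) (θ : ℝ), HasDerivAt (fun θ => p.eval (Real.cos θ))
      ((derivative p).eval (Real.cos θ) * -Real.sin θ) θ := fun p θ =>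
    (p.hasDerivAt _).comp θ (Real.hasDerivAt_cos θ)
  have hsp : ∀ θ : ℝ, HasDerivAt (fun θ => Real.sin θ ^ k)
      (k * Real.sin θ ^ (k - 1) * Real.cos θ) θ := fun θ => (Real.hasDerivAt_sin θ).pow k
  -- At k = 0 the truncated exponent k − 1 is 0, but the factor k vanishes, so the identity holds
  -- for every k.
  have hpow : ∀ s : ℝ, (k : ℝ) * s ^ (k - 1) * s = k * s ^ k := fun s => by
    rcases k with _ | k
    · simp
    · rw [Nat.add_sub_cancel, pow_succ]; ring
  have h1 : ∀ θ, deriv (polar l k) θ = c * (k * Real.sin θ ^ (k - 1) * Real.cos θ) *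
      G.eval (Real.cos θ) + c * Real.sin θ ^ k * ((derivative G).eval (Real.cos θ) * -Real.sin θ) :=
    fun θ => (((hsp θ).const_mul c).mul (hGd G θ)).deriv
  have h2 : (fun θ => Real.sin θ * deriv (polar l k) θ) = fun θ =>
      c * ((k * Real.sin θ ^ k * Real.cos θ) * G.eval (Real.cos θ)
        - Real.sin θ ^ k * Real.sin θ ^ 2 * (derivative G).eval (Real.cos θ)) := by
    funext θ
    rw [h1, ← hpow]
    ring
  rw [h2]
  have hd := (((((hsp θ).const_mul (k : ℝ)).mul (Real.hasDerivAt_cos θ)).mul (hGd G θ)).sub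
    (((hsp θ).mul ((Real.hasDerivAt_sin θ).pow 2)).mul (hGd (derivative G) θ))).const_mul c
  refine hd.congr_deriv ?_
  have hs2 : Real.cos θ ^ 2 = 1 - Real.sin θ ^ 2 := by
    rw [← Real.sin_sq_add_cos_sq θ]; ring
  have hp : (k : ℝ) * Real.sin θ ^ (k - 1) = k * Real.sin θ ^ k / Real.sin θ := by
    rw [← hpow, mul_div_assoc, div_self hθ, mul_one]
  have hpol : polar l k θ = c * Real.sin θ ^ k * G.eval (Real.cos θ) := rfl
  simp only [Pi.mul_apply, Pi.pow_apply]
  rw [hpol, hp]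
  push_cast at hode ⊢
  generalize Real.sin θ ^ k = S
  generalize eval (Real.cos θ) G = G0 at *
  generalize eval (Real.cos θ) (derivative G) = G1 at *
  generalize eval (Real.cos θ) (derivative (derivative G)) = G2 at *
  generalize Real.sin θ = s at *
  generalize Real.cos θ = x at *
  rw [hs2] at hode
  field_simp
  simp only [hs2]
  linear_combination (-c * S * s ^ 2) * hode

end Legendre

end RNStat

namespace RNStat
open MeasureTheory

variable {B : Background} {β : ℂ} {lam : ℂ} {φ f : ℝ → ℂ}

/-! ### Separation of variables -/

theorem metric_inv (B : Background) {x : Fin 4 → ℝ} (h1 : x 1 ≠ 0) (h2 : Real.sin (x 2) ≠ 0) :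
    (B.metric x)⁻¹ = !![-(B.ht (x 1) * B.h (x 1)), B.h (x 1) - 1, 0, 0;
      B.h (x 1) - 1, B.OmegaSq (x 1), 0, 0;
      0, 0, (x 1 ^ 2)⁻¹, 0; 0, 0, 0, (x 1 ^ 2 * Real.sin (x 2) ^ 2)⁻¹] := by
  refine Matrix.inv_eq_right_inv ?_
  ext i j
  fin_cases i <;> fin_cases j <;>
    simp [Background.metric, Background.h, Matrix.mul_apply, Fin.sum_univ_four, h1] <;> (try field_simp) <;> try ring

/-- The (τ, r) block has determinant −1 whatever h̃ is. -/
theorem density_eq (B : Background) {x : Fin 4 → ℝ} (h2 : 0 < Real.sin (x 2)) :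
    B.density x = x 1 ^ 2 * Real.sin (x 2) := by
  have : (B.metric x).det = -((x 1 ^ 2 * Real.sin (x 2)) ^ 2) := by
    simp [Background.metric, Matrix.det_succ_row_zero, Fin.sum_univ_succ, Matrix.submatrix,
      Fin.succAbove]
    ring
  rw [Background.density, this, abs_neg, abs_of_nonneg (sq_nonneg _), Real.sqrt_sq (by positivity)]

theorem coordDeriv_prod (a b c : ℝ → ℂ) (x : Fin 4 → ℝ) :
    coordDeriv 0 (fun y => a (y 1) * b (y 2) * c (y 3)) x = 0 ∧
    coordDeriv 1 (fun y => a (y 1) * b (y 2) * c (y 3)) x = deriv a (x 1) * b (x 2) * c (x 3) ∧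
    coordDeriv 2 (fun y => a (y 1) * b (y 2) * c (y 3)) x = a (x 1) * deriv b (x 2) * c (x 3) ∧
    coordDeriv 3 (fun y => a (y 1) * b (y 2) * c (y 3)) x = a (x 1) * b (x 2) * deriv c (x 3) := by
  refine ⟨?_, ?_, ?_, ?_⟩ <;> simp [coordDeriv, Function.update]

/-- The coordinate patch outside the horizon. -/
def patch : Set (Fin 4 → ℝ) := {y | 1 < y 1 ∧ 0 < y 2 ∧ y 2 < Real.pi}

theorem isOpen_patch : IsOpen patch :=
  (isOpen_lt continuous_const (continuous_apply 1)).inter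
    ((isOpen_lt continuous_const (continuous_apply 2)).inter
      (isOpen_lt (continuous_apply 2) continuous_const))

theorem coordDeriv_congr {F G : (Fin 4 → ℝ) → ℂ} (h : EqOn F G patch) (μ : Fin 4)
    {x : Fin 4 → ℝ} (hx : x ∈ patch) : coordDeriv μ F x = coordDeriv μ G x := by
  refine Filter.EventuallyEq.deriv_eq ?_
  have hc : ContinuousAt (fun s : ℝ => Function.update x μ s) (x μ) :=
    (continuous_const.update μ continuous_id).continuousAt
  have : ∀ᶠ s in 𝓝 (x μ), Function.update x μ s ∈ patch :=
    hc.eventually_mem (by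
      rw [Function.update_eq_self]
      exact isOpen_patch.mem_nhds hx)
  filter_upwards [this] with s hs using h hs

theorem gaugeDeriv_eq (B : Background) (F : (Fin 4 → ℝ) → ℂ) (x : Fin 4 → ℝ) :
    B.gaugeDeriv 0 F x = coordDeriv 0 F x + Complex.I * B.q / (x 1 : ℝ) * F x ∧
    B.gaugeDeriv 1 F x = coordDeriv 1 F x ∧ B.gaugeDeriv 2 F x = coordDeriv 2 F x ∧
    B.gaugeDeriv 3 F x = coordDeriv 3 F x := by
  refine ⟨?_, ?_, ?_, ?_⟩ <;> simp only [Background.gaugeDeriv, Background.potential, Background.q]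
  · push_cast
    ring
  all_goals simp

/-- No time derivative contributes, the angular part reduces to the Legendre equation, and what
remains is the radial operator for f. The weight 1/r inside and the factor r outside account for the
term Ω²′/r. -/
theorem box_separated (hB : B.Admissible) (hr : B.rPlus = 1) (hf : ContDiffOn ℝ ∞ f (Ioi 1))
    (l : ℕ) (m : ℤ) {x : Fin 4 → ℝ} (hx : x ∈ patch) :
    ((x 1 : ℝ) : ℂ) * B.chargedBox
      (fun y => ((y 1 : ℝ) : ℂ)⁻¹ * (f (y 1) * sphHarmonic l m (y 2) (y 3))) x
      = sphHarmonic l m (x 2) (x 3) * radialExpr B ((l : ℂ) * (l + 1)) f (x 1) := by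
  set a : ℝ → ℂ := fun s => (s : ℂ)⁻¹ * f s with ha
  set b : ℝ → ℂ := fun θ => (polar l m.natAbs θ : ℂ) with hb
  set c : ℝ → ℂ := fun φ => Complex.exp (Complex.I * m * φ) with hc
  have hΦ : (fun y : Fin 4 → ℝ => ((y 1 : ℝ) : ℂ)⁻¹ * (f (y 1) * sphHarmonic l m (y 2) (y 3)))
      = fun y => a (y 1) * b (y 2) * c (y 3) := by
    funext y
    rw [sphHarmonic_eq]
    simp only [ha, hb, hc]
    ring
  have hc1 : ∀ φ, HasDerivAt c (Complex.I * m * c φ) φ := fun φ => by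
    have := (((hasDerivAt_id φ).ofReal_comp.const_mul (Complex.I * (m : ℂ)))).cexp
    refine this.congr_deriv ?_
    simp only [hc, id]
    push_cast
    ring
  have hb1 : ∀ θ, deriv b θ = ((deriv (polar l m.natAbs) θ : ℝ) : ℂ) := fun θ =>
    (hasDerivAt_polar l m.natAbs θ).ofReal_comp.deriv
  obtain ⟨hx1, hx2, hx3⟩ := hx
  have hsin : 0 < Real.sin (x 2) := Real.sin_pos_of_pos_of_lt_pi hx2 hx3
  set A0 : ℝ → ℂ := fun s => (s : ℂ) ^ 2 * (-(B.ht s * B.h s) * (Complex.I * B.q / s * a s)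
    + (B.h s - 1) * deriv a s) with hA0
  set A1 : ℝ → ℂ := fun s => (s : ℂ) ^ 2 * ((B.h s - 1) * (Complex.I * B.q / s * a s)
    + B.OmegaSq s * deriv a s) with hA1
  set V : Fin 4 → (Fin 4 → ℝ) → ℂ := fun μ y => (B.density y : ℂ) *
    ∑ ν : Fin 4, (((B.metric y)⁻¹ μ ν : ℝ) : ℂ) *
      B.gaugeDeriv ν (fun y => a (y 1) * b (y 2) * c (y 3)) y with hV
  -- On the patch each flux component is a product of one-variable functions, so the outer
  -- derivatives act on a single factor.
  have hVall : ∀ y ∈ patch,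
      V 0 y = A0 (y 1) * (Real.sin (y 2) * b (y 2)) * c (y 3) ∧
      V 1 y = A1 (y 1) * (Real.sin (y 2) * b (y 2)) * c (y 3) ∧
      V 2 y = a (y 1) * (Real.sin (y 2) * deriv b (y 2)) * c (y 3) ∧
      V 3 y = a (y 1) * (b (y 2) / Real.sin (y 2)) * (Complex.I * m * c (y 3)) := by
    rintro y ⟨hy1, hy2, hy3⟩
    have hs : 0 < Real.sin (y 2) := Real.sin_pos_of_pos_of_lt_pi hy2 hy3
    have hsc : (Real.sin (y 2) : ℂ) ≠ 0 := by exact_mod_cast hs.ne'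
    have hy0 : y 1 ≠ 0 := by linarith
    have hyc : (y 1 : ℂ) ≠ 0 := by exact_mod_cast hy0
    obtain ⟨g0, g1, g2, g3⟩ := gaugeDeriv_eq B (fun y => a (y 1) * b (y 2) * c (y 3)) y
    obtain ⟨d0, d1, d2, d3⟩ := coordDeriv_prod a b c y
    rw [d0, zero_add] at g0
    rw [d1] at g1
    rw [d2] at g2
    rw [d3, (hc1 _).deriv] at g3
    refine ⟨?_, ?_, ?_, ?_⟩ <;> simp only [hV] <;>
      rw [density_eq B hs, metric_inv B hy0 hs.ne', Fin.sum_univ_four, g0, g1, g2, g3] <;>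
      simp [hA0, hA1] <;> field_simp
  obtain ⟨W0, W1, W2, W3⟩ := hVall x ⟨hx1, hx2, hx3⟩
  have hbox : B.chargedBox (fun y => a (y 1) * b (y 2) * c (y 3)) x =
      (B.density x : ℂ)⁻¹ * ∑ μ : Fin 4, B.gaugeDeriv μ (V μ) x := rfl
  have k1 := (coordDeriv_congr (fun y hy => (hVall y hy).1) 0 ⟨hx1, hx2, hx3⟩).trans
    (coordDeriv_prod A0 (fun θ => Real.sin θ * b θ) c x).1
  have k2 := (coordDeriv_congr (fun y hy => (hVall y hy).2.1) 1 ⟨hx1, hx2, hx3⟩).trans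
    (coordDeriv_prod A1 (fun θ => Real.sin θ * b θ) c x).2.1
  have k3 := (coordDeriv_congr (fun y hy => (hVall y hy).2.2.1) 2 ⟨hx1, hx2, hx3⟩).trans
    (coordDeriv_prod a (fun θ => Real.sin θ * deriv b θ) c x).2.2.1
  have k4 := (coordDeriv_congr (fun y hy => (hVall y hy).2.2.2) 3 ⟨hx1, hx2, hx3⟩).trans
    (coordDeriv_prod a (fun θ => b θ / Real.sin θ) (fun φ => Complex.I * m * c φ) x).2.2.2
  have hr0 : x 1 ≠ 0 := by linarith
  have hrc : (x 1 : ℂ) ≠ 0 := by exact_mod_cast hr0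
  have hsc : (Real.sin (x 2) : ℂ) ≠ 0 := by exact_mod_cast hsin.ne'
  have hf1 : ∀ s : ℝ, 1 < s → HasDerivAt f (deriv f s) s := fun s hs =>
    hasDerivAt_of_smooth isOpen_Ioi hf hs
  have hf2 : HasDerivAt (deriv f) (deriv (deriv f) (x 1)) (x 1) :=
    hasDerivAt_of_smooth isOpen_Ioi (contDiffOn_deriv_of_smooth isOpen_Ioi hf) hx1
  have hid : HasDerivAt (fun s : ℝ => (s : ℂ)) 1 (x 1) := (hasDerivAt_id (x 1)).ofReal_comp
  have ha1 : ∀ s : ℝ, 1 < s → deriv a s = (s : ℂ)⁻¹ * deriv f s - ((s : ℂ) ^ 2)⁻¹ * f s :=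
    fun s hs => by
      have hs0 : (s : ℂ) ≠ 0 := by exact_mod_cast (by linarith : s ≠ 0)
      have := (((hasDerivAt_id s).ofReal_comp.inv hs0).mul (hf1 s hs)).deriv
      refine Eq.trans this ?_
      simp only [id]
      push_cast
      field_simp
      simp only [Pi.inv_apply]
      field_simp
      ring
  have hO := hasDerivAt_OmegaSq B hr0
  have hh : HasDerivAt B.h (deriv B.h (x 1)) (x 1) :=
    ((hasDerivAt_ht hB hr hx1).mul hO).const_sub 2 |>.differentiableAt.hasDerivAt
  have hOf : HasDerivAt (fun s : ℝ => (B.OmegaSq s : ℂ) * deriv f s)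
      (deriv (fun s : ℝ => (B.OmegaSq s : ℂ) * deriv f s) (x 1)) (x 1) :=
    (hO.ofReal_comp.mul hf2).differentiableAt.hasDerivAt
  -- In terms of f the radial flux is (h − 1)iqf + rΩ²f′ − Ω²f; the block Ω²f′ is kept whole because
  -- the radial operator contains its derivative.
  have hA1' : HasDerivAt A1 _ (x 1) :=
    ((((hh.ofReal_comp.sub_const 1).mul ((hf1 _ hx1).const_mul (Complex.I * B.q))).add
      (hid.mul hOf)).sub (hO.ofReal_comp.mul (hf1 _ hx1))).congr_of_eventuallyEq (by
        filter_upwards [Ioi_mem_nhds hx1] with s hs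
        have hs0 : (s : ℂ) ≠ 0 := by
          have : (1 : ℝ) < s := hs
          exact_mod_cast (by linarith : s ≠ 0)
        simp only [hA1, Pi.mul_apply, Pi.add_apply, Pi.sub_apply]
        rw [ha1 s hs]
        simp only [ha]
        field_simp
        ring)
  have hB2 : deriv (fun θ => Real.sin θ * deriv b θ) (x 2) =
      ((((m.natAbs : ℝ) ^ 2 / Real.sin (x 2) - l * (l + 1) * Real.sin (x 2)) *
        polar l m.natAbs (x 2) : ℝ) : ℂ) := by
    have := (hasDerivAt_sin_mul_deriv_polar l m.natAbs hsin.ne').ofReal_comp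
    refine Eq.trans ?_ this.deriv
    congr 1
    funext θ
    rw [hb1]
    push_cast
    rfl
  -- The polar equation produces |m|², the azimuthal derivative m²; these two terms cancel.
  have hm : (m.natAbs : ℝ) ^ 2 = (m : ℝ) ^ 2 := by
    rw [Nat.cast_natAbs, Int.cast_abs, sq_abs]
  obtain ⟨g0, -, -, -⟩ := gaugeDeriv_eq B (V 0) x
  obtain ⟨-, g1, -, -⟩ := gaugeDeriv_eq B (V 1) x
  obtain ⟨-, -, g2, -⟩ := gaugeDeriv_eq B (V 2) x
  obtain ⟨-, -, -, g3⟩ := gaugeDeriv_eq B (V 3) x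
  rw [hΦ, hbox, Fin.sum_univ_four, g0, g1, g2, g3, k1, k2, k3, k4, W0, hA1'.deriv,
    ((hc1 (x 3)).const_mul _).deriv, hB2, density_eq B hsin, sphHarmonic_eq, radialExpr, hO.deriv]
  simp only [hA0, ha1 _ hx1]
  simp only [ha, hb]
  rw [show Complex.exp (Complex.I * m * x 3) = c (x 3) from rfl, hm]
  generalize Real.sin (x 2) = S at hsc ⊢
  generalize c (x 3) = c3
  generalize deriv (fun s : ℝ => (B.OmegaSq s : ℂ) * deriv f s) (x 1) = d2
  push_cast
  field_simp
  ring_nf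
  simp only [Complex.I_sq]
  ring

theorem isMode_of_solvesRadial (hB : B.Admissible) (hr : B.rPlus = 1) (l : ℕ) (m : ℤ)
    (h : B.SolvesRadial ((l : ℂ) * (l + 1)) f) : B.IsMode l m f := by
  refine ⟨h.1, fun x h1 h2 h3 => ?_⟩
  have h0 := h.1
  have h4 : radialExpr B ((l : ℂ) * (l + 1)) f (x 1) = 0 := h.2 _ h1
  rw [hr] at h0 h1
  rw [box_separated hB hr h0 l m ⟨h1, h2, h3⟩, h4, mul_zero]

theorem solvesRadial_of_isMode (hB : B.Admissible) (hr : B.rPlus = 1) {l : ℕ} {m : ℤ}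
    (hm : m.natAbs ≤ l) (h : B.IsMode l m f) : B.SolvesRadial ((l : ℂ) * (l + 1)) f := by
  refine ⟨h.1, fun r h1 => ?_⟩
  obtain ⟨θ, hθ0, hθ1, hθ⟩ := exists_polar_ne_zero hm
  have h2 := h.2 ![0, r, θ, 0] (by simpa using h1) (by simpa using hθ0) (by simpa using hθ1)
  have h0 := h.1
  rw [hr] at h0 h1
  rw [box_separated hB hr h0 l m ⟨by simpa using h1, by simpa using hθ0, by simpa using hθ1⟩,
    sphHarmonic_eq] at h2
  have h3 := (mul_eq_zero.1 h2).resolve_left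
    (mul_ne_zero (by exact_mod_cast hθ) (Complex.exp_ne_zero _))
  exact h3

end RNStat

namespace RNStat
open MeasureTheory

variable {κ q : ℝ} {β : ℂ}

/-! ### The connection formulas -/

/-- Γ(1 ± β) = ±βΓ(±β); the sign in `connRatio` absorbs the quotient of the two prefactors. -/
theorem Gamma_neg_div (h : β ≠ 0) :
    -Complex.Gamma (1 + -β) / Complex.Gamma (1 + β) = Complex.Gamma (-β) / Complex.Gamma β := by
  rw [add_comm 1 (-β), add_comm 1 β, Complex.Gamma_add_one _ h,
    Complex.Gamma_add_one _ (neg_ne_zero.2 h), neg_mul, neg_neg, mul_div_mul_left _ _ h]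

theorem pa_eq_stmt (q : ℝ) (β : ℂ) : pa q β = 1 / 2 + β / 2 + Complex.I * q ∧
    pa q (-β) = 1 / 2 - β / 2 + Complex.I * q := by
  constructor <;> simp only [pa] <;> ring

theorem connRatio_eq_extremal (hq : q ≠ 0) (hβ : β ∈ strip) (h : β ≠ 0) :
    connRatio 0 q β = ratioExtremal q β := by
  have hn := neg_mem_strip hβ
  have h2 : 2 * Complex.I * (q : ℂ) ≠ 0 := Complex.slitPlane_ne_zero (two_I_mul_mem_slitPlane hq)
  rw [connRatio, conn_eq le_rfl hq hβ, conn_eq le_rfl hq hn, connVal, connVal, if_pos rfl,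
    if_pos rfl, neg_neg, ratioExtremal, ← Gamma_neg_div h, ← (pa_eq_stmt q β).1,
    ← (pa_eq_stmt q β).2]
  have e : (2 * Complex.I * (q : ℂ)) ^ pa q β =
      (2 * Complex.I * (q : ℂ)) ^ pa q (-β) * (2 * Complex.I * (q : ℂ)) ^ β := by
    rw [← Complex.cpow_add _ _ h2]
    congr 1
    simp only [pa]
    ring
  have n1 : (2 * Complex.I * (q : ℂ)) ^ pa q (-β) ≠ 0 := by simp [Complex.cpow_eq_zero_iff, hq]
  have g1 := Complex.Gamma_ne_zero_of_re_pos (one_add_re_pos (strip_bounds hβ).1)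
  have g2 := Complex.Gamma_ne_zero_of_re_pos (pa_re_pos q (strip_bounds hβ).1)
  have g3 := Complex.Gamma_ne_zero_of_re_pos (pa_re_pos q (strip_bounds hn).1)
  rw [e]
  generalize (2 * Complex.I * (q : ℂ)) ^ pa q (-β) = P at n1 ⊢
  field_simp

/-- With r₊ = 1 this makes c − a and c − b equal to 1/2 ∓ β/2 + iP. -/
theorem horizonCharge_eq (hκ : κ ≠ 0) (q : ℝ) : horizonCharge q (1 - 2 * κ) 1 κ = q / κ - q := by
  rw [horizonCharge]
  field_simp
  ring

theorem connRatio_eq_subextremal (hκ : 0 < κ) (hq : q ≠ 0) (hβ : β ∈ strip) (h : β ≠ 0) :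
    connRatio κ q β = ratioSubextremal q (1 - 2 * κ) 1 κ β := by
  have hn := neg_mem_strip hβ
  have hk : (0 : ℝ) < 2 * κ := by positivity
  have hk' : (κ : ℂ) ≠ 0 := by exact_mod_cast hκ.ne'
  have e1 : nuPar κ q β = 1 / 2 - β / 2 + Complex.I * horizonCharge q (1 - 2 * κ) 1 κ := by
    rw [horizonCharge_eq hκ.ne', nuPar, pa]
    push_cast
    ring
  have e2 : nuPar κ q (-β) = 1 / 2 + β / 2 + Complex.I * horizonCharge q (1 - 2 * κ) 1 κ := by
    rw [horizonCharge_eq hκ.ne', nuPar, pa]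
    push_cast
    ring
  rw [connRatio, conn_eq hκ.le hq hβ, conn_eq hκ.le hq hn, connVal, connVal, if_neg hκ.ne',
    if_neg hκ.ne', neg_neg, ratioSubextremal, ← Gamma_neg_div h, ← (pa_eq_stmt q β).1,
    ← (pa_eq_stmt q β).2, ← e1, ← e2, show (1 : ℝ) - (1 - 2 * κ) = 2 * κ by ring]
  have e : ((2 * κ : ℝ) : ℂ) ^ pa q β =
      ((2 * κ : ℝ) : ℂ) ^ pa q (-β) * ((2 * κ : ℝ) : ℂ) ^ β := by
    rw [← Complex.cpow_add _ _ (by exact_mod_cast hk.ne')]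
    congr 1
    simp only [pa]
    ring
  have n1 := cpow_ne_zero_of_pos hk (pa q (-β))
  have g1 := Complex.Gamma_ne_zero_of_re_pos (one_add_re_pos (strip_bounds hβ).1)
  have g2 := Complex.Gamma_ne_zero_of_re_pos (pa_re_pos q (strip_bounds hβ).1)
  have g3 := Complex.Gamma_ne_zero_of_re_pos (pa_re_pos q (strip_bounds hn).1)
  have g4 := Complex.Gamma_ne_zero_of_re_pos (c_re_pos κ q)
  have g5 := Complex.Gamma_ne_zero_of_re_pos (nuPar_re_pos (κ := κ) q (strip_bounds hn).2)
  have g6 := Complex.Gamma_ne_zero_of_re_pos (nuPar_re_pos (κ := κ) q (strip_bounds hβ).2)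
  rw [e]
  generalize ((2 * κ : ℝ) : ℂ) ^ pa q (-β) = P at n1 ⊢
  generalize Complex.Gamma (1 + Complex.I * q / κ) = G at g4 ⊢
  field_simp

/-! ### Moduli of the connection coefficients -/

/-- Reflection formula on the critical line, where 1 − z is the conjugate of z. -/
theorem norm_Gamma_half_sq (x : ℝ) :
    ‖Complex.Gamma (1 / 2 + Complex.I * x)‖ ^ 2 = Real.pi / Real.cosh (Real.pi * x) := by
  have h1 := Complex.Gamma_mul_Gamma_one_sub (1 / 2 + Complex.I * x)
  have e1 : 1 - (1 / 2 + Complex.I * (x : ℂ)) = (starRingEnd ℂ) (1 / 2 + Complex.I * x) := by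
    simp only [map_add, map_mul, map_div₀, map_one, map_ofNat, Complex.conj_I, Complex.conj_ofReal]
    ring
  have e2 : Complex.sin (Real.pi * (1 / 2 + Complex.I * x)) = Complex.cosh ((Real.pi * x : ℝ) : ℂ) := by
    have : (Real.pi : ℂ) * (1 / 2 + Complex.I * x) = ((Real.pi * x : ℝ) : ℂ) * Complex.I + Real.pi / 2 := by
      push_cast; ring
    rw [this, Complex.sin_add_pi_div_two, Complex.cos_mul_I]
  rw [e1, Complex.Gamma_conj, Complex.mul_conj, e2, ← Complex.ofReal_cosh] at h1
  rw [← Complex.normSq_eq_norm_sq]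
  exact_mod_cast h1

/-- The logarithm of the modulus of a quotient of Gamma functions. -/
noncomputable def logCosh (p s : ℝ) : ℝ :=
  Real.log (Real.cosh (Real.pi * (p - s / 2)) / Real.cosh (Real.pi * (p + s / 2)))

theorem log_norm_Gamma_div (p s : ℝ) :
    Real.log ‖Complex.Gamma (1 / 2 + Complex.I * s / 2 + Complex.I * p) /
      Complex.Gamma (1 / 2 - Complex.I * s / 2 + Complex.I * p)‖ = 1 / 2 * logCosh p s := by
  have e1 : (1 / 2 + Complex.I * s / 2 + Complex.I * p : ℂ)
      = 1 / 2 + Complex.I * ((p + s / 2 : ℝ) : ℂ) := by push_cast; ring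
  have e2 : (1 / 2 - Complex.I * s / 2 + Complex.I * p : ℂ)
      = 1 / 2 + Complex.I * ((p - s / 2 : ℝ) : ℂ) := by push_cast; ring
  have h1 := norm_Gamma_half_sq (p + s / 2)
  have h2 := norm_Gamma_half_sq (p - s / 2)
  have c1 := Real.cosh_pos (Real.pi * (p + s / 2))
  have c2 := Real.cosh_pos (Real.pi * (p - s / 2))
  have hpi := Real.pi_pos
  rw [e1, e2, norm_div, logCosh]
  have h3 : Real.cosh (Real.pi * (p - s / 2)) / Real.cosh (Real.pi * (p + s / 2)) =
      (‖Complex.Gamma (1 / 2 + Complex.I * ((p + s / 2 : ℝ) : ℂ))‖ /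
        ‖Complex.Gamma (1 / 2 + Complex.I * ((p - s / 2 : ℝ) : ℂ))‖) ^ 2 := by
    rw [div_pow, h1, h2]
    field_simp
  rw [h3, Real.log_pow]
  push_cast
  ring

theorem logCosh_neg (p s : ℝ) : logCosh (-p) s = -logCosh p s := by
  rw [logCosh, logCosh, ← Real.log_inv, inv_div, ← Real.cosh_neg (Real.pi * (-p - s / 2)),
    ← Real.cosh_neg (Real.pi * (-p + s / 2))]
  congr 3 <;> ring_nf

theorem sign_mul_logCosh (hq : q ≠ 0) (s : ℝ) : q.sign * logCosh q s = logCosh |q| s := by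
  rcases lt_or_gt_of_ne hq with h | h
  · rw [Real.sign_of_neg h, abs_of_neg h, logCosh_neg]; ring
  · rw [Real.sign_of_pos h, abs_of_pos h, one_mul]

theorem sign_mul_logCosh_horizonCharge (hq : q ≠ 0) (rm rp kap s : ℝ) :
    q.sign * logCosh (horizonCharge q rm rp kap) s = logCosh (horizonCharge |q| rm rp kap) s := by
  rcases lt_or_gt_of_ne hq with h | h
  · have : horizonCharge |q| rm rp kap = -horizonCharge q rm rp kap := by
      rw [abs_of_neg h, horizonCharge, horizonCharge]; ring
    rw [Real.sign_of_neg h, this, logCosh_neg]; ring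
  · rw [Real.sign_of_pos h, abs_of_pos h, one_mul]

/-- The two arguments are complex conjugates, so this factor does not affect the modulus. -/
theorem norm_Gamma_neg_div {s : ℝ} (hs : s ≠ 0) :
    ‖Complex.Gamma (-(Complex.I * s)) / Complex.Gamma (Complex.I * s)‖ = 1 := by
  have e : -(Complex.I * (s : ℂ)) = (starRingEnd ℂ) (Complex.I * s) := by simp
  rw [e, Complex.Gamma_conj, norm_div, RCLike.norm_conj, div_self]
  rw [norm_ne_zero_iff]
  refine Complex.Gamma_ne_zero fun m hm => hs ?_
  have := congrArg Complex.im hm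
  simpa using this

theorem arg_two_I_mul (hq : q ≠ 0) : Complex.arg (2 * Complex.I * q) = q.sign * (Real.pi / 2) := by
  rcases lt_or_gt_of_ne hq with h | h
  · have : (2 * Complex.I * q : ℂ) = ((-2 * q : ℝ) : ℂ) * (-Complex.I) := by push_cast; ring
    rw [this, Complex.arg_real_mul _ (by linarith), Complex.arg_neg_I, Real.sign_of_neg h]
    ring
  · have : (2 * Complex.I * q : ℂ) = ((2 * q : ℝ) : ℂ) * Complex.I := by push_cast; ring
    rw [this, Complex.arg_real_mul _ (by linarith), Complex.arg_I, Real.sign_of_pos h]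
    ring

theorem sign_mul_sign (hq : q ≠ 0) : q.sign * q.sign = 1 := by
  rcases lt_or_gt_of_ne hq with h | h
  · rw [Real.sign_of_neg h]; norm_num
  · rw [Real.sign_of_pos h]; norm_num

theorem Gamma_div_ne_zero (p s : ℝ) :
    ‖Complex.Gamma (1 / 2 + Complex.I * s / 2 + Complex.I * p) /
      Complex.Gamma (1 / 2 - Complex.I * s / 2 + Complex.I * p)‖ ≠ 0 := by
  rw [norm_ne_zero_iff]
  refine div_ne_zero (Complex.Gamma_ne_zero_of_re_pos ?_) (Complex.Gamma_ne_zero_of_re_pos ?_) <;>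
    simp

theorem logRatioExtremal_eq (q s : ℝ) :
    logRatioExtremal q s = -(Real.pi / 2) * (s - 1 / Real.pi * logCosh |q| s) := rfl

theorem logRatioSubextremal_eq (q s rm rp kap : ℝ) :
    logRatioSubextremal q s rm rp kap = -(Real.pi / 2) * (s - 1 / Real.pi * logCosh |q| s) +
      Real.pi / 2 * (s + 1 / Real.pi * logCosh (horizonCharge |q| rm rp kap) s) := by
  rw [logRatioSubextremal, logCosh, logCosh, ← neg_neg (Real.log (Real.cosh (Real.pi *
    (horizonCharge |q| rm rp kap - s / 2)) / _)), ← Real.log_inv, inv_div]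
  ring

/-- The power of 2iq has modulus exp(−sign(q)πs/2), since its argument is sign(q)π/2. In the
sub-extremal case the base is positive and the corresponding modulus is 1. -/
theorem sign_mul_log_norm_ratioExtremal (hq : q ≠ 0) {s : ℝ} (hs : s ≠ 0) :
    q.sign * Real.log ‖ratioExtremal q (Complex.I * s)‖ = logRatioExtremal q s := by
  have h2 : 2 * Complex.I * (q : ℂ) ≠ 0 := Complex.slitPlane_ne_zero (two_I_mul_mem_slitPlane hq)
  have h3 : ‖(2 * Complex.I * (q : ℂ)) ^ (Complex.I * (s : ℂ))‖
      = Real.exp (-(q.sign * (Real.pi / 2) * s)) := by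
    rw [Complex.norm_cpow_of_ne_zero h2, arg_two_I_mul hq, Real.exp_neg]
    simp
  rw [ratioExtremal, norm_mul, norm_mul, norm_Gamma_neg_div hs, mul_one, h3,
    Real.log_mul (Real.exp_pos _).ne' (Gamma_div_ne_zero q s), Real.log_exp, log_norm_Gamma_div,
    logRatioExtremal_eq, ← sign_mul_logCosh hq]
  have hp := Real.pi_pos.ne'
  field_simp
  linear_combination (-s * Real.pi) * sign_mul_sign hq

theorem sign_mul_log_norm_ratioSubextremal (hq : q ≠ 0) {s rm rp : ℝ} (kap : ℝ) (hr : rm < rp)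
    (hs : s ≠ 0) : q.sign * Real.log ‖ratioSubextremal q rm rp kap (Complex.I * s)‖
      = logRatioSubextremal q s rm rp kap := by
  have h3 : ‖((rp - rm : ℝ) : ℂ) ^ (Complex.I * (s : ℂ))‖ = 1 := by
    rw [Complex.norm_cpow_eq_rpow_re_of_pos (by linarith)]
    simp
  rw [ratioSubextremal, norm_mul, norm_mul, norm_mul, norm_Gamma_neg_div hs, mul_one, h3, one_mul,
    Real.log_mul (Gamma_div_ne_zero q s) (Gamma_div_ne_zero _ s), log_norm_Gamma_div,
    log_norm_Gamma_div, logRatioSubextremal_eq, ← sign_mul_logCosh hq,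
    ← sign_mul_logCosh_horizonCharge hq]
  have hp := Real.pi_pos.ne'
  field_simp
  ring

theorem hasDerivAt_logCosh (p : ℝ) :
    HasDerivAt (logCosh p) (-(Real.pi * Real.tanh (Real.pi * p))) 0 := by
  have h1 : HasDerivAt (fun s : ℝ => Real.cosh (Real.pi * (p - s / 2)))
      (Real.sinh (Real.pi * (p - 0 / 2)) * (Real.pi * (-(1 / 2)))) 0 :=
    ((((hasDerivAt_id (0 : ℝ)).div_const 2).const_sub p).const_mul Real.pi).cosh
  have h2 : HasDerivAt (fun s : ℝ => Real.cosh (Real.pi * (p + s / 2)))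
      (Real.sinh (Real.pi * (p + 0 / 2)) * (Real.pi * (1 / 2))) 0 :=
    ((((hasDerivAt_id (0 : ℝ)).div_const 2).const_add p).const_mul Real.pi).cosh
  have c1 := Real.cosh_pos (Real.pi * (p - 0 / 2))
  have c2 := Real.cosh_pos (Real.pi * (p + 0 / 2))
  refine ((h1.div h2 c2.ne').log (div_pos c1 c2).ne').congr_deriv ?_
  simp only [zero_div, sub_zero, add_zero, Pi.div_apply]
  rw [Real.tanh_eq_sinh_div_cosh]
  have := (Real.cosh_pos (Real.pi * p)).ne'
  field_simp
  ring

theorem hasDerivAt_logRatioExtremal (q : ℝ) :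
    HasDerivAt (logRatioExtremal q) (imRatioExtremal q) 0 := by
  have := ((hasDerivAt_id (0 : ℝ)).sub ((hasDerivAt_logCosh |q|).const_mul
    (1 / Real.pi))).const_mul (-(Real.pi / 2))
  refine this.congr_deriv ?_
  have := Real.pi_pos.ne'
  rw [imRatioExtremal]
  field_simp
  ring

theorem hasDerivAt_logRatioSubextremal (q rm rp kap : ℝ) :
    HasDerivAt (fun s => logRatioSubextremal q s rm rp kap) (imRatioSubextremal q rm rp kap) 0 := by
  have h := (((hasDerivAt_id (0 : ℝ)).sub ((hasDerivAt_logCosh |q|).const_mul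
    (1 / Real.pi))).const_mul (-(Real.pi / 2))).add (((hasDerivAt_id (0 : ℝ)).add
    ((hasDerivAt_logCosh (horizonCharge |q| rm rp kap)).const_mul
    (1 / Real.pi))).const_mul (Real.pi / 2))
  refine (h.congr_of_eventuallyEq (Eventually.of_forall fun s => ?_)).congr_deriv ?_
  · exact logRatioSubextremal_eq q s rm rp kap
  · have := Real.pi_pos.ne'
    rw [imRatioSubextremal]
    field_simp
    ring

/-! ### The extremal limit -/

theorem tendsto_exp_neg_two_mul (a : ℝ) :
    Tendsto (fun x : ℝ => Real.exp (-2 * (x + a))) atTop (𝓝 0) := by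
  refine Real.tendsto_exp_atBot.comp ?_
  exact (tendsto_atTop_add_const_right _ a tendsto_id).const_mul_atTop_of_neg (by norm_num)

theorem cosh_eq_exp_mul (x : ℝ) : Real.cosh x = Real.exp x * ((1 + Real.exp (-2 * x)) / 2) := by
  rw [Real.cosh_eq, show -x = x + -2 * x by ring, Real.exp_add]
  ring

/-- The quotient of hyperbolic cosines tends to e^(2a). As |P| → ∞ this makes the horizon
contribution to the sub-extremal formula vanish. -/
theorem tendsto_log_cosh_div (a : ℝ) :
    Tendsto (fun x : ℝ => Real.log (Real.cosh (x + a) / Real.cosh (x - a))) atTop (𝓝 (2 * a)) := by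
  have t1 := (tendsto_exp_neg_two_mul a).const_add 1
  have t2 := (tendsto_exp_neg_two_mul (-a)).const_add 1
  rw [add_zero] at t1 t2
  have t3 := ((t1.log one_ne_zero).sub (t2.log one_ne_zero)).const_add (2 * a)
  rw [sub_self, add_zero] at t3
  refine t3.congr fun x => ?_
  have p1 : 0 < 1 + Real.exp (-2 * (x + a)) := by positivity
  have p2 : 0 < 1 + Real.exp (-2 * (x + -a)) := by positivity
  rw [← sub_eq_add_neg] at p2 ⊢
  rw [cosh_eq_exp_mul (x + a), cosh_eq_exp_mul (x - a), Real.log_div (by positivity) (by positivity),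
    Real.log_mul (Real.exp_pos _).ne' (by positivity),
    Real.log_mul (Real.exp_pos _).ne' (by positivity), Real.log_div p1.ne' two_ne_zero,
    Real.log_div p2.ne' two_ne_zero, Real.log_exp, Real.log_exp]
  ring

theorem tendsto_tanh_atTop : Tendsto Real.tanh atTop (𝓝 1) := by
  have t := tendsto_exp_neg_two_mul 0
  have := (t.const_sub 1).div (t.const_add 1) (by norm_num)
  rw [sub_zero, add_zero, div_one] at this
  refine this.congr fun x => ?_
  have h := Real.exp_pos x
  have e : Real.exp (-x) = Real.exp x * Real.exp (-2 * (x + 0)) := by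
    rw [← Real.exp_add]; congr 1; ring
  rw [Real.tanh_eq_sinh_div_cosh, Real.sinh_eq, Real.cosh_eq, e]
  have : 0 < 1 + Real.exp (-2 * (x + 0)) := by positivity
  have h2 : 0 < Real.exp x + Real.exp x * Real.exp (-2 * (x + 0)) := by positivity
  simp only [Pi.div_apply]
  field_simp

theorem tendsto_horizonCharge (hq : q ≠ 0) :
    Tendsto (fun kap : ℝ => Real.pi * horizonCharge |q| (1 - 2 * kap) 1 kap) (𝓝[>] 0) atTop := by
  have h0 : 0 < |q| := abs_pos.2 hq
  have h1 : Tendsto (fun kap : ℝ => |q| * kap⁻¹ + -|q|) (𝓝[>] 0) atTop :=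
    tendsto_atTop_add_const_right _ _ (tendsto_inv_nhdsGT_zero.const_mul_atTop h0)
  refine (h1.const_mul_atTop Real.pi_pos).congr' ?_
  filter_upwards [self_mem_nhdsWithin] with kap hk
  rw [horizonCharge_eq (ne_of_gt hk), div_eq_mul_inv]
  ring

theorem tendsto_logRatioSubextremal (hq : q ≠ 0) (s : ℝ) :
    Tendsto (fun kap : ℝ => logRatioSubextremal q s (1 - 2 * kap) 1 kap) (𝓝[>] 0)
      (𝓝 (logRatioExtremal q s)) := by
  have h := (tendsto_log_cosh_div (Real.pi * (s / 2))).comp (tendsto_horizonCharge hq)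
  have h2 := (((h.const_mul (1 / Real.pi)).const_sub s).const_mul (Real.pi / 2)).const_add
    (logRatioExtremal q s)
  have e : logRatioExtremal q s + Real.pi / 2 * (s - 1 / Real.pi * (2 * (Real.pi * (s / 2))))
      = logRatioExtremal q s := by
    have := Real.pi_pos.ne'
    field_simp
    ring
  rw [e] at h2
  refine h2.congr fun kap => ?_
  simp only [Function.comp, logRatioSubextremal, logRatioExtremal, mul_add, mul_sub]

theorem tendsto_imRatioSubextremal (hq : q ≠ 0) :
    Tendsto (fun kap : ℝ => imRatioSubextremal q (1 - 2 * kap) 1 kap) (𝓝[>] 0)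
      (𝓝 (imRatioExtremal q)) := by
  have h := tendsto_tanh_atTop.comp (tendsto_horizonCharge hq)
  have h2 := (((h.const_sub 1).sub_const (2 * Real.tanh (Real.pi * |q|))).const_mul
    (Real.pi / 2)).const_add (-(Real.pi / 2) * (1 - Real.tanh (Real.pi * |q|)))
  have e : -(Real.pi / 2) * (1 - Real.tanh (Real.pi * |q|)) + Real.pi / 2 *
      (1 - 1 - 2 * Real.tanh (Real.pi * |q|)) = imRatioExtremal q := by
    rw [imRatioExtremal]; ring
  rw [e] at h2
  exact h2

/-! ### The phase derivative at `β = 0` -/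

theorem I_mul_mem_strip (s : ℝ) : Complex.I * (s : ℂ) ∈ strip := by simp [strip]

theorem sign_mul_log_norm_connRatio_extremal (hq : q ≠ 0) (s : ℝ) :
    q.sign * Real.log ‖connRatio 0 q (Complex.I * s)‖ = logRatioExtremal q s := by
  rcases eq_or_ne s 0 with rfl | hs
  · rw [Complex.ofReal_zero, mul_zero, connRatio_zero le_rfl hq, logRatioExtremal_eq, logCosh]
    simp [(Real.cosh_pos _).ne']
  · rw [connRatio_eq_extremal hq (I_mul_mem_strip s) (by simpa using hs),
      sign_mul_log_norm_ratioExtremal hq hs]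

theorem sign_mul_log_norm_connRatio_subextremal (hκ : 0 < κ) (hq : q ≠ 0) (s : ℝ) :
    q.sign * Real.log ‖connRatio κ q (Complex.I * s)‖ = logRatioSubextremal q s (1 - 2 * κ) 1 κ := by
  rcases eq_or_ne s 0 with rfl | hs
  · rw [Complex.ofReal_zero, mul_zero, connRatio_zero hκ.le hq, logRatioSubextremal_eq, logCosh,
      logCosh]
    simp [(Real.cosh_pos _).ne']
  · rw [connRatio_eq_subextremal hκ hq (I_mul_mem_strip s) (by simpa using hs),
      sign_mul_log_norm_ratioSubextremal hq _ (by linarith) hs]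

theorem hasDerivAt_comp_I_mul {R : ℂ → ℂ} (hR : DifferentiableAt ℂ R 0) :
    HasDerivAt (fun s : ℝ => R (Complex.I * s)) (Complex.I * deriv R 0) 0 := by
  have h1 : HasDerivAt (fun s : ℝ => Complex.I * (s : ℂ)) Complex.I 0 := by
    simpa using (hasDerivAt_id (0 : ℝ)).ofReal_comp.const_mul Complex.I
  have h2 : HasDerivAt R (deriv R 0) (Complex.I * ((0 : ℝ) : ℂ)) := by
    simpa using hR.hasDerivAt
  have := h2.comp (0 : ℝ) h1
  rw [mul_comm] at this
  exact this

theorem hasDerivAt_log_norm_comp {R : ℂ → ℂ} (hR : DifferentiableAt ℂ R 0) (h0 : R 0 = -1) :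
    HasDerivAt (fun s : ℝ => Real.log ‖R (Complex.I * s)‖) (deriv R 0).im 0 := by
  -- R(0) = −1 is outside the slit plane; −R has the same modulus and takes the value 1 there.
  have h1 := (hasDerivAt_comp_I_mul hR).neg.clog_real (by simp [h0])
  have h2 := Complex.reCLM.hasFDerivAt.comp_hasDerivAt (0 : ℝ) h1
  refine (h2.congr_of_eventuallyEq (Eventually.of_forall fun s => ?_)).congr_deriv ?_
  · simp [Complex.log_re]
  · simp [h0]

theorem sign_mul_im_deriv_connRatio_extremal (hq : q ≠ 0) :
    q.sign * (deriv (connRatio 0 q) 0).im = imRatioExtremal q := by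
  have h := (hasDerivAt_log_norm_comp (differentiableAt_connRatio le_rfl hq zero_mem_strip)
    (connRatio_zero le_rfl hq)).const_mul q.sign
  simp only [sign_mul_log_norm_connRatio_extremal hq] at h
  exact h.unique (hasDerivAt_logRatioExtremal q)

theorem sign_mul_im_deriv_connRatio_subextremal (hκ : 0 < κ) (hq : q ≠ 0) :
    q.sign * (deriv (connRatio κ q) 0).im = imRatioSubextremal q (1 - 2 * κ) 1 κ := by
  have h := (hasDerivAt_log_norm_comp (differentiableAt_connRatio hκ.le hq zero_mem_strip)
    (connRatio_zero hκ.le hq)).const_mul q.sign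
  simp only [sign_mul_log_norm_connRatio_subextremal hκ hq] at h
  exact h.unique (hasDerivAt_logRatioSubextremal q _ _ _)

/-! ### The parameter `β_ℓ` -/

theorem betaL_sq (l : ℕ) (q : ℝ) : betaL l q ^ 2 = (((2 * l + 1) ^ 2 - 4 * q ^ 2 : ℝ) : ℂ) := by
  rw [betaL]
  rcases le_total 0 ((2 * l + 1 : ℝ) ^ 2 - 4 * q ^ 2) with h | h
  · rw [Real.sqrt_eq_zero_of_nonpos (by linarith : 4 * q ^ 2 - (2 * l + 1 : ℝ) ^ 2 ≤ 0),
      Complex.ofReal_zero, zero_mul, add_zero, ← Complex.ofReal_pow, Real.sq_sqrt h]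
  · rw [Real.sqrt_eq_zero_of_nonpos h, Complex.ofReal_zero, zero_add, mul_pow, Complex.I_sq,
      ← Complex.ofReal_pow, Real.sq_sqrt (by linarith)]
    push_cast
    ring

theorem sepConst_betaL (l : ℕ) (q : ℝ) : sepConst q (betaL l q) = (l : ℂ) * (l + 1) := by
  rw [sepConst, betaL_sq]
  push_cast
  ring

/-- The real part is below 1 exactly when (2ℓ + 1)² − 4q² < 1. -/
theorem betaL_mem_strip {l : ℕ} (h : (l * (l + 1) : ℝ) < q ^ 2) : betaL l q ∈ strip := by
  have e : (betaL l q).re = Real.sqrt ((2 * l + 1) ^ 2 - 4 * q ^ 2) := by simp [betaL]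
  rw [strip, mem_ofPred_eq, e, abs_of_nonneg (Real.sqrt_nonneg _), Real.sqrt_lt' one_pos]
  linarith

theorem betaL_eq_of_imag {l : ℕ} (h : (2 * l + 1 : ℝ) ^ 2 < 4 * q ^ 2) :
    betaL l q = Complex.I * ((betaL l q).im : ℂ) ∧ (betaL l q).im ≠ 0 := by
  have h0 : Real.sqrt ((2 * l + 1 : ℝ) ^ 2 - 4 * q ^ 2) = 0 :=
    Real.sqrt_eq_zero_of_nonpos (by linarith)
  have e : betaL l q = (Real.sqrt (4 * q ^ 2 - (2 * l + 1) ^ 2) : ℂ) * Complex.I := by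
    rw [betaL, h0, Complex.ofReal_zero, zero_add]
  have e2 : (betaL l q).im = Real.sqrt (4 * q ^ 2 - (2 * l + 1) ^ 2) := by rw [e]; simp
  refine ⟨by rw [e2, e, mul_comm], ?_⟩
  rw [e2]
  exact (Real.sqrt_pos.2 (by linarith)).ne'

theorem betaL_eq_of_le {l : ℕ} (h : q ^ 2 ≤ (l * (l + 1) : ℝ)) :
    ∃ b : ℝ, 1 ≤ b ∧ betaL l q = b := by
  refine ⟨Real.sqrt ((2 * l + 1) ^ 2 - 4 * q ^ 2), ?_, ?_⟩
  · rw [Real.one_le_sqrt]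
    linarith
  · rw [betaL, Real.sqrt_eq_zero_of_nonpos (by linarith : 4 * q ^ 2 - (2 * l + 1 : ℝ) ^ 2 ≤ 0)]
    simp

end RNStat

namespace RNStat
open MeasureTheory

variable {B : Background} {β lam N : ℂ} {φ ψ f p : ℝ → ℂ}

/-! ### Solutions of the radial equation -/

theorem lift_horizonNormalised (hB : B.Admissible) (hr : B.rPlus = 1)
    (h : ContDiffOn ℝ ∞ φ (Ici 0)) (h0 : φ 0 = 1) : B.HorizonNormalised (lift B φ) := by
  rw [Background.HorizonNormalised, hr]
  refine ⟨lift_smooth hB hr Subset.rfl (fun r h1 => sub_nonneg.2 h1) h, ?_⟩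
  simp [lift, gaugePhase_one, h0]

theorem eqOn_lift_of_horizonNormalised (hB : B.Admissible) (hr : B.rPlus = 1)
    (hφ : IsRed B.kappaPlus B.q lam φ) (hφ' : ContDiffOn ℝ ∞ φ (Ici 0)) (hφ0 : φ 0 = 1)
    (hψ : IsRed B.kappaPlus B.q lam ψ) (hw : wr B.kappaPlus B.q φ ψ 1 ≠ 0)
    (hf : B.SolvesRadial lam f) (hf' : B.HorizonNormalised f) : EqOn f (lift B φ) (Ici 1) := by
  rw [Background.HorizonNormalised, hr] at hf'
  have hs : ContDiffOn ℝ ∞ (lower B f) (Ici 0) := lower_smooth hB hr Subset.rfl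
    (fun y hy => by
      have : (0 : ℝ) ≤ y := hy
      exact le_add_of_nonneg_right this) hf'.1
  have h0 : lower B f 0 = 1 := by simp [lower, gaugePhase_one, hf'.2]
  have h1 := (lower_isRed hB hr hf).eqOn_of_regular (params hB hr).1 hφ hψ hs hφ' hw
    (by rw [h0, hφ0]) (by rw [hφ0]; exact one_ne_zero)
  intro r h
  have h2 : (1 : ℝ) ≤ r := h
  rw [← lift_lower B f (by linarith : r ≠ 0), lift, lift, h1 (sub_nonneg.2 h2)]

theorem eqOn_lift_lower (B : Background) (f : ℝ → ℂ) : EqOn f (lift B (lower B f)) (Ioi 1) :=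
  fun r h => by
    have : (1 : ℝ) < r := h
    exact (lift_lower B f (by linarith : r ≠ 0)).symm

theorem eqOn_lift (hN : N ≠ 0) (h : EqOn (fun y => N * lower B f y) φ (Ioi 0)) :
    EqOn f (lift B fun y => N⁻¹ * φ y) (Ioi 1) := by
  intro r hr'
  rw [eqOn_lift_lower B f hr', lift, lift, ← h (show (0 : ℝ) < r - 1 from sub_pos.2 hr')]
  simp only
  rw [inv_mul_cancel_left₀ hN]

theorem lift_minus (hB : B.Admissible) (hr : B.rPlus = 1) (hN : IsPhaseLimit B N)
    (hβ : -1 < β.re) (hp : IsRed B.kappaPlus B.q (sepConst B.q β) p)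
    (hw : wr B.kappaPlus B.q (infSol B.kappaPlus B.q β) p 1 ≠ 0) :
    B.SolvesRadial (sepConst B.q β) (lift B fun y => N⁻¹ * infSol B.kappaPlus B.q β y) ∧
    B.MinusAsymptotics β (lift B fun y => N⁻¹ * infSol B.kappaPlus B.q β y) ∧
    ∀ f, B.SolvesRadial (sepConst B.q β) f → B.MinusAsymptotics β f →
      EqOn f (lift B fun y => N⁻¹ * infSol B.kappaPlus B.q β y) (Ioi 1) := by
  have hκ := (params hB hr).1
  refine ⟨lift_solvesRadial hB hr ((infSol_isRed hκ hβ).const_mul _), ?_, fun f hf ha => ?_⟩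
  · rw [minusAsymptotics_lift hB hr hN fun _ _ => rfl]
    simp only [mul_inv_cancel_left₀ hN.1]
    exact asyMinus_infSol hκ hβ
  · rw [minusAsymptotics_lift hB hr hN (eqOn_lift_lower B f)] at ha
    exact eqOn_lift hN.1 (eqOn_infSol_of_asyMinus hκ hβ hp hw ((lower_isRed hB hr hf).const_mul N) ha)

theorem lift_plus (hB : B.Admissible) (hr : B.rPlus = 1) (hN : IsPhaseLimit B N)
    (hβ : -1 < β.re) (hp : IsRed B.kappaPlus B.q (sepConst B.q β) p)
    (hpa : AsyPlus B.q β p) (hw : wr B.kappaPlus B.q (infSol B.kappaPlus B.q β) p 1 ≠ 0) :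
    B.SolvesRadial (sepConst B.q β) (lift B fun y => N⁻¹ * p y) ∧
    B.PlusAsymptotics β (lift B fun y => N⁻¹ * p y) ∧
    ∀ f, B.SolvesRadial (sepConst B.q β) f → B.PlusAsymptotics β f →
      (∃ c : ℂ, ∀ r : ℝ, 1 < r → f r = lift B (fun y => N⁻¹ * p y) r +
        c * lift B (fun y => N⁻¹ * infSol B.kappaPlus B.q β y) r) ∧
      (β ∈ strip → EqOn f (lift B fun y => N⁻¹ * p y) (Ioi 1)) := by
  have hκ := (params hB hr).1
  refine ⟨lift_solvesRadial hB hr (hp.const_mul _), ?_, fun f hf ha => ?_⟩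
  · rw [plusAsymptotics_lift hB hr hN fun _ _ => rfl]
    simpa only [mul_inv_cancel_left₀ hN.1] using hpa
  · rw [plusAsymptotics_lift hB hr hN (eqOn_lift_lower B f)] at ha
    obtain ⟨c, hc, hc0⟩ := eq_add_infSol_of_asyPlus hκ hβ hp hw hpa
      ((lower_isRed hB hr hf).const_mul N) ha
    have h1 := eqOn_lift (φ := fun y => p y + c * infSol B.kappaPlus B.q β y) hN.1
      fun y hy => hc y hy
    have h2 : ∀ r : ℝ, 1 < r → f r = lift B (fun y => N⁻¹ * p y) r +
        c * lift B (fun y => N⁻¹ * infSol B.kappaPlus B.q β y) r := fun r h => by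
      rw [h1 h, lift, lift, lift]
      ring
    refine ⟨⟨c, h2⟩, fun hs r h => ?_⟩
    rw [h2 r h, hc0 hs, zero_mul, add_zero]

/-- Normalising the solutions at infinity by N⁻¹ multiplies both coefficients by N; linear
independence gives uniqueness. -/
theorem lift_decomposition (hN : N ≠ 0) (hψ : IsRed B.kappaPlus B.q lam ψ)
    (hp : IsRed B.kappaPlus B.q lam p) (hw : wr B.kappaPlus B.q ψ p 1 ≠ 0) {A C : ℂ}
    (hφ : ∀ y, 0 < y → φ y = A * p y + C * ψ y) (a b : ℂ) :
    (∀ r : ℝ, 1 < r → lift B φ r = a * lift B (fun y => N⁻¹ * p y) r +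
      b * lift B (fun y => N⁻¹ * ψ y) r) ↔ (a = N * A ∧ b = N * C) := by
  have key : ∀ r : ℝ, 1 < r → ((lift B φ r = a * lift B (fun y => N⁻¹ * p y) r +
      b * lift B (fun y => N⁻¹ * ψ y) r) ↔
      A * p (r - 1) + C * ψ (r - 1) = N⁻¹ * a * p (r - 1) + N⁻¹ * b * ψ (r - 1)) := by
    intro r h
    have hg : gaugePhase B r * r ≠ 0 := mul_ne_zero (gaugePhase_ne_zero B r)
      (by exact_mod_cast (by linarith : r ≠ 0))
    simp only [lift]
    rw [← mul_right_inj' hg (b := A * _ + _), ← hφ _ (sub_pos.2 h)]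
    constructor <;> intro h' <;> rw [h'] <;> ring
  constructor
  · intro h
    obtain ⟨h1, h2⟩ := coeff_unique hψ hp hw (a := A) (b := C) (a' := N⁻¹ * a) (b' := N⁻¹ * b)
      fun y hy => by
        have := (key (1 + y) (by linarith)).1 (h _ (by linarith))
        rwa [add_sub_cancel_left] at this
    rw [h1, h2]
    exact ⟨(mul_inv_cancel_left₀ hN a).symm, (mul_inv_cancel_left₀ hN b).symm⟩
  · rintro ⟨rfl, rfl⟩ r h
    rw [key r h, inv_mul_cancel_left₀ hN, inv_mul_cancel_left₀ hN]

/-- The singularity at β = 0 is removed: `connRatio` is regular there with value −1, so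
differentiability of the extension is inherited. -/
theorem extendedRatio_eq {κ q : ℝ} (hκ : 0 ≤ κ) (hq : q ≠ 0) (hN : N ≠ 0) :
    extendedRatio (fun β => N * coefPlus κ q β) (fun β => N * coefMinus κ q β) = connRatio κ q := by
  funext β
  rw [extendedRatio]
  rcases eq_or_ne β 0 with rfl | h
  · rw [Function.update_self, connRatio_zero hκ hq]
  · rw [Function.update_of_ne h, mul_div_mul_left _ _ hN, coefMinus_div_coefPlus h]

theorem exists_zero_asymptotics {w wp wm : ℝ → ℂ} {a d : ℂ} (hp : B.PlusAsymptotics 0 wp)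
    (hm : B.MinusAsymptotics 0 wm) (h : ∀ r : ℝ, 1 < r → w r = a * wp r + a * d * wm r) :
    ∃ C : ℝ, ∀ r : ℝ, 2 < r →
      ‖w r - a * (r : ℂ) ^ (1 / 2 + Complex.I * B.q) * (Real.log r + d)‖
        ≤ C * r ^ (-(1 / 2) : ℝ) * Real.log r := by
  obtain ⟨C₁, h₁⟩ := hp
  obtain ⟨C₂, h₂⟩ := hm
  have hl2 : 0 < Real.log 2 := Real.log_pos (by norm_num)
  refine ⟨‖a‖ * (|C₁| + ‖d‖ * (|C₂| / Real.log 2)), fun r hr => ?_⟩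
  have hr0 : 0 < r := by linarith
  have e1 := h₁ r hr
  have e2 := h₂ r hr
  rw [zero_div, add_zero, if_pos rfl, if_neg (by norm_num), mul_one] at e1
  rw [zero_div, sub_zero] at e2
  have hlr : Real.log 2 ≤ Real.log r := Real.log_le_log two_pos hr.le
  have hl : 0 < Real.log r := hl2.trans_le hlr
  have hlc : (Real.log r : ℂ) ≠ 0 := by exact_mod_cast hl.ne'
  have hn := cpow_ne_zero_of_pos hr0 (1 / 2 + Complex.I * B.q)
  have hre : (1 / 2 + Complex.I * (B.q : ℂ)).re = 1 / 2 := by simp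
  have hnorm : ‖(r : ℂ) ^ (1 / 2 + Complex.I * (B.q : ℂ))‖ = r ^ (1 / 2 : ℝ) := by
    rw [Complex.norm_cpow_eq_rpow_re_of_pos hr0, hre]
  have hpow : r ^ (1 / 2 : ℝ) * r⁻¹ = r ^ (-(1 / 2) : ℝ) := by
    rw [← Real.rpow_neg_one, ← Real.rpow_add hr0]
    norm_num
  generalize (r : ℂ) ^ (1 / 2 + Complex.I * (B.q : ℂ)) = P at *
  have e : w r - a * P * (Real.log r + d) = a * P * (Real.log r * (wp r / (P * Real.log r) - 1)
      + d * (wm r / P - 1)) := by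
    rw [h r (by linarith)]
    field_simp
    ring
  have hri := inv_pos.2 hr0
  have f1 : ‖wp r / (P * Real.log r) - 1‖ ≤ |C₁| * r⁻¹ :=
    e1.trans (mul_le_mul_of_nonneg_right (le_abs_self _) hri.le)
  -- The recessive error O(1/r) is absorbed into r⁻¹ log r, using log r ≥ log 2.
  have f2 : ‖wm r / P - 1‖ ≤ |C₂| / Real.log 2 * r⁻¹ * Real.log r := by
    refine (e2.trans (mul_le_mul_of_nonneg_right (le_abs_self _) hri.le)).trans ?_
    have : |C₂| * r⁻¹ * 1 ≤ |C₂| * r⁻¹ * (Real.log r / Real.log 2) := by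
      gcongr
      rwa [one_le_div hl2]
    calc |C₂| * r⁻¹ = |C₂| * r⁻¹ * 1 := (mul_one _).symm
      _ ≤ _ := this
      _ = _ := by ring
  rw [e, norm_mul, norm_mul, hnorm, ← hpow]
  have g := norm_add_le ((Real.log r : ℂ) * (wp r / (P * Real.log r) - 1)) (d * (wm r / P - 1))
  rw [norm_mul, norm_mul, Complex.norm_real, Real.norm_of_nonneg hl.le] at g
  calc _ ≤ ‖a‖ * r ^ (1 / 2 : ℝ) * (Real.log r * (|C₁| * r⁻¹) +
        ‖d‖ * (|C₂| / Real.log 2 * r⁻¹ * Real.log r)) := by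
        have : 0 ≤ r ^ (1 / 2 : ℝ) := Real.rpow_nonneg hr0.le _
        gcongr
        refine g.trans ?_
        gcongr
    _ = _ := by ring

end RNStat

namespace RNStat
open MeasureTheory

variable {B : Background} {β N : ℂ} {φ p : ℝ → ℂ}

/-! ### Assembly of the solutions -/

theorem lift_regular (hB : B.Admissible) (hr : B.rPlus = 1)
    (hφ : IsRed B.kappaPlus B.q (sepConst B.q β) φ) (hφ' : ContDiffOn ℝ ∞ φ (Ici 0))
    (hφ0 : φ 0 = 1) (hβ : -1 < β.re)
    (hw : wr B.kappaPlus B.q φ (infSol B.kappaPlus B.q β) 1 ≠ 0) :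
    B.SolvesRadial (sepConst B.q β) (lift B φ) ∧ B.HorizonNormalised (lift B φ) ∧
      ∀ f, B.SolvesRadial (sepConst B.q β) f → B.HorizonNormalised f →
        EqOn f (lift B φ) (Ici 1) :=
  ⟨lift_solvesRadial hB hr hφ, lift_horizonNormalised hB hr hφ' hφ0, fun _ hf hf' =>
    eqOn_lift_of_horizonNormalised hB hr hφ hφ' hφ0 (infSol_isRed (params hB hr).1 hβ) hw hf hf'⟩

theorem lift_ne_zero {lam : ℝ} (hq : B.q ≠ 0) (hφ : IsRed B.kappaPlus B.q lam φ)
    (hφ' : ContDiffOn ℝ ∞ φ (Ici 0)) (hφ0 : φ 0 = 1) {r : ℝ} (h : 1 ≤ r) : lift B φ r ≠ 0 :=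
  mul_ne_zero (mul_ne_zero (gaugePhase_ne_zero B r) (by exact_mod_cast (by linarith : r ≠ 0)))
    (ne_zero_of_regular hq hφ hφ' hφ0 (sub_nonneg.2 h))

theorem wr_hor_infSol_ne_zero {κ q : ℝ} (hκ : 0 ≤ κ) (hq : q ≠ 0) (hβ : β ∈ strip) :
    wr κ q (hor κ q β) (infSol κ q β) 1 ≠ 0 := by
  rw [wr_swap]
  exact neg_ne_zero.2 (conn_ne_zero hκ hq hβ)

/-- The family of solutions with complex separation constant. -/
theorem strip_solutions (hB : B.Admissible) (hr : B.rPlus = 1) (hq : B.q ≠ 0)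
    (hN : IsPhaseLimit B N) (hβ : β ∈ strip) :
    (B.SolvesRadial (sepConst B.q β) (lift B (hor B.kappaPlus B.q β)) ∧
      B.HorizonNormalised (lift B (hor B.kappaPlus B.q β)) ∧
      ∀ f, B.SolvesRadial (sepConst B.q β) f → B.HorizonNormalised f →
        EqOn f (lift B (hor B.kappaPlus B.q β)) (Ici 1)) ∧
    (B.SolvesRadial (sepConst B.q β) (lift B fun y => N⁻¹ * infSol B.kappaPlus B.q β y) ∧
      B.MinusAsymptotics β (lift B fun y => N⁻¹ * infSol B.kappaPlus B.q β y) ∧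
      ∀ f, B.SolvesRadial (sepConst B.q β) f → B.MinusAsymptotics β f →
        EqOn f (lift B fun y => N⁻¹ * infSol B.kappaPlus B.q β y) (Ioi 1)) ∧
    (B.SolvesRadial (sepConst B.q β) (lift B fun y => N⁻¹ * plusSol B.kappaPlus B.q β y) ∧
      B.PlusAsymptotics β (lift B fun y => N⁻¹ * plusSol B.kappaPlus B.q β y) ∧
      ∀ f, B.SolvesRadial (sepConst B.q β) f → B.PlusAsymptotics β f →
        (∃ c : ℂ, ∀ r : ℝ, 1 < r → f r = lift B (fun y => N⁻¹ * plusSol B.kappaPlus B.q β y) r +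
          c * lift B (fun y => N⁻¹ * infSol B.kappaPlus B.q β y) r) ∧
        (β ∈ strip → EqOn f (lift B fun y => N⁻¹ * plusSol B.kappaPlus B.q β y) (Ioi 1))) ∧
    (∀ a b : ℂ, (∀ r : ℝ, 1 < r → lift B (hor B.kappaPlus B.q β) r =
        a * lift B (fun y => N⁻¹ * plusSol B.kappaPlus B.q β y) r +
        b * lift B (fun y => N⁻¹ * infSol B.kappaPlus B.q β y) r) ↔
      (a = N * coefPlus B.kappaPlus B.q β ∧ b = N * coefMinus B.kappaPlus B.q β)) ∧
    N * coefPlus B.kappaPlus B.q β ≠ 0 := by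
  have hκ := (params hB hr).1
  have hb := (strip_bounds hβ).1
  have hR := horRange_of_strip (κ := B.kappaPlus) hβ
  have hp := plusSol_isRed hκ hq hβ
  have hw := wr_plusSol_ne_zero hκ hq hβ
  exact ⟨lift_regular hB hr (hor_isRed hκ hq hR) (hor_smooth hκ hR) (hor_zero hR) hb
      (wr_hor_infSol_ne_zero hκ hq hβ), lift_minus hB hr hN hb hp hw,
    lift_plus hB hr hN hb hp (asyPlus_plusSol hκ hq hβ) hw,
    lift_decomposition hN.1 (infSol_isRed hκ hb) hp hw fun y hy => hor_eq hκ hq hβ hy,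
    mul_ne_zero hN.1 (coefPlus_ne_zero hκ hq hβ)⟩

/-- Passage from the radial equation to the wave equation. -/
theorem modes_of_solutions (hB : B.Admissible) (hr : B.rPlus = 1) {l : ℕ} {m : ℤ}
    (hm : m.natAbs ≤ l) {P : (ℝ → ℂ) → Prop} {R : (ℝ → ℂ) → Prop} {w : ℝ → ℂ}
    (h : B.SolvesRadial (sepConst B.q (betaL l B.q)) w ∧ P w ∧
      ∀ f, B.SolvesRadial (sepConst B.q (betaL l B.q)) f → P f → R f) :
    B.IsMode l m w ∧ P w ∧ ∀ f, B.IsMode l m f → P f → R f := by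
  rw [sepConst_betaL] at h
  exact ⟨isMode_of_solvesRadial hB hr l m h.1, h.2.1, fun f hf =>
    h.2.2 f (solvesRadial_of_isMode hB hr hm hf)⟩

theorem connRatio_eq_ratio (hB : B.Admissible) (hr : B.rPlus = 1) (hq : B.q ≠ 0)
    (hβ : β ∈ strip) (h : β ≠ 0) :
    (0 < B.kappaPlus → connRatio B.kappaPlus B.q β =
      ratioSubextremal B.q B.rMinus B.rPlus B.kappaPlus β) ∧
    (B.kappaPlus = 0 → connRatio B.kappaPlus B.q β = ratioExtremal B.q β) := by
  constructor
  · intro hκ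
    rw [(params hB hr).2.2.2, hr, connRatio_eq_subextremal hκ hq hβ h]
  · intro hκ
    rw [hκ, connRatio_eq_extremal hq hβ h]

/-- The stationary solutions with angular momentum number `l`. -/
theorem stationary_modes (hB : B.Admissible) (hr : B.rPlus = 1) (hq : B.q ≠ 0)
    (hN : IsPhaseLimit B N) (l : ℕ) : ∃ (w wp wm : ℝ → ℂ) (ap am : ℂ),
    (∀ m : ℤ, m.natAbs ≤ l →
      (B.IsMode l m w ∧ B.HorizonNormalised w ∧
        ∀ f, B.IsMode l m f → B.HorizonNormalised f → EqOn f w (Ici 1)) ∧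
      (B.IsMode l m wm ∧ B.MinusAsymptotics (betaL l B.q) wm ∧
        ∀ f, B.IsMode l m f → B.MinusAsymptotics (betaL l B.q) f → EqOn f wm (Ioi 1)) ∧
      (B.IsMode l m wp ∧ B.PlusAsymptotics (betaL l B.q) wp ∧
        (∀ f, B.IsMode l m f → B.PlusAsymptotics (betaL l B.q) f →
          ∃ c : ℂ, ∀ r : ℝ, 1 < r → f r = wp r + c * wm r) ∧
        ((l * (l + 1) : ℝ) < B.q ^ 2 →
          ∀ f, B.IsMode l m f → B.PlusAsymptotics (betaL l B.q) f → EqOn f wp (Ioi 1)))) ∧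
    (∀ a b : ℂ, (∀ r : ℝ, 1 < r → w r = a * wp r + b * wm r) ↔ (a = ap ∧ b = am)) ∧
    ap ≠ 0 ∧
    ((l * (l + 1) : ℝ) < B.q ^ 2 →
      w = lift B (hor B.kappaPlus B.q (betaL l B.q)) ∧
      wp = lift B (fun y => N⁻¹ * plusSol B.kappaPlus B.q (betaL l B.q) y) ∧
      wm = lift B (fun y => N⁻¹ * infSol B.kappaPlus B.q (betaL l B.q) y) ∧
      ap = N * coefPlus B.kappaPlus B.q (betaL l B.q) ∧
      am = N * coefMinus B.kappaPlus B.q (betaL l B.q)) ∧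
    (∀ r : ℝ, 1 ≤ r → w r ≠ 0) := by
  have hκ := (params hB hr).1
  have hlam : sepConst B.q (betaL l B.q) = ((l * (l + 1) : ℝ) : ℂ) := by
    rw [sepConst_betaL]
    push_cast
    ring
  rcases lt_or_ge (l * (l + 1) : ℝ) (B.q ^ 2) with h | h
  · have hβ := betaL_mem_strip h
    have hR := horRange_of_strip (κ := B.kappaPlus) hβ
    obtain ⟨h1, h2, h3, h4, h5⟩ := strip_solutions hB hr hq hN hβ
    refine ⟨_, _, _, _, _, fun m hm => ⟨modes_of_solutions hB hr hm h1,
      modes_of_solutions hB hr hm h2, ?_⟩, h4, h5, fun _ => ⟨rfl, rfl, rfl, rfl, rfl⟩,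
      fun r h => lift_ne_zero hq (hlam ▸ hor_isRed hκ hq hR) (hor_smooth hκ hR) (hor_zero hR) h⟩
    obtain ⟨m1, m2, m3⟩ := modes_of_solutions hB hr hm h3
    exact ⟨m1, m2, fun f hf ha => (m3 f hf ha).1, fun _ f hf ha => (m3 f hf ha).2 hβ⟩
  -- Here β_ℓ = b ≥ 1 is real and lies outside the strip; the dominant solution is a multiple of the
  -- regular one, with coefficients Na and 0.
  · obtain ⟨b, hb, e⟩ := betaL_eq_of_le h
    obtain ⟨φ, p, a, hφ, hφ', hφ0, hw, hp, hpa, hwp, ha, hφp⟩ :=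
      exists_solutions_of_one_le hκ hq hb
    rw [← e] at hφ hw hp hpa hwp
    have hre : -1 < (betaL l B.q).re := by
      rw [e, Complex.ofReal_re]
      linarith
    refine ⟨_, _, _, _, _, fun m hm => ⟨modes_of_solutions hB hr hm
      (lift_regular hB hr hφ hφ' hφ0 hre hw),
      modes_of_solutions hB hr hm (lift_minus hB hr hN hre hp hwp), ?_⟩,
      lift_decomposition (A := a) (C := 0) hN.1 (infSol_isRed hκ hre) hp hwp fun y _ => by
        rw [hφp, zero_mul, add_zero], mul_ne_zero hN.1 ha, fun h' => absurd h' h.not_gt,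
      fun r h => lift_ne_zero hq (hlam ▸ hφ) hφ' hφ0 h⟩
    obtain ⟨m1, m2, m3⟩ := modes_of_solutions hB hr hm (lift_plus hB hr hN hre hp hpa hwp)
    exact ⟨m1, m2, fun f hf ha => (m3 f hf ha).1, fun h' => absurd h' h.not_gt⟩

end RNStat

namespace RNStat
open MeasureTheory

variable {B : Background} {N : ℂ}

/-! ### The limit of vanishing exponent -/

/-- For β ≠ 0 the product is N·conn(β), which is continuous at 0, where `coefPlus` is defined to be
the limiting value. -/
theorem tendsto_coefPlus_mul {κ q : ℝ} (hκ : 0 ≤ κ) (N : ℂ) :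
    Tendsto (fun β : ℂ => N * coefPlus κ q β * β) (𝓝[≠] 0) (𝓝 (N * coefPlus κ q 0)) := by
  have h := ((differentiableAt_conn (q := q) hκ zero_mem_strip).continuousAt.tendsto.const_mul
    N).mono_left (nhdsWithin_le_nhds (s := {0}ᶜ))
  have e : coefPlus κ q 0 = conn κ q 0 := if_pos rfl
  rw [e]
  refine h.congr' ?_
  filter_upwards [self_mem_nhdsWithin] with β hβ
  have hβ' : β ≠ 0 := hβ
  rw [coefPlus, if_neg hβ', mul_assoc, div_mul_cancel₀ _ hβ']

theorem coefMinus_zero {κ q : ℝ} (hκ : 0 ≤ κ) (hq : q ≠ 0) :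
    coefMinus κ q 0 = coefPlus κ q 0 * deriv (connRatio κ q) 0 := by
  rw [coefMinus, coefPlus, if_pos rfl, if_pos rfl, remLimit_zero hκ hq]

theorem tendsto_lift_hor (hB : B.Admissible) (hr : B.rPlus = 1) {r : ℝ} (h : 1 ≤ r) :
    Tendsto (fun β : ℂ => lift B (hor B.kappaPlus B.q β) r) (𝓝[≠] 0)
      (𝓝 (lift B (hor B.kappaPlus B.q 0) r)) :=
  ((differentiableAt_hor (params hB hr).1 (sub_nonneg.2 h)
    zero_mem_strip).continuousAt.tendsto.const_mul _).mono_left nhdsWithin_le_nhds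

theorem log_norm_ratio (hB : B.Admissible) (hr : B.rPlus = 1) (hq : B.q ≠ 0) {β : ℂ}
    (hβ : β = Complex.I * β.im) :
    (0 < B.kappaPlus → B.q.sign * Real.log ‖connRatio B.kappaPlus B.q β‖ =
      logRatioSubextremal B.q β.im B.rMinus B.rPlus B.kappaPlus) ∧
    (B.kappaPlus = 0 → B.q.sign * Real.log ‖connRatio B.kappaPlus B.q β‖ =
      logRatioExtremal B.q β.im) := by
  constructor
  · intro hκ
    rw [(params hB hr).2.2.2, hr, ← sign_mul_log_norm_connRatio_subextremal hκ hq, ← hβ]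
  · intro hκ
    rw [hκ, ← sign_mul_log_norm_connRatio_extremal hq, ← hβ]

theorem im_deriv_ratio (hB : B.Admissible) (hr : B.rPlus = 1) (hq : B.q ≠ 0) :
    (0 < B.kappaPlus → B.q.sign * (deriv (connRatio B.kappaPlus B.q) 0).im =
      imRatioSubextremal B.q B.rMinus B.rPlus B.kappaPlus) ∧
    (B.kappaPlus = 0 → B.q.sign * (deriv (connRatio B.kappaPlus B.q) 0).im =
      imRatioExtremal B.q) := by
  constructor
  · intro hκ
    rw [(params hB hr).2.2.2, hr, sign_mul_im_deriv_connRatio_subextremal hκ hq]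
  · intro hκ
    rw [hκ, sign_mul_im_deriv_connRatio_extremal hq]

end RNStat
-- The main theorem
open RNStat in
theorem mainTheorem6 (B : Background) (hB : B.Admissible) (hr : B.rPlus = 1) (hq : B.q ≠ 0) :
    -- `W β`, `Wp β`, `Wm β`, `Ap β`, `Am β`: the solutions and coefficients as functions of `β`
    ∃ (W Wp Wm : ℂ → ℝ → ℂ) (Ap Am : ℂ → ℂ),
      (∀ β : ℂ, |β.re| < 1 →
        (B.SolvesRadial (sepConst B.q β) (W β) ∧ B.HorizonNormalised (W β) ∧
          ∀ f, B.SolvesRadial (sepConst B.q β) f → B.HorizonNormalised f →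
            EqOn f (W β) (Ici 1)) ∧
        (B.SolvesRadial (sepConst B.q β) (Wm β) ∧ B.MinusAsymptotics β (Wm β) ∧
          ∀ f, B.SolvesRadial (sepConst B.q β) f → B.MinusAsymptotics β f →
            EqOn f (Wm β) (Ioi 1)) ∧
        (B.SolvesRadial (sepConst B.q β) (Wp β) ∧ B.PlusAsymptotics β (Wp β) ∧
          ∀ f, B.SolvesRadial (sepConst B.q β) f → B.PlusAsymptotics β f →
            EqOn f (Wp β) (Ioi 1)) ∧
        (∀ a b : ℂ, (∀ r : ℝ, 1 < r → W β r = a * Wp β r + b * Wm β r) ↔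
          (a = Ap β ∧ b = Am β)) ∧
        Ap β ≠ 0 ∧
        (β ≠ 0 →
          Am β = Ap (-β) ∧
          (0 < B.kappaPlus →
            Am β / Ap β = ratioSubextremal B.q B.rMinus B.rPlus B.kappaPlus β) ∧
          (B.kappaPlus = 0 → Am β / Ap β = ratioExtremal B.q β))) ∧
      -- the limit `β → 0`
      DifferentiableAt ℂ (extendedRatio Ap Am) 0 ∧
      Tendsto (fun β : ℂ => Ap β * β) (𝓝[≠] 0) (𝓝 (Ap 0)) ∧
      Am 0 = Ap 0 * deriv (extendedRatio Ap Am) 0 ∧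
      Am 0 = Ap 0 *
        (1 / Complex.I * deriv (fun s : ℝ => extendedRatio Ap Am (Complex.I * s)) 0) ∧
      (∀ r : ℝ, 1 ≤ r → Tendsto (fun β : ℂ => W β r) (𝓝[≠] 0) (𝓝 (W 0 r))) ∧
      (∃ C : ℝ, ∀ r : ℝ, 2 < r →
        ‖W 0 r - Ap 0 * (r : ℂ) ^ (1 / 2 + Complex.I * B.q) *
            (Real.log r + deriv (extendedRatio Ap Am) 0)‖
          ≤ C * r ^ (-(1 / 2) : ℝ) * Real.log r) ∧
      B.q.sign * (Am 0 / Ap 0).im =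
        -(B.q.sign * (deriv (fun s : ℝ => extendedRatio Ap Am (Complex.I * s)) 0).re) ∧
      (0 < B.kappaPlus → B.q.sign * (Am 0 / Ap 0).im =
        imRatioSubextremal B.q B.rMinus B.rPlus B.kappaPlus) ∧
      (B.kappaPlus = 0 → B.q.sign * (Am 0 / Ap 0).im = imRatioExtremal B.q) ∧
      Tendsto (fun kap : ℝ => imRatioSubextremal B.q (1 - 2 * kap) 1 kap) (𝓝[>] 0)
        (𝓝 (imRatioExtremal B.q)) ∧
      -- the stationary solutions themselves
      ∀ l : ℕ, ∃ (w wp wm : ℝ → ℂ) (ap am : ℂ),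
        (∀ m : ℤ, m.natAbs ≤ l →
          (B.IsMode l m w ∧ B.HorizonNormalised w ∧
            ∀ f, B.IsMode l m f → B.HorizonNormalised f → EqOn f w (Ici 1)) ∧
          (B.IsMode l m wm ∧ B.MinusAsymptotics (betaL l B.q) wm ∧
            ∀ f, B.IsMode l m f → B.MinusAsymptotics (betaL l B.q) f → EqOn f wm (Ioi 1)) ∧
          (B.IsMode l m wp ∧ B.PlusAsymptotics (betaL l B.q) wp ∧
            (∀ f, B.IsMode l m f → B.PlusAsymptotics (betaL l B.q) f →
              ∃ c : ℂ, ∀ r : ℝ, 1 < r → f r = wp r + c * wm r) ∧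
            ((l * (l + 1) : ℝ) < B.q ^ 2 →
              ∀ f, B.IsMode l m f → B.PlusAsymptotics (betaL l B.q) f →
                EqOn f wp (Ioi 1)))) ∧
        (∀ a b : ℂ, (∀ r : ℝ, 1 < r → w r = a * wp r + b * wm r) ↔ (a = ap ∧ b = am)) ∧
        ap ≠ 0 ∧
        -- for `β_ℓ ∈ [0, 1) ∪ i(0, ∞)` these are the members `β = β_ℓ` of the family above
        ((l * (l + 1) : ℝ) < B.q ^ 2 →
          EqOn w (W (betaL l B.q)) (Ici 1) ∧ EqOn wp (Wp (betaL l B.q)) (Ioi 1) ∧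
          EqOn wm (Wm (betaL l B.q)) (Ioi 1) ∧
          ap = Ap (betaL l B.q) ∧ am = Am (betaL l B.q)) ∧
        -- the case `β_ℓ ∈ i(0, ∞)`
        ((2 * l + 1 : ℝ) ^ 2 < 4 * B.q ^ 2 →
          am ≠ 0 ∧
          (0 < B.kappaPlus → B.q.sign * Real.log ‖am / ap‖ =
            logRatioSubextremal B.q (betaL l B.q).im B.rMinus B.rPlus B.kappaPlus) ∧
          (B.kappaPlus = 0 → B.q.sign * Real.log ‖am / ap‖ =
            logRatioExtremal B.q (betaL l B.q).im) ∧
          Tendsto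
            (fun kap : ℝ => logRatioSubextremal B.q (betaL l B.q).im (1 - 2 * kap) 1 kap)
            (𝓝[>] 0) (𝓝 (logRatioExtremal B.q (betaL l B.q).im))) ∧
        (∀ r : ℝ, 1 ≤ r → w r ≠ 0) := by 
  -- One gauge constant serves for all β and all ℓ; it drops out of the coefficient ratio.
  obtain ⟨N, hN⟩ : ∃ N, IsPhaseLimit B N := exists_phase_limit hB hr
  have hκ := (params hB hr).1
  have hS := fun β hβ => strip_solutions hB hr hq hN (β := β) hβ
  have hE := extendedRatio_eq hκ hq hN.1
  have hdiv : ∀ β : ℂ, β ≠ 0 → N * coefMinus B.kappaPlus B.q β /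
      (N * coefPlus B.kappaPlus B.q β) = connRatio B.kappaPlus B.q β := fun β h => by
    rw [mul_div_mul_left _ _ hN.1, coefMinus_div_coefPlus h]
  have h0 := coefMinus_zero hκ hq
  have hdiv0 : N * coefMinus B.kappaPlus B.q 0 / (N * coefPlus B.kappaPlus B.q 0) =
      deriv (connRatio B.kappaPlus B.q) 0 := by
    rw [h0, mul_div_mul_left _ _ hN.1,
      mul_div_cancel_left₀ _ (coefPlus_ne_zero hκ hq zero_mem_strip)]
  have hd := differentiableAt_connRatio hκ hq zero_mem_strip
  have hI := (hasDerivAt_comp_I_mul hd).deriv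
  refine ⟨fun β => lift B (hor B.kappaPlus B.q β),
    fun β => lift B fun y => N⁻¹ * plusSol B.kappaPlus B.q β y,
    fun β => lift B fun y => N⁻¹ * infSol B.kappaPlus B.q β y,
    fun β => N * coefPlus B.kappaPlus B.q β, fun β => N * coefMinus B.kappaPlus B.q β,
    fun β hβ => ?_, ?_⟩
  · obtain ⟨h1, h2, h3, h4, h5⟩ := hS β hβ
    refine ⟨h1, h2, ⟨h3.1, h3.2.1, fun f hf ha => (h3.2.2 f hf ha).2 hβ⟩, h4, h5, fun h => ?_⟩
    simp only [hdiv β h]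
    exact ⟨by rw [coefMinus_eq h], connRatio_eq_ratio hB hr hq hβ h⟩
  -- The extended ratio is now `connRatio`, and every coefficient statement at β = 0 concerns its
  -- value or derivative there.
  · simp only [hE, hI, hdiv0]
    refine ⟨hd, tendsto_coefPlus_mul hκ N, by rw [h0, mul_assoc], ?_,
      fun r => tendsto_lift_hor hB hr, ?_, by simp, (im_deriv_ratio hB hr hq).1,
      (im_deriv_ratio hB hr hq).2, tendsto_imRatioSubextremal hq, fun l => ?_⟩
    · rw [h0, one_div, inv_mul_cancel_left₀ Complex.I_ne_zero, mul_assoc]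
    · obtain ⟨-, h2, h3, h4, -⟩ := hS 0 zero_mem_strip
      exact exists_zero_asymptotics h3.2.1 h2.2.1
        ((h4 _ _).2 ⟨rfl, by rw [h0, mul_assoc]⟩)
    · obtain ⟨w, wp, wm, ap, am, h1, h2, h3, h4, h5⟩ := stationary_modes hB hr hq hN l
      refine ⟨w, wp, wm, ap, am, h1, h2, h3, fun h => ?_, fun h => ?_, h5⟩
      · obtain ⟨rfl, rfl, rfl, rfl, rfl⟩ := h4 h
        exact ⟨fun _ _ => rfl, fun _ _ => rfl, fun _ _ => rfl, rfl, rfl⟩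
      -- Since 4ℓ(ℓ + 1) < (2ℓ + 1)² < 4q², an imaginary exponent lies in the strip and belongs to
      -- the family.
      · have hl : (l * (l + 1) : ℝ) < B.q ^ 2 := by linarith
        obtain ⟨-, -, -, rfl, rfl⟩ := h4 hl
        obtain ⟨hb, hb0⟩ := betaL_eq_of_imag h
        have hβ := betaL_mem_strip hl
        have hne : betaL l B.q ≠ 0 := fun h' => hb0 (by rw [h', Complex.zero_im])
        rw [hdiv _ hne]
        exact ⟨mul_ne_zero hN.1 (by
            rw [coefMinus_eq hne]
            exact coefPlus_ne_zero hκ hq (neg_mem_strip hβ)),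
          (log_norm_ratio hB hr hq hb).1, (log_norm_ratio hB hr hq hb).2,
          tendsto_logRatioSubextremal hq _⟩
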